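/- Let $d\ge 1$ and $n=d+1$. Let $\alpha_1,\beta_1,\alpha_2,\beta_2,\dots,\alpha_n,\beta_n$ be $2n$ distinct points of the unit circle $S^1\subset\mathbb C$, in this cyclic order, and let $\gamma\subset\mathbb C$ be a smooth Jordan curve. Let $F=F_\alpha^\beta:\mathbb C^n\to\mathbb C^n$ be the linear automorphism that sends $(p(\alpha_1),\dots,p(\alpha_n))$ to $(p(\beta_1),\dots,p(\beta_n))$ for every complex polynomial $p$ of degree at most $n-1$, and let $\Delta(\gamma)=\{(a,\dots,a):a\in\gamma\}$. There is a form $\psi=\sum_k\mu_k\,dx_k\wedge dy_k$ on $\mathbb C^n$ with all $\mu_k>0$ such that $F^*\psi=\sum_k\nu_k\,dx_k\wedge dy_k$ with all $\nu_k>0$; fix any such $\psi$. (A diagonal rescaling of coordinates takes $\psi$ to $\omega_{\mathrm{std}}$, and $\gamma^n$ and $F(\gamma^n)$ are Lagrangian for $\psi$.) A Lagrangian smoothing of $\gamma^n\cup F(\gamma^n)$ along $\Delta(\gamma)$ is formed as follows. Choose $\varepsilon>0$ and a symplectic embedding $\Psi$ of $$S^1\times(-\varepsilon,\varepsilon)\times(-\varepsilon,\varepsilon)^{d}\times(-\varepsilon,\varepsilon)^{d},\qquad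 ds\wedge dt+\sum_i dx_i\wedge dy_i\qquad(S^1=\mathbb R/\mathbb Z)$$ into $(\mathbb C^n,\psi)$, such that $\Psi^{-1}(\gamma^n)=\{t=0,\,y=0\}$, $\Psi^{-1}(F(\gamma^n))=\{t=0,\,x=0\}$ and $\Psi(\{t=0,\,x=y=0\})=\Delta(\gamma)$. Choose $0<r<\varepsilon$, a sign $\sigma=\pm1$, and a smooth regular embedded curve $u\mapsto(a(u),b(u))$, $u\in\mathbb R$, in $[0,\infty)^2\setminus\{0\}$ that equals $(-u,0)$ for $u\le -r$ and $(0,u)$ for $u\ge r$, and lies in $[0,r]^2$ for $|u|\le r$. Remove the open tube $\Psi(\{t=0,\,y=0,\,|x|<r\})$ from $\gamma^n$ and the open tube $\Psi(\{t=0,\,x=0,\,|y|<r\})$ from $F(\gamma^n)$, and insert the handles $\{\Psi(s,0,a(u)\xi,\sigma b(u)\xi): s\in S^1,\ |u|<r,\ \xi\in S^{d-1}\}$. The smoothing is regarded as an immersed submanifold: a point where the two punctured tori meet is a double point. Such smoothings exist, for either sign $\sigma$ and with the image of $\Psi$ inside any prescribed neighbourhood of $\Delta(\gamma)$. Moreover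 every such smoothing is a Lagrangian immersion of $S^1\times(\mathbb T^{d}\#\mathbb T^{d})$ into $(\mathbb C^n,\psi)$: there are a compact smooth manifold $P$ that is a connected sum of two copies of $\mathbb T^{d}$, depending only on $d$, and a smooth Lagrangian immersion $\iota:S^1\times P\to\mathbb C^n$ such that $S^1\times P$ is the disjoint union of two closed sets, which $\iota$ maps bijectively onto the two punctured tori, and an open set, which $\iota$ maps bijectively onto the handles. -/

import Mathlib

open scoped Manifold ContDiff

noncomputable section

/-! Smooth Jordan curves, the evaluation maps and the two tori. -/

/-- `Γ` is a smooth Jordan curve: the image of a `1`-periodic smooth regular parametrization that is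
injective on a period. -/
def IsSmoothJordanCurve (Γ : Set ℂ) : Prop :=
  ∃ c : ℝ → ℂ, ContDiff ℝ ∞ c ∧ Function.Periodic c 1 ∧ (∀ t, deriv c t ≠ 0) ∧
    Set.InjOn c (Set.Ico 0 1) ∧ Set.range c = Γ

/-- The `2n` points `α₁, β₁, α₂, β₂, …, αₙ, βₙ` are distinct, lie on the unit circle, and occur on it
in this cyclic order (for one of the two orientations of the circle). -/
def CyclicallyOrdered {n : ℕ} (α β : Fin n → ℂ) : Prop :=
  ∃ θ φ : Fin n → ℝ, (∀ k, θ k < φ k) ∧ (∀ k l, k < l → φ k < θ l) ∧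
    (∀ k l, φ k < θ l + 2 * Real.pi) ∧
    ((∀ k, α k = Complex.exp (θ k * Complex.I) ∧ β k = Complex.exp (φ k * Complex.I)) ∨
     (∀ k, α k = Complex.exp (-(θ k * Complex.I)) ∧ β k = Complex.exp (-(φ k * Complex.I))))

/-- The map `F = ev_β ∘ (ev_α)⁻¹ : ℂⁿ → ℂⁿ`: it sends `z` to `(p(β₁), …, p(βₙ))`, where `p` is the
polynomial of degree `≤ n - 1` with `p(αₖ) = zₖ` for all `k`. -/
def evalChange {n : ℕ} (α β : Fin n → ℂ) (z : Fin n → ℂ) : Fin n → ℂ :=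
  fun k => (Lagrange.interpolate Finset.univ α z).eval (β k)

theorem evalChange_eval {n : ℕ} (α β : Fin n → ℂ) (hα : Function.Injective α)
    (p : Polynomial ℂ) (hp : p.degree < n) :
    evalChange α β (fun k => p.eval (α k)) = fun k => p.eval (β k) := by
  funext k
  have h := Lagrange.eq_interpolate (s := Finset.univ) (v := α) (f := p) hα.injOn (by simpa using hp)
  simp only [evalChange]
  rw [← h]

/-- The torus `γⁿ ⊆ ℂⁿ`. -/
def curveTorus (n : ℕ) (Γ : Set ℂ) : Set (Fin n → ℂ) := {z | ∀ k, z k ∈ Γ}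

/-- The diagonal loop `Δ(γ) = {(a, …, a) : a ∈ γ}`. -/
def diagonalLoop (n : ℕ) (Γ : Set ℂ) : Set (Fin n → ℂ) := (fun a _ => a) '' Γ

/-- The constant two-form `∑ₖ μₖ dxₖ ∧ dyₖ` on `ℂⁿ`, where `zₖ = xₖ + i yₖ`. -/
def diagonalForm {n : ℕ} (μ : Fin n → ℝ) (v w : Fin n → ℂ) : ℝ :=
  ∑ k, μ k * ((v k).re * (w k).im - (v k).im * (w k).re)

/-- The form `∑ₖ μₖ dxₖ ∧ dyₖ` is positive diagonal, and so is its pull-back by `F`. -/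
def IsAdaptedForm {n : ℕ} (α β : Fin n → ℂ) (μ : Fin n → ℝ) : Prop :=
  (∀ k, 0 < μ k) ∧ ∃ ν : Fin n → ℝ, (∀ k, 0 < ν k) ∧
    ∀ v w, diagonalForm μ (evalChange α β v) (evalChange α β w) = diagonalForm ν v w

/-! Lagrangian immersions. -/

/-- `f : N → V` is a smooth immersion, Lagrangian for the constant symplectic form `Ω` on `V`. -/
def IsLagrangianImmersion {E H N V : Type*} [NormedAddCommGroup E] [NormedSpace ℝ E]
    [TopologicalSpace H] (I : ModelWithCorners ℝ E H) [TopologicalSpace N] [ChartedSpace H N]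
    [NormedAddCommGroup V] [NormedSpace ℝ V] (Ω : V → V → ℝ) (f : N → V) : Prop :=
  ContMDiff I 𝓘(ℝ, V) ∞ f ∧
  2 * Module.finrank ℝ E = Module.finrank ℝ V ∧
  (∀ p, Function.Injective (mfderiv I 𝓘(ℝ, V) f p)) ∧
  ∀ (p : N) (v w : TangentSpace I p),
    Ω (mfderiv I 𝓘(ℝ, V) f p v) (mfderiv I 𝓘(ℝ, V) f p w) = 0

/-! Lagrangian smoothing of two Lagrangians along a clean loop of intersection. -/

/-- The space `ℝ × ℝ × ℝᵐ × ℝᵐ` with coordinates `(s, t, x, y)`. -/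
abbrev LocalModel (m : ℕ) : Type :=
  ℝ × ℝ × EuclideanSpace ℝ (Fin m) × EuclideanSpace ℝ (Fin m)

/-- The form `ds ∧ dt + dx₁ ∧ dy₁ + ⋯ + dxₘ ∧ dyₘ`. -/
def modelForm {m : ℕ} (v w : LocalModel m) : ℝ :=
  (v.1 * w.2.1 - v.2.1 * w.1) +
    ∑ i, (v.2.2.1 i * w.2.2.2 i - v.2.2.2 i * w.2.2.1 i)

/-- The box `ℝ × (-ε, ε) × (-ε, ε)ᵐ × (-ε, ε)ᵐ`; the local model of a clean loop of intersection is
its quotient by the translation `s ↦ s + 1`. -/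
def modelBox (m : ℕ) (ε : ℝ) : Set (LocalModel m) :=
  {p | |p.2.1| < ε ∧ (∀ i, |p.2.2.1 i| < ε) ∧ ∀ i, |p.2.2.2 i| < ε}

/-- The choices made in a Lagrangian smoothing of `L₀ ∪ L₁` along the clean loop of intersection `Δ`
in the `2(m+1)`-dimensional vector space `V` with constant symplectic form `Ω`.

* `chart` is a symplectic tubular neighbourhood of `Δ` (written on the universal cover of
  `S¹ × (-ε, ε) × (-ε, ε)ᵐ × (-ε, ε)ᵐ`, where `S¹ = ℝ / ℤ`) that takes `{t = 0, y = 0}` to `L₀`,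
  `{t = 0, x = 0}` to `L₁` and the central circle to `Δ`;
* `u ↦ (a u, b u)` is a smooth regular embedded curve in the closed quadrant without the origin that
  comes in along the first axis up to `(r, 0)` and leaves along the second axis from `(0, r)`;
* `sign` selects one of the two resolutions of a transverse crossing. -/
structure SmoothingData {V : Type*} [NormedAddCommGroup V] [NormedSpace ℝ V] (m : ℕ)
    (Ω : V → V → ℝ) (L₀ L₁ Δ : Set V) where
  ε : ℝ
  chart : LocalModel m → V
  chart_smooth : ContDiffOn ℝ ∞ chart (modelBox m ε)
  chart_eq_iff : ∀ p ∈ modelBox m ε, ∀ q ∈ modelBox m ε,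
    chart p = chart q ↔ p.2 = q.2 ∧ ∃ k : ℤ, q.1 = p.1 + k
  chart_symplectic : ∀ p ∈ modelBox m ε, ∀ v w,
    Ω (fderiv ℝ chart p v) (fderiv ℝ chart p w) = modelForm v w
  chart_mem_left : ∀ p ∈ modelBox m ε, chart p ∈ L₀ ↔ p.2.1 = 0 ∧ p.2.2.2 = 0
  chart_mem_right : ∀ p ∈ modelBox m ε, chart p ∈ L₁ ↔ p.2.1 = 0 ∧ p.2.2.1 = 0
  chart_core : Set.range (fun s : ℝ => chart (s, 0, 0, 0)) = Δ
  r : ℝ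
  r_pos : 0 < r
  r_lt : r < ε
  a : ℝ → ℝ
  b : ℝ → ℝ
  a_smooth : ContDiff ℝ ∞ a
  b_smooth : ContDiff ℝ ∞ b
  regular : ∀ u, deriv a u ≠ 0 ∨ deriv b u ≠ 0
  embedded : Function.Injective fun u => (a u, b u)
  a_nonneg : ∀ u, 0 ≤ a u
  b_nonneg : ∀ u, 0 ≤ b u
  ne_origin : ∀ u, a u ≠ 0 ∨ b u ≠ 0
  incoming : ∀ u, u ≤ -r → a u = -u ∧ b u = 0
  outgoing : ∀ u, r ≤ u → a u = 0 ∧ b u = u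
  bounded : ∀ u, |u| ≤ r → a u ≤ r ∧ b u ≤ r
  sign : ℝ
  sign_eq : sign = 1 ∨ sign = -1

namespace SmoothingData

variable {V : Type*} [NormedAddCommGroup V] [NormedSpace ℝ V] {m : ℕ}
  {Ω : V → V → ℝ} {L₀ L₁ Δ : Set V}

/-- The neighbourhood of the clean loop in which the smoothing takes place. -/
def nbhd (D : SmoothingData m Ω L₀ L₁ Δ) : Set V := D.chart '' modelBox m D.ε

/-- The open tube around the loop that is removed from `L₀`. -/
def leftTube (D : SmoothingData m Ω L₀ L₁ Δ) : Set V :=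
  {z | ∃ (s : ℝ) (x : EuclideanSpace ℝ (Fin m)), ‖x‖ < D.r ∧ z = D.chart (s, 0, x, 0)}

/-- The open tube around the loop that is removed from `L₁`. -/
def rightTube (D : SmoothingData m Ω L₀ L₁ Δ) : Set V :=
  {z | ∃ (s : ℝ) (y : EuclideanSpace ℝ (Fin m)), ‖y‖ < D.r ∧ z = D.chart (s, 0, 0, y)}

/-- The family, parametrized by the loop, of Lagrangian handles
`{(a(u) ξ, ± b(u) ξ) : |u| < r, ξ ∈ S^{m-1}}` that is glued in. -/
def handle (D : SmoothingData m Ω L₀ L₁ Δ) : Set V :=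
  {z | ∃ (s u : ℝ) (ξ : EuclideanSpace ℝ (Fin m)), |u| < D.r ∧ ‖ξ‖ = 1 ∧
    z = D.chart (s, 0, D.a u • ξ, (D.sign * D.b u) • ξ)}

/-- The result of the smoothing, as a subset of `V`. -/
def result (D : SmoothingData m Ω L₀ L₁ Δ) : Set V :=
  (L₀ \ D.leftTube) ∪ (L₁ \ D.rightTube) ∪ D.handle

/-- `f : N → V` is the smoothing as an immersed (rather than embedded) submanifold: `N` is the
disjoint union of two closed pieces, carried bijectively onto what is left of `L₀` and of `L₁`, and
of an open piece carried bijectively onto the handles. Thus points of intersection of what is left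
of `L₀` with what is left of `L₁` are double points of `f`, and `f` has no others. -/
def IsRealizedBy (D : SmoothingData m Ω L₀ L₁ Δ) {N : Type*} [TopologicalSpace N]
    (f : N → V) : Prop :=
  ∃ A B : Set N, IsClosed A ∧ IsClosed B ∧ Disjoint A B ∧
    Set.BijOn f A (L₀ \ D.leftTube) ∧ Set.BijOn f B (L₁ \ D.rightTube) ∧
    Set.BijOn f (A ∪ B)ᶜ D.handle

theorem IsRealizedBy.range_eq {D : SmoothingData m Ω L₀ L₁ Δ} {N : Type*} [TopologicalSpace N]
    {f : N → V} (h : D.IsRealizedBy f) : Set.range f = D.result := by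
  obtain ⟨A, B, -, -, -, hA, hB, hC⟩ := h
  rw [result, ← hA.image_eq, ← hB.image_eq, ← hC.image_eq, ← Set.image_union, ← Set.image_union,
    Set.union_compl_self, Set.image_univ]

end SmoothingData

/-! Tori and connected sums. -/

/-- The torus `𝕋ᵐ`, with the product smooth structure. -/
abbrev Torus (m : ℕ) : Type := Fin m → Circle

/-- The model with corners of the torus `𝕋ᵐ`. -/
abbrev torusModel (m : ℕ) :
    ModelWithCorners ℝ (Fin m → EuclideanSpace ℝ (Fin 1))
      (ModelPi fun _ : Fin m => EuclideanSpace ℝ (Fin 1)) :=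
  ModelWithCorners.pi fun _ : Fin m => 𝓡 1

/-- The smooth manifold `P` is a connected sum of the smooth `m`-manifolds `M₁` and `M₂`: there are
smooth open embeddings `h₁ : ℝᵐ → M₁` and `h₂ : ℝᵐ → M₂` such that `P` is obtained from
`M₁ \ {h₁(0)}` and `M₂ \ {h₂(0)}` by gluing `h₁(v)` to `h₂(v / ‖v‖²)` for all `v ≠ 0`; the smooth
open embeddings of the two pieces in `P` are `j₁` and `j₂`. -/
def IsConnectedSum (m : ℕ) {E₁ H₁ E₂ H₂ : Type*}
    [NormedAddCommGroup E₁] [NormedSpace ℝ E₁] [TopologicalSpace H₁]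
    [NormedAddCommGroup E₂] [NormedSpace ℝ E₂] [TopologicalSpace H₂]
    (I₁ : ModelWithCorners ℝ E₁ H₁) (I₂ : ModelWithCorners ℝ E₂ H₂) (M₁ M₂ P : Type*)
    [TopologicalSpace M₁] [ChartedSpace H₁ M₁] [TopologicalSpace M₂] [ChartedSpace H₂ M₂]
    [TopologicalSpace P] [ChartedSpace (EuclideanSpace ℝ (Fin m)) P] : Prop :=
  ∃ (h₁ : EuclideanSpace ℝ (Fin m) → M₁) (h₂ : EuclideanSpace ℝ (Fin m) → M₂)
    (j₁ : M₁ → P) (j₂ : M₂ → P),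
    Function.Injective h₁ ∧ IsLocalDiffeomorph (𝓡 m) I₁ ∞ h₁ ∧
    Function.Injective h₂ ∧ IsLocalDiffeomorph (𝓡 m) I₂ ∞ h₂ ∧
    Set.InjOn j₁ {h₁ 0}ᶜ ∧ IsLocalDiffeomorphOn I₁ (𝓡 m) ∞ j₁ {h₁ 0}ᶜ ∧
    Set.InjOn j₂ {h₂ 0}ᶜ ∧ IsLocalDiffeomorphOn I₂ (𝓡 m) ∞ j₂ {h₂ 0}ᶜ ∧
    j₁ '' {h₁ 0}ᶜ ∪ j₂ '' {h₂ 0}ᶜ = Set.univ ∧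
    ∀ p ≠ h₁ 0, ∀ q ≠ h₂ 0,
      j₁ p = j₂ q ↔ ∃ v ≠ 0, p = h₁ v ∧ q = h₂ ((‖v‖ ^ 2)⁻¹ • v)

end

/-!
Why the theorem is true.

*The source.* The connected sum of two tori is modelled by `DoubleTorus d`: two copies of `ℝᵈ` minus
the integer lattice, modulo translations, glued along punctured balls of radius `1/4` by an inversion
`neckInv` that preserves directions. The embedded discs are reparametrized balls of radius `1/4`, and
in their coordinates the gluing is `v ↦ v / ‖v‖²` (`isConnectedSum_doubleTorus`).

*Every smoothing is an immersion of `S¹ × P`.* In the coordinates of the chart the handle is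
`(s, u, ξ) ↦ (s, 0, a(u) ξ, ± b(u) ξ)`, so that its two ends are given by the inclusions of the two
tori with a radial parameter. The point is that the product structure, including the loop direction,
has to be matched on both sides with the same framing of the neck. Near the diagonal loop `γⁿ` and
`F(γⁿ)` are parametrized by `(s, v) ↦ (c(s), c(s + v₁), …, c(s + v_d))` and by its image under `F`. The
form pairs the transverse derivatives `A₀(s)`, `A₁(s)` of these parametrizations, read in the chart
(`inner_A`); since `F^*ψ` is diagonal with positive coefficients, the pairing is a constant
nondegenerate one up to a positive factor. Hence for a constant linear map `G` the segment between
`A₀(s)` and `A₁(s) G` consists of isomorphisms; and `G` is joined to a coordinatewise change of sign,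
an automorphism of the lattice, by a path of isomorphisms (`exists_linearMap_path`). Tubular
neighbourhoods of the loop in a torus are unique up to reparametrization of the torus
(`TorusTube.exists_straight`, by linearization on a small ball and a clopen argument for bijectivity),
so each punctured torus has a parametrization that near its boundary is radial with a prescribed
family of directions (`TorusTube.exists_param`). The two parametrizations fit the handle
(`SmoothingData.exists_fittedPair`), and the pieces glue to a Lagrangian immersion that realizes the
smoothing (`FittedPair.glued_isLagrangian`, `FittedPair.glued_isRealizedBy`). No orientation enters:
a change of sign is absorbed by an automorphism of one of the tori.

*Adapted forms exist.* The matrix of `F` in Lagrange form is a Cauchy matrix with scaled rows and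
columns. For alternating points on the circle the residues of `∏ (z - αⱼ) / ∏ (z - βⱼ)` divided by
`βₖ` have a common argument (`CyclicallyOrdered.exists_weights`), and with the corresponding positive
weights the columns of the matrix are orthogonal (`exists_isAdaptedForm`).

*Smoothings exist.* A product of area-preserving collars of `γ` is a symplectic chart that takes
`{t = 0, y = 0}` to `γⁿ`. A real vector with real image under `F` is constant, because a polynomial
of degree at most `d` that is real at `2d + 2` points of the circle is constant
(`exists_eq_const_of_real`); so `γⁿ` and `F(γⁿ)` meet cleanly along the diagonal loop, and `F(γⁿ)`
is in the collar a graph over `(s, y)` (`exists_graph`). This graph is Lagrangian, so the shear that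
takes `{t = 0, x = 0}` to it is symplectic, and the sheared collar is the required chart
(`exists_smoothing`).
-/

noncomputable section

open Set Filter Topology

/-! ### Isotropic immersions and the periodic implicit function theorem -/

section Germs

variable {X Y Z V W : Type*} [NormedAddCommGroup X] [NormedSpace ℝ X] [NormedAddCommGroup Y]
  [NormedSpace ℝ Y] [NormedAddCommGroup Z] [NormedSpace ℝ Z] [NormedAddCommGroup V]
  [NormedSpace ℝ V] [NormedAddCommGroup W] [NormedSpace ℝ W]

/-- `g` is smooth at `w` with injective derivative. -/
def ImmersionAt (g : X → Y) (w : X) : Prop :=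
  ContDiffAt ℝ ∞ g w ∧ Function.Injective (fderiv ℝ g w)

/-- `g` is an immersion at `w` whose derivative has isotropic range for `Ω`. -/
def IsotropicImmersionAt (Ω : V → V → ℝ) (g : X → V) (w : X) : Prop :=
  ImmersionAt g w ∧ ∀ a b, Ω (fderiv ℝ g w a) (fderiv ℝ g w b) = 0

theorem ImmersionAt.differentiableAt {g : X → Y} {w : X} (h : ImmersionAt g w) :
    DifferentiableAt ℝ g w := h.1.differentiableAt (by simp)

theorem ImmersionAt.comp {g : Y → Z} {l : X → Y} {w : X} (hg : ImmersionAt g (l w))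
    (hl : ImmersionAt l w) : ImmersionAt (fun x => g (l x)) w := by
  refine ⟨hg.1.comp w hl.1, ?_⟩
  have := fderiv_comp w hg.differentiableAt hl.differentiableAt
  rw [show (fun x => g (l x)) = g ∘ l from rfl, this]
  exact hg.2.comp hl.2

theorem ImmersionAt.congr {g g' : X → Y} {w : X} (hg : ImmersionAt g w) (h : g' =ᶠ[𝓝 w] g) :
    ImmersionAt g' w :=
  ⟨hg.1.congr_of_eventuallyEq h, by rw [h.fderiv_eq]; exact hg.2⟩

theorem ImmersionAt.of_comp {g : Y → Z} {l : X → Y} {w : X} (hg : ContDiffAt ℝ ∞ g (l w))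
    (hl : ContDiffAt ℝ ∞ l w) (h : Function.Injective (fderiv ℝ (fun x => g (l x)) w)) :
    ImmersionAt l w := by
  refine ⟨hl, ?_⟩
  have := fderiv_comp w (hg.differentiableAt (by simp)) (hl.differentiableAt (by simp))
  rw [show (fun x => g (l x)) = g ∘ l from rfl, this] at h
  exact Function.Injective.of_comp (f := fderiv ℝ g (l w)) h

theorem IsotropicImmersionAt.comp {Ω : V → V → ℝ} {g : Y → V} {l : X → Y} {w : X}
    (hg : IsotropicImmersionAt Ω g (l w)) (hl : ImmersionAt l w) :
    IsotropicImmersionAt Ω (fun x => g (l x)) w := by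
  refine ⟨hg.1.comp hl, fun a b => ?_⟩
  have := fderiv_comp w hg.1.differentiableAt hl.differentiableAt
  rw [show (fun x => g (l x)) = g ∘ l from rfl, this]
  exact hg.2 _ _

theorem IsotropicImmersionAt.congr {Ω : V → V → ℝ} {g g' : X → V} {w : X}
    (hg : IsotropicImmersionAt Ω g w) (h : g' =ᶠ[𝓝 w] g) : IsotropicImmersionAt Ω g' w :=
  ⟨hg.1.congr h, by rw [h.fderiv_eq]; exact hg.2⟩

theorem immersionAt_id (w : X) : ImmersionAt (fun x : X => x) w :=
  ⟨contDiffAt_id, by rw [fderiv_fun_id]; exact fun a b h => h⟩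

theorem immersionAt_of_hasFDerivAt {g : X → Y} {g' : X →L[ℝ] Y} {w : X} (h : ContDiffAt ℝ ∞ g w)
    (hg : HasFDerivAt g g' w) (hi : ∀ v, g' v = 0 → v = 0) : ImmersionAt g w :=
  ⟨h, by rw [hg.fderiv]; exact (injective_iff_map_eq_zero g').2 hi⟩

theorem immersionAt_add_const (w c : X) : ImmersionAt (fun x : X => x + c) w :=
  ⟨contDiffAt_id.add contDiffAt_const, by
    rw [fderiv_add_const, fderiv_fun_id]; exact fun a b h => h⟩

/-- An immersion between spaces of the same dimension is locally open. -/
theorem ImmersionAt.map_nhds [FiniteDimensional ℝ X] [FiniteDimensional ℝ Y] {g : X → Y} {w : X}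
    (h : ImmersionAt g w) (hd : Module.finrank ℝ X = Module.finrank ℝ Y) :
    map g (𝓝 w) = 𝓝 (g w) := by
  have hs : HasStrictFDerivAt g (fderiv ℝ g w) w := h.1.hasStrictFDerivAt (by simp)
  let e := (LinearEquiv.ofInjectiveOfFinrankEq (fderiv ℝ g w : X →ₗ[ℝ] Y) h.2
    hd).toContinuousLinearEquiv
  have he : (e : X →L[ℝ] Y) = fderiv ℝ g w := by ext; rfl
  rw [← he] at hs
  have := FiniteDimensional.complete ℝ X
  exact hs.map_nhds_eq_of_equiv

/-- An immersion between spaces of the same dimension has a smooth local inverse. -/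
theorem ImmersionAt.exists_localInverse [FiniteDimensional ℝ X] [FiniteDimensional ℝ Y] {g : X → Y}
    {w : X} (h : ImmersionAt g w) (hd : Module.finrank ℝ X = Module.finrank ℝ Y) :
    ∃ l : Y → X, ContDiffAt ℝ ∞ l (g w) ∧ l (g w) = w ∧ (∀ᶠ y in 𝓝 (g w), g (l y) = y) ∧
      ∀ᶠ x in 𝓝 w, l (g x) = x := by
  let e := (LinearEquiv.ofInjectiveOfFinrankEq (fderiv ℝ g w : X →ₗ[ℝ] Y) h.2
    hd).toContinuousLinearEquiv
  have he : (e : X →L[ℝ] Y) = fderiv ℝ g w := by ext; rfl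
  have hs : HasFDerivAt g (e : X →L[ℝ] Y) w := by
    rw [he]; exact h.differentiableAt.hasFDerivAt
  have := FiniteDimensional.complete ℝ X
  let φ := h.1.toOpenPartialHomeomorph g hs (by simp)
  have hsrc : w ∈ φ.source := h.1.mem_toOpenPartialHomeomorph_source hs (by simp)
  have hφ : ⇑φ = g := h.1.toOpenPartialHomeomorph_coe hs (by simp)
  refine ⟨h.1.localInverse hs (by simp), h.1.to_localInverse hs (by simp),
    h.1.localInverse_apply_image hs (by simp), ?_, ?_⟩
  · have := φ.eventually_right_inverse' hsrc
    rw [hφ] at this; exact this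
  · have := φ.eventually_left_inverse hsrc
    rw [hφ] at this; exact this

/-- An immersion is locally injective. -/
theorem ImmersionAt.eventually_injective [FiniteDimensional ℝ X] {g : X → Y}
    {w : X} (h : ImmersionAt g w) : ∃ U ∈ 𝓝 w, InjOn g U := by
  have hs : HasStrictFDerivAt g (fderiv ℝ g w) w := h.1.hasStrictFDerivAt (by simp)
  obtain ⟨K, hK0, hK⟩ := LinearMap.exists_antilipschitzWith (fderiv ℝ g w : X →ₗ[ℝ] Y)
    (LinearMap.ker_eq_bot.2 h.2)
  obtain ⟨U, hU, hlip⟩ : ∃ U ∈ 𝓝 w, ApproximatesLinearOn g (fderiv ℝ g w) U (K⁻¹ / 2) :=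
    hs.approximates_deriv_on_nhds (Or.inr (by positivity))
  refine ⟨U, hU, fun x hx y hy hxy => ?_⟩
  have h1 := hlip x hx y hy
  rw [hxy, sub_self, zero_sub, norm_neg] at h1
  have h2 := hK.le_mul_dist x y
  rw [dist_eq_norm, dist_eq_norm, ← map_sub] at h2
  by_contra hne
  have h3 : 0 < ‖x - y‖ := norm_pos_iff.2 (sub_ne_zero.2 hne)
  have hKp : (0 : ℝ) < K := by exact_mod_cast hK0
  have h4 : ‖x - y‖ ≤ K * ((K : ℝ)⁻¹ / 2 * ‖x - y‖) :=
    h2.trans (mul_le_mul_of_nonneg_left (by simpa using h1) hKp.le)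
  have h5 : (K : ℝ) * ((K : ℝ)⁻¹ / 2 * ‖x - y‖) = ‖x - y‖ / 2 := by field_simp
  linarith

end Germs

section Periodic

/-- A property of `(s, y)` that holds near each `(s₀, 0)`, `s₀ ∈ [0, 1]`, holds for all `s ∈ [0, 1]`
and all `y` in a fixed ball. -/
theorem exists_uniform_ball {Y : Type*} [SeminormedAddCommGroup Y] {p : ℝ → Y → Prop}
    (h : ∀ s ∈ Icc (0 : ℝ) 1, ∀ᶠ q : ℝ × Y in 𝓝 (s, 0), p q.1 q.2) :
    ∃ δ > 0, ∀ s ∈ Icc (0 : ℝ) 1, ∀ y, ‖y‖ < δ → p s y := by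
  have := (isCompact_Icc (a := (0 : ℝ)) (b := 1)).eventually_forall_of_forall_eventually
    (x₀ := (0 : Y)) (P := fun y s => p s y) (fun s hs => by
      have := h s hs
      rw [nhds_prod_eq] at this ⊢
      exact (Filter.eventually_swap_iff (p := fun q : ℝ × Y => p q.1 q.2)).1 this)
  obtain ⟨δ, hδ, H⟩ := Metric.eventually_nhds_iff.1 this
  exact ⟨δ, hδ, fun s hs y hy => H (by simpa using hy) s hs⟩

theorem exists_uniform_ball_of_periodic {Y : Type*} [SeminormedAddCommGroup Y] {p : ℝ → Y → Prop}
    (hp : ∀ s y, p (s + 1) y ↔ p s y)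
    (h : ∀ s, ∀ᶠ q : ℝ × Y in 𝓝 (s, 0), p q.1 q.2) :
    ∃ δ > 0, ∀ s y, ‖y‖ < δ → p s y := by
  obtain ⟨δ, hδ, H⟩ := exists_uniform_ball (fun s _ => h s)
  refine ⟨δ, hδ, fun s y hy => ?_⟩
  have hper : Function.Periodic (fun s => p s y) 1 := fun s => propext (hp s y)
  have h1 : p (Int.fract s) y := H _ ⟨Int.fract_nonneg s, (Int.fract_lt_one s).le⟩ y hy
  have h2 : p (s - ⌊s⌋ * 1) y = p s y := hper.sub_int_mul_eq ⌊s⌋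
  rw [mul_one] at h2
  exact h2 ▸ h1

theorem isInvertible_of_bijective {Z W : Type*} [NormedAddCommGroup Z] [NormedSpace ℝ Z]
    [NormedAddCommGroup W] [NormedSpace ℝ W] [FiniteDimensional ℝ Z]
    (L : Z →L[ℝ] W) (h : Function.Bijective L) : L.IsInvertible := by
  have : FiniteDimensional ℝ W := Module.Finite.of_surjective (L : Z →ₗ[ℝ] W) h.2
  exact ⟨(LinearEquiv.ofBijective (L : Z →ₗ[ℝ] W) h).toContinuousLinearEquiv, by ext; rfl⟩

variable {Y Z W : Type*} [NormedAddCommGroup Y]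
  [NormedSpace ℝ Y] [NormedAddCommGroup Z] [NormedSpace ℝ Z]
  [NormedAddCommGroup W] [NormedSpace ℝ W] [FiniteDimensional ℝ Y] [FiniteDimensional ℝ Z]

theorem IsInvertible.eventually {E : Type*} [TopologicalSpace E] [FiniteDimensional ℝ W]
    {L : E → Z →L[ℝ] W} {x : E}
    (hL : ContinuousAt L x) (h : (L x).IsInvertible) : ∀ᶠ y in 𝓝 x, (L y).IsInvertible := by
  have : CompleteSpace Z := FiniteDimensional.complete ℝ Z
  have ho : IsOpen (range ((↑) : (Z ≃L[ℝ] W) → Z →L[ℝ] W)) := ContinuousLinearEquiv.isOpen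
  exact hL.eventually (ho.mem_nhds h)

/-- Implicit function theorem along a circle of zeros, uniformly in the point of the circle. -/
theorem exists_periodic_implicit [FiniteDimensional ℝ W] {H : (ℝ × Y) × Z → W} {δ₀ : ℝ}
    (hδ₀ : 0 < δ₀)
    (hH : ∀ s y z, ‖y‖ < δ₀ → ‖z‖ < δ₀ → ContDiffAt ℝ ∞ H ((s, y), z))
    (h0 : ∀ s, H ((s, 0), 0) = 0)
    (hbij : ∀ s, Function.Bijective fun z : Z => fderiv ℝ H ((s, 0), 0) ((0, 0), z))
    (hper : ∀ s y z, H ((s + 1, y), z) = H ((s, y), z)) :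
    ∃ δ > 0, ∃ δ₁ > 0, ∃ φ : ℝ × Y → Z,
      (∀ s y, ‖y‖ < δ → ContDiffAt ℝ ∞ φ (s, y) ∧ ‖φ (s, y)‖ < δ₀ ∧ H ((s, y), φ (s, y)) = 0 ∧
        φ (s + 1, y) = φ (s, y)) ∧
      (∀ s, φ (s, 0) = 0) ∧
      ∀ s y z, ‖y‖ < δ → ‖z‖ < δ₁ → H ((s, y), z) = 0 → z = φ (s, y) := by
  classical
  have hH0 : ∀ s, ContDiffAt ℝ ∞ H ((s, 0), 0) := fun s =>
    hH s 0 0 (by simpa using hδ₀) (by simpa using hδ₀)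
  have hcW : CompleteSpace W := FiniteDimensional.complete ℝ W
  have hcY : CompleteSpace Y := FiniteDimensional.complete ℝ Y
  have hcZ : CompleteSpace Z := FiniteDimensional.complete ℝ Z
  let D : (ℝ × Y) × Z → Z →L[ℝ] W := fun q => fderiv ℝ H q ∘L .inr ℝ (ℝ × Y) Z
  have hinv : ∀ s, (D ((s, 0), 0)).IsInvertible := fun s =>
    isInvertible_of_bijective _ (hbij s)
  have hDper : ∀ s y z, D ((s + 1, y), z) = D ((s, y), z) := by
    intro s y z
    have h1 : (fun q : (ℝ × Y) × Z => H (q + ((1, 0), 0))) = H := by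
      funext ⟨⟨s, y⟩, z⟩; simp [hper]
    have h2 := fderiv_comp_add_right (𝕜 := ℝ) (f := H) (x := ((s, y), z)) ((1, 0), 0)
    rw [h1] at h2
    simp only [D, h2]
    simp
  -- local uniqueness and invertibility, uniformly in the point of the circle
  obtain ⟨δ₁, hδ₁, huniq⟩ : ∃ δ > 0, ∀ s (q : Y × Z × Z), ‖q‖ < δ →
      (H ((s, q.1), q.2.1) = 0 → H ((s, q.1), q.2.2) = 0 → q.2.1 = q.2.2) ∧
        (D ((s, q.1), q.2.1)).IsInvertible := by
    refine exists_uniform_ball_of_periodic (Y := Y × Z × Z) (p := fun s q =>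
      (H ((s, q.1), q.2.1) = 0 → H ((s, q.1), q.2.2) = 0 → q.2.1 = q.2.2) ∧
        (D ((s, q.1), q.2.1)).IsInvertible)
      (fun s q => by simp only [hper, hDper]) fun s => ?_
    have h1 := (hH0 s).eventually_apply_eq_iff_implicitFunction (by simp) (hinv s)
    have h2 : ∀ᶠ q in 𝓝 ((s, 0), 0), (D q).IsInvertible := by
      refine IsInvertible.eventually ?_ (hinv s)
      have h3 : ContDiffAt ℝ 0 (fderiv ℝ H) ((s, 0), 0) :=
        (hH0 s).fderiv_right (m := 0) (by simp)
      exact (h3.continuousAt).clm_comp continuousAt_const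
    have t1 : Tendsto (fun q : ℝ × Y × Z × Z => ((q.1, q.2.1), q.2.2.1)) (𝓝 (s, 0))
        (𝓝 ((s, 0), 0)) := by
      have : Continuous (fun q : ℝ × Y × Z × Z => ((q.1, q.2.1), q.2.2.1)) := by fun_prop
      simpa using this.tendsto (s, 0)
    have t2 : Tendsto (fun q : ℝ × Y × Z × Z => ((q.1, q.2.1), q.2.2.2)) (𝓝 (s, 0))
        (𝓝 ((s, 0), 0)) := by
      have : Continuous (fun q : ℝ × Y × Z × Z => ((q.1, q.2.1), q.2.2.2)) := by fun_prop
      simpa using this.tendsto (s, 0)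
    filter_upwards [t1.eventually h1, t2.eventually h1, t1.eventually h2] with q hq1 hq2 hq3
    rw [h0 s] at hq1 hq2
    exact ⟨fun e1 e2 => by rw [← hq1.1 e1, ← hq2.1 e2], hq3⟩
  -- local existence
  let δ₂ := min δ₀ δ₁
  have hδ₂ : 0 < δ₂ := lt_min hδ₀ hδ₁
  obtain ⟨δ₃, hδ₃, hex⟩ : ∃ δ > 0, ∀ s (y : Y), ‖y‖ < δ → ∃ z, ‖z‖ < δ₂ ∧ H ((s, y), z) = 0 := by
    refine exists_uniform_ball_of_periodic (p := fun s y => ∃ z, ‖z‖ < δ₂ ∧ H ((s, y), z) = 0)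
      (fun s y => by simp only [hper]) fun s => ?_
    have h1 := (hH0 s).eventually_apply_implicitFunction (by simp) (hinv s)
    have h2 := (hH0 s).contDiffAt_implicitFunction (by simp) (hinv s)
    have h3 := Filter.Tendsto.eventually_lt_const (u := δ₂) (lt_of_eq_of_lt
      (congrArg norm ((hH0 s).implicitFunction_apply_self (by simp) (hinv s))) (by simpa using hδ₂))
      h2.continuousAt.norm
    filter_upwards [h1, h3] with q hq1 hq2
    exact ⟨_, hq2, hq1.trans (h0 s)⟩
  let φ : ℝ × Y → Z := fun q => if h : ∃ z, ‖z‖ < δ₂ ∧ H (q, z) = 0 then h.choose else 0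
  let δ := min δ₃ (min δ₁ δ₀)
  have hδ1 : δ ≤ δ₁ := (min_le_right _ _).trans (min_le_left _ _)
  have hδ0 : δ ≤ δ₀ := (min_le_right _ _).trans (min_le_right _ _)
  have hφ : ∀ s y, ‖y‖ < δ → ‖φ (s, y)‖ < δ₂ ∧ H ((s, y), φ (s, y)) = 0 := by
    intro s y hy
    have h := hex s y (hy.trans_le (min_le_left _ _))
    simp only [φ, dif_pos h]
    exact h.choose_spec
  have hφu : ∀ s y z, ‖y‖ < δ → ‖z‖ < δ₁ → H ((s, y), z) = 0 → z = φ (s, y) := by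
    intro s y z hy hz hHz
    obtain ⟨h1, h2⟩ := hφ s y hy
    refine (huniq s (y, z, φ (s, y)) ?_).1 hHz h2
    simp only [Prod.norm_mk, max_lt_iff]
    exact ⟨hy.trans_le hδ1, hz, h1.trans_le (min_le_right _ _)⟩
  have hpos : 0 < δ := lt_min hδ₃ (lt_min hδ₁ hδ₀)
  refine ⟨δ, hpos, δ₁, hδ₁, φ, fun s y hy => ⟨?_, ?_, (hφ s y hy).2, ?_⟩, fun s => ?_, hφu⟩
  · obtain ⟨h1, h2⟩ := hφ s y hy
    have hHy : ContDiffAt ℝ ∞ H ((s, y), φ (s, y)) :=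
      hH s y _ (hy.trans_le hδ0) (h1.trans_le (min_le_left _ _))
    have hiy : (D ((s, y), φ (s, y))).IsInvertible := by
      refine (huniq s (y, φ (s, y), φ (s, y)) ?_).2
      simp only [Prod.norm_mk, max_lt_iff]
      exact ⟨hy.trans_le hδ1, h1.trans_le (min_le_right _ _), h1.trans_le (min_le_right _ _)⟩
    have hgs := hHy.contDiffAt_implicitFunction (by simp) hiy
    refine hgs.congr_of_eventuallyEq ?_
    have e1 : ∀ᶠ q : ℝ × Y in 𝓝 (s, y), ‖q.2‖ < δ :=
      (continuous_snd.norm.continuousAt (x := ((s, y) : ℝ × Y))).eventually (gt_mem_nhds hy)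
    have e2 := Filter.Tendsto.eventually_lt_const (u := δ₂) (lt_of_eq_of_lt
      (congrArg norm (hHy.implicitFunction_apply_self (by simp) hiy)) h1) hgs.continuousAt.norm
    filter_upwards [e1, e2, hHy.eventually_apply_implicitFunction (by simp) hiy] with q q1 q2 q3
    exact (hφu q.1 q.2 _ q1 (q2.trans_le (min_le_right _ _)) (q3.trans h2)).symm
  · exact (hφ s y hy).1.trans_le (min_le_left _ _)
  · refine hφu s y _ hy ((hφ (s + 1) y hy).1.trans_le (min_le_right _ _)) ?_
    rw [← hper]; exact (hφ (s + 1) y hy).2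
  · exact (hφu s 0 0 (by simpa using hpos) (by simpa using hδ₁) (h0 s)).symm

end Periodic

/-! ### The integer lattice and functions of the nearest lattice point -/

section Lattice

variable {d : ℕ}

/-- The vector of `ℝᵈ` with the integer coordinates `k`. -/
def latticeVec (k : Fin d → ℤ) : EuclideanSpace ℝ (Fin d) := WithLp.toLp 2 fun i => (k i : ℝ)

/-- The difference between `v` and the nearest point of the integer lattice. -/
def cubeRep (v : EuclideanSpace ℝ (Fin d)) : EuclideanSpace ℝ (Fin d) :=
  WithLp.toLp 2 fun i => v i - round (v i)

@[simp] theorem latticeVec_apply (k : Fin d → ℤ) (i : Fin d) : latticeVec k i = k i := rfl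

@[simp] theorem cubeRep_apply (v : EuclideanSpace ℝ (Fin d)) (i : Fin d) :
    cubeRep v i = v i - round (v i) := rfl

theorem cubeRep_add_latticeVec (v : EuclideanSpace ℝ (Fin d)) (k : Fin d → ℤ) :
    cubeRep (v + latticeVec k) = cubeRep v := by
  ext i; simp

theorem cubeRep_add_round (v : EuclideanSpace ℝ (Fin d)) :
    cubeRep v + latticeVec (fun i => round (v i)) = v := by
  ext i; simp

theorem cubeRep_eq_iff {v w : EuclideanSpace ℝ (Fin d)} :
    cubeRep v = cubeRep w ↔ ∃ k, w = v + latticeVec k := by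
  constructor
  · intro h
    refine ⟨fun i => round (w i) - round (v i), ?_⟩
    ext i
    have := congrArg (fun x => x i) h
    simp only [cubeRep_apply] at this
    simp only [PiLp.add_apply, latticeVec_apply, Int.cast_sub]
    linarith
  · rintro ⟨k, rfl⟩
    exact (cubeRep_add_latticeVec v k).symm

theorem round_eq_zero_of_abs_lt {x : ℝ} (h : |x| < 1 / 2) : round x = 0 := by
  rw [abs_lt] at h
  rw [round_eq_zero_iff]
  exact ⟨by linarith [h.1], by linarith [h.2]⟩

theorem EuclideanSpace.abs_apply_le_norm (v : EuclideanSpace ℝ (Fin d)) (i : Fin d) :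
    |v i| ≤ ‖v‖ := by simpa using PiLp.norm_apply_le v i

theorem cubeRep_eq_self_of_abs {v : EuclideanSpace ℝ (Fin d)} (h : ∀ i, |v i| < 1 / 2) :
    cubeRep v = v := by
  ext i
  simp [round_eq_zero_of_abs_lt (h i)]

theorem cubeRep_eq_self {v : EuclideanSpace ℝ (Fin d)} (h : ‖v‖ < 1 / 2) : cubeRep v = v :=
  cubeRep_eq_self_of_abs fun i => (EuclideanSpace.abs_apply_le_norm v i).trans_lt h

theorem cubeRep_zero : cubeRep (0 : EuclideanSpace ℝ (Fin d)) = 0 := cubeRep_eq_self (by simp)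

theorem abs_cubeRep_apply_le (v : EuclideanSpace ℝ (Fin d)) (i : Fin d) :
    |cubeRep v i| ≤ 1 / 2 := abs_sub_round (v i)

theorem cubeRep_cubeRep (v : EuclideanSpace ℝ (Fin d)) : cubeRep (cubeRep v) = cubeRep v := by
  conv_rhs => rw [← cubeRep_add_round v]
  rw [cubeRep_add_latticeVec]

theorem continuous_norm_cubeRep :
    Continuous fun v : EuclideanSpace ℝ (Fin d) => ‖cubeRep v‖ := by
  have h : ∀ i : Fin d, Continuous fun v : EuclideanSpace ℝ (Fin d) => |v i - round (v i)| := by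
    intro i
    have h1 : Continuous fun x : ℝ => |x - round x| := by
      have h2 : (fun x : ℝ => |x - round x|) = fun x : ℝ => ‖(x : AddCircle (1 : ℝ))‖ := by
        funext x; exact (UnitAddCircle.norm_eq).symm
      rw [h2]
      exact continuous_norm.comp (AddCircle.continuous_mk' (1 : ℝ))
    exact h1.comp (by fun_prop : Continuous fun v : EuclideanSpace ℝ (Fin d) => v i)
  simp only [EuclideanSpace.norm_eq, cubeRep_apply, Real.norm_eq_abs]
  exact Real.continuous_sqrt.comp (continuous_finsetSum _ fun i _ => (h i).pow 2)

theorem eventually_cubeRep_eq {v₀ : EuclideanSpace ℝ (Fin d)} (h : ‖cubeRep v₀‖ < 1 / 2) :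
    ∀ᶠ v in 𝓝 v₀, cubeRep v = v + (cubeRep v₀ - v₀) := by
  have h1 : ∀ᶠ v in 𝓝 v₀, ‖v + (cubeRep v₀ - v₀)‖ < 1 / 2 := by
    have : ContinuousAt (fun v => ‖v + (cubeRep v₀ - v₀)‖) v₀ := by fun_prop
    exact this.eventually_lt continuousAt_const (by simpa using h)
  filter_upwards [h1] with v hv
  rw [← cubeRep_eq_self hv, cubeRep_eq_iff]
  refine ⟨-fun i => round (v₀ i), ?_⟩
  ext i; simp

theorem eventually_cubeRep_add {v₀ : EuclideanSpace ℝ (Fin d)} (h : ‖cubeRep v₀‖ < 1 / 2)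
    (s : ℝ) : ∀ᶠ w : ℝ × EuclideanSpace ℝ (Fin d) in 𝓝 (s, v₀),
      (w.1, cubeRep w.2) = w + (0, cubeRep v₀ - v₀) := by
  have := (continuous_snd.tendsto (s, v₀)).eventually (eventually_cubeRep_eq h)
  filter_upwards [this] with w hw
  rw [hw]; ext <;> simp

theorem eventually_norm_cubeRep_lt {v₀ : EuclideanSpace ℝ (Fin d)} {R : ℝ} (h : ‖cubeRep v₀‖ < R)
    (s : ℝ) : ∀ᶠ w : ℝ × EuclideanSpace ℝ (Fin d) in 𝓝 (s, v₀), ‖cubeRep w.2‖ < R := by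
  have h1 : Continuous fun w : ℝ × EuclideanSpace ℝ (Fin d) => ‖cubeRep w.2‖ :=
    continuous_norm_cubeRep.comp continuous_snd
  exact (isOpen_lt h1 continuous_const).mem_nhds h

theorem eventually_lt_norm_cubeRep {v₀ : EuclideanSpace ℝ (Fin d)} {R : ℝ} (h : R < ‖cubeRep v₀‖)
    (s : ℝ) : ∀ᶠ w : ℝ × EuclideanSpace ℝ (Fin d) in 𝓝 (s, v₀), R < ‖cubeRep w.2‖ := by
  have h1 : Continuous fun w : ℝ × EuclideanSpace ℝ (Fin d) => ‖cubeRep w.2‖ :=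
    continuous_norm_cubeRep.comp continuous_snd
  exact (isOpen_lt continuous_const h1).mem_nhds h

theorem cubeRep_eq_zero_iff {v : EuclideanSpace ℝ (Fin d)} :
    cubeRep v = 0 ↔ ∃ k, v = latticeVec k := by
  rw [← cubeRep_zero, eq_comm, cubeRep_eq_iff]; simp

theorem isCompact_cube :
    IsCompact {v : EuclideanSpace ℝ (Fin d) | ∀ i, v i ∈ Icc (-1 / 2 : ℝ) (1 / 2)} := by
  have h := isCompact_univ_pi fun _ : Fin d => isCompact_Icc (a := (-1 / 2 : ℝ)) (b := 1 / 2)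
  have h2 := h.image (PiLp.continuous_toLp 2 fun _ : Fin d => ℝ)
  convert h2 using 1
  ext v
  simp only [mem_ofPred_eq, mem_image, mem_univ_pi]
  constructor
  · intro hv; exact ⟨fun i => v i, hv, by ext i; rfl⟩
  · rintro ⟨u, hu, rfl⟩ i; exact hu i

theorem cubeRep_mem_cube (v : EuclideanSpace ℝ (Fin d)) :
    ∀ i, cubeRep v i ∈ Icc (-1 / 2 : ℝ) (1 / 2) := fun i => by
  have := abs_le.1 (abs_cubeRep_apply_le v i)
  exact ⟨by linarith [this.1], this.2⟩

/-- Points of small norm that differ by a lattice vector agree. -/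
theorem eq_of_cubeRep_eq {v w : EuclideanSpace ℝ (Fin d)} (hv : ‖v‖ < 1 / 2) (hw : ‖w‖ < 1 / 2)
    (h : cubeRep v = cubeRep w) : v = w := by
  rwa [cubeRep_eq_self hv, cubeRep_eq_self hw] at h

end Lattice

section Clopen

/-- Clopen argument: a continuous, open and locally injective self-map of a compact connected
Hausdorff space that takes some value exactly once is bijective. -/
theorem bijective_of_isOpenMap_of_locallyInjective {Y : Type*} [TopologicalSpace Y]
    [CompactSpace Y] [T2Space Y] [PreconnectedSpace Y] {m : Y → Y} (hc : Continuous m)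
    (ho : IsOpenMap m) (hl : ∀ x, ∃ U ∈ 𝓝 x, InjOn m U) {x₀ : Y}
    (h₀ : ∀ x, m x = m x₀ → x = x₀) : Function.Bijective m := by
  have hinj : ∀ x x', m x = m x' → x = x' := by
    let S : Set Y := {y | ∀ x x', m x = y → m x' = y → x = x'}
    have hS1 : IsOpen S := by
      rw [isOpen_iff_mem_nhds]
      intro y hy
      by_cases hne : ∃ x, m x = y
      · obtain ⟨x, rfl⟩ := hne
        obtain ⟨U, hU, hUi⟩ := hl x
        obtain ⟨U', hU', hU'o, hxU'⟩ := mem_nhds_iff.1 hU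
        have hcl : IsClosed (m '' U'ᶜ) := (hU'o.isClosed_compl.isCompact.image hc).isClosed
        have hny : m x ∉ m '' U'ᶜ := by
          rintro ⟨z, hz, hzx⟩
          exact hz (hy z x hzx rfl ▸ hxU')
        filter_upwards [hcl.isOpen_compl.mem_nhds hny] with y' hy' a b ha hb
        have haU : a ∈ U' := by by_contra h; exact hy' ⟨a, h, ha⟩
        have hbU : b ∈ U' := by by_contra h; exact hy' ⟨b, h, hb⟩
        exact hUi (hU' haU) (hU' hbU) (ha.trans hb.symm)
      · have hcl : IsClosed (range m) := (isCompact_range hc).isClosed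
        filter_upwards [hcl.isOpen_compl.mem_nhds (by simpa using hne)] with y' hy' a b ha
        exact (hy' ⟨a, ha⟩).elim
    have hS2 : IsClosed S := by
      rw [← isOpen_compl_iff, isOpen_iff_mem_nhds]
      intro y hy
      simp only [S, mem_compl_iff, mem_ofPred_eq, not_forall] at hy
      obtain ⟨a, b, ha, hb, hab⟩ := hy
      obtain ⟨U, V, hU, hV, haU, hbV, hUV⟩ := t2_separation hab
      have h1 : m '' U ∈ 𝓝 y := ha ▸ (ho U hU).mem_nhds ⟨a, haU, rfl⟩
      have h2 : m '' V ∈ 𝓝 y := hb ▸ (ho V hV).mem_nhds ⟨b, hbV, rfl⟩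
      filter_upwards [h1, h2]
      rintro y' ⟨a', ha', rfl⟩ ⟨b', hb', hab'⟩ hy'
      have := hy' a' b' rfl hab'
      subst this
      exact Set.disjoint_left.1 hUV ha' hb'
    have hSu : S = univ := IsClopen.eq_univ ⟨hS2, hS1⟩
      ⟨m x₀, fun x x' h h' => (h₀ x h).trans (h₀ x' h').symm⟩
    intro x x' h
    exact (hSu ▸ mem_univ (m x') : m x' ∈ S) x x' h rfl
  refine ⟨hinj, ?_⟩
  have hr : range m = univ := IsClopen.eq_univ
    ⟨(isCompact_range hc).isClosed, ho.isOpen_range⟩ ⟨m x₀, x₀, rfl⟩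
  exact range_eq_univ.1 hr

end Clopen

/-! ### Linearizing a torus parametrization near a tube -/

/-- An isotropic torus parametrized by `C`, periodic under `ℤ × ℤᵈ`, together with a tube
parametrized by `T` around the loop `v = 0` that lies in the torus. The map `f` is the coordinate
change `T⁻¹ ∘ C` near the loop, and `lift` says that `T` is open in the torus. -/
structure TorusTube (d : ℕ) {V : Type*} [NormedAddCommGroup V] [NormedSpace ℝ V]
    (Ω : V → V → ℝ) where
  C : ℝ × EuclideanSpace ℝ (Fin d) → V
  T : ℝ × EuclideanSpace ℝ (Fin d) → V
  f : ℝ × EuclideanSpace ℝ (Fin d) → ℝ × EuclideanSpace ℝ (Fin d)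
  ε : ℝ
  ρ : ℝ
  ρ_pos : 0 < ρ
  C_iso : ∀ w, IsotropicImmersionAt Ω C w
  T_iso : ∀ p, ‖p.2‖ < ε → IsotropicImmersionAt Ω T p
  C_eq : ∀ w w', C w = C w' ↔ (∃ k : ℤ, w'.1 = w.1 + k) ∧ cubeRep w.2 = cubeRep w'.2
  T_eq : ∀ p p', ‖p.2‖ < ε → ‖p'.2‖ < ε → (T p = T p' ↔ (∃ k : ℤ, p'.1 = p.1 + k) ∧ p.2 = p'.2)
  T_mem : ∀ p, ‖p.2‖ < ε → T p ∈ range C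
  lift : ∀ w p, ‖p.2‖ < ε → C w = T p → ∃ l : ℝ × EuclideanSpace ℝ (Fin d) →
    ℝ × EuclideanSpace ℝ (Fin d), ContDiffAt ℝ ∞ l w ∧ l w = p ∧ ∀ᶠ w' in 𝓝 w, C w' = T (l w')
  f_smooth : ∀ s v, ‖v‖ < ρ → ContDiffAt ℝ ∞ f (s, v)
  f_zero : ∀ s, f (s, 0) = (s, 0)
  f_per : ∀ s v, ‖v‖ < ρ → f (s + 1, v) = f (s, v) + (1, 0)
  f_lift : ∀ s v, ‖v‖ < ρ → ‖(f (s, v)).2‖ < ε ∧ C (s, v) = T (f (s, v))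

/-- A continuous periodic family of injective linear maps is uniformly bounded below. -/
theorem exists_uniform_lower_bound {E F : Type*} [NormedAddCommGroup E] [NormedSpace ℝ E]
    [NormedAddCommGroup F] [NormedSpace ℝ F] [FiniteDimensional ℝ E] {A : ℝ → E →L[ℝ] F}
    (hc : Continuous A) (hp : Function.Periodic A 1) (hi : ∀ s v, A s v = 0 → v = 0) :
    ∃ m > 0, ∀ s v, m * ‖v‖ ≤ ‖A s v‖ := by
  have hK : IsCompact (Icc (0 : ℝ) 1 ×ˢ Metric.sphere (0 : E) 1) :=
    isCompact_Icc.prod (isCompact_sphere 0 1)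
  have hcont : Continuous fun q : ℝ × E => ‖A q.1 q.2‖ := by fun_prop
  obtain ⟨m, hm, H⟩ := hK.exists_forall_le' hcont.continuousOn (a := 0) (by
    rintro ⟨s, v⟩ ⟨-, hv⟩
    refine norm_pos_iff.2 fun h => ?_
    have := hi s v h
    simp [this] at hv)
  refine ⟨m, hm, fun s v => ?_⟩
  rcases eq_or_ne v 0 with rfl | hv
  · simp
  have h1 : A (Int.fract s) = A s := by
    have := hp.sub_int_mul_eq (x := s) ⌊s⌋
    rw [mul_one] at this; exact this
  have h2 := H (Int.fract s, ‖v‖⁻¹ • v) ⟨⟨Int.fract_nonneg s, (Int.fract_lt_one s).le⟩, by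
    simp [norm_smul, hv]⟩
  simp only [h1, map_smul, norm_smul, norm_inv, norm_norm] at h2
  have h3 : 0 < ‖v‖ := norm_pos_iff.2 hv
  rwa [inv_mul_eq_div, le_div_iff₀ h3] at h2

theorem exists_uniform_upper_bound {F : Type*} [NormedAddCommGroup F] {A : ℝ → F}
    (hc : Continuous A) (hp : Function.Periodic A 1) : ∃ K > 0, ∀ s, ‖A s‖ ≤ K := by
  obtain ⟨K, hK⟩ := (isCompact_Icc (a := (0 : ℝ)) (b := 1)).exists_bound_of_continuousOn
    hc.continuousOn
  refine ⟨max K 1, by positivity, fun s => ?_⟩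
  have h1 : A (Int.fract s) = A s := by
    have := hp.sub_int_mul_eq (x := s) ⌊s⌋
    rw [mul_one] at this; exact this
  rw [← h1]
  exact (hK _ ⟨Int.fract_nonneg s, (Int.fract_lt_one s).le⟩).trans (le_max_left _ _)

/-- A smooth function of `t` that is `0` for `t ≤ 1`, and `1` for `4 ≤ t`. -/
def cutoff (t : ℝ) : ℝ := Real.smoothTransition ((t - 1) / 3)

theorem contDiff_cutoff : ContDiff ℝ ∞ cutoff :=
  Real.smoothTransition.contDiff.comp (by fun_prop)

theorem cutoff_of_le {t : ℝ} (h : t ≤ 1) : cutoff t = 0 :=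
  Real.smoothTransition.zero_of_nonpos (by linarith)

theorem cutoff_of_ge {t : ℝ} (h : 4 ≤ t) : cutoff t = 1 :=
  Real.smoothTransition.one_of_one_le (by linarith)

theorem cutoff_mem (t : ℝ) : 0 ≤ cutoff t ∧ cutoff t ≤ 1 :=
  ⟨Real.smoothTransition.nonneg _, Real.smoothTransition.le_one _⟩

theorem exists_deriv_cutoff_bound : ∃ K > 0, ∀ t, |deriv cutoff t| ≤ K := by
  have hc : Continuous (deriv cutoff) := contDiff_cutoff.continuous_deriv (by simp)
  obtain ⟨K, hK⟩ := (isCompact_Icc (a := (1 : ℝ)) (b := 4)).exists_bound_of_continuousOn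
    hc.continuousOn
  refine ⟨max K 1, by positivity, fun t => ?_⟩
  by_cases ht : t ∈ Icc (1 : ℝ) 4
  · exact (hK t ht).trans (le_max_left _ _)
  · have : deriv cutoff t = 0 := by
      rw [mem_Icc, not_and_or, not_le, not_le] at ht
      rcases ht with ht | ht
      · have : cutoff =ᶠ[𝓝 t] fun _ => 0 := by
          filter_upwards [gt_mem_nhds ht] with x hx using cutoff_of_le hx.le
        rw [this.deriv_eq]; simp
      · have : cutoff =ᶠ[𝓝 t] fun _ => 1 := by
          filter_upwards [lt_mem_nhds ht] with x hx using cutoff_of_ge hx.le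
        rw [this.deriv_eq]; simp
    rw [this]; simp

namespace TorusTube

variable {d : ℕ} {V : Type*} [NormedAddCommGroup V] [NormedSpace ℝ V] {Ω : V → V → ℝ}
  (S : TorusTube d Ω)

theorem ε_pos : 0 < S.ε := by
  have := (S.f_lift 0 0 (by simpa using S.ρ_pos)).1
  rw [S.f_zero] at this; simpa using this

/-- The transverse linear part of the coordinate change `f` along the loop. -/
def A (s : ℝ) : EuclideanSpace ℝ (Fin d) →L[ℝ] EuclideanSpace ℝ (Fin d) :=
  (ContinuousLinearMap.snd ℝ ℝ _).comp
    ((fderiv ℝ S.f (s, 0)).comp (ContinuousLinearMap.inr ℝ ℝ _))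

theorem A_apply (s : ℝ) (v : EuclideanSpace ℝ (Fin d)) :
    S.A s v = (fderiv ℝ S.f (s, 0) (0, v)).2 := rfl

theorem f_smooth_zero (s : ℝ) : ContDiffAt ℝ ∞ S.f (s, 0) :=
  S.f_smooth s 0 (by simpa using S.ρ_pos)

theorem hasFDerivAt_f (s : ℝ) : HasFDerivAt S.f (fderiv ℝ S.f (s, 0)) (s, 0) :=
  ((S.f_smooth_zero s).differentiableAt (by simp)).hasFDerivAt

theorem contDiff_A : ContDiff ℝ ∞ S.A := by
  rw [contDiff_iff_contDiffAt]
  intro s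
  have h1 : ContDiffAt ℝ ∞ (fderiv ℝ S.f) (s, 0) := (S.f_smooth_zero s).fderiv_right (by simp)
  have h2 : ContDiffAt ℝ ∞ (fun s : ℝ => fderiv ℝ S.f (s, 0)) s :=
    ContDiffAt.comp s (g := fderiv ℝ S.f) (f := fun s : ℝ => (s, 0)) h1 (by fun_prop)
  exact contDiffAt_const.clm_comp (h2.clm_comp contDiffAt_const)

theorem fderiv_f_add_one {s : ℝ} {v : EuclideanSpace ℝ (Fin d)} (hv : ‖v‖ < S.ρ) :
    fderiv ℝ S.f (s + 1, v) = fderiv ℝ S.f (s, v) := by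
  have h1 := fderiv_comp_add_right (𝕜 := ℝ) (f := S.f) (x := (s, v)) (1, 0)
  have h2 : (fun q => S.f (q + (1, 0))) =ᶠ[𝓝 (s, v)] fun q => S.f q + (1, 0) := by
    have : ∀ᶠ q : ℝ × EuclideanSpace ℝ (Fin d) in 𝓝 (s, v), ‖q.2‖ < S.ρ :=
      (continuous_snd.norm.continuousAt).eventually (gt_mem_nhds hv)
    filter_upwards [this] with q hq
    rw [← S.f_per q.1 q.2 hq]; congr 1; ext <;> simp
  rw [h2.fderiv_eq, fderiv_add_const] at h1
  rw [h1]; simp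

theorem A_periodic : Function.Periodic S.A 1 := fun s => by
  ext v : 1
  rw [A_apply, A_apply, S.fderiv_f_add_one (by simpa using S.ρ_pos)]

theorem fderiv_f_zero (s : ℝ) : fderiv ℝ S.f (s, 0) (1, 0) = (1, 0) := by
  have h1 : HasDerivAt (fun s : ℝ => (s, (0 : EuclideanSpace ℝ (Fin d)))) (1, 0) s :=
    (hasDerivAt_id s).prodMk (hasDerivAt_const s _)
  have h2 := (S.hasFDerivAt_f s).comp_hasDerivAt s h1
  have h3 : S.f ∘ (fun s : ℝ => (s, (0 : EuclideanSpace ℝ (Fin d)))) = fun s => (s, 0) :=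
    funext S.f_zero
  rw [h3] at h2
  exact h2.unique h1

theorem immersionAt_f {s : ℝ} {v : EuclideanSpace ℝ (Fin d)} (hv : ‖v‖ < S.ρ) :
    ImmersionAt S.f (s, v) := by
  refine ImmersionAt.of_comp (g := S.T) (S.T_iso _ (S.f_lift s v hv).1).1.1 (S.f_smooth s v hv) ?_
  have : (fun x => S.T (S.f x)) =ᶠ[𝓝 (s, v)] S.C := by
    have : ∀ᶠ q : ℝ × EuclideanSpace ℝ (Fin d) in 𝓝 (s, v), ‖q.2‖ < S.ρ :=
      (continuous_snd.norm.continuousAt).eventually (gt_mem_nhds hv)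
    filter_upwards [this] with q hq using (S.f_lift q.1 q.2 hq).2.symm
  rw [this.fderiv_eq]
  exact (S.C_iso _).1.2

theorem A_injective (s : ℝ) (v : EuclideanSpace ℝ (Fin d)) (h : S.A s v = 0) : v = 0 := by
  have h1 := (S.immersionAt_f (s := s) (v := 0) (by simpa using S.ρ_pos)).2
  set L := fderiv ℝ S.f (s, 0)
  have h2 : L (-(L (0, v)).1, v) = L 0 := by
    have : ((-(L (0, v)).1, v) : ℝ × EuclideanSpace ℝ (Fin d)) =
        (0, v) - (L (0, v)).1 • (1, 0) := by ext <;> simp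
    rw [this, map_sub, map_smul, S.fderiv_f_zero, map_zero]
    ext1
    · simp
    · simpa [A_apply] using h
  exact (Prod.ext_iff.1 (h1 h2)).2

/-- The linear model of the coordinate change. -/
def lin (w : ℝ × EuclideanSpace ℝ (Fin d)) : ℝ × EuclideanSpace ℝ (Fin d) := (w.1, S.A w.1 w.2)

/-- The coordinate change blended into its linear model over the shell `δ ≤ ‖v‖ ≤ 2 δ`. -/
def blend (δ : ℝ) (w : ℝ × EuclideanSpace ℝ (Fin d)) : ℝ × EuclideanSpace ℝ (Fin d) :=
  S.lin w + cutoff (‖w.2‖ ^ 2 / δ ^ 2) • (S.f w - S.lin w)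

theorem contDiff_lin : ContDiff ℝ ∞ S.lin :=
  contDiff_fst.prodMk ((S.contDiff_A.comp contDiff_fst).clm_apply contDiff_snd)

theorem blend_of_le {δ : ℝ} (hδ : 0 < δ) {w : ℝ × EuclideanSpace ℝ (Fin d)} (h : ‖w.2‖ ≤ δ) :
    S.blend δ w = S.lin w := by
  have : ‖w.2‖ ^ 2 / δ ^ 2 ≤ 1 := by
    rw [div_le_one (by positivity)]; gcongr
  simp [blend, cutoff_of_le this]

theorem blend_of_ge {δ : ℝ} (hδ : 0 < δ) {w : ℝ × EuclideanSpace ℝ (Fin d)} (h : 2 * δ ≤ ‖w.2‖) :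
    S.blend δ w = S.f w := by
  have : 4 ≤ ‖w.2‖ ^ 2 / δ ^ 2 := by
    rw [le_div_iff₀ (by positivity)]; nlinarith
  simp [blend, cutoff_of_ge this]

theorem lin_add_one (s : ℝ) (v : EuclideanSpace ℝ (Fin d)) :
    S.lin (s + 1, v) = S.lin (s, v) + (1, 0) := by
  simp [lin, S.A_periodic s]

theorem blend_add_one {δ : ℝ} {s : ℝ} {v : EuclideanSpace ℝ (Fin d)} (hv : ‖v‖ < S.ρ) :
    S.blend δ (s + 1, v) = S.blend δ (s, v) + (1, 0) := by
  simp only [blend, S.lin_add_one, S.f_per s v hv]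
  rw [add_sub_add_right_eq_sub]; abel

/-- The error of the linear model of the coordinate change. -/
def err (w : ℝ × EuclideanSpace ℝ (Fin d)) : ℝ × EuclideanSpace ℝ (Fin d) := S.f w - S.lin w

theorem err_smooth {s : ℝ} {v : EuclideanSpace ℝ (Fin d)} (hv : ‖v‖ < S.ρ) :
    ContDiffAt ℝ ∞ S.err (s, v) := (S.f_smooth s v hv).sub S.contDiff_lin.contDiffAt

theorem err_zero (s : ℝ) : S.err (s, 0) = 0 := by simp [err, lin, S.f_zero]

theorem hasFDerivAt_lin (w : ℝ × EuclideanSpace ℝ (Fin d)) :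
    HasFDerivAt S.lin ((ContinuousLinearMap.fst ℝ ℝ _).prod
      ((S.A w.1).comp (ContinuousLinearMap.snd ℝ ℝ _) +
        ((deriv S.A w.1 w.2 : EuclideanSpace ℝ (Fin d)) |>
          (ContinuousLinearMap.fst ℝ ℝ (EuclideanSpace ℝ (Fin d))).smulRight))) w := by
  have h1 : HasFDerivAt (fun w : ℝ × EuclideanSpace ℝ (Fin d) => S.A w.1)
      ((ContinuousLinearMap.fst ℝ ℝ (EuclideanSpace ℝ (Fin d))).smulRight (deriv S.A w.1)) w := by
    have h2 : HasDerivAt S.A (deriv S.A w.1) w.1 :=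
      ((S.contDiff_A.differentiable (by simp)) _).hasDerivAt
    have h3 := HasFDerivAt.comp w h2.hasFDerivAt (hasFDerivAt_fst (𝕜 := ℝ) (p := w))
    refine h3.congr_fderiv ?_
    ext <;> simp
  refine (hasFDerivAt_fst.prodMk (h1.clm_apply hasFDerivAt_snd)).congr_fderiv ?_
  ext <;> simp

theorem fderiv_lin (w q : ℝ × EuclideanSpace ℝ (Fin d)) :
    fderiv ℝ S.lin w q = (q.1, S.A w.1 q.2 + q.1 • deriv S.A w.1 w.2) := by
  rw [(S.hasFDerivAt_lin w).fderiv]; simp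

theorem fderiv_err_zero (s : ℝ) (q : ℝ × EuclideanSpace ℝ (Fin d)) :
    fderiv ℝ S.err (s, 0) q = ((fderiv ℝ S.f (s, 0) (0, q.2)).1, 0) := by
  have h1 : fderiv ℝ S.err (s, 0) = fderiv ℝ S.f (s, 0) - fderiv ℝ S.lin (s, 0) :=
    fderiv_sub (S.hasFDerivAt_f s).differentiableAt (S.hasFDerivAt_lin _).differentiableAt
  have h2 : q = q.1 • (1, 0) + (0, q.2) := by ext <;> simp
  rw [h1, sub_apply, S.fderiv_lin]
  conv_lhs => rw [h2]
  rw [map_add, map_smul, S.fderiv_f_zero]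
  ext1
  · simp
  · simp [A_apply]

end TorusTube

namespace TorusTube

variable {d : ℕ} {V : Type*} [NormedAddCommGroup V] [NormedSpace ℝ V] {Ω : V → V → ℝ}
  (S : TorusTube d Ω)

theorem fderiv_err_add_one {s : ℝ} {v : EuclideanSpace ℝ (Fin d)} (hv : ‖v‖ < S.ρ) :
    fderiv ℝ S.err (s + 1, v) = fderiv ℝ S.err (s, v) := by
  have h1 := fderiv_comp_add_right (𝕜 := ℝ) (f := S.err) (x := (s, v)) (1, 0)
  have h2 : (fun q => S.err (q + (1, 0))) =ᶠ[𝓝 (s, v)] S.err := by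
    have : ∀ᶠ q : ℝ × EuclideanSpace ℝ (Fin d) in 𝓝 (s, v), ‖q.2‖ < S.ρ :=
      (continuous_snd.norm.continuousAt).eventually (gt_mem_nhds hv)
    filter_upwards [this] with q hq
    have e : q + (1, 0) = (q.1 + 1, q.2) := by ext <;> simp
    simp only [err, e, S.f_per q.1 q.2 hq, S.lin_add_one]
    rw [add_sub_add_right_eq_sub]
  rw [h2.fderiv_eq] at h1
  rw [h1]; simp

theorem continuousAt_fderiv_err {s : ℝ} {v : EuclideanSpace ℝ (Fin d)} (hv : ‖v‖ < S.ρ) :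
    ContinuousAt (fderiv ℝ S.err) (s, v) :=
  (S.err_smooth hv).continuousAt_fderiv (by simp)

theorem continuous_fderiv_err_zero : Continuous fun s : ℝ => fderiv ℝ S.err (s, 0) :=
  continuous_iff_continuousAt.2 fun s =>
    ContinuousAt.comp (g := fderiv ℝ S.err) (f := fun s : ℝ => (s, 0))
      (S.continuousAt_fderiv_err (by simpa using S.ρ_pos)) (by fun_prop)

/-- The error of the linear model is uniformly `C¹`-close to its value on the loop. -/
theorem exists_err_close {η : ℝ} (hη : 0 < η) : ∃ δ > 0, δ ≤ S.ρ ∧ ∀ s v, ‖v‖ < δ →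
    ‖fderiv ℝ S.err (s, v) - fderiv ℝ S.err (s, 0)‖ ≤ η ∧
      ‖S.err (s, v) - fderiv ℝ S.err (s, 0) (0, v)‖ ≤ η * ‖v‖ := by
  obtain ⟨δ, hδ, H⟩ : ∃ δ > 0, ∀ s (v : EuclideanSpace ℝ (Fin d)), ‖v‖ < δ → ‖v‖ < S.ρ →
      ‖fderiv ℝ S.err (s, v) - fderiv ℝ S.err (s, 0)‖ ≤ η := by
    refine exists_uniform_ball_of_periodic (p := fun s v => ‖v‖ < S.ρ →
      ‖fderiv ℝ S.err (s, v) - fderiv ℝ S.err (s, 0)‖ ≤ η) (fun s v => ?_) fun s => ?_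
    · refine forall_congr' fun hv => ?_
      rw [S.fderiv_err_add_one hv, S.fderiv_err_add_one (by simpa using S.ρ_pos)]
    · have h1 : ContinuousAt (fun q : ℝ × EuclideanSpace ℝ (Fin d) =>
          ‖fderiv ℝ S.err q - fderiv ℝ S.err (q.1, 0)‖) (s, 0) := by
        refine ((S.continuousAt_fderiv_err (by simpa using S.ρ_pos)).sub ?_).norm
        exact (S.continuous_fderiv_err_zero.comp continuous_fst).continuousAt
      filter_upwards [h1.eventually (gt_mem_nhds (by simpa using hη))] with q hq _
      exact le_of_lt hq
  refine ⟨min δ S.ρ, lt_min hδ S.ρ_pos, min_le_right _ _, fun s v hv => ?_⟩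
  have H' : ∀ v, ‖v‖ < min δ S.ρ → ‖fderiv ℝ S.err (s, v) - fderiv ℝ S.err (s, 0)‖ ≤ η :=
    fun v hv => H s v (hv.trans_le (min_le_left _ _)) (hv.trans_le (min_le_right _ _))
  refine ⟨H' v hv, ?_⟩
  have hd : ∀ x ∈ Metric.ball (0 : EuclideanSpace ℝ (Fin d)) (min δ S.ρ), HasFDerivWithinAt
      (fun x => S.err (s, x) - fderiv ℝ S.err (s, 0) (0, x))
      ((fderiv ℝ S.err (s, x) - fderiv ℝ S.err (s, 0)).comp
        (ContinuousLinearMap.inr ℝ ℝ _)) (Metric.ball 0 (min δ S.ρ)) x := by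
    intro x hx
    have hx' : ‖x‖ < min δ S.ρ := by simpa using hx
    have h1 : HasFDerivAt S.err (fderiv ℝ S.err (s, x)) (s, x) :=
      ((S.err_smooth (hx'.trans_le (min_le_right _ _))).differentiableAt (by simp)).hasFDerivAt
    have h2 : HasFDerivAt (fun x : EuclideanSpace ℝ (Fin d) => (s, x))
        (ContinuousLinearMap.inr ℝ ℝ _) x := hasFDerivAt_prodMk_right s x
    have h3 := HasFDerivAt.comp x h1 h2
    have h4 : HasFDerivAt (fun x : EuclideanSpace ℝ (Fin d) => fderiv ℝ S.err (s, 0) (0, x))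
        ((fderiv ℝ S.err (s, 0)).comp (ContinuousLinearMap.inr ℝ ℝ _)) x :=
      ((fderiv ℝ S.err (s, 0)).comp (ContinuousLinearMap.inr ℝ ℝ _)).hasFDerivAt
    refine ((h3.sub h4).congr_fderiv ?_).hasFDerivWithinAt
    ext <;> simp
  have hb : ∀ x ∈ Metric.ball (0 : EuclideanSpace ℝ (Fin d)) (min δ S.ρ),
      ‖(fderiv ℝ S.err (s, x) - fderiv ℝ S.err (s, 0)).comp
        (ContinuousLinearMap.inr ℝ ℝ (EuclideanSpace ℝ (Fin d)))‖ ≤ η := by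
    intro x hx
    have hx' : ‖x‖ < min δ S.ρ := by simpa using hx
    refine (ContinuousLinearMap.opNorm_comp_le _ _).trans ?_
    refine (mul_le_mul (H' x hx') (ContinuousLinearMap.norm_inr_le_one ℝ ℝ _) (norm_nonneg _)
      hη.le).trans (by simp)
  have := (convex_ball (0 : EuclideanSpace ℝ (Fin d)) (min δ S.ρ)).norm_image_sub_le_of_norm_hasFDerivWithin_le
    hd hb (Metric.mem_ball_self (lt_min hδ S.ρ_pos)) (by simpa using hv)
  have e : fderiv ℝ S.err (s, 0) (0, 0) = 0 := map_zero _
  simpa [S.err_zero, e] using this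

theorem hasFDerivAt_blend {δ s : ℝ} {v : EuclideanSpace ℝ (Fin d)} (hv : ‖v‖ < S.ρ) :
    ∃ c : ℝ × EuclideanSpace ℝ (Fin d) →L[ℝ] ℝ,
      (∀ q, c q = deriv cutoff (‖v‖ ^ 2 / δ ^ 2) * (2 * inner ℝ v q.2 / δ ^ 2)) ∧
      HasFDerivAt (S.blend δ) (fderiv ℝ S.lin (s, v) +
        (cutoff (‖v‖ ^ 2 / δ ^ 2) • fderiv ℝ S.err (s, v) + c.smulRight (S.err (s, v)))) (s, v) := by
  have h1 : HasFDerivAt (fun w : ℝ × EuclideanSpace ℝ (Fin d) => ‖w.2‖ ^ 2 / δ ^ 2)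
      ((δ ^ 2)⁻¹ • ((2 : ℝ) • (innerSL ℝ v).comp (ContinuousLinearMap.snd ℝ ℝ _))) (s, v) := by
    have := (hasFDerivAt_snd (𝕜 := ℝ) (p := ((s, v) : ℝ × EuclideanSpace ℝ (Fin d)))).norm_sq
    refine ((this.const_smul ((δ ^ 2)⁻¹)).congr_of_eventuallyEq ?_).congr_fderiv ?_
    · filter_upwards with w; simp [div_eq_inv_mul]
    · ext <;> simp
  have h2 : HasDerivAt cutoff (deriv cutoff (‖v‖ ^ 2 / δ ^ 2)) (‖v‖ ^ 2 / δ ^ 2) :=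
    (contDiff_cutoff.differentiable (by simp) _).hasDerivAt
  have h3 := h2.comp_hasFDerivAt (s, v) h1
  have h4 : HasFDerivAt S.err (fderiv ℝ S.err (s, v)) (s, v) :=
    ((S.err_smooth hv).differentiableAt (by simp)).hasFDerivAt
  have h5 : HasFDerivAt S.lin (fderiv ℝ S.lin (s, v)) (s, v) :=
    (S.hasFDerivAt_lin _).differentiableAt.hasFDerivAt
  refine ⟨_, ?_, h5.add (h3.smul h4)⟩
  intro q
  simp
  left
  ring

set_option maxHeartbeats 800000 in
/-- For small `δ` the blended coordinate change is an immersion into the tube, and it meets the core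
only along the loop. -/
theorem exists_blend : ∃ δ > 0, 2 * δ < min S.ρ (1 / 4) ∧ ∀ s v, ‖v‖ < min S.ρ (1 / 4) →
    ImmersionAt (S.blend δ) (s, v) ∧ ‖(S.blend δ (s, v)).2‖ < S.ε ∧
      ((S.blend δ (s, v)).2 = 0 → v = 0) := by
  obtain ⟨m, hm, hmA⟩ := exists_uniform_lower_bound S.contDiff_A.continuous S.A_periodic
    S.A_injective
  obtain ⟨M, hM, hMA⟩ := exists_uniform_upper_bound S.contDiff_A.continuous S.A_periodic
  have hAd : Continuous (deriv S.A) := S.contDiff_A.continuous_deriv (by simp)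
  have hAdp : Function.Periodic (deriv S.A) 1 := fun s => by
    have h1 : (fun s => S.A (s + 1)) = S.A := funext S.A_periodic
    have := deriv_comp_add_const (f := S.A) 1 s
    rw [h1] at this; exact this.symm
  obtain ⟨N, hN, hNA⟩ := exists_uniform_upper_bound hAd hAdp
  obtain ⟨K, hK, hKe⟩ := exists_uniform_upper_bound S.continuous_fderiv_err_zero
    (fun s => S.fderiv_err_add_one (by simpa using S.ρ_pos))
  obtain ⟨κ, hκ, hκc⟩ := exists_deriv_cutoff_bound
  let K₂ := 2 * (1 + K) * (1 + 8 * κ)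
  have hK₂ : 0 < K₂ := by positivity
  let η := min (1 / 2) (m / (2 * (2 * K₂ + 1 + 8 * κ)))
  have hη : 0 < η := lt_min (by norm_num) (by positivity)
  have hη1 : η ≤ 1 / 2 := min_le_left _ _
  have hη2 : η * (2 * K₂ + 1 + 8 * κ) ≤ m / 2 := by
    have : η ≤ m / (2 * (2 * K₂ + 1 + 8 * κ)) := min_le_right _ _
    rw [le_div_iff₀ (by positivity)] at this
    linarith
  have hη3 : η ≤ m / 2 := by nlinarith
  obtain ⟨δ₀, hδ₀, hδρ, herr⟩ := S.exists_err_close hη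
  let R := min δ₀ (1 / 4)
  have hR : 0 < R := lt_min hδ₀ (by norm_num)
  let δ := min (R / 4) (min (η / (2 * N)) (S.ε / (4 * (M + 1))))
  have hδ : 0 < δ := lt_min (by positivity) (lt_min (by positivity)
    (div_pos S.ε_pos (by positivity)))
  have hδ1 : 2 * δ < R := by
    have : δ ≤ R / 4 := min_le_left _ _
    linarith
  have hδ2 : 2 * δ * N ≤ η := by
    have : δ ≤ η / (2 * N) := (min_le_right _ _).trans (min_le_left _ _)
    rw [le_div_iff₀ (by positivity)] at this; linarith
  have hδ3 : 2 * δ * (M + 1) < S.ε := by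
    have : δ ≤ S.ε / (4 * (M + 1)) := (min_le_right _ _).trans (min_le_right _ _)
    rw [le_div_iff₀ (by positivity)] at this; have := S.ε_pos; linarith
  have hδ4 : 2 * δ < min S.ρ (1 / 4) :=
    lt_min ((hδ1.trans_le (min_le_left _ _)).trans_le hδρ) (hδ1.trans_le (min_le_right _ _))
  refine ⟨δ, hδ, hδ4, fun s v hv => ?_⟩
  have hvρ : ‖v‖ < S.ρ := hv.trans_le (min_le_left _ _)
  have hv4 : ‖v‖ < 1 / 4 := hv.trans_le (min_le_right _ _)
  rcases lt_or_ge (2 * δ) ‖v‖ with hbig | hsmall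
  · -- outside the shell the map is the coordinate change itself
    have he : S.blend δ =ᶠ[𝓝 (s, v)] S.f := by
      have : ∀ᶠ q : ℝ × EuclideanSpace ℝ (Fin d) in 𝓝 (s, v), 2 * δ < ‖q.2‖ :=
        (continuous_snd.norm.continuousAt).eventually (lt_mem_nhds hbig)
      filter_upwards [this] with q hq using S.blend_of_ge hδ hq.le
    have he' : S.blend δ (s, v) = S.f (s, v) := he.self_of_nhds
    refine ⟨(S.immersionAt_f hvρ).congr he, he' ▸ (S.f_lift s v hvρ).1, fun h => ?_⟩
    rw [he'] at h
    have h1 := (S.f_lift s v hvρ).2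
    have h2 := (S.f_lift (S.f (s, v)).1 0 (by simpa using S.ρ_pos)).2
    rw [S.f_zero] at h2
    have h3 : S.f (s, v) = ((S.f (s, v)).1, 0) := Prod.ext rfl h
    rw [h3, ← h2] at h1
    have h4 := ((S.C_eq _ _).1 h1).2
    exact eq_of_cubeRep_eq (by linarith) (by simp) h4
  · have hvδ : ‖v‖ < δ₀ := (hsmall.trans_lt hδ1).trans_le (min_le_left _ _)
    obtain ⟨hD, hE⟩ := herr s v hvδ
    set D := fderiv ℝ S.err (s, v)
    set D₀ := fderiv ℝ S.err (s, 0)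
    have hD₀2 : ∀ q, (D₀ q).2 = 0 := fun q => by simp only [D₀]; rw [S.fderiv_err_zero]
    have hD₀1 : ∀ q, D₀ q = D₀ (0, q.2) := fun q => by
      simp only [D₀]; rw [S.fderiv_err_zero, S.fderiv_err_zero]
    have hD₀n : ∀ q, ‖D₀ q‖ ≤ K * ‖q.2‖ := fun q => by
      rw [hD₀1]
      refine (D₀.le_opNorm _).trans ?_
      simpa [Prod.norm_mk] using mul_le_mul_of_nonneg_right (hKe s) (norm_nonneg q.2)
    have hDq : ∀ q, ‖D q - D₀ q‖ ≤ η * (|q.1| + ‖q.2‖) := fun q => by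
      refine ((D - D₀).le_opNorm q).trans (mul_le_mul hD ?_ (norm_nonneg _) hη.le)
      rw [Prod.norm_def, Real.norm_eq_abs]
      exact max_le (by linarith [norm_nonneg q.2]) (by linarith [abs_nonneg q.1])
    have he2 : ‖(S.err (s, v)).2‖ ≤ η * ‖v‖ := by
      have := (norm_snd_le _).trans hE
      simpa [hD₀2] using this
    have he1 : |(S.err (s, v)).1| ≤ (K + η) * ‖v‖ := by
      have h1 := norm_add_le (S.err (s, v) - D₀ (0, v)) (D₀ (0, v))
      rw [sub_add_cancel] at h1
      have h2 := norm_fst_le (S.err (s, v))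
      rw [Real.norm_eq_abs] at h2
      have h3 := hD₀n (0, v)
      simp only at h3
      nlinarith
    obtain ⟨hχ0, hχ1⟩ := cutoff_mem (‖v‖ ^ 2 / δ ^ 2)
    refine ⟨?_, ?_, fun h => ?_⟩
    · obtain ⟨c, hc, hder⟩ := S.hasFDerivAt_blend (δ := δ) (s := s) hvρ
      refine immersionAt_of_hasFDerivAt ?_ hder fun q hq => ?_
      · have h1 : ContDiffAt ℝ ∞ (fun w : ℝ × EuclideanSpace ℝ (Fin d) =>
            cutoff (‖w.2‖ ^ 2 / δ ^ 2)) (s, v) :=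
          (contDiff_cutoff.comp (((contDiff_snd).norm_sq ℝ).div_const _)).contDiffAt
        exact S.contDiff_lin.contDiffAt.add (h1.smul (S.err_smooth hvρ))
      · set χ := cutoff (‖v‖ ^ 2 / δ ^ 2)
        have hcq : |c q| ≤ 4 * κ * ‖q.2‖ / δ := by
          rw [hc, abs_mul]
          have h1 : |2 * inner ℝ v q.2 / δ ^ 2| ≤ 4 * ‖q.2‖ / δ := by
            rw [abs_div, abs_mul, abs_of_pos (by positivity : 0 < δ ^ 2), abs_two,
              div_le_div_iff₀ (by positivity) hδ]
            have h2 := abs_real_inner_le_norm v q.2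
            have h3 : ‖v‖ * ‖q.2‖ ≤ 2 * δ * ‖q.2‖ := by gcongr
            nlinarith
          calc _ ≤ κ * (4 * ‖q.2‖ / δ) := mul_le_mul (hκc _) h1 (abs_nonneg _) hκ.le
            _ = _ := by ring
        have hq1 := congrArg Prod.fst hq
        have hq2 := congrArg Prod.snd hq
        simp only [add_apply, smul_apply,
          ContinuousLinearMap.smulRight_apply, S.fderiv_lin, Prod.fst_add, Prod.smul_fst,
          Prod.snd_add, Prod.smul_snd, Prod.fst_zero, Prod.snd_zero, smul_eq_mul] at hq1 hq2
        have hd1 : |(D q).1| ≤ η * (|q.1| + ‖q.2‖) + K * ‖q.2‖ := by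
          have h1 := norm_add_le (D q - D₀ q) (D₀ q)
          rw [sub_add_cancel] at h1
          have h2 := norm_fst_le (D q)
          rw [Real.norm_eq_abs] at h2
          linarith [hDq q, hD₀n q]
        have hd2 : ‖(D q).2‖ ≤ η * (|q.1| + ‖q.2‖) := by
          have := (norm_snd_le _).trans (hDq q)
          simpa [hD₀2] using this
        have hp : 0 ≤ ‖q.2‖ := norm_nonneg _
        have hce1 : |c q * (S.err (s, v)).1| ≤ 8 * κ * (K + η) * ‖q.2‖ := by
          rw [abs_mul]
          calc _ ≤ (4 * κ * ‖q.2‖ / δ) * ((K + η) * (2 * δ)) := by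
                refine mul_le_mul hcq (he1.trans ?_) (abs_nonneg _) (by positivity)
                gcongr
            _ = _ := by field_simp; ring
        have hce2 : ‖c q • (S.err (s, v)).2‖ ≤ 8 * κ * η * ‖q.2‖ := by
          rw [norm_smul, Real.norm_eq_abs]
          calc _ ≤ (4 * κ * ‖q.2‖ / δ) * (η * (2 * δ)) := by
                refine mul_le_mul hcq (he2.trans ?_) (norm_nonneg _) (by positivity)
                gcongr
            _ = _ := by field_simp; ring
        have hs : |q.1| ≤ K₂ * ‖q.2‖ := by
          have h1 : q.1 = -(χ * (D q).1) - c q * (S.err (s, v)).1 := by linarith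
          have h2 : |q.1| ≤ |χ * (D q).1| + |c q * (S.err (s, v)).1| := by
            conv_lhs => rw [h1]
            refine (abs_sub _ _).trans (by rw [abs_neg])
          have h3 : |χ * (D q).1| ≤ |(D q).1| := by
            rw [abs_mul, abs_of_nonneg hχ0]
            exact mul_le_of_le_one_left (abs_nonneg _) hχ1
          have h4 : η * |q.1| ≤ 1 / 2 * |q.1| := by gcongr
          have h5 : 8 * κ * (K + η) * ‖q.2‖ ≤ 8 * κ * (K + 1) * ‖q.2‖ := by gcongr; linarith
          have h6 : η * ‖q.2‖ ≤ 1 * ‖q.2‖ := by gcongr; linarith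
          simp only [K₂]
          linarith only [h2, h3, hd1, h4, hce1, h5, h6]
        have hA : m * ‖q.2‖ ≤ |q.1| * (2 * δ * N) + η * (|q.1| + ‖q.2‖) + 8 * κ * η * ‖q.2‖ := by
          have h1 : S.A s q.2 = -(q.1 • deriv S.A s v) - χ • (D q).2 - c q • (S.err (s, v)).2 := by
            rw [← sub_eq_zero, ← hq2]; abel
          have h2 : ‖S.A s q.2‖ ≤ ‖q.1 • deriv S.A s v‖ + ‖χ • (D q).2‖ +
              ‖c q • (S.err (s, v)).2‖ := by
            rw [h1]
            refine (norm_sub_le _ _).trans (add_le_add_left ((norm_sub_le _ _).trans ?_) _)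
            rw [norm_neg]
          have h3 : ‖q.1 • deriv S.A s v‖ ≤ |q.1| * (2 * δ * N) := by
            rw [norm_smul, Real.norm_eq_abs]
            refine mul_le_mul_of_nonneg_left (((deriv S.A s).le_opNorm v).trans ?_) (abs_nonneg _)
            rw [mul_comm]
            exact mul_le_mul hsmall (hNA s) (norm_nonneg _) (by positivity)
          have h4 : ‖χ • (D q).2‖ ≤ ‖(D q).2‖ := by
            rw [norm_smul, Real.norm_of_nonneg hχ0]
            exact mul_le_of_le_one_left (norm_nonneg _) hχ1
          linarith only [hmA s q.2, h2, h3, h4, hd2, hce2]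
        have hq20 : ‖q.2‖ = 0 := by
          have h1 : |q.1| * (2 * δ * N) ≤ |q.1| * η :=
            mul_le_mul_of_nonneg_left hδ2 (abs_nonneg _)
          have h2 : η * |q.1| ≤ η * (K₂ * ‖q.2‖) := by gcongr
          have h3 : η * (2 * K₂ + 1 + 8 * κ) * ‖q.2‖ ≤ m / 2 * ‖q.2‖ := by gcongr
          have h4 : m * ‖q.2‖ ≤ m / 2 * ‖q.2‖ := by linarith only [h1, h2, h3, hA]
          nlinarith only [h4, hm, hp]
        rw [hq20, mul_zero] at hs
        have h1 : q.1 = 0 := abs_eq_zero.1 (le_antisymm hs (abs_nonneg _))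
        exact Prod.ext h1 (norm_eq_zero.1 hq20)
    · have h1 : ‖(S.blend δ (s, v)).2‖ ≤ M * ‖v‖ + η * ‖v‖ := by
        have : (S.blend δ (s, v)).2 = S.A s v + cutoff (‖v‖ ^ 2 / δ ^ 2) • (S.err (s, v)).2 := rfl
        rw [this]
        refine (norm_add_le _ _).trans (add_le_add (((S.A s).le_opNorm v).trans ?_) ?_)
        · gcongr; exact hMA s
        · rw [norm_smul, Real.norm_of_nonneg hχ0]
          exact (mul_le_of_le_one_left (norm_nonneg _) hχ1).trans he2
      refine h1.trans_lt (lt_of_le_of_lt ?_ hδ3)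
      have : M * ‖v‖ + η * ‖v‖ ≤ (M + 1) * ‖v‖ := by nlinarith [norm_nonneg v]
      refine this.trans ?_
      rw [mul_comm]; gcongr
    · have h0 : S.A s v = -(cutoff (‖v‖ ^ 2 / δ ^ 2) • (S.err (s, v)).2) :=
        eq_neg_of_add_eq_zero_left h
      have h1 : ‖S.A s v‖ ≤ η * ‖v‖ := by
        rw [h0, norm_neg, norm_smul, Real.norm_of_nonneg hχ0]
        exact (mul_le_of_le_one_left (norm_nonneg _) hχ1).trans he2
      have h2 := hmA s v
      have h3 : η * ‖v‖ ≤ m / 2 * ‖v‖ := by gcongr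
      have : ‖v‖ = 0 := by nlinarith [norm_nonneg v]
      exact norm_eq_zero.1 this

end TorusTube

namespace TorusTube

variable {d : ℕ} {V : Type*} [NormedAddCommGroup V] [NormedSpace ℝ V] {Ω : V → V → ℝ}
  (S : TorusTube d Ω)

theorem C_cubeRep (s : ℝ) (v : EuclideanSpace ℝ (Fin d)) : S.C (s, cubeRep v) = S.C (s, v) :=
  (S.C_eq _ _).2 ⟨⟨0, by simp⟩, cubeRep_cubeRep v⟩

theorem T_add_one {s : ℝ} {x : EuclideanSpace ℝ (Fin d)} (hx : ‖x‖ < S.ε) :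
    S.T (s + 1, x) = S.T (s, x) :=
  ((S.T_eq (s, x) (s + 1, x) hx hx).2 ⟨⟨1, by simp⟩, rfl⟩).symm

theorem T_zero (s : ℝ) : S.T (s, 0) = S.C (s, 0) := by
  have := (S.f_lift s 0 (by simpa using S.ρ_pos)).2
  rw [this, S.f_zero]

theorem isCompact_fundamental : IsCompact (Icc (0 : ℝ) 1 ×ˢ
    {v : EuclideanSpace ℝ (Fin d) | ∀ i, v i ∈ Icc (-1 / 2 : ℝ) (1 / 2)}) :=
  isCompact_Icc.prod isCompact_cube

theorem C_eq_fundamental (w : ℝ × EuclideanSpace ℝ (Fin d)) :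
    S.C (Int.fract w.1, cubeRep w.2) = S.C w :=
  (S.C_eq _ _).2 ⟨⟨⌊w.1⌋, (Int.fract_add_floor w.1).symm⟩, cubeRep_cubeRep _⟩

theorem fundamental_mem (w : ℝ × EuclideanSpace ℝ (Fin d)) :
    (Int.fract w.1, cubeRep w.2) ∈ Icc (0 : ℝ) 1 ×ˢ
      {v : EuclideanSpace ℝ (Fin d) | ∀ i, v i ∈ Icc (-1 / 2 : ℝ) (1 / 2)} :=
  ⟨⟨Int.fract_nonneg _, (Int.fract_lt_one _).le⟩, cubeRep_mem_cube _⟩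

theorem continuous_C : Continuous S.C :=
  continuous_iff_continuousAt.2 fun w => (S.C_iso w).1.1.continuousAt

theorem isCompact_range_C : IsCompact (range S.C) := by
  have : range S.C = S.C '' (Icc (0 : ℝ) 1 ×ˢ
    {v : EuclideanSpace ℝ (Fin d) | ∀ i, v i ∈ Icc (-1 / 2 : ℝ) (1 / 2)}) := by
    refine Subset.antisymm ?_ (image_subset_range _ _)
    rintro _ ⟨w, rfl⟩
    exact ⟨_, fundamental_mem w, S.C_eq_fundamental w⟩
  rw [this]
  exact isCompact_fundamental.image S.continuous_C

/-- The parametrization of the torus, with codomain the torus. -/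
def Cr (w : ℝ × EuclideanSpace ℝ (Fin d)) : range S.C := ⟨S.C w, w, rfl⟩

theorem continuous_Cr : Continuous S.Cr := S.continuous_C.subtype_mk _

theorem isQuotientMap_Cr : IsQuotientMap S.Cr := by
  let K : Set (ℝ × EuclideanSpace ℝ (Fin d)) := Icc (0 : ℝ) 1 ×ˢ
    {v : EuclideanSpace ℝ (Fin d) | ∀ i, v i ∈ Icc (-1 / 2 : ℝ) (1 / 2)}
  have : CompactSpace K := isCompact_iff_compactSpace.1 isCompact_fundamental
  let g : K → range S.C := fun w => S.Cr w
  have hg : Continuous g := S.continuous_Cr.comp continuous_subtype_val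
  have hs : Function.Surjective g := by
    rintro ⟨_, w, rfl⟩
    exact ⟨⟨_, fundamental_mem w⟩, Subtype.ext (S.C_eq_fundamental w)⟩
  have hq : IsQuotientMap g := (hg.isClosedMap).isQuotientMap hg hs
  exact IsQuotientMap.of_comp continuous_subtype_val S.continuous_Cr hq

theorem isOpenMap_Cr : IsOpenMap S.Cr := by
  intro U hU
  rw [← S.isQuotientMap_Cr.isOpen_preimage]
  have : S.Cr ⁻¹' (S.Cr '' U) = ⋃ (k : ℤ) (n : Fin d → ℤ),
      (fun w : ℝ × EuclideanSpace ℝ (Fin d) => w + ((k : ℝ), latticeVec n)) ⁻¹' U := by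
    ext w
    simp only [mem_preimage, mem_image, mem_iUnion]
    constructor
    · rintro ⟨u, hu, h⟩
      obtain ⟨⟨k, hk⟩, h2⟩ := (S.C_eq _ _).1 (congrArg Subtype.val h).symm
      obtain ⟨n, hn⟩ := cubeRep_eq_iff.1 h2
      refine ⟨k, n, ?_⟩
      convert hu using 1
      ext1
      · exact hk.symm
      · exact hn.symm
    · rintro ⟨k, n, h⟩
      refine ⟨_, h, Subtype.ext ((S.C_eq _ _).2 ⟨⟨-k, ?_⟩, ?_⟩)⟩
      · simp
      · exact cubeRep_add_latticeVec _ _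
  rw [this]
  exact isOpen_iUnion fun k => isOpen_iUnion fun n => hU.preimage (by fun_prop)

/-- `g` is, near `w`, the parametrization of the torus or of the tube after a local immersion. -/
def IsLocallyParam (g : ℝ × EuclideanSpace ℝ (Fin d) → V) (w : ℝ × EuclideanSpace ℝ (Fin d)) :
    Prop :=
  ∃ l : ℝ × EuclideanSpace ℝ (Fin d) → ℝ × EuclideanSpace ℝ (Fin d), ImmersionAt l w ∧
    (g =ᶠ[𝓝 w] (fun x => S.C (l x)) ∨ ‖(l w).2‖ < S.ε ∧ g =ᶠ[𝓝 w] fun x => S.T (l x))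

variable {S}

theorem IsLocallyParam.iso {g : ℝ × EuclideanSpace ℝ (Fin d) → V}
    {w : ℝ × EuclideanSpace ℝ (Fin d)} (h : S.IsLocallyParam g w) :
    IsotropicImmersionAt Ω g w := by
  obtain ⟨l, hl, h | ⟨h1, h2⟩⟩ := h
  · exact ((S.C_iso _).comp hl).congr h
  · exact ((S.T_iso _ h1).comp hl).congr h2

variable (S)

/-- A lift of the torus parametrization through the tube is an immersion. -/
theorem exists_lift {w p : ℝ × EuclideanSpace ℝ (Fin d)} (hp : ‖p.2‖ < S.ε) (h : S.C w = S.T p) :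
    ∃ l : ℝ × EuclideanSpace ℝ (Fin d) → ℝ × EuclideanSpace ℝ (Fin d),
      ImmersionAt l w ∧ l w = p ∧ S.C =ᶠ[𝓝 w] fun x => S.T (l x) := by
  obtain ⟨l, hl, rfl, he⟩ := S.lift w p hp h
  have he' : S.C =ᶠ[𝓝 w] fun x => S.T (l x) := he
  refine ⟨l, ImmersionAt.of_comp (S.T_iso _ hp).1.1 hl ?_, rfl, he⟩
  rw [← he'.fderiv_eq]
  exact (S.C_iso w).1.2

variable {S}

/-- Where the value of a locally parametrized map lies in the tube, it lifts to the tube. -/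
theorem IsLocallyParam.exists_lift {g : ℝ × EuclideanSpace ℝ (Fin d) → V}
    {w p : ℝ × EuclideanSpace ℝ (Fin d)} (h : S.IsLocallyParam g w) (hp : ‖p.2‖ < S.ε)
    (hgp : g w = S.T p) :
    ∃ l : ℝ × EuclideanSpace ℝ (Fin d) → ℝ × EuclideanSpace ℝ (Fin d),
      ImmersionAt l w ∧ (l w).2 = p.2 ∧ g =ᶠ[𝓝 w] fun x => S.T (l x) := by
  obtain ⟨l, hl, h | ⟨h1, h2⟩⟩ := h
  · obtain ⟨l', hl', h1, h2⟩ := S.exists_lift hp ((h.self_of_nhds).symm.trans hgp)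
    refine ⟨fun x => l' (l x), ImmersionAt.comp hl' hl, congrArg Prod.snd h1,
      h.trans (hl.1.continuousAt.eventually h2)⟩
  · refine ⟨l, hl, ?_, h2⟩
    exact ((S.T_eq _ _ h1 hp).1 (h2.self_of_nhds.symm.trans hgp)).2

/-- A locally parametrized map is open, as a map to the torus. -/
theorem IsLocallyParam.nhds_le {g : ℝ × EuclideanSpace ℝ (Fin d) → range S.C}
    {w : ℝ × EuclideanSpace ℝ (Fin d)} (h : S.IsLocallyParam (fun x => (g x : V)) w) :
    𝓝 (g w) ≤ map g (𝓝 w) := by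
  have hC : ∀ {g : ℝ × EuclideanSpace ℝ (Fin d) → range S.C} {w : ℝ × EuclideanSpace ℝ (Fin d)}
      {l : ℝ × EuclideanSpace ℝ (Fin d) → ℝ × EuclideanSpace ℝ (Fin d)}, ImmersionAt l w →
      (fun x => (g x : V)) =ᶠ[𝓝 w] (fun x => S.C (l x)) → 𝓝 (g w) ≤ map g (𝓝 w) := by
    intro g w l hl h
    have h1 : g =ᶠ[𝓝 w] fun x => S.Cr (l x) := by
      filter_upwards [h] with x hx using Subtype.ext hx
    rw [map_congr h1, h1.self_of_nhds]
    have := S.isOpenMap_Cr.nhds_le (l w)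
    rw [← hl.map_nhds rfl, Filter.map_map] at this
    exact this
  obtain ⟨l, hl, h | ⟨h1, h2⟩⟩ := h
  · exact hC hl h
  · obtain ⟨w', hw'⟩ := S.T_mem _ h1
    obtain ⟨l', hl', hlw, hl2⟩ := S.exists_lift h1 hw'
    -- both `g` and the parametrization of the torus factor locally through the tube
    obtain ⟨j, hj, hj0, hj1, hj2⟩ := hl'.exists_localInverse rfl
    rw [hlw] at hj hj0 hj1
    have h3 : ∀ᶠ x in 𝓝 w, (g x : V) = S.C (j (l x)) := by
      have e1 : ∀ᶠ y in 𝓝 (l w), S.C (j y) = S.T (l' (j y)) := by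
        have := hj.continuousAt.tendsto
        rw [hj0] at this
        exact this.eventually hl2
      filter_upwards [h2, hl.1.continuousAt.eventually e1, hl.1.continuousAt.eventually hj1]
        with x a b c
      rw [b, c]; exact a
    refine hC (l := fun x => j (l x)) (ImmersionAt.comp ?_ hl) h3
    refine ImmersionAt.of_comp (g := l') (by rw [hj0]; exact hl'.1) hj ?_
    have : (fun y => l' (j y)) =ᶠ[𝓝 (l w)] fun y => y := hj1
    rw [this.fderiv_eq, fderiv_fun_id]
    exact fun a b h => h

variable (S)

/-- The torus parametrization, modified near the loop so as to become linear there in the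
coordinates of the tube. -/
def straight (δ : ℝ) (w : ℝ × EuclideanSpace ℝ (Fin d)) : V :=
  open Classical in
  if ‖cubeRep w.2‖ < min S.ρ (1 / 4) then S.T (S.blend δ (w.1, cubeRep w.2)) else S.C w

set_option maxHeartbeats 1000000 in
/-- Tubular neighbourhoods of the loop are unique up to reparametrization of the torus: there is a
parametrization of the torus that is linear near the loop in the coordinates of the tube. -/
theorem exists_straight : ∃ (g : ℝ × EuclideanSpace ℝ (Fin d) → V) (δ : ℝ), 0 < δ ∧ δ < 1 / 4 ∧
    (∀ w, S.IsLocallyParam g w) ∧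
    (∀ s v, ‖v‖ < δ → ‖S.A s v‖ < S.ε ∧ g (s, v) = S.T (s, S.A s v)) ∧
    (∀ w w' : ℝ × EuclideanSpace ℝ (Fin d), g w = g w' ↔ (∃ k : ℤ, w'.1 = w.1 + k) ∧ cubeRep w.2 = cubeRep w'.2) ∧
    range g = range S.C := by
  classical
  obtain ⟨δ, hδ, hδ2, hb⟩ := S.exists_blend
  set R := min S.ρ (1 / 4) with hR
  have hRρ : R ≤ S.ρ := min_le_left _ _
  have hR4 : R ≤ 1 / 4 := min_le_right _ _
  have hRpos : 0 < R := lt_min S.ρ_pos (by norm_num)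
  let g := S.straight δ
  have hg1 : ∀ w, ‖cubeRep w.2‖ < R → g w = S.T (S.blend δ (w.1, cubeRep w.2)) := fun w hw =>
    if_pos hw
  have hg2 : ∀ w, 2 * δ ≤ ‖cubeRep w.2‖ → g w = S.C w := by
    intro w hw
    by_cases h : ‖cubeRep w.2‖ < R
    · have h1 := (S.f_lift w.1 (cubeRep w.2) (h.trans_le hRρ)).2
      rw [S.C_cubeRep] at h1
      have h2 : S.blend δ (w.1, cubeRep w.2) = S.f (w.1, cubeRep w.2) := S.blend_of_ge hδ hw
      rw [hg1 w h, h2]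
      exact h1.symm
    · exact if_neg h
  clear_value g
  have hgl : ∀ w, S.IsLocallyParam g w := by
    rintro ⟨s, v⟩
    by_cases h : ‖cubeRep v‖ < R
    · have e1 : ∀ᶠ w : ℝ × EuclideanSpace ℝ (Fin d) in 𝓝 (s, v), ‖cubeRep w.2‖ < R :=
        eventually_norm_cubeRep_lt h s
      have e2 := eventually_cubeRep_add (v₀ := v) (by linarith) s
      have e3 : ((s, v) + (0, cubeRep v - v) : ℝ × EuclideanSpace ℝ (Fin d)) = (s, cubeRep v) := by
        ext1 <;> simp
      refine ⟨fun w => S.blend δ (w + (0, cubeRep v - v)), ?_, Or.inr ⟨?_, ?_⟩⟩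
      · refine ImmersionAt.comp (g := S.blend δ) ?_ (immersionAt_add_const _ _)
        rw [e3]; exact (hb s _ h).1
      · simp only [e3]; exact (hb s _ h).2.1
      · filter_upwards [e1, e2] with w h1 h2
        rw [hg1 w h1, h2]
    · have h' : 2 * δ < ‖cubeRep v‖ := by linarith
      have e1 : ∀ᶠ w : ℝ × EuclideanSpace ℝ (Fin d) in 𝓝 (s, v), 2 * δ < ‖cubeRep w.2‖ :=
        eventually_lt_norm_cubeRep h' s
      refine ⟨fun w => w, immersionAt_id _, Or.inl ?_⟩
      filter_upwards [e1] with w hw using hg2 w hw.le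
  have hgmem : ∀ w, g w ∈ range S.C := by
    intro w
    by_cases h : ‖cubeRep w.2‖ < R
    · rw [hg1 w h]; exact S.T_mem _ (hb w.1 _ h).2.1
    · rw [hg2 w (by linarith)]; exact ⟨w, rfl⟩
  have hgp : ∀ w w' : ℝ × EuclideanSpace ℝ (Fin d), (∃ k : ℤ, w'.1 = w.1 + k) → cubeRep w.2 = cubeRep w'.2 → g w = g w' := by
    rintro w w' ⟨k, hk⟩ h
    by_cases hw : ‖cubeRep w.2‖ < R
    · have h1 : Function.Periodic (fun s => S.T (S.blend δ (s, cubeRep w.2))) 1 := fun s => by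
        simp only
        rw [S.blend_add_one (hw.trans_le hRρ)]
        have := S.T_add_one (s := (S.blend δ (s, cubeRep w.2)).1) (hb s _ hw).2.1
        rw [← this]
        congr 1
        ext1 <;> simp
      rw [hg1 w hw, hg1 w' (h ▸ hw), ← h, hk]
      exact ((h1.int_mul k) w.1 ▸ by simp)
    · rw [hg2 w (by linarith), hg2 w' (by rw [← h]; linarith)]
      exact (S.C_eq _ _).2 ⟨⟨k, hk⟩, h⟩
  have hgcore : ∀ w, g w = g (0, 0) → ∃ k : ℤ, w.1 = k ∧ cubeRep w.2 = 0 := by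
    intro w hw
    have h00 : g (0, 0) = S.T (0, 0) := by
      rw [hg1 _ (by simpa [cubeRep_zero] using hRpos), S.blend_of_le hδ (by simp [cubeRep_zero, hδ.le])]
      simp [lin, cubeRep_zero]
    rw [h00] at hw
    by_cases h : ‖cubeRep w.2‖ < R
    · rw [hg1 w h] at hw
      have h2 := (S.T_eq _ _ (hb w.1 _ h).2.1 (by simpa using S.ε_pos)).1 hw
      have h3 := (hb w.1 _ h).2.2 h2.2
      rw [h3, S.blend_of_le hδ (by simpa using hδ.le)] at h2
      obtain ⟨⟨k, hk⟩, -⟩ := h2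
      refine ⟨-k, ?_, h3⟩
      simp only [lin] at hk
      push_cast; linarith
    · rw [hg2 w (by linarith), S.T_zero] at hw
      obtain ⟨⟨k, hk⟩, h2⟩ := (S.C_eq _ _).1 hw
      exact absurd (by simp [h2, cubeRep_zero, hRpos] : ‖cubeRep w.2‖ < R) h
  let gr : ℝ × EuclideanSpace ℝ (Fin d) → range S.C := fun w => ⟨g w, hgmem w⟩
  have hgc : Continuous gr := Continuous.subtype_mk
    (continuous_iff_continuousAt.2 fun w => (hgl w).iso.1.1.continuousAt) _
  -- the induced self-map of the torus
  let m : range S.C → range S.C := fun y => gr y.2.choose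
  have hm : ∀ w, m (S.Cr w) = gr w := by
    intro w
    have h1 : S.C (S.Cr w).2.choose = S.C w := (S.Cr w).2.choose_spec
    obtain ⟨h2, h3⟩ := (S.C_eq _ _).1 h1
    exact Subtype.ext (hgp _ _ h2 h3)
  have hCs : Function.Surjective S.Cr := S.isQuotientMap_Cr.surjective
  have hmc : Continuous m := by
    rw [S.isQuotientMap_Cr.continuous_iff]
    have : m ∘ S.Cr = gr := funext hm
    rwa [this]
  have : CompactSpace (range S.C) := isCompact_iff_compactSpace.1 S.isCompact_range_C
  have : PreconnectedSpace (range S.C) :=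
    isPreconnected_iff_preconnectedSpace.1 (isPreconnected_range S.continuous_C)
  have hbij : Function.Bijective m := by
    refine bijective_of_isOpenMap_of_locallyInjective hmc ?_ ?_ (x₀ := S.Cr (0, 0)) ?_
    · rw [isOpenMap_iff_nhds_le]
      intro y
      obtain ⟨w, rfl⟩ := hCs y
      rw [hm]
      have h1 : 𝓝 (gr w) ≤ map gr (𝓝 w) := IsLocallyParam.nhds_le (hgl w)
      have h2 : map gr (𝓝 w) = map m (map S.Cr (𝓝 w)) := by
        rw [Filter.map_map]; congr 1; exact (funext hm).symm
      rw [h2] at h1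
      exact h1.trans (map_mono S.continuous_Cr.continuousAt)
    · intro y
      obtain ⟨w, rfl⟩ := hCs y
      obtain ⟨U, hU, hUi⟩ := (hgl w).iso.1.eventually_injective
      refine ⟨S.Cr '' U, S.isOpenMap_Cr.image_mem_nhds hU, ?_⟩
      rintro _ ⟨a, ha, rfl⟩ _ ⟨b, hb', rfl⟩ hab
      rw [hm, hm] at hab
      rw [hUi ha hb' (congrArg Subtype.val hab)]
    · intro y hy
      obtain ⟨w, rfl⟩ := hCs y
      rw [hm, hm] at hy
      obtain ⟨k, hk, h0⟩ := hgcore w (congrArg Subtype.val hy)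
      refine Subtype.ext ((S.C_eq _ _).2 ⟨⟨-k, ?_⟩, ?_⟩)
      · simp [hk]
      · simp [h0, cubeRep_zero]
  refine ⟨g, δ, hδ, by linarith, hgl, fun s v hv => ?_, fun w w' => ⟨fun h => ?_, fun h =>
    hgp w w' h.1 h.2⟩, ?_⟩
  · have hvR : ‖v‖ < R := by linarith
    have hcv : cubeRep v = v := cubeRep_eq_self (by linarith)
    have h1 : S.blend δ (s, v) = (s, S.A s v) := S.blend_of_le hδ hv.le
    refine ⟨?_, ?_⟩
    · have := (hb s v hvR).2.1
      rwa [h1] at this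
    · rw [hg1 _ (by simpa [hcv] using hvR)]
      simp only [hcv, h1]
  · have h1 : m (S.Cr w) = m (S.Cr w') := by rw [hm, hm]; exact Subtype.ext h
    exact (S.C_eq _ _).1 (congrArg Subtype.val (hbij.1 h1))
  · refine Subset.antisymm (range_subset_iff.2 hgmem) ?_
    intro y hy
    obtain ⟨y', hy'⟩ := hbij.2 ⟨y, hy⟩
    obtain ⟨w, rfl⟩ := hCs y'
    rw [hm] at hy'
    exact ⟨w, congrArg Subtype.val hy'⟩

end TorusTube

/-! ### Radial reparametrizations -/

section Ramp

/-- A smooth monotone function that is `0` on `(-∞, a]` and `1` on `[b, ∞)`, for `a < b`. -/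
def ramp (a b x : ℝ) : ℝ := Real.smoothTransition ((x - a) / (b - a))

variable {a b : ℝ}

theorem contDiff_ramp (a b : ℝ) : ContDiff ℝ ∞ (ramp a b) :=
  Real.smoothTransition.contDiff.comp (by fun_prop)

theorem ramp_of_le (hab : a < b) {x : ℝ} (h : x ≤ a) : ramp a b x = 0 :=
  Real.smoothTransition.zero_of_nonpos (div_nonpos_of_nonpos_of_nonneg (by linarith) (by linarith))

theorem ramp_of_ge (hab : a < b) {x : ℝ} (h : b ≤ x) : ramp a b x = 1 :=
  Real.smoothTransition.one_of_one_le (by rw [le_div_iff₀ (by linarith)]; linarith)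

theorem ramp_nonneg (x : ℝ) : 0 ≤ ramp a b x := Real.smoothTransition.nonneg _

theorem ramp_le_one (x : ℝ) : ramp a b x ≤ 1 := Real.smoothTransition.le_one _

theorem ramp_monotone (hab : a < b) : Monotone (ramp a b) := fun x y h =>
  Real.smoothTransition.monotone (by
    rw [div_le_div_iff_of_pos_right (by linarith)]; linarith)

theorem hasDerivAt_ramp (a b x : ℝ) : HasDerivAt (ramp a b) (deriv (ramp a b) x) x :=
  ((contDiff_ramp a b).differentiable (by simp) x).hasDerivAt

theorem deriv_ramp_nonneg (hab : a < b) (x : ℝ) : 0 ≤ deriv (ramp a b) x :=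
  (ramp_monotone hab).deriv_nonneg

theorem deriv_ramp_of_lt (hab : a < b) {x : ℝ} (h : x < a) : deriv (ramp a b) x = 0 := by
  have : ramp a b =ᶠ[𝓝 x] fun _ => 0 := by
    filter_upwards [gt_mem_nhds h] with y hy using ramp_of_le hab hy.le
  rw [this.deriv_eq]; simp

/-- Blending an increasing function upwards into a larger increasing function along a monotone
cutoff gives an increasing function. -/
theorem exists_hasDerivAt_blend_pos {f₁ f₂ χ : ℝ → ℝ} {x f₁' f₂' χ' : ℝ}
    (h₁ : HasDerivAt f₁ f₁' x) (h₂ : HasDerivAt f₂ f₂' x) (hχ : HasDerivAt χ χ' x)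
    (p₁ : 0 < f₁') (p₂ : 0 < f₂') (pχ : 0 ≤ χ') (c₀ : 0 ≤ χ x) (c₁ : χ x ≤ 1)
    (hle : f₁ x ≤ f₂ x ∨ χ' = 0) :
    ∃ c > 0, HasDerivAt (fun y => (1 - χ y) * f₁ y + χ y * f₂ y) c x := by
  refine ⟨_, ?_, ((hχ.const_sub 1).mul h₁).add (hχ.mul h₂)⟩
  have h3 : 0 ≤ χ' * (f₂ x - f₁ x) := by
    rcases hle with h | h
    · exact mul_nonneg pχ (by linarith)
    · simp [h]
  have h4 : 0 < (1 - χ x) * f₁' + χ x * f₂' := by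
    rcases c₀.eq_or_lt with h | h
    · rw [← h]; simpa using p₁
    · have := mul_nonneg (sub_nonneg.2 c₁) p₁.le
      have := mul_pos h p₂
      linarith
  linarith

/-- A function with positive derivative beyond `t₀` that is eventually the identity is a bijection
between half-lines. -/
theorem bijOn_Ioi_of_hasDerivAt_pos {h : ℝ → ℝ} {t₀ h₀ b : ℝ} (hc : ContinuousOn h (Ici t₀))
    (hd : ∀ t, t₀ < t → ∃ c > 0, HasDerivAt h c t) (h0 : h t₀ = h₀) (hb : ∀ t, b ≤ t → h t = t) :
    BijOn h (Ioi t₀) (Ioi h₀) ∧ StrictMonoOn h (Ici t₀) := by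
  have hm : StrictMonoOn h (Ici t₀) := by
    refine strictMonoOn_of_deriv_pos (convex_Ici t₀) hc fun t ht => ?_
    rw [interior_Ici] at ht
    obtain ⟨c, hc, hd⟩ := hd t ht
    rwa [hd.deriv]
  refine ⟨⟨fun t ht => ?_, (hm.mono Ioi_subset_Ici_self).injOn, fun y hy => ?_⟩, hm⟩
  · have := hm (mem_Ici.2 le_rfl) (mem_Ici.2 (le_of_lt ht)) ht
    rwa [h0] at this
  · have hy' : h₀ < y := hy
    obtain ⟨B, hB1, hB2, hB3⟩ : ∃ B, t₀ ≤ B ∧ b ≤ B ∧ y ≤ B :=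
      ⟨max t₀ (max b y), le_max_left _ _, (le_max_left _ _).trans (le_max_right _ _),
        (le_max_right _ _).trans (le_max_right _ _)⟩
    have := intermediate_value_Icc hB1 (hc.mono Icc_subset_Ici_self)
    have hmem : y ∈ Icc (h t₀) (h B) := ⟨by rw [h0]; exact hy'.le, by rw [hb B hB2]; exact hB3⟩
    obtain ⟨t, ht, hty⟩ := this hmem
    refine ⟨t, lt_of_le_of_ne ht.1 ?_, hty⟩
    rintro rfl
    rw [h0] at hty
    linarith

/-- An increasing diffeomorphism from `(0, ∞)` to `(r, ∞)` that is affine near `0` and the identity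
beyond a point of `(r, ε)`. -/
theorem exists_radial_profile {r ε : ℝ} (hr : 0 < r) (hrε : r < ε) :
    ∃ (e : ℝ → ℝ) (c x₁ r₂ : ℝ), 0 < c ∧ 0 < x₁ ∧ x₁ < r₂ ∧ 0 < r₂ ∧ r₂ < ε ∧ ContDiff ℝ ∞ e ∧
      (∀ x ≤ x₁, e x = r + c * x) ∧ (∀ x, r₂ ≤ x → e x = x) ∧
      (∀ x, 0 < x → ∃ c > 0, HasDerivAt e c x) := by
  let x₁ := (2 * r + ε) / 3
  let r₂ := (r + 2 * ε) / 3
  have h1 : r < x₁ := by simp only [x₁]; linarith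
  have h2 : x₁ < r₂ := by simp only [x₁, r₂]; linarith
  have hx1 : 0 < x₁ := hr.trans h1
  have hc : 0 < 1 - r / x₁ := by rw [sub_pos, div_lt_one hx1]; exact h1
  refine ⟨fun x => (1 - ramp x₁ r₂ x) * (r + (1 - r / x₁) * x) + ramp x₁ r₂ x * x, 1 - r / x₁, x₁,
    r₂, hc, hx1, h2, hx1.trans h2, by simp only [r₂]; linarith, ?_, fun x hx => ?_, fun x hx => ?_,
    fun x hx => ?_⟩
  · have := contDiff_ramp x₁ r₂
    fun_prop
  · simp only [ramp_of_le h2 hx]; ring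
  · simp only [ramp_of_ge h2 hx]; ring
  · refine exists_hasDerivAt_blend_pos (f₁ := fun x => r + (1 - r / x₁) * x) (f₂ := fun x => x)
      (((hasDerivAt_id x).const_mul (1 - r / x₁)).const_add r) (hasDerivAt_id x)
      (hasDerivAt_ramp x₁ r₂ x) (by simpa using hc) one_pos (deriv_ramp_nonneg h2 x)
      (ramp_nonneg x) (ramp_le_one x) ?_
    rcases lt_or_ge x x₁ with h | h
    · exact Or.inr (deriv_ramp_of_lt h2 h)
    · left
      have h3 : r ≤ r / x₁ * x := by
        rw [div_mul_eq_mul_div, le_div_iff₀ hx1]; nlinarith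
      linarith

end Ramp

section Radial

variable {E : Type*} [NormedAddCommGroup E] [InnerProductSpace ℝ E]

/-- A radial map `v ↦ k(s, v) v` is an immersion where it is radially increasing. -/
theorem immersionAt_radial {k : ℝ × E → ℝ} {s : ℝ} {v : E} {c : ℝ}
    (hk : ContDiffAt ℝ ∞ k (s, v)) (hk0 : k (s, v) ≠ 0) (hc : c ≠ 0)
    (hd : HasDerivAt (fun τ : ℝ => τ * k (s, τ • v)) c 1) :
    ImmersionAt (fun w : ℝ × E => (w.1, k w • w.2)) (s, v) := by
  have hkd : HasFDerivAt k (fderiv ℝ k (s, v)) (s, v) :=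
    (hk.differentiableAt (by simp)).hasFDerivAt
  refine immersionAt_of_hasFDerivAt (contDiffAt_fst.prodMk (hk.smul contDiffAt_snd))
    (hasFDerivAt_fst.prodMk (hkd.smul hasFDerivAt_snd)) fun q hq => ?_
  have hq1 : q.1 = 0 := by simpa using congrArg Prod.fst hq
  have hq2 : k (s, v) • q.2 + (fderiv ℝ k (s, v) q) • v = 0 := by simpa using congrArg Prod.snd hq
  have h1 : HasDerivAt (fun τ : ℝ => ((s, τ • v) : ℝ × E)) (0, v) 1 := by
    have := ((hasDerivAt_id (1 : ℝ)).smul_const v)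
    simpa using (hasDerivAt_const (1 : ℝ) s).prodMk this
  have h2 : HasDerivAt (fun τ : ℝ => k (s, τ • v)) (fderiv ℝ k (s, v) (0, v)) 1 := by
    have h3 : HasFDerivAt k (fderiv ℝ k (s, v)) (s, (1 : ℝ) • v) := by simpa using hkd
    exact h3.comp_hasDerivAt (1 : ℝ) h1
  have h3 : c = k (s, v) + fderiv ℝ k (s, v) (0, v) := by
    have := ((hasDerivAt_id (1 : ℝ)).mul h2).unique hd
    rw [← this]; simp
  -- the kernel consists of multiples of `v`
  set t := -(fderiv ℝ k (s, v) q / k (s, v)) with ht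
  have h4 : q.2 = t • v := by
    have : k (s, v) • q.2 = k (s, v) • (t • v) := by
      rw [eq_neg_of_add_eq_zero_left hq2, smul_smul, ht, ← neg_smul]
      congr 1; field_simp
    exact smul_right_injective E hk0 this
  have h5 : q = t • (0, v) := Prod.ext (by simp [hq1]) (by simp [h4])
  have h6 : (t * c) • v = 0 := by
    rw [← hq2, h4, h3]
    conv_rhs => rw [h5, map_smul]
    rw [smul_smul, ← add_smul]; congr 1
    simp; ring
  rcases smul_eq_zero.1 h6 with h | h
  · rcases mul_eq_zero.1 h with h | h
    · rw [h5, h, zero_smul]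
    · exact absurd h hc
  · rw [h5, h]; simp

/-- The radial map of norm profile `e`. -/
def radialMap (e : ℝ → ℝ) (w : ℝ × E) : ℝ × E := (w.1, (e ‖w.2‖ / ‖w.2‖) • w.2)

theorem norm_radialMap {e : ℝ → ℝ} {w : ℝ × E} (hw : w.2 ≠ 0) (he : 0 ≤ e ‖w.2‖) :
    ‖(radialMap e w).2‖ = e ‖w.2‖ := by
  have : 0 < ‖w.2‖ := norm_pos_iff.2 hw
  simp only [radialMap]
  rw [norm_smul, Real.norm_of_nonneg (by positivity)]
  field_simp

theorem immersionAt_radialMap {e : ℝ → ℝ} (he : ContDiff ℝ ∞ e) {s : ℝ} {v : E} (hv : v ≠ 0)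
    (hpos : 0 < e ‖v‖) (hd : ∃ c > 0, HasDerivAt e c ‖v‖) : ImmersionAt (radialMap e) (s, v) := by
  obtain ⟨c, hc, hd⟩ := hd
  have hn : 0 < ‖v‖ := norm_pos_iff.2 hv
  have hnc : ContDiffAt ℝ ∞ (fun w : ℝ × E => ‖w.2‖) (s, v) := contDiffAt_snd.norm ℝ hv
  have hk : ContDiffAt ℝ ∞ (fun w : ℝ × E => e ‖w.2‖ / ‖w.2‖) (s, v) :=
    (he.contDiffAt.comp (s, v) hnc).div hnc hn.ne'
  refine immersionAt_radial (k := fun w : ℝ × E => e ‖w.2‖ / ‖w.2‖) hk (by positivity) hc.ne' ?_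
  have h1 : HasDerivAt (fun τ : ℝ => τ * ‖v‖) ‖v‖ 1 := by
    simpa using (hasDerivAt_id (1 : ℝ)).mul_const ‖v‖
  have h2 : HasDerivAt (fun τ : ℝ => e (τ * ‖v‖) / ‖v‖) c 1 := by
    have h3 : HasDerivAt e c (1 * ‖v‖) := by simpa using hd
    have := (h3.comp (1 : ℝ) h1).div_const ‖v‖
    rwa [mul_div_cancel_right₀ _ hn.ne'] at this
  refine h2.congr_of_eventuallyEq ?_
  filter_upwards [lt_mem_nhds (zero_lt_one)] with τ hτ
  simp only [norm_smul, Real.norm_of_nonneg hτ.le]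
  field_simp

theorem hasFDerivAt_norm_sq_snd (w : ℝ × E) : HasFDerivAt (fun w : ℝ × E => ‖w.2‖ ^ 2)
    ((2 : ℝ) • (innerSL ℝ w.2).comp (ContinuousLinearMap.snd ℝ ℝ E)) w := by
  refine (hasFDerivAt_snd (𝕜 := ℝ) (p := w)).norm_sq.congr_fderiv ?_
  ext <;> simp [two_smul]

/-- A map `v ↦ φ(‖v‖) N(M v)`, where `N` is the normalization and the linear map `M` depends on `s`
and `‖v‖` only, is an immersion if the profile `φ` is increasing. -/
theorem immersionAt_polar {M : ℝ × ℝ → E →L[ℝ] E} {φ : ℝ → ℝ} {s : ℝ} {v : E} {c : ℝ}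
    (hM : ContDiff ℝ ∞ M) (hφ : ContDiff ℝ ∞ φ) (hv : v ≠ 0)
    (hMi : ∀ q u, M q u = 0 → u = 0) (hpos : 0 < φ (‖v‖ ^ 2)) (hc : 0 < c)
    (hd : HasDerivAt φ c (‖v‖ ^ 2)) :
    ImmersionAt (fun w : ℝ × E => (w.1, (φ (‖w.2‖ ^ 2) / ‖M (w.1, ‖w.2‖ ^ 2) w.2‖) •
      M (w.1, ‖w.2‖ ^ 2) w.2)) (s, v) := by
  have hMv : M (s, ‖v‖ ^ 2) v ≠ 0 := fun h => hv (hMi _ _ h)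
  have hR : ContDiff ℝ ∞ fun w : ℝ × E => ‖w.2‖ ^ 2 := contDiff_snd.norm_sq ℝ
  have hM1 : ContDiff ℝ ∞ fun w : ℝ × E => M (w.1, ‖w.2‖ ^ 2) := hM.comp (contDiff_fst.prodMk hR)
  have hM2 : ContDiff ℝ ∞ fun w : ℝ × E => M (w.1, ‖w.2‖ ^ 2) w.2 := hM1.clm_apply contDiff_snd
  have hψ : ContDiffAt ℝ ∞ (fun w : ℝ × E => φ (‖w.2‖ ^ 2) / ‖M (w.1, ‖w.2‖ ^ 2) w.2‖) (s, v) :=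
    (hφ.comp hR).contDiffAt.div (hM2.contDiffAt.norm ℝ hMv) (by simpa using hMv)
  set ψ : ℝ × E → ℝ := fun w => φ (‖w.2‖ ^ 2) / ‖M (w.1, ‖w.2‖ ^ 2) w.2‖ with hψdef
  have hψ0 : ψ (s, v) ≠ 0 := div_ne_zero hpos.ne' (norm_ne_zero_iff.2 hMv)
  have hψd : HasFDerivAt ψ (fderiv ℝ ψ (s, v)) (s, v) :=
    (hψ.differentiableAt (by simp)).hasFDerivAt
  have hM1d : HasFDerivAt (fun w : ℝ × E => M (w.1, ‖w.2‖ ^ 2))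
      ((fderiv ℝ M (s, ‖v‖ ^ 2)).comp ((ContinuousLinearMap.fst ℝ ℝ E).prod
        ((2 : ℝ) • (innerSL ℝ v).comp (ContinuousLinearMap.snd ℝ ℝ E)))) (s, v) := by
    have h1 : HasFDerivAt M (fderiv ℝ M (s, ‖v‖ ^ 2)) (s, ‖v‖ ^ 2) :=
      (hM.differentiable (by simp) _).hasFDerivAt
    exact HasFDerivAt.comp (s, v) h1 ((hasFDerivAt_fst (𝕜 := ℝ) (p := ((s, v) : ℝ × E))).prodMk
      (hasFDerivAt_norm_sq_snd (s, v)))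
  obtain ⟨L, hF, hL⟩ : ∃ L : ℝ × E →L[ℝ] E,
      HasFDerivAt (fun w : ℝ × E => ψ w • M (w.1, ‖w.2‖ ^ 2) w.2) L (s, v) ∧
      ∀ q, L q = ψ (s, v) • (M (s, ‖v‖ ^ 2) q.2 +
        fderiv ℝ M (s, ‖v‖ ^ 2) (q.1, 2 * inner ℝ v q.2) v) +
        (fderiv ℝ ψ (s, v) q) • M (s, ‖v‖ ^ 2) v := by
    refine ⟨_, hψd.smul (hM1d.clm_apply
      (hasFDerivAt_snd (𝕜 := ℝ) (p := ((s, v) : ℝ × E)))), fun q => ?_⟩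
    simp
  refine immersionAt_of_hasFDerivAt (contDiffAt_fst.prodMk (hψ.smul hM2.contDiffAt))
    (hasFDerivAt_fst.prodMk hF) fun q hq => ?_
  have hq1 : q.1 = 0 := by simpa using congrArg Prod.fst hq
  have hq2 : L q = 0 := by simpa using congrArg Prod.snd hq
  -- the norm of the image is `φ (‖v‖ ^ 2)`, so the kernel is orthogonal to `v`
  have hin : inner ℝ v q.2 = 0 := by
    have h1 : (fun w : ℝ × E => φ (‖w.2‖ ^ 2) ^ 2) =ᶠ[𝓝 (s, v)]
        fun w => inner ℝ (ψ w • M (w.1, ‖w.2‖ ^ 2) w.2) (ψ w • M (w.1, ‖w.2‖ ^ 2) w.2) := by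
      have h2 : ∀ᶠ w in 𝓝 ((s, v) : ℝ × E), M (w.1, ‖w.2‖ ^ 2) w.2 ≠ 0 :=
        hM2.continuous.continuousAt.eventually_ne hMv
      filter_upwards [h2] with w hw
      have : 0 < ‖M (w.1, ‖w.2‖ ^ 2) w.2‖ := norm_pos_iff.2 hw
      rw [real_inner_self_eq_norm_sq, norm_smul, hψdef, mul_pow, Real.norm_eq_abs, sq_abs]
      field_simp
    have h3 := (hF.inner ℝ hF).congr_of_eventuallyEq h1
    have h4 : HasFDerivAt (fun w : ℝ × E => φ (‖w.2‖ ^ 2) ^ 2)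
        ((2 * φ (‖v‖ ^ 2) * c) • ((2 : ℝ) • (innerSL ℝ v).comp (ContinuousLinearMap.snd ℝ ℝ E)))
        (s, v) := by
      have h6 := (hd.pow 2).comp_hasFDerivAt (s, v) (hasFDerivAt_norm_sq_snd (s, v))
      refine h6.congr_fderiv ?_
      simp
    have h7 := DFunLike.congr_fun (h3.unique h4) q
    simp only [ContinuousLinearMap.comp_apply, ContinuousLinearMap.prod_apply,
      fderivInnerCLM_apply, hq2, inner_zero_right, inner_zero_left, add_zero, smul_apply,
      ContinuousLinearMap.coe_snd', innerSL_apply_apply, smul_eq_mul] at h7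
    have h8 : 2 * φ (‖v‖ ^ 2) * c * 2 ≠ 0 := by positivity
    have h9 : 2 * φ (‖v‖ ^ 2) * c * 2 * inner ℝ v q.2 = 0 := by linarith
    exact (mul_eq_zero.1 h9).resolve_left h8
  -- to first order `M` is constant along the kernel
  have hq3 : ψ (s, v) • M (s, ‖v‖ ^ 2) q.2 + (fderiv ℝ ψ (s, v) q) • M (s, ‖v‖ ^ 2) v = 0 := by
    have h0 : ((0 : ℝ), 2 * (0 : ℝ)) = 0 := by simp
    rwa [hL, hq1, hin, h0, map_zero, zero_apply, add_zero] at hq2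
  have h5 : M (s, ‖v‖ ^ 2) (ψ (s, v) • q.2 + (fderiv ℝ ψ (s, v) q) • v) = 0 := by
    rw [map_add, map_smul, map_smul]; exact hq3
  have h6 := hMi _ _ h5
  have h7 : inner ℝ q.2 (ψ (s, v) • q.2 + (fderiv ℝ ψ (s, v) q) • v) = (0 : ℝ) := by
    rw [h6, inner_zero_right]
  rw [inner_add_right, inner_smul_right, inner_smul_right, real_inner_comm, real_inner_comm v,
    hin, mul_zero, add_zero] at h7
  have h8 : q.2 = 0 := inner_self_eq_zero.1 ((mul_eq_zero.1 h7).resolve_left hψ0)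
  exact Prod.ext hq1 h8

/-- For a family of linear isomorphisms `N_R`, the map `v ↦ φ(R) N_R v / ‖N_R v‖`, `R = 16 ‖v‖²`, is
a bijection from a shell to the shell given by the affine profile `φ(R) = 4 r (R - 1/2)`. -/
theorem bijOn_polar [FiniteDimensional ℝ E] {N : ℝ → E →L[ℝ] E} (hN : ∀ R u, N R u = 0 → u = 0)
    {r R₁ : ℝ} (hr : 0 < r) :
    BijOn (fun v : E => (4 * r * (16 * ‖v‖ ^ 2 - 1 / 2) / ‖N (16 * ‖v‖ ^ 2) v‖) •
        N (16 * ‖v‖ ^ 2) v) {v | 3 / 4 < 16 * ‖v‖ ^ 2 ∧ 16 * ‖v‖ ^ 2 < R₁}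
      {x | r < ‖x‖ ∧ ‖x‖ < 4 * r * (R₁ - 1 / 2)} := by
  have hnorm : ∀ v : E, 3 / 4 < 16 * ‖v‖ ^ 2 →
      ‖(4 * r * (16 * ‖v‖ ^ 2 - 1 / 2) / ‖N (16 * ‖v‖ ^ 2) v‖) • N (16 * ‖v‖ ^ 2) v‖ =
        4 * r * (16 * ‖v‖ ^ 2 - 1 / 2) ∧ N (16 * ‖v‖ ^ 2) v ≠ 0 := by
    intro v hv
    have hv0 : v ≠ 0 := by rintro rfl; simp at hv; linarith
    have h1 : N (16 * ‖v‖ ^ 2) v ≠ 0 := fun h => hv0 (hN _ _ h)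
    have h2 : 0 < ‖N (16 * ‖v‖ ^ 2) v‖ := norm_pos_iff.2 h1
    have h3 : 0 < 4 * r * (16 * ‖v‖ ^ 2 - 1 / 2) := mul_pos (by linarith) (by linarith)
    refine ⟨?_, h1⟩
    rw [norm_smul, Real.norm_of_nonneg (by positivity)]
    field_simp
  refine ⟨?_, ?_, ?_⟩
  · rintro v ⟨h1, h2⟩
    simp only [mem_ofPred_eq]
    rw [(hnorm v h1).1]
    constructor <;> nlinarith
  · rintro v ⟨h1, -⟩ v' ⟨h1', -⟩ h
    have e1 := congrArg norm h
    simp only at e1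
    rw [(hnorm v h1).1, (hnorm v' h1').1] at e1
    have e2 : 16 * ‖v‖ ^ 2 = 16 * ‖v'‖ ^ 2 := by
      have := mul_left_cancel₀ (by linarith : 4 * r ≠ 0) e1
      linarith
    simp only [← e2] at h
    set R := 16 * ‖v‖ ^ 2
    have h3 : 0 < 4 * r * (R - 1 / 2) := mul_pos (by linarith) (by linarith)
    have p1 : 0 < ‖N R v‖ := norm_pos_iff.2 (hnorm v h1).2
    have p2 : 0 < ‖N R v'‖ := norm_pos_iff.2 (by have := (hnorm v' h1').2; rwa [← e2] at this)
    rw [← map_smul, ← map_smul, ← sub_eq_zero, ← map_sub] at h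
    have h4 := sub_eq_zero.1 (hN _ _ h)
    have h5 : ‖v‖ = ‖v'‖ := by
      have : ‖v‖ ^ 2 = ‖v'‖ ^ 2 := by linarith
      exact (sq_eq_sq₀ (norm_nonneg _) (norm_nonneg _)).1 this
    have hv0 : 0 < ‖v‖ := by
      rcases (norm_nonneg v).eq_or_lt with h0 | h0
      · simp only [R, ← h0] at h1; norm_num at h1
      · exact h0
    have h6 := congrArg norm h4
    rw [norm_smul, norm_smul, ← h5, Real.norm_of_nonneg (by positivity),
      Real.norm_of_nonneg (by positivity)] at h6
    have h7 := mul_right_cancel₀ hv0.ne' h6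
    rw [← h7] at h4
    exact smul_right_injective E (div_pos h3 p1).ne' h4
  · rintro x ⟨h1, h2⟩
    set R := ‖x‖ / (4 * r) + 1 / 2 with hR
    have hRx : 4 * r * (R - 1 / 2) = ‖x‖ := by rw [hR]; field_simp; ring
    have hR34 : 3 / 4 < R := by nlinarith
    have hRR : R < R₁ := by nlinarith
    have hs : Function.Surjective (N R : E →ₗ[ℝ] E) :=
      LinearMap.injective_iff_surjective.1 ((injective_iff_map_eq_zero _).2 (hN R))
    obtain ⟨u, hu⟩ := hs x
    have hu' : N R u = x := hu
    have hx0 : 0 < ‖x‖ := hr.trans h1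
    have hu0 : u ≠ 0 := by rintro rfl; rw [map_zero] at hu'; rw [← hu'] at hx0; simp at hx0
    have hun : 0 < ‖u‖ := norm_pos_iff.2 hu0
    let v := (√R / 4 / ‖u‖) • u
    have hvn : 16 * ‖v‖ ^ 2 = R := by
      simp only [v]
      rw [norm_smul, Real.norm_of_nonneg (by positivity), div_mul_cancel₀ _ hun.ne', div_pow,
        Real.sq_sqrt (by linarith)]
      ring
    refine ⟨v, ⟨by rw [hvn]; exact hR34, by rw [hvn]; exact hRR⟩, ?_⟩
    simp only [hvn, hRx]
    simp only [v]
    have hk : 0 < √R / 4 / ‖u‖ := div_pos (div_pos (Real.sqrt_pos.2 (by linarith)) (by norm_num)) hun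
    rw [map_smul, hu', norm_smul, Real.norm_of_nonneg hk.le, smul_smul]
    have : ‖x‖ / (√R / 4 / ‖u‖ * ‖x‖) * (√R / 4 / ‖u‖) = 1 := by
      field_simp
    rw [this, one_smul]

end Radial

theorem deriv_ramp_of_gt {a b x : ℝ} (hab : a < b) (h : b < x) : deriv (ramp a b) x = 0 := by
  have : ramp a b =ᶠ[𝓝 x] fun _ => 1 := by
    filter_upwards [lt_mem_nhds h] with y hy using ramp_of_ge hab hy.le
  rw [this.deriv_eq]; simp

/-- The norm profile, on a ray of slope `a`, of the reparametrization of the punctured space by the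
complement of the ball `16 t² ≤ 3/4`. -/
def innerProfile (q R₁ R₂ a t : ℝ) : ℝ :=
  (1 - ramp R₁ R₂ (16 * t ^ 2)) * (q * (16 * t ^ 2 - 3 / 4) / a) + ramp R₁ R₂ (16 * t ^ 2) * t

section InnerProfile

variable {q R₁ R₂ a : ℝ}

theorem innerProfile_of_le (h12 : R₁ < R₂) {t : ℝ} (ht : 16 * t ^ 2 ≤ R₁) :
    innerProfile q R₁ R₂ a t = q * (16 * t ^ 2 - 3 / 4) / a := by
  simp [innerProfile, ramp_of_le h12 ht]

theorem innerProfile_of_ge (h12 : R₁ < R₂) {t : ℝ} (ht : R₂ ≤ 16 * t ^ 2) :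
    innerProfile q R₁ R₂ a t = t := by
  simp [innerProfile, ramp_of_ge h12 ht]

theorem hasDerivAt_innerProfile (h12 : R₁ < R₂) (hq : 0 < q) (ha : 0 < a)
    (hqa : q * (R₂ - 3 / 4) ≤ a / 5) {t : ℝ} (ht0 : 0 < t) (ht : 3 / 4 < 16 * t ^ 2) :
    ∃ c > 0, HasDerivAt (innerProfile q R₁ R₂ a) c t := by
  have h0 : HasDerivAt (fun t : ℝ => 16 * t ^ 2) (32 * t) t := by
    refine ((hasDerivAt_pow 2 t).const_mul 16).congr_deriv ?_
    simp; ring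
  refine exists_hasDerivAt_blend_pos (f₁ := fun t => q * (16 * t ^ 2 - 3 / 4) / a)
    (f₂ := fun t => t) (χ := fun t => ramp R₁ R₂ (16 * t ^ 2)) (χ' := deriv (ramp R₁ R₂)
      (16 * t ^ 2) * (32 * t)) (((h0.sub_const _).const_mul q).div_const a)
    (hasDerivAt_id t) (HasDerivAt.comp t (h₂ := ramp R₁ R₂) (hasDerivAt_ramp R₁ R₂ (16 * t ^ 2)) h0) (by positivity) one_pos
    (mul_nonneg (deriv_ramp_nonneg h12 _) (by positivity)) (ramp_nonneg _) (ramp_le_one _) ?_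
  rcases le_or_gt (16 * t ^ 2) R₂ with h | h
  · left
    have h1 : q * (16 * t ^ 2 - 3 / 4) ≤ a / 5 :=
      (mul_le_mul_of_nonneg_left (by linarith) hq.le).trans hqa
    have h2 : 1 / 5 ≤ t := by nlinarith
    rw [div_le_iff₀ ha]
    nlinarith
  · right; rw [deriv_ramp_of_gt h12 h, zero_mul]

theorem continuous_innerProfile : Continuous (innerProfile q R₁ R₂ a) := by
  have := (contDiff_ramp R₁ R₂).continuous
  unfold innerProfile
  fun_prop

theorem bijOn_innerProfile (h12 : R₁ < R₂) (h1 : 3 / 4 < R₁) (hq : 0 < q)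
    (ha : 0 < a) (hqa : q * (R₂ - 3 / 4) ≤ a / 5) :
    BijOn (innerProfile q R₁ R₂ a) (Ioi (√3 / 8)) (Ioi 0) ∧
      StrictMonoOn (innerProfile q R₁ R₂ a) (Ici (√3 / 8)) := by
  have h3 : √3 ^ 2 = 3 := Real.sq_sqrt (by norm_num)
  have h3' : 0 < √3 := Real.sqrt_pos.2 (by norm_num)
  refine bijOn_Ioi_of_hasDerivAt_pos (b := 1 + R₂) continuous_innerProfile.continuousOn
    (fun t ht => hasDerivAt_innerProfile h12 hq ha hqa (by linarith) ?_) ?_ fun t ht => ?_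
  · nlinarith
  · have e : 16 * (√3 / 8) ^ 2 = 3 / 4 := by rw [div_pow, h3]; norm_num
    rw [innerProfile_of_le h12 (by rw [e]; exact h1.le), e]; simp
  · exact innerProfile_of_ge h12 (by nlinarith)

theorem sqrt_three_div_lt {t : ℝ} (ht0 : 0 ≤ t) : √3 / 8 < t ↔ 3 / 4 < 16 * t ^ 2 := by
  have h3 : √3 ^ 2 = 3 := Real.sq_sqrt (by norm_num)
  have h3' : 0 < √3 := Real.sqrt_pos.2 (by norm_num)
  constructor
  · intro h; nlinarith
  · intro h; by_contra h'; nlinarith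

end InnerProfile

/-! ### Parametrizations of a torus without a tube -/

namespace TorusTube

variable {d : ℕ} {V : Type*} [NormedAddCommGroup V] [NormedSpace ℝ V] {Ω : V → V → ℝ}
  (S : TorusTube d Ω)

theorem T_add_int (k : ℤ) {p : ℝ × EuclideanSpace ℝ (Fin d)} (hx : ‖p.2‖ < S.ε) :
    S.T (p.1 + k, p.2) = S.T p :=
  ((S.T_eq p (p.1 + k, p.2) hx hx).2 ⟨⟨k, rfl⟩, rfl⟩).symm

theorem isClosed_image_T {R : ℝ} (hR : R < S.ε) : IsClosed (S.T '' {p | ‖p.2‖ ≤ R}) := by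
  have h1 : S.T '' {p | ‖p.2‖ ≤ R} = S.T '' (Icc (0 : ℝ) 1 ×ˢ Metric.closedBall 0 R) := by
    refine Subset.antisymm ?_ (image_mono fun p hp => by simpa using hp.2)
    rintro _ ⟨p, hp, rfl⟩
    refine ⟨(Int.fract p.1, p.2), ⟨⟨Int.fract_nonneg _, (Int.fract_lt_one _).le⟩, by simpa using hp⟩, ?_⟩
    have := S.T_add_int ⌊p.1⌋ (p := (Int.fract p.1, p.2)) (lt_of_le_of_lt hp hR)
    rw [← this]
    simp only [Int.fract_add_floor]
  rw [h1]
  refine ((isCompact_Icc.prod (isCompact_closedBall 0 R)).image_of_continuousOn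
    fun p hp => ?_).isClosed
  have hp2 : ‖p.2‖ ≤ R := by simpa using hp.2
  exact (S.T_iso p (hp2.trans_lt hR)).1.1.continuousAt.continuousWithinAt

open Classical in
/-- The self-map of the torus that pushes the tube radially outwards, off the tube of radius `r`. -/
def expand (e : ℝ → ℝ) (z : V) : V :=
  if h : ∃ p, ‖p.2‖ < S.ε ∧ z = S.T p then S.T (radialMap e h.choose) else z

variable {S}

theorem expand_T {e : ℝ → ℝ} (he : ∀ x, 0 < x → x < S.ε → 0 ≤ e x ∧ e x < S.ε)
    {p : ℝ × EuclideanSpace ℝ (Fin d)} (hp : ‖p.2‖ < S.ε) (hp0 : p.2 ≠ 0) :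
    S.expand e (S.T p) = S.T (radialMap e p) ∧ ‖(radialMap e p).2‖ < S.ε ∧
      ‖(radialMap e p).2‖ = e ‖p.2‖ := by
  have h : ∃ q, ‖q.2‖ < S.ε ∧ S.T p = S.T q := ⟨p, hp, rfl⟩
  have hn : ‖(radialMap e p).2‖ = e ‖p.2‖ := norm_radialMap hp0 (he _ (norm_pos_iff.2 hp0) hp).1
  have hn' : ‖(radialMap e p).2‖ < S.ε := by rw [hn]; exact (he _ (norm_pos_iff.2 hp0) hp).2
  refine ⟨?_, hn', hn⟩
  rw [expand, dif_pos h]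
  obtain ⟨h1, h2⟩ := h.choose_spec
  set q := h.choose
  obtain ⟨⟨k, hk⟩, h3⟩ := (S.T_eq p q hp h1).1 h2
  have h4 : radialMap e q = ((radialMap e p).1 + k, (radialMap e p).2) := by
    simp only [radialMap, ← h3, hk]
  rw [h4]
  exact S.T_add_int k hn'

theorem expand_of_notMem {e : ℝ → ℝ} {z : V} (h : ¬ ∃ p, ‖p.2‖ < S.ε ∧ z = S.T p) :
    S.expand e z = z := dif_neg h

variable (S)

/-- There is a parametrization of the complement in the torus of a closed tube around the loop by
the complement of the loop, that is radial near the loop. -/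
theorem exists_punctured {r : ℝ} (hr : 0 < r) (hrε : r < S.ε) :
    ∃ (G : ℝ × EuclideanSpace ℝ (Fin d) → V) (δ c : ℝ), 0 < δ ∧ 0 < c ∧
    (∀ w, cubeRep w.2 ≠ 0 → IsotropicImmersionAt Ω G w) ∧
    (∀ s v, v ≠ 0 → ‖v‖ < δ →
      G (s, v) = S.T (s, ((r + c * ‖S.A s v‖) / ‖S.A s v‖) • S.A s v)) ∧
    (∀ w w' : ℝ × EuclideanSpace ℝ (Fin d), cubeRep w.2 ≠ 0 → cubeRep w'.2 ≠ 0 → (G w = G w' ↔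
      (∃ k : ℤ, w'.1 = w.1 + k) ∧ cubeRep w.2 = cubeRep w'.2)) ∧
    G '' {w | cubeRep w.2 ≠ 0} = range S.C \ S.T '' {p | ‖p.2‖ ≤ r} := by
  obtain ⟨e, c, x₁, r₂, hc, hx₁, hx12, hr₂, hr₂ε, hes, he1, he2, hed⟩ :=
    exists_radial_profile hr hrε
  obtain ⟨g, δ, hδ, hδ4, hgl, hgT, hgi, hgr⟩ := S.exists_straight
  have he0 : e 0 = r := by rw [he1 0 hx₁.le]; ring
  obtain ⟨heb, hem⟩ := bijOn_Ioi_of_hasDerivAt_pos (t₀ := 0) hes.continuous.continuousOn hed he0 he2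
  have her : ∀ x, 0 < x → r < e x := fun x hx => heb.1 hx
  have hε := S.ε_pos
  have heε : ∀ x, 0 < x → x < S.ε → 0 ≤ e x ∧ e x < S.ε := by
    intro x hx hx'
    refine ⟨(hr.trans (her x hx)).le, ?_⟩
    have := hem (mem_Ici.2 hx.le) (mem_Ici.2 hε.le) hx'
    rwa [he2 _ hr₂ε.le] at this
  -- points of the tube are not on the loop unless the transverse coordinate vanishes
  have hcore : ∀ w : ℝ × EuclideanSpace ℝ (Fin d), cubeRep w.2 ≠ 0 → ∀ p : ℝ × EuclideanSpace ℝ (Fin d), g w = S.T p → p.2 ≠ 0 := by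
    intro w hw p hp h0
    have h1 := (hgT p.1 0 (by simpa using hδ)).2
    rw [map_zero, ← h0] at h1
    rw [show ((p.1, p.2) : ℝ × EuclideanSpace ℝ (Fin d)) = p from rfl, ← hp] at h1
    have h2 := ((hgi _ _).1 h1).2
    rw [h0, cubeRep_zero] at h2
    exact hw h2.symm
  have hfar : ∀ z, z ∉ S.T '' {p | ‖p.2‖ ≤ r₂} → S.expand e z = z := by
    intro z hz
    by_cases h : ∃ p, ‖p.2‖ < S.ε ∧ z = S.T p
    · obtain ⟨p, hp, rfl⟩ := h
      have h1 : r₂ < ‖p.2‖ := by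
        by_contra h; exact hz ⟨p, not_lt.1 h, rfl⟩
      have h0 : 0 < ‖p.2‖ := hr₂.trans h1
      rw [(expand_T heε hp (norm_pos_iff.1 h0)).1]
      congr 1
      simp only [radialMap, he2 _ h1.le, div_self h0.ne', one_smul]
    · exact expand_of_notMem h
  obtain ⟨K, hK, hAK⟩ := exists_uniform_upper_bound S.contDiff_A.continuous S.A_periodic
  refine ⟨fun w => S.expand e (g w), min δ (x₁ / K), c, lt_min hδ (by positivity), hc,
    fun w hw => ?_, fun s v hv hvδ => ?_, fun w w' hw hw' => ⟨fun h => ?_, fun h => ?_⟩, ?_⟩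
  · by_cases h : g w ∈ S.T '' {p | ‖p.2‖ ≤ r₂}
    · obtain ⟨p, hp, hpw⟩ := h
      have hp' : ‖p.2‖ < S.ε := lt_of_le_of_lt hp hr₂ε
      have hp0 : p.2 ≠ 0 := hcore w hw p hpw.symm
      obtain ⟨l, hl, hlw, hgl'⟩ := (hgl w).exists_lift hp' hpw.symm
      have hlε : ‖(l w).2‖ < S.ε := by rw [hlw]; exact hp'
      have hl0 : (l w).2 ≠ 0 := by rw [hlw]; exact hp0
      have e1 : ∀ᶠ x in 𝓝 w, ‖(l x).2‖ < S.ε :=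
        (continuous_snd.norm.continuousAt.comp hl.1.continuousAt).eventually (gt_mem_nhds hlε)
      have e2 : ∀ᶠ x in 𝓝 w, (l x).2 ≠ 0 :=
        (continuous_snd.continuousAt.comp hl.1.continuousAt).eventually_ne hl0
      have hex := expand_T heε hlε hl0
      have i1 : ImmersionAt (radialMap e) (l w) :=
        immersionAt_radialMap (s := (l w).1) (v := (l w).2) hes hl0
          (hr.trans (her _ (norm_pos_iff.2 hl0))) (hed _ (norm_pos_iff.2 hl0))
      refine (IsotropicImmersionAt.comp (l := fun x => radialMap e (l x))
        (S.T_iso (radialMap e (l w)) hex.2.1) (ImmersionAt.comp i1 hl)).congr ?_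
      filter_upwards [hgl', e1, e2] with x h1 h2 h3
      rw [h1, (expand_T heε h2 h3).1]
    · have e1 : ∀ᶠ x in 𝓝 w, g x ∉ S.T '' {p | ‖p.2‖ ≤ r₂} :=
        (hgl w).iso.1.1.continuousAt.eventually ((S.isClosed_image_T hr₂ε).isOpen_compl.mem_nhds h)
      refine (hgl w).iso.congr ?_
      filter_upwards [e1] with x hx using hfar _ hx
  · have hvδ1 : ‖v‖ < δ := hvδ.trans_le (min_le_left _ _)
    have hvδ2 : ‖v‖ < x₁ / K := hvδ.trans_le (min_le_right _ _)
    obtain ⟨h1, h2⟩ := hgT s v hvδ1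
    have h3 : S.A s v ≠ 0 := fun h => hv (S.A_injective s v h)
    have h4 : ‖S.A s v‖ ≤ x₁ := by
      refine (ContinuousLinearMap.le_opNorm _ _).trans ?_
      rw [lt_div_iff₀ hK] at hvδ2
      have := mul_le_mul_of_nonneg_right (hAK s) (norm_nonneg v)
      linarith
    simp only [h2]
    rw [(expand_T (p := (s, S.A s v)) heε h1 h3).1]
    simp only [radialMap, he1 _ h4]
  · refine (hgi w w').1 ?_
    by_cases h1 : ∃ p, ‖p.2‖ < S.ε ∧ g w = S.T p
    · by_cases h2 : ∃ p, ‖p.2‖ < S.ε ∧ g w' = S.T p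
      · obtain ⟨p, hp, hpw⟩ := h1
        obtain ⟨p', hp', hpw'⟩ := h2
        have hp0 := hcore w hw p hpw
        have hp0' := hcore w' hw' p' hpw'
        have E := expand_T heε hp hp0
        have E' := expand_T heε hp' hp0'
        simp only [hpw, hpw', E.1, E'.1] at h
        obtain ⟨h3, h4⟩ := (S.T_eq _ _ E.2.1 E'.2.1).1 h
        have h5 : ‖p.2‖ = ‖p'.2‖ := heb.2.1 (norm_pos_iff.2 hp0) (norm_pos_iff.2 hp0') (by
          rw [← E.2.2, ← E'.2.2, h4])
        have h6 : 0 < e ‖p'.2‖ / ‖p'.2‖ := div_pos (hr.trans (her _ (norm_pos_iff.2 hp0')))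
          (norm_pos_iff.2 hp0')
        simp only [radialMap, h5] at h3 h4
        rw [hpw, hpw']
        exact (S.T_eq p p' hp hp').2 ⟨h3, smul_right_injective _ h6.ne' h4⟩
      · obtain ⟨p, hp, hpw⟩ := h1
        have E := expand_T heε hp (hcore w hw p hpw)
        simp only [hpw, E.1, expand_of_notMem h2] at h
        exact absurd ⟨_, E.2.1, h.symm⟩ h2
    · by_cases h2 : ∃ p, ‖p.2‖ < S.ε ∧ g w' = S.T p
      · obtain ⟨p, hp, hpw⟩ := h2
        have E := expand_T heε hp (hcore w' hw' p hpw)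
        simp only [hpw, E.1, expand_of_notMem h1] at h
        exact absurd ⟨_, E.2.1, h⟩ h1
      · simpa only [expand_of_notMem h1, expand_of_notMem h2] using h
  · simp only [(hgi w w').2 h]
  · ext z
    constructor
    · rintro ⟨w, hw, rfl⟩
      simp only
      by_cases h1 : ∃ p, ‖p.2‖ < S.ε ∧ g w = S.T p
      · obtain ⟨p, hp, hpw⟩ := h1
        have E := expand_T heε hp (hcore w hw p hpw)
        rw [hpw, E.1]
        refine ⟨S.T_mem _ E.2.1, ?_⟩
        rintro ⟨q, hq, hqe⟩
        have hq' : ‖q.2‖ ≤ r := hq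
        have h2 := ((S.T_eq _ _ (hq'.trans_lt hrε) E.2.1).1 hqe).2
        rw [h2, E.2.2] at hq'
        exact absurd (her _ (norm_pos_iff.2 (hcore w hw p hpw))) (not_lt.2 hq')
      · rw [expand_of_notMem h1]
        refine ⟨hgr ▸ mem_range_self w, ?_⟩
        rintro ⟨q, hq, hqe⟩
        exact h1 ⟨q, lt_of_le_of_lt hq hrε, hqe.symm⟩
    · rintro ⟨hz1, hz2⟩
      by_cases h1 : ∃ p, ‖p.2‖ < S.ε ∧ z = S.T p
      · obtain ⟨p, hp, rfl⟩ := h1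
        have hpr : r < ‖p.2‖ := by
          by_contra h; exact hz2 ⟨p, not_lt.1 h, rfl⟩
        have hpn : 0 < ‖p.2‖ := hr.trans hpr
        obtain ⟨x, hx, hxe⟩ := heb.2.2 (show ‖p.2‖ ∈ Ioi r from hpr)
        have hx0 : 0 < x := hx
        have hxε : x < S.ε := by
          by_contra h
          rw [he2 x (hr₂ε.le.trans (not_lt.1 h))] at hxe
          linarith
        let q : ℝ × EuclideanSpace ℝ (Fin d) := (p.1, (x / ‖p.2‖) • p.2)
        have hqn : ‖q.2‖ = x := by
          simp only [q]
          rw [norm_smul, Real.norm_of_nonneg (by positivity)]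
          field_simp
        have hq0 : q.2 ≠ 0 := norm_pos_iff.1 (by rw [hqn]; exact hx0)
        have hqε : ‖q.2‖ < S.ε := by rw [hqn]; exact hxε
        have E := expand_T heε hqε hq0
        have hqr : radialMap e q = p := by
          simp only [radialMap, hqn, hxe]
          simp only [q]
          rw [smul_smul]
          have : ‖p.2‖ / x * (x / ‖p.2‖) = 1 := by field_simp
          rw [this, one_smul]
        have h2 : S.T q ∈ range g := by rw [hgr]; exact S.T_mem q hqε
        obtain ⟨w, hw⟩ := h2
        refine ⟨w, fun h0 => hq0 ?_, by simp only [hw, E.1, hqr]⟩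
        have h3 := (hgT w.1 0 (by simpa using hδ)).2
        rw [map_zero] at h3
        have h4 : g w = g (w.1, 0) := (hgi _ _).2 ⟨⟨0, by simp⟩, by rw [h0, cubeRep_zero]⟩
        rw [← h4, hw] at h3
        exact ((S.T_eq q (w.1, 0) hqε (by simpa using hε)).1 h3).2
      · rw [← hgr] at hz1
        obtain ⟨w, rfl⟩ := hz1
        refine ⟨w, fun h0 => h1 ⟨(w.1, 0), by simpa using hε, ?_⟩, by simp only [expand_of_notMem h1]⟩
        have h3 := (hgT w.1 0 (by simpa using hδ)).2
        rw [map_zero] at h3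
        rw [← h3]
        exact (hgi _ _).2 ⟨⟨0, by simp⟩, by rw [show cubeRep w.2 = 0 from h0, cubeRep_zero]⟩

end TorusTube

namespace TorusTube

variable {d : ℕ} {V : Type*} [NormedAddCommGroup V] [NormedSpace ℝ V] {Ω : V → V → ℝ}
  (S : TorusTube d Ω)

theorem eventually_lt_sq_norm_cubeRep {s c : ℝ} {v : EuclideanSpace ℝ (Fin d)}
    (h : c < 16 * ‖cubeRep v‖ ^ 2) :
    ∀ᶠ w : ℝ × EuclideanSpace ℝ (Fin d) in 𝓝 (s, v), c < 16 * ‖cubeRep w.2‖ ^ 2 := by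
  have : Continuous fun w : ℝ × EuclideanSpace ℝ (Fin d) => 16 * ‖cubeRep w.2‖ ^ 2 :=
    ((continuous_norm_cubeRep.comp continuous_snd).pow 2).const_mul 16
  exact continuousAt_const.eventually_lt this.continuousAt h

theorem eventually_sq_norm_cubeRep_lt {s c : ℝ} {v : EuclideanSpace ℝ (Fin d)}
    (h : 16 * ‖cubeRep v‖ ^ 2 < c) :
    ∀ᶠ w : ℝ × EuclideanSpace ℝ (Fin d) in 𝓝 (s, v), 16 * ‖cubeRep w.2‖ ^ 2 < c := by
  have : Continuous fun w : ℝ × EuclideanSpace ℝ (Fin d) => 16 * ‖cubeRep w.2‖ ^ 2 :=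
    ((continuous_norm_cubeRep.comp continuous_snd).pow 2).const_mul 16
  exact this.continuousAt.eventually_lt continuousAt_const h

/-- A map that is an immersion at `(s, cubeRep v)` gives, on composing with the reduction to the
fundamental cube, an immersion at `(s, v)`. -/
theorem exists_translate {v : EuclideanSpace ℝ (Fin d)} (h : ‖cubeRep v‖ < 1 / 2) (s : ℝ) :
    ∃ l : ℝ × EuclideanSpace ℝ (Fin d) → ℝ × EuclideanSpace ℝ (Fin d), ImmersionAt l (s, v) ∧
      l (s, v) = (s, cubeRep v) ∧ ∀ᶠ w in 𝓝 (s, v), l w = (w.1, cubeRep w.2) := by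
  have e : ((s, v) + (0, cubeRep v - v) : ℝ × EuclideanSpace ℝ (Fin d)) = (s, cubeRep v) := by
    ext1 <;> simp
  refine ⟨fun w => w + (0, cubeRep v - v), immersionAt_add_const _ _, e, ?_⟩
  filter_upwards [eventually_cubeRep_add h s] with w hw
  exact hw.symm

set_option maxHeartbeats 1000000 in
/-- There is a parametrization of the complement in the torus of a closed tube around the loop by
the complement of a ball, that is linear up to a radial factor near the ball. -/
theorem exists_annulus {r : ℝ} (hr : 0 < r) (hrε : r < S.ε) :
    ∃ (P : ℝ × EuclideanSpace ℝ (Fin d) → V) (η : ℝ), 0 < η ∧ η ≤ 1 / 16 ∧ r + 4 * r * η < S.ε ∧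
    (∀ s v, 3 / 4 < 16 * ‖cubeRep v‖ ^ 2 → IsotropicImmersionAt Ω P (s, v)) ∧
    (∀ s v, 3 / 4 < 16 * ‖v‖ ^ 2 → 16 * ‖v‖ ^ 2 < 3 / 4 + η →
      P (s, v) = S.T (s, (4 * r * (16 * ‖v‖ ^ 2 - 1 / 2) / ‖S.A s v‖) • S.A s v)) ∧
    (∀ w w' : ℝ × EuclideanSpace ℝ (Fin d), 3 / 4 < 16 * ‖cubeRep w.2‖ ^ 2 →
      3 / 4 < 16 * ‖cubeRep w'.2‖ ^ 2 → (P w = P w' ↔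
      (∃ k : ℤ, w'.1 = w.1 + k) ∧ cubeRep w.2 = cubeRep w'.2)) ∧
    P '' {w | 3 / 4 < 16 * ‖cubeRep w.2‖ ^ 2} = range S.C \ S.T '' {p | ‖p.2‖ ≤ r} := by
  obtain ⟨G, δ, c, hδ, hc, hG1, hG2, hG3, hG4⟩ := S.exists_punctured hr hrε
  obtain ⟨m, hm, hAm⟩ := exists_uniform_lower_bound S.contDiff_A.continuous S.A_periodic
    S.A_injective
  set q := 4 * r / c with hq
  have hqp : 0 < q := by positivity
  obtain ⟨η, hη, hη1, hη2, hη3, hη4⟩ : ∃ η, 0 < η ∧ η ≤ 1 / 16 ∧ r + 4 * r * η < S.ε ∧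
      q * (2 * η) ≤ m / 5 ∧ q * η / m < δ := by
    have h1 : ∀ᶠ η : ℝ in 𝓝[>] 0, η ≤ 1 / 16 :=
      (eventually_le_nhds (by norm_num)).filter_mono nhdsWithin_le_nhds
    have h2 : ∀ᶠ η : ℝ in 𝓝[>] 0, r + 4 * r * η < S.ε := by
      refine Filter.Eventually.filter_mono nhdsWithin_le_nhds ?_
      have : Continuous fun η : ℝ => r + 4 * r * η := by fun_prop
      exact this.continuousAt.eventually (gt_mem_nhds (by simpa using hrε))
    have h3 : ∀ᶠ η : ℝ in 𝓝[>] 0, q * (2 * η) < m / 5 := by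
      refine Filter.Eventually.filter_mono nhdsWithin_le_nhds ?_
      have : Continuous fun η : ℝ => q * (2 * η) := by fun_prop
      exact this.continuousAt.eventually (gt_mem_nhds (by simpa using hm))
    have h4 : ∀ᶠ η : ℝ in 𝓝[>] 0, q * η / m < δ := by
      refine Filter.Eventually.filter_mono nhdsWithin_le_nhds ?_
      have : Continuous fun η : ℝ => q * η / m := by fun_prop
      exact this.continuousAt.eventually (gt_mem_nhds (by simpa using hδ))
    have h0 : ∀ᶠ η : ℝ in 𝓝[>] 0, 0 < η := self_mem_nhdsWithin
    obtain ⟨η, h⟩ := (h0.and (h1.and (h2.and (h3.and h4)))).exists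
    exact ⟨η, h.1, h.2.1, h.2.2.1, h.2.2.2.1.le, h.2.2.2.2⟩
  set R₁ := 3 / 4 + η with hR₁
  set R₂ := 3 / 4 + 2 * η with hR₂
  have h12 : R₁ < R₂ := by simp only [hR₁, hR₂]; linarith
  have h341 : 3 / 4 < R₁ := by simp only [hR₁]; linarith
  have hR21 : R₂ < 1 := by simp only [hR₂]; linarith
  -- the reparametrization `W` of the complement of the ball by the punctured space
  let α : ℝ × EuclideanSpace ℝ (Fin d) → ℝ := fun w => ‖S.A w.1 w.2‖ / ‖w.2‖
  let κ : ℝ × EuclideanSpace ℝ (Fin d) → ℝ := fun w =>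
    innerProfile q R₁ R₂ (α w) ‖w.2‖ / ‖w.2‖
  let W : ℝ × EuclideanSpace ℝ (Fin d) → ℝ × EuclideanSpace ℝ (Fin d) := fun w => (w.1, κ w • w.2)
  have hne : ∀ v : EuclideanSpace ℝ (Fin d), 3 / 4 < 16 * ‖v‖ ^ 2 → 0 < ‖v‖ := by
    intro v hv
    rcases (norm_nonneg v).eq_or_lt with h0 | h0
    · rw [← h0] at hv; norm_num at hv
    · exact h0
  have hα : ∀ w : ℝ × EuclideanSpace ℝ (Fin d), 0 < ‖w.2‖ → m ≤ α w := by
    intro w hw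
    simp only [α]
    rw [le_div_iff₀ hw]
    exact hAm _ _
  have hqα : ∀ w : ℝ × EuclideanSpace ℝ (Fin d), 0 < ‖w.2‖ → q * (R₂ - 3 / 4) ≤ α w / 5 := by
    intro w hw
    have := hα w hw
    have h2 : R₂ - 3 / 4 = 2 * η := by simp only [hR₂]; ring
    rw [h2]; linarith
  have hαp : ∀ w : ℝ × EuclideanSpace ℝ (Fin d), 0 < ‖w.2‖ → 0 < α w := fun w hw =>
    hm.trans_le (hα w hw)
  have hαs : ∀ (s t : ℝ) (v : EuclideanSpace ℝ (Fin d)), 0 < t → α (s, t • v) = α (s, v) := by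
    intro s t v ht
    simp only [α, map_smul, norm_smul, Real.norm_of_nonneg ht.le]
    rw [mul_div_mul_left _ _ ht.ne']
  have hprof : ∀ w : ℝ × EuclideanSpace ℝ (Fin d), 0 < ‖w.2‖ →
      BijOn (innerProfile q R₁ R₂ (α w)) (Ioi (√3 / 8)) (Ioi 0) ∧
      StrictMonoOn (innerProfile q R₁ R₂ (α w)) (Ici (√3 / 8)) := fun w hw =>
    bijOn_innerProfile h12 h341 hqp (hαp w hw) (hqα w hw)
  have hWn : ∀ w : ℝ × EuclideanSpace ℝ (Fin d), 3 / 4 < 16 * ‖w.2‖ ^ 2 → 0 < κ w ∧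
      ‖(W w).2‖ = innerProfile q R₁ R₂ (α w) ‖w.2‖ := by
    intro w hw
    have h0 := hne _ hw
    have h1 : 0 < innerProfile q R₁ R₂ (α w) ‖w.2‖ :=
      (hprof w h0).1.1 ((sqrt_three_div_lt h0.le).2 hw)
    have h2 : 0 < κ w := div_pos h1 h0
    refine ⟨h2, ?_⟩
    simp only [W]
    rw [norm_smul, Real.norm_of_nonneg h2.le]
    exact div_mul_cancel₀ _ h0.ne'
  have hWge : ∀ w : ℝ × EuclideanSpace ℝ (Fin d), R₂ ≤ 16 * ‖w.2‖ ^ 2 → W w = w := by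
    intro w hw
    have h0 := hne w.2 (by linarith)
    have : κ w = 1 := by
      simp only [κ]
      rw [innerProfile_of_ge h12 hw, div_self h0.ne']
    simp only [W, this, one_smul]
  have hWlt : ∀ w : ℝ × EuclideanSpace ℝ (Fin d), 3 / 4 < 16 * ‖w.2‖ ^ 2 → 16 * ‖w.2‖ ^ 2 < R₂ →
      16 * ‖(W w).2‖ ^ 2 < R₂ := by
    intro w hw hw2
    have h0 := hne _ hw
    have hs : 0 < √R₂ := Real.sqrt_pos.2 (by linarith)
    have hs2 : √R₂ ^ 2 = R₂ := Real.sq_sqrt (by linarith)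
    have e1 : 16 * (√R₂ / 4) ^ 2 = R₂ := by rw [div_pow, hs2]; ring
    have h1 : ‖w.2‖ < √R₂ / 4 := by
      by_contra h
      have := not_lt.1 h
      nlinarith
    have h2 : √3 / 8 < √R₂ / 4 := (sqrt_three_div_lt (by positivity)).2 (by rw [e1]; linarith)
    have h3 := (hprof w h0).2 (mem_Ici.2 ((sqrt_three_div_lt h0.le).2 hw).le) (mem_Ici.2 h2.le) h1
    rw [innerProfile_of_ge h12 e1.ge] at h3
    have h4 : 0 ≤ innerProfile q R₁ R₂ (α w) ‖w.2‖ := by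
      rw [← (hWn w hw).2]; exact norm_nonneg _
    have h5 := pow_lt_pow_left₀ h3 h4 two_ne_zero
    rw [(hWn w hw).2]
    linarith
  have hWcube : ∀ (s : ℝ) (v : EuclideanSpace ℝ (Fin d)), 3 / 4 < 16 * ‖cubeRep v‖ ^ 2 →
      cubeRep (W (s, cubeRep v)).2 = (W (s, cubeRep v)).2 ∧ (W (s, cubeRep v)).2 ≠ 0 := by
    intro s v hv
    have h0 := hne _ hv
    refine ⟨?_, smul_ne_zero (hWn (s, cubeRep v) hv).1.ne' (norm_pos_iff.1 h0)⟩
    rcases lt_or_ge (16 * ‖cubeRep v‖ ^ 2) R₂ with h | h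
    · have := hWlt (s, cubeRep v) hv h
      refine cubeRep_eq_self ?_
      nlinarith [norm_nonneg (W (s, cubeRep v)).2]
    · rw [hWge (s, cubeRep v) h]
      exact cubeRep_cubeRep v
  have hWinj : ∀ (s s' : ℝ) (v v' : EuclideanSpace ℝ (Fin d)), (∃ k : ℤ, s' = s + k) →
      3 / 4 < 16 * ‖v‖ ^ 2 → 3 / 4 < 16 * ‖v'‖ ^ 2 → (W (s, v)).2 = (W (s', v')).2 → v = v' := by
    rintro s s' v v' ⟨k, rfl⟩ hv hv' h
    have h0 := hne _ hv
    have h0' := hne _ hv'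
    have e1 : α (s + k, v') = α (s, v') := by
      have : S.A (s + k) = S.A s := by
        have := S.A_periodic.int_mul k s
        rwa [mul_one] at this
      simp only [α, this]
    have k1 := (hWn (s, v) hv)
    have k2 := (hWn (s + k, v') hv')
    have e2 : v' = (κ (s, v) / κ (s + k, v')) • v := by
      rw [div_eq_inv_mul, ← smul_smul, show κ (s, v) • v = κ (s + k, v') • v' from h,
        inv_smul_smul₀ k2.1.ne']
    have e3 : α (s, v') = α (s, v) := by
      rw [e2]; exact hαs _ _ _ (div_pos k1.1 k2.1)
    have e4 : ‖v‖ = ‖v'‖ := by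
      refine (hprof (s, v) h0).1.2.1 ((sqrt_three_div_lt h0.le).2 hv)
        ((sqrt_three_div_lt h0'.le).2 hv') ?_
      have := k2.2
      simp only [e1, e3] at this
      rw [← this, ← h]
      exact k1.2.symm
    have e5 : κ (s + k, v') = κ (s, v) := by simp only [κ, e1, e3, e4]
    rw [e5, div_self k1.1.ne', one_smul] at e2
    exact e2.symm
  have hWsurj : ∀ (s : ℝ) (x : EuclideanSpace ℝ (Fin d)), cubeRep x = x → x ≠ 0 → ∃ v,
      cubeRep v = v ∧ 3 / 4 < 16 * ‖v‖ ^ 2 ∧ W (s, v) = (s, x) := by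
    intro s x hx hx0
    rcases lt_or_ge (16 * ‖x‖ ^ 2) R₂ with h | h
    · have hxn : 0 < ‖x‖ := norm_pos_iff.2 hx0
      obtain ⟨t, ht, hte⟩ := (hprof (s, x) hxn).1.2.2 (show ‖x‖ ∈ Ioi 0 from hxn)
      have ht0 : 0 < t := lt_of_le_of_lt (by positivity) ht
      have ht1 : 3 / 4 < 16 * t ^ 2 := (sqrt_three_div_lt ht0.le).1 ht
      have hn : ‖(t / ‖x‖) • x‖ = t := by
        rw [norm_smul, Real.norm_of_nonneg (by positivity)]; field_simp
      have hk : κ (s, (t / ‖x‖) • x) = ‖x‖ / t := by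
        simp only [κ, hn]
        rw [hαs _ _ _ (by positivity), hte]
      have ht2 : 16 * t ^ 2 < R₂ := by
        by_contra h'
        rw [innerProfile_of_ge h12 (not_lt.1 h')] at hte
        rw [← hte] at h; exact h' h
      refine ⟨(t / ‖x‖) • x, cubeRep_eq_self ?_, by rw [hn]; exact ht1, ?_⟩
      · rw [hn]; nlinarith
      · simp only [W, hk, smul_smul]
        rw [show ‖x‖ / t * (t / ‖x‖) = 1 by field_simp, one_smul]
    · exact ⟨x, hx, by linarith, hWge (s, x) h⟩
  have hWimm : ∀ s v, 3 / 4 < 16 * ‖v‖ ^ 2 → ImmersionAt W (s, v) := by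
    intro s v hv
    have h0 := hne _ hv
    have hv0 : v ≠ 0 := norm_pos_iff.1 h0
    obtain ⟨b, hb, hbd⟩ := hasDerivAt_innerProfile h12 hqp (hαp (s, v) h0) (hqα (s, v) h0) h0 hv
    have hA : ContDiff ℝ ∞ fun w : ℝ × EuclideanSpace ℝ (Fin d) => S.A w.1 w.2 :=
      (S.contDiff_A.comp contDiff_fst).clm_apply contDiff_snd
    have hn : ContDiffAt ℝ ∞ (fun w : ℝ × EuclideanSpace ℝ (Fin d) => ‖w.2‖) (s, v) :=
      contDiffAt_snd.norm ℝ hv0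
    have hαc : ContDiffAt ℝ ∞ α (s, v) :=
      (hA.contDiffAt.norm ℝ (fun h => hv0 (S.A_injective s v h))).div hn h0.ne'
    have hκc : ContDiffAt ℝ ∞ κ (s, v) := by
      have hsq : ContDiffAt ℝ ∞ (fun w : ℝ × EuclideanSpace ℝ (Fin d) => 16 * ‖w.2‖ ^ 2) (s, v) :=
        contDiffAt_const.mul (hn.pow 2)
      have hr1 : ContDiffAt ℝ ∞ (fun w : ℝ × EuclideanSpace ℝ (Fin d) =>
        ramp R₁ R₂ (16 * ‖w.2‖ ^ 2)) (s, v) := (contDiff_ramp R₁ R₂).contDiffAt.comp (s, v) hsq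
      refine ContDiffAt.div ?_ hn h0.ne'
      exact ((contDiffAt_const.sub hr1).mul ((contDiffAt_const.mul
        (hsq.sub contDiffAt_const)).div hαc (hαp (s, v) h0).ne')).add (hr1.mul hn)
    refine immersionAt_radial hκc (hWn (s, v) hv).1.ne' hb.ne' ?_
    have h1 : HasDerivAt (fun τ : ℝ => τ * ‖v‖) ‖v‖ 1 := by
      simpa using (hasDerivAt_id (1 : ℝ)).mul_const ‖v‖
    have h2 : HasDerivAt (fun τ : ℝ => innerProfile q R₁ R₂ (α (s, v)) (τ * ‖v‖) / ‖v‖) b 1 := by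
      have h3 : HasDerivAt (innerProfile q R₁ R₂ (α (s, v))) b (1 * ‖v‖) := by simpa using hbd
      have := (HasDerivAt.comp (1 : ℝ) h3 h1).div_const ‖v‖
      rwa [mul_div_cancel_right₀ _ h0.ne'] at this
    refine h2.congr_of_eventuallyEq ?_
    filter_upwards [lt_mem_nhds (zero_lt_one)] with τ hτ
    simp only [κ, hαs s τ v hτ]
    simp only [norm_smul, Real.norm_of_nonneg hτ.le]
    field_simp
  refine ⟨fun w => G (W (w.1, cubeRep w.2)), η, hη, hη1, hη2, fun s v hv => ?_,
    fun s v hv hv' => ?_, fun w w' hw hw' => ?_, ?_⟩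
  · rcases lt_or_ge (16 * ‖cubeRep v‖ ^ 2) 1 with h | h
    · obtain ⟨l, hl, hlv, hle⟩ := exists_translate (v := v)
        (by nlinarith [norm_nonneg (cubeRep v)]) s
      have h1 := hWcube s v hv
      have h2 : IsotropicImmersionAt Ω G (W (l (s, v))) := by
        rw [hlv]; exact hG1 _ (by rw [h1.1]; exact h1.2)
      have h3 : ImmersionAt W (l (s, v)) := by rw [hlv]; exact hWimm _ _ hv
      refine (IsotropicImmersionAt.comp (l := fun x => W (l x)) h2 (ImmersionAt.comp h3 hl)).congr ?_
      filter_upwards [hle] with w hw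
      rw [hw]
    · have h1 : cubeRep v ≠ 0 := norm_pos_iff.1 (hne _ hv)
      refine (hG1 (s, v) h1).congr ?_
      filter_upwards [eventually_lt_sq_norm_cubeRep (s := s) (hR21.trans_le h),
        eventually_lt_sq_norm_cubeRep (s := s) hv] with w hw hw2
      rw [hWge (w.1, cubeRep w.2) hw.le]
      have : cubeRep w.2 ≠ 0 := norm_pos_iff.1 (hne _ hw2)
      exact (hG3 _ _ (by simpa [cubeRep_cubeRep] using this) this).2
        ⟨⟨0, by simp⟩, cubeRep_cubeRep _⟩
  · have h0 := hne _ hv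
    have hcv : cubeRep v = v := cubeRep_eq_self (by nlinarith)
    have h1 := hWn (s, v) hv
    rw [innerProfile_of_le h12 hv'.le] at h1
    have hA0 : 0 < ‖S.A s v‖ := norm_pos_iff.2 fun h => (norm_pos_iff.1 h0) (S.A_injective s v h)
    have h2 : ‖(W (s, v)).2‖ < δ := by
      rw [h1.2]
      refine lt_of_le_of_lt ?_ hη4
      have : m ≤ α (s, v) := hα (s, v) h0
      gcongr
      linarith
    have h3 := hG2 s (W (s, v)).2 (smul_ne_zero h1.1.ne' (norm_pos_iff.1 h0)) h2
    simp only [hcv]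
    refine Eq.trans h3 ?_
    have h4 : S.A s (W (s, v)).2 = (q * (16 * ‖v‖ ^ 2 - 3 / 4) / ‖S.A s v‖) • S.A s v := by
      simp only [W, map_smul, κ, innerProfile_of_le h12 hv'.le, α]
      congr 1
      field_simp
    have h5 : 0 < q * (16 * ‖v‖ ^ 2 - 3 / 4) := mul_pos hqp (by linarith)
    rw [h4, norm_smul, Real.norm_of_nonneg (by positivity), div_mul_cancel₀ _ hA0.ne', smul_smul]
    congr 3
    rw [show r + c * (q * (16 * ‖v‖ ^ 2 - 3 / 4)) = 4 * r * (16 * ‖v‖ ^ 2 - 1 / 2) by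
      rw [hq]; field_simp; ring]
    rw [div_mul_div_comm, mul_comm (q * _) ‖S.A s v‖, mul_div_mul_right _ _ h5.ne']
  · have h1 := hWcube w.1 w.2 hw
    have h2 := hWcube w'.1 w'.2 hw'
    rw [hG3 _ _ (by rw [h1.1]; exact h1.2) (by rw [h2.1]; exact h2.2), h1.1, h2.1]
    refine and_congr_right fun hk => ⟨fun h => hWinj _ _ _ _ hk hw hw' h, fun h => ?_⟩
    obtain ⟨k, hk⟩ := hk
    have hk' : w'.1 = w.1 + k := hk
    have : S.A (w.1 + k) = S.A w.1 := by
      have := S.A_periodic.int_mul k w.1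
      rwa [mul_one] at this
    simp only [W, κ, α, h, hk', this]
  · rw [← hG4]
    ext z
    constructor
    · rintro ⟨w, hw, rfl⟩
      have h1 := hWcube w.1 w.2 hw
      exact ⟨_, by rw [mem_ofPred_eq, h1.1]; exact h1.2, rfl⟩
    · rintro ⟨w, hw, rfl⟩
      obtain ⟨v, hv1, hv2, hv3⟩ := hWsurj w.1 (cubeRep w.2) (cubeRep_cubeRep _) hw
      refine ⟨(w.1, v), by rw [mem_ofPred_eq, hv1]; exact hv2, ?_⟩
      simp only [hv1, hv3]
      exact (hG3 _ _ (by simpa [cubeRep_cubeRep] using hw) hw).2 ⟨⟨0, by simp⟩, cubeRep_cubeRep _⟩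

end TorusTube

namespace TorusTube

variable {d : ℕ} {V : Type*} [NormedAddCommGroup V] [NormedSpace ℝ V] {Ω : V → V → ℝ}
  (S : TorusTube d Ω)

open Classical in
set_option maxHeartbeats 400000 in
/-- There is a parametrization of the complement in the torus of a closed tube around the loop by
the complement of a ball that near the ball is, up to a radial factor, a prescribed family of
linear maps; the family has to be joined to the transverse linear part of the torus. -/
theorem exists_param {r : ℝ} (hr : 0 < r) (hrε : r < S.ε)
    {M : ℝ × ℝ → EuclideanSpace ℝ (Fin d) →L[ℝ] EuclideanSpace ℝ (Fin d)} (hM : ContDiff ℝ ∞ M)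
    (hMi : ∀ q u, M q u = 0 → u = 0) (hMp : ∀ s τ, M (s + 1, τ) = M (s, τ))
    (hM1 : ∀ s, M (s, 1) = S.A s) :
    ∃ (Q : ℝ × EuclideanSpace ℝ (Fin d) → V) (η : ℝ), 0 < η ∧ η ≤ 1 / 16 ∧ r + 4 * r * η < S.ε ∧
    (∀ s v, 3 / 4 < 16 * ‖cubeRep v‖ ^ 2 → IsotropicImmersionAt Ω Q (s, v)) ∧
    (∀ s v, 3 / 4 < 16 * ‖v‖ ^ 2 → 16 * ‖v‖ ^ 2 < 3 / 4 + η →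
      Q (s, v) = S.T (s, (4 * r * (16 * ‖v‖ ^ 2 - 1 / 2) / ‖M (s, 0) v‖) • M (s, 0) v)) ∧
    (∀ w w' : ℝ × EuclideanSpace ℝ (Fin d), 3 / 4 < 16 * ‖cubeRep w.2‖ ^ 2 →
      3 / 4 < 16 * ‖cubeRep w'.2‖ ^ 2 → (Q w = Q w' ↔
      (∃ k : ℤ, w'.1 = w.1 + k) ∧ cubeRep w.2 = cubeRep w'.2)) ∧
    Q '' {w | 3 / 4 < 16 * ‖cubeRep w.2‖ ^ 2} = range S.C \ S.T '' {p | ‖p.2‖ ≤ r} := by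
  obtain ⟨P, η, hη, hη1, hη2, hP1, hP2, hP3, hP4⟩ := S.exists_annulus hr hrε
  let χ : ℝ → ℝ := ramp (3 / 4 + η / 3) (3 / 4 + 2 * η / 3)
  have hχ12 : 3 / 4 + η / 3 < 3 / 4 + 2 * η / 3 := by linarith
  let N : ℝ → ℝ → EuclideanSpace ℝ (Fin d) →L[ℝ] EuclideanSpace ℝ (Fin d) := fun s R => M (s, χ R)
  have hN : ∀ s R u, N s R u = 0 → u = 0 := fun s R u h => hMi _ u h
  have hNp : ∀ (s : ℝ) (k : ℤ) R, N (s + k) R = N s R := by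
    intro s k R
    have : Function.Periodic (fun s => N s R) 1 := fun s => hMp s _
    have := this.int_mul k s
    rwa [mul_one] at this
  have hAp : ∀ (s : ℝ) (k : ℤ), S.A (s + k) = S.A s := by
    intro s k
    have := S.A_periodic.int_mul k s
    rwa [mul_one] at this
  -- the two families of linear maps, made into bijections between shells
  let pN : ℝ → EuclideanSpace ℝ (Fin d) → EuclideanSpace ℝ (Fin d) := fun s v =>
    (4 * r * (16 * ‖v‖ ^ 2 - 1 / 2) / ‖N s (16 * ‖v‖ ^ 2) v‖) • N s (16 * ‖v‖ ^ 2) v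
  let pA : ℝ → EuclideanSpace ℝ (Fin d) → EuclideanSpace ℝ (Fin d) := fun s v =>
    (4 * r * (16 * ‖v‖ ^ 2 - 1 / 2) / ‖S.A s v‖) • S.A s v
  let Z : Set (EuclideanSpace ℝ (Fin d)) := {v | 3 / 4 < 16 * ‖v‖ ^ 2 ∧ 16 * ‖v‖ ^ 2 < 3 / 4 + η}
  let X : Set (EuclideanSpace ℝ (Fin d)) := {x | r < ‖x‖ ∧ ‖x‖ < 4 * r * (3 / 4 + η - 1 / 2)}
  have hpN : ∀ s, BijOn (pN s) Z X := fun s => bijOn_polar (hN s) hr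
  have hpA : ∀ s, BijOn (pA s) Z X := fun s =>
    bijOn_polar (N := fun _ => S.A s) (fun _ => S.A_injective s) hr
  have hX : ∀ x ∈ X, ‖x‖ < S.ε := by
    rintro x ⟨-, hx⟩
    nlinarith
  have hZc : ∀ v ∈ Z, cubeRep v = v := by
    rintro v ⟨-, hv⟩
    exact cubeRep_eq_self (by nlinarith)
  have hPZ : ∀ s, ∀ v ∈ Z, P (s, v) = S.T (s, pA s v) := fun s v hv => hP2 s v hv.1 hv.2
  let Q : ℝ × EuclideanSpace ℝ (Fin d) → V := fun w =>
    if 16 * ‖cubeRep w.2‖ ^ 2 < 3 / 4 + η then S.T (w.1, pN w.1 (cubeRep w.2)) else P w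
  have hQ1 : ∀ w : ℝ × EuclideanSpace ℝ (Fin d), 16 * ‖cubeRep w.2‖ ^ 2 < 3 / 4 + η → Q w = S.T (w.1, pN w.1 (cubeRep w.2)) :=
    fun w hw => if_pos hw
  have hQ2 : ∀ w : ℝ × EuclideanSpace ℝ (Fin d), ¬ 16 * ‖cubeRep w.2‖ ^ 2 < 3 / 4 + η → Q w = P w := fun w hw => if_neg hw
  clear_value Q
  -- the comparison of `Q` with `P` in the shell
  have hθ : ∀ w : ℝ × EuclideanSpace ℝ (Fin d), cubeRep w.2 ∈ Z → ∃ v ∈ Z, Q w = P (w.1, v) ∧ pA w.1 v = pN w.1 (cubeRep w.2) := by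
    intro w hw
    obtain ⟨v, hv, hve⟩ := (hpA w.1).2.2 ((hpN w.1).1 hw)
    exact ⟨v, hv, by rw [hQ1 w hw.2, hPZ _ _ hv, hve], hve⟩
  have hQ3 : ∀ w : ℝ × EuclideanSpace ℝ (Fin d), 3 / 4 + 2 * η / 3 < 16 * ‖cubeRep w.2‖ ^ 2 → Q w = P w := by
    intro w hw
    by_cases h : 16 * ‖cubeRep w.2‖ ^ 2 < 3 / 4 + η
    · have h1 : cubeRep w.2 ∈ Z := ⟨by linarith, h⟩
      have h2 : pN w.1 (cubeRep w.2) = pA w.1 (cubeRep w.2) := by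
        simp only [pN, pA, N, χ, ramp_of_ge hχ12 hw.le, hM1]
      rw [hQ1 w h, h2, ← hPZ _ _ h1]
      exact (hP3 _ _ (by simpa only [cubeRep_cubeRep] using h1.1) h1.1).2
        ⟨⟨0, by simp⟩, cubeRep_cubeRep _⟩
    · exact hQ2 w h
  refine ⟨Q, η / 3, by linarith, by linarith, by nlinarith, fun s v hv => ?_, fun s v hv hv' => ?_, fun w w' hw hw' => ?_, ?_⟩
  · rcases lt_or_ge (16 * ‖cubeRep v‖ ^ 2) (3 / 4 + η) with h | h
    · obtain ⟨l, hl, hlv, hle⟩ := exists_translate (v := v)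
        (by nlinarith [norm_nonneg (cubeRep v)]) s
      have hv0 : cubeRep v ≠ 0 := by
        intro h0; rw [h0] at hv; norm_num at hv
      have himm : ImmersionAt (fun w : ℝ × EuclideanSpace ℝ (Fin d) => (w.1, pN w.1 w.2))
          (s, cubeRep v) := by
        have h1 : ContDiff ℝ ∞ fun q : ℝ × ℝ => M (q.1, χ (16 * q.2)) :=
          hM.comp (contDiff_fst.prodMk ((contDiff_ramp _ _).comp (contDiff_const.mul contDiff_snd)))
        have h2 : 0 < 4 * r * (16 * ‖cubeRep v‖ ^ 2 - 1 / 2) :=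
          mul_pos (by positivity) (by linarith)
        have h3 : HasDerivAt (fun x : ℝ => 4 * r * (16 * x - 1 / 2)) (4 * r * 16)
            (‖cubeRep v‖ ^ 2) := by
          have := (((hasDerivAt_id (‖cubeRep v‖ ^ 2)).const_mul 16).sub_const (1 / 2)).const_mul
            (4 * r)
          simpa using this
        have h4 := immersionAt_polar (M := fun q : ℝ × ℝ => M (q.1, χ (16 * q.2)))
          (φ := fun x => 4 * r * (16 * x - 1 / 2)) (s := s) h1 (by fun_prop) hv0
          (fun q u hu => hMi _ u hu) h2 (by positivity) h3
        simpa only [pN, N] using h4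
      have h1 : ImmersionAt (fun w : ℝ × EuclideanSpace ℝ (Fin d) => (w.1, pN w.1 w.2)) (l (s, v)) := by
        rw [hlv]; exact himm
      have h2 : ‖pN s (cubeRep v)‖ < S.ε := hX _ ((hpN s).1 ⟨hv, h⟩)
      have h3 : IsotropicImmersionAt Ω S.T ((l (s, v)).1, pN (l (s, v)).1 (l (s, v)).2) := by
        rw [hlv]; exact S.T_iso _ h2
      refine (IsotropicImmersionAt.comp (l := fun x => ((l x).1, pN (l x).1 (l x).2)) h3
        (ImmersionAt.comp h1 hl)).congr ?_
      filter_upwards [hle, eventually_sq_norm_cubeRep_lt (s := s) h] with w hw hw2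
      rw [hQ1 w hw2, hw]
    · refine (hP1 s v hv).congr ?_
      filter_upwards [eventually_lt_sq_norm_cubeRep (s := s)
        (show 3 / 4 + 2 * η / 3 < 16 * ‖cubeRep v‖ ^ 2 by linarith)] with w hw using hQ3 w hw
  · have hvc : cubeRep v = v := hZc v ⟨hv, by linarith⟩
    rw [hQ1 (s, v) (by simp only [hvc]; linarith)]
    simp only [hvc, pN, N, χ, ramp_of_le hχ12 hv'.le]
  · have hwZ : ∀ w : ℝ × EuclideanSpace ℝ (Fin d), 3 / 4 < 16 * ‖cubeRep w.2‖ ^ 2 →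
        16 * ‖cubeRep w.2‖ ^ 2 < 3 / 4 + η → cubeRep w.2 ∈ Z := fun w h1 h2 => ⟨h1, h2⟩
    have mixed : ∀ w w' : ℝ × EuclideanSpace ℝ (Fin d), 3 / 4 < 16 * ‖cubeRep w.2‖ ^ 2 →
        3 / 4 < 16 * ‖cubeRep w'.2‖ ^ 2 → 16 * ‖cubeRep w.2‖ ^ 2 < 3 / 4 + η →
        ¬ 16 * ‖cubeRep w'.2‖ ^ 2 < 3 / 4 + η → Q w ≠ Q w' := by
      intro w w' hw hw' h h' he
      obtain ⟨v, hv, hv1, hv2⟩ := hθ w ⟨hw, h⟩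
      rw [hv1, hQ2 w' h'] at he
      have h1 := ((hP3 _ _ (by simpa only [hZc v hv] using hv.1) hw').1 he).2
      simp only [hZc v hv] at h1
      rw [← h1] at h'
      exact h' hv.2
    by_cases h : 16 * ‖cubeRep w.2‖ ^ 2 < 3 / 4 + η <;>
      by_cases h' : 16 * ‖cubeRep w'.2‖ ^ 2 < 3 / 4 + η
    · have m1 := (hpN w.1).1 (hwZ w hw h)
      have m2 := (hpN w'.1).1 (hwZ w' hw' h')
      rw [hQ1 w h, hQ1 w' h', 
        S.T_eq (w.1, pN w.1 (cubeRep w.2)) (w'.1, pN w'.1 (cubeRep w'.2)) (hX _ m1) (hX _ m2)]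
      refine and_congr_right fun hk => ?_
      obtain ⟨k, hk⟩ := hk
      have e : pN w'.1 = pN w.1 := by
        simp only at hk
        simp only [pN, hk, hNp]
      simp only [e]
      exact ⟨fun he => (hpN w.1).2.1 (hwZ w hw h) (hwZ w' hw' h') he, fun he => by rw [he]⟩
    · refine ⟨fun he => absurd he (mixed w w' hw hw' h h'), fun he => ?_⟩
      rw [he.2] at h; exact absurd h h'
    · refine ⟨fun he => absurd he.symm (mixed w' w hw' hw h' h), fun he => ?_⟩
      rw [he.2] at h; exact absurd h' h
    · rw [hQ2 w h, hQ2 w' h']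
      exact hP3 w w' hw hw'
  · rw [← hP4]
    ext z
    constructor
    · rintro ⟨w, hw, rfl⟩
      by_cases h : 16 * ‖cubeRep w.2‖ ^ 2 < 3 / 4 + η
      · obtain ⟨v, hv, hv1, -⟩ := hθ w ⟨hw, h⟩
        exact ⟨(w.1, v), by simpa only [mem_ofPred_eq, hZc v hv] using hv.1, hv1.symm⟩
      · exact ⟨w, hw, (hQ2 w h).symm⟩
    · rintro ⟨w, hw, rfl⟩
      replace hw : 3 / 4 < 16 * ‖cubeRep w.2‖ ^ 2 := hw
      by_cases h : 16 * ‖cubeRep w.2‖ ^ 2 < 3 / 4 + η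
      · have h1 : cubeRep w.2 ∈ Z := ⟨hw, h⟩
        obtain ⟨v, hv, hve⟩ := (hpN w.1).2.2 ((hpA w.1).1 h1)
        refine ⟨(w.1, v), by simpa only [mem_ofPred_eq, hZc v hv] using hv.1, ?_⟩
        rw [hQ1 (w.1, v) (by simpa only [hZc v hv] using hv.2)]
        simp only [hZc v hv, hve]
        rw [← hPZ _ _ h1]
        exact (hP3 _ _ (by simpa only [cubeRep_cubeRep] using hw) hw).2
          ⟨⟨0, by simp⟩, cubeRep_cubeRep _⟩
      · exact ⟨w, hw, hQ2 w h⟩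

end TorusTube

section

/-! ### The exponential map of the torus -/

section TorusManifold

variable {E H N : Type*} [NormedAddCommGroup E] [NormedSpace ℝ E] [TopologicalSpace H]
  {I : ModelWithCorners ℝ E H} [TopologicalSpace N] [ChartedSpace H N] {d : ℕ}

theorem contMDiffAt_torus {f : N → Torus d} {x : N}
    (h : ∀ k, ContMDiffAt I (𝓡 1) ∞ (fun y => f y k) x) : ContMDiffAt I (torusModel d) ∞ f x := by
  rw [contMDiffAt_iff]
  refine ⟨continuousAt_pi.2 fun k => (h k).continuousAt, ?_⟩
  refine contDiffWithinAt_pi.2 fun k => ?_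
  exact (contMDiffAt_iff.1 (h k)).2

theorem contMDiffAt_torus_apply (k : Fin d) (p : Torus d) :
    ContMDiffAt (torusModel d) (𝓡 1) ∞ (fun q : Torus d => q k) p := by
  rw [contMDiffAt_iff]
  refine ⟨(continuous_apply k).continuousAt, ?_⟩
  have h1 : ContDiffWithinAt ℝ ∞ (fun y : Fin d → EuclideanSpace ℝ (Fin 1) => y k)
    (range (torusModel d)) (extChartAt (torusModel d) p p) :=
    (contDiff_apply ℝ _ k).contDiffWithinAt
  refine h1.congr_of_eventuallyEq ?_ ?_
  · have h2 : (extChartAt (𝓡 1) (p k)).target ∈ 𝓝 (extChartAt (𝓡 1) (p k) (p k)) :=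
      extChartAt_target_mem_nhds (p k)
    have h3 : Continuous fun y : Fin d → EuclideanSpace ℝ (Fin 1) => y k := continuous_apply k
    have h4 := (h3.continuousAt (x := extChartAt (torusModel d) p p)).preimage_mem_nhds
      (show (extChartAt (𝓡 1) (p k)).target ∈ 𝓝 (extChartAt (torusModel d) p p k) from h2)
    refine Filter.Eventually.filter_mono nhdsWithin_le_nhds ?_
    filter_upwards [h4] with y hy
    exact (extChartAt (𝓡 1) (p k)).right_inv hy
  · exact (extChartAt (𝓡 1) (p k)).right_inv (mem_extChartAt_target (p k))

end TorusManifold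

/-- The covering `t ↦ exp (2πit)` of the circle. -/
def circleCover (t : ℝ) : Circle := Circle.exp (2 * Real.pi * t)

theorem circleCover_eq_iff {t t' : ℝ} : circleCover t = circleCover t' ↔ ∃ k : ℤ, t' = t + k := by
  unfold circleCover
  rw [Circle.exp_eq_exp]
  have hp := Real.pi_pos
  constructor
  · rintro ⟨m, hm⟩
    refine ⟨-m, ?_⟩
    have : 2 * Real.pi * (t' - (t + (-m : ℤ))) = 0 := by push_cast; linarith
    have := (mul_eq_zero.1 this).resolve_left (by positivity)
    linarith
  · rintro ⟨k, rfl⟩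
    exact ⟨-k, by push_cast; ring⟩

theorem contMDiff_circleCover : ContMDiff 𝓘(ℝ, ℝ) (𝓡 1) ∞ circleCover :=
  contMDiff_circleExp.comp (contMDiff_const.mul contMDiff_id)

/-- The branch of the inverse of `circleCover` that takes `circleCover t₀` to `t₀`. -/
def circleLog (t₀ : ℝ) (z : Circle) : ℝ :=
  t₀ + (Complex.log (z * ((circleCover t₀)⁻¹ : Circle))).im / (2 * Real.pi)

/-- The domain of the branch `circleLog t₀`. -/
def circleSlit (t₀ : ℝ) : Set Circle :=
  {z | (z : ℂ) * ((circleCover t₀)⁻¹ : Circle) ∈ Complex.slitPlane}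

theorem isOpen_circleSlit (t₀ : ℝ) : IsOpen (circleSlit t₀) :=
  Complex.isOpen_slitPlane.preimage ((continuous_subtype_val (p := fun z : ℂ => z ∈ Submonoid.unitSphere ℂ)).mul continuous_const)

theorem contMDiffOn_circleLog (t₀ : ℝ) :
    ContMDiffOn (𝓡 1) 𝓘(ℝ, ℝ) ∞ (circleLog t₀) (circleSlit t₀) := by
  intro z hz
  have h1 : ContMDiffAt (𝓡 1) 𝓘(ℝ, ℂ) ∞ (fun z : Circle => (z : ℂ)) z := by
    have : Fact (Module.finrank ℝ ℂ = 1 + 1) := finrank_real_complex_fact'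
    exact contMDiff_coe_sphere z
  have h2 : ContDiffAt ℝ ∞ (fun w : ℂ => t₀ + (Complex.log (w * ((circleCover t₀)⁻¹ : Circle))).im /
      (2 * Real.pi)) (z : ℂ) := by
    have h3 : ContDiffAt ℝ ∞ Complex.log ((z : ℂ) * ((circleCover t₀)⁻¹ : Circle)) :=
      (Complex.contDiffAt_log hz).restrict_scalars ℝ
    have h4 : ContDiffAt ℝ ∞ (fun w : ℂ => Complex.log (w * ((circleCover t₀)⁻¹ : Circle))) (z : ℂ) :=
      ContDiffAt.comp (z : ℂ) (f := fun w : ℂ => w * ((circleCover t₀)⁻¹ : Circle)) h3 (by fun_prop)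
    have h5 : ContDiffAt ℝ ∞ (fun w : ℂ => (Complex.log (w * ((circleCover t₀)⁻¹ : Circle))).im) (z : ℂ) :=
      Complex.imCLM.contDiff.contDiffAt.comp (z : ℂ) h4
    exact contDiffAt_const.add (h5.div_const _)
  exact (h2.contMDiffAt.comp z h1).contMDiffWithinAt

theorem circleCover_mul_inv (t t₀ : ℝ) : ((circleCover t : ℂ) * ((circleCover t₀)⁻¹ : Circle)) =
    Complex.exp ((2 * Real.pi * (t - t₀) : ℝ) * Complex.I) := by
  rw [← Circle.coe_mul, ← div_eq_mul_inv]
  simp only [circleCover]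
  rw [← Circle.exp_sub, Circle.coe_exp]
  congr 3; ring

theorem circleLog_circleCover {t₀ t : ℝ} (h : |t - t₀| < 1 / 2) :
    circleLog t₀ (circleCover t) = t ∧ circleCover t ∈ circleSlit t₀ := by
  have hp := Real.pi_pos
  rw [abs_lt] at h
  have h1 : Complex.log ((circleCover t : ℂ) * ((circleCover t₀)⁻¹ : Circle)) =
      (2 * Real.pi * (t - t₀) : ℝ) * Complex.I := by
    rw [circleCover_mul_inv, Complex.log_exp]
    · simp; nlinarith
    · simp; nlinarith
  constructor
  · rw [circleLog, h1]
    simp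
  · rw [circleSlit, mem_ofPred_eq, circleCover_mul_inv, Complex.mem_slitPlane_iff_arg]
    refine ⟨?_, Complex.exp_ne_zero _⟩
    rw [Complex.arg_exp_mul_I, (toIocMod_eq_self _).2]
    · intro h2; nlinarith
    · constructor <;> nlinarith

theorem circleCover_circleLog {t₀ : ℝ} {z : Circle} (h : z ∈ circleSlit t₀) :
    circleCover (circleLog t₀ z) = z ∧ |circleLog t₀ z - t₀| < 1 / 2 := by
  have hp := Real.pi_pos
  have h1 : (Complex.log ((z : ℂ) * ((circleCover t₀)⁻¹ : Circle))).im =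
      Complex.arg ((z * (circleCover t₀)⁻¹ : Circle) : ℂ) := by
    rw [Complex.log_im, Circle.coe_mul]
  have h2 := Complex.mem_slitPlane_iff_arg.1 h
  constructor
  · rw [circleLog, h1]
    have : circleCover (t₀ + Complex.arg ((z * (circleCover t₀)⁻¹ : Circle) : ℂ) / (2 * Real.pi)) =
        circleCover t₀ * Circle.exp (Complex.arg ((z * (circleCover t₀)⁻¹ : Circle) : ℂ)) := by
      simp only [circleCover]
      rw [← Circle.exp_add]
      congr 1
      field_simp
    rw [this, Circle.exp_arg, mul_comm z, mul_inv_cancel_left]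
  · rw [circleLog, h1, add_sub_cancel_left, abs_div, abs_of_pos (by positivity : 0 < 2 * Real.pi),
      div_lt_iff₀ (by positivity), abs_lt]
    have h3 := Complex.neg_pi_lt_arg ((z * (circleCover t₀)⁻¹ : Circle) : ℂ)
    have h4 := lt_of_le_of_ne (Complex.arg_le_pi ((z * (circleCover t₀)⁻¹ : Circle) : ℂ))
      (by rw [Circle.coe_mul]; exact h2.1)
    constructor <;> linarith

variable {d : ℕ}

/-- The covering of the torus by `ℝᵈ`. -/
def torusCover (v : EuclideanSpace ℝ (Fin d)) : Torus d := fun k => circleCover (v k)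

theorem torusCover_eq_iff {v w : EuclideanSpace ℝ (Fin d)} :
    torusCover v = torusCover w ↔ cubeRep v = cubeRep w := by
  rw [cubeRep_eq_iff]
  constructor
  · intro h
    choose k hk using fun i => circleCover_eq_iff.1 (congrFun h i)
    exact ⟨k, by ext i; simp [hk]⟩
  · rintro ⟨k, rfl⟩
    funext i
    exact circleCover_eq_iff.2 ⟨k i, by simp⟩

theorem surjective_circleCover : Function.Surjective circleCover := fun z =>
  ⟨Complex.arg z / (2 * Real.pi), by
    have := Real.pi_pos
    rw [circleCover, mul_div_cancel₀ _ (by positivity), Circle.exp_arg]⟩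

theorem surjective_torusCover : Function.Surjective (torusCover (d := d)) := fun p => by
  choose t ht using fun k => surjective_circleCover (p k)
  exact ⟨WithLp.toLp 2 t, funext ht⟩

theorem isLocalDiffeomorph_torusCover :
    IsLocalDiffeomorph (𝓡 d) (torusModel d) ∞ (torusCover (d := d)) := by
  intro v₀
  let Φ : PartialDiffeomorph (𝓡 d) (torusModel d) (EuclideanSpace ℝ (Fin d)) (Torus d) ∞ :=
    { toFun := torusCover
      invFun := fun p => WithLp.toLp 2 fun k => circleLog (v₀ k) (p k)
      source := {v | ∀ k, |v k - v₀ k| < 1 / 2}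
      target := {p | ∀ k, p k ∈ circleSlit (v₀ k)}
      map_source' := fun v hv k => (circleLog_circleCover (hv k)).2
      map_target' := fun p hp k => (circleCover_circleLog (hp k)).2
      left_inv' := fun v hv => by ext k; exact (circleLog_circleCover (hv k)).1
      right_inv' := fun p hp => funext fun k => (circleCover_circleLog (hp k)).1
      open_source := by
        simp only [ofPred_forall]
        exact isOpen_iInter_of_finite fun k => isOpen_lt (by fun_prop) continuous_const
      open_target := by
        simp only [ofPred_forall]
        exact isOpen_iInter_of_finite fun k =>
          (isOpen_circleSlit (v₀ k)).preimage (continuous_apply k)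
      contMDiffOn_toFun := fun v _ => by
        refine (contMDiffAt_torus fun k => ?_).contMDiffWithinAt
        have h : ContDiffAt ℝ ∞ (fun y : EuclideanSpace ℝ (Fin d) => y k) v := by fun_prop
        exact (contMDiff_circleCover (v k)).comp v h.contMDiffAt
      contMDiffOn_invFun := fun p hp => by
        have h1 : ContMDiffAt (torusModel d) 𝓘(ℝ, Fin d → ℝ) ∞
            (fun p : Torus d => fun k => circleLog (v₀ k) (p k)) p := by
          refine contMDiffAt_pi_space.2 fun k => ?_
          have h2 := (contMDiffOn_circleLog (v₀ k)).contMDiffAt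
            ((isOpen_circleSlit (v₀ k)).mem_nhds (hp k))
          exact ContMDiffAt.comp (g := circleLog (v₀ k)) (f := fun q : Torus d => q k) p h2
            (contMDiffAt_torus_apply k p)
        have h2 : ContDiff ℝ ∞ (fun x : Fin d → ℝ => WithLp.toLp 2 x) :=
          (EuclideanSpace.equiv (Fin d) ℝ).symm.contDiff
        exact (h2.contMDiff.contMDiffAt.comp p h1).contMDiffWithinAt }
  exact ⟨Φ, fun k => by simp, fun v _ => rfl⟩

theorem isLocalDiffeomorph_circleCover :
    IsLocalDiffeomorph 𝓘(ℝ, ℝ) (𝓡 1) ∞ circleCover := by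
  intro t₀
  let Φ : PartialDiffeomorph 𝓘(ℝ, ℝ) (𝓡 1) ℝ Circle ∞ :=
    { toFun := circleCover
      invFun := circleLog t₀
      source := {t | |t - t₀| < 1 / 2}
      target := circleSlit t₀
      map_source' := fun t ht => (circleLog_circleCover ht).2
      map_target' := fun p hp => (circleCover_circleLog hp).2
      left_inv' := fun v hv => (circleLog_circleCover hv).1
      right_inv' := fun p hp => (circleCover_circleLog hp).1
      open_source := isOpen_lt (by fun_prop) continuous_const
      open_target := isOpen_circleSlit t₀
      contMDiffOn_toFun := contMDiff_circleCover.contMDiffOn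
      contMDiffOn_invFun := contMDiffOn_circleLog t₀ }
  exact ⟨Φ, by simp [Φ], fun v _ => rfl⟩

end

section

/-! ### The double torus -/

variable {d : ℕ}

/-- The inversion `w ↦ √(1/(16‖w‖²) - 1) w` of the punctured ball of radius `1/4`; it exchanges the
spheres of radius `ρ` and `ρ'` with `ρ² + ρ'² = 1/16`. -/
def neckInv (w : EuclideanSpace ℝ (Fin d)) : EuclideanSpace ℝ (Fin d) :=
  √(1 / (16 * ‖w‖ ^ 2) - 1) • w

/-- The points `x`, `y` of the punctured ball of radius `1/4` are exchanged by the inversion. In this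
form the relation is symmetric and closed. -/
def NeckRel (x y : EuclideanSpace ℝ (Fin d)) : Prop :=
  ‖x‖ ^ 2 + ‖y‖ ^ 2 = 1 / 16 ∧ ‖x‖ • y = ‖y‖ • x

theorem NeckRel.symm {x y : EuclideanSpace ℝ (Fin d)} (h : NeckRel x y) : NeckRel y x :=
  ⟨by rw [add_comm]; exact h.1, h.2.symm⟩

theorem NeckRel.norm_lt {x y : EuclideanSpace ℝ (Fin d)} (h : NeckRel x y) (hy : y ≠ 0) :
    ‖x‖ < 1 / 4 := by
  have h1 := h.1
  have : 0 < ‖y‖ := norm_pos_iff.2 hy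
  nlinarith [norm_nonneg x]

theorem NeckRel.eq {x y y' : EuclideanSpace ℝ (Fin d)} (h : NeckRel x y) (h' : NeckRel x y')
    (hx : x ≠ 0) : y = y' := by
  have h1 : ‖y‖ = ‖y'‖ := by
    have : ‖y‖ ^ 2 = ‖y'‖ ^ 2 := by linarith [h.1, h'.1]
    exact (sq_eq_sq₀ (norm_nonneg _) (norm_nonneg _)).1 this
  have h2 : ‖x‖ • y = ‖x‖ • y' := by rw [h.2, h'.2, h1]
  exact smul_right_injective _ (norm_ne_zero_iff.2 hx) h2

theorem neckRel_neckInv {x : EuclideanSpace ℝ (Fin d)} (hx : x ≠ 0) (hx4 : ‖x‖ < 1 / 4) :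
    NeckRel x (neckInv x) ∧ neckInv x ≠ 0 ∧ ‖neckInv x‖ ^ 2 = 1 / 16 - ‖x‖ ^ 2 := by
  have h0 : 0 < ‖x‖ := norm_pos_iff.2 hx
  have h1 : 0 < 1 / (16 * ‖x‖ ^ 2) - 1 := by
    rw [sub_pos, lt_div_iff₀ (by positivity)]; nlinarith
  have h2 : 0 < √(1 / (16 * ‖x‖ ^ 2) - 1) := Real.sqrt_pos.2 h1
  have h3 : ‖neckInv x‖ = √(1 / (16 * ‖x‖ ^ 2) - 1) * ‖x‖ := by
    rw [neckInv, norm_smul, Real.norm_of_nonneg h2.le]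
  have h4 : ‖neckInv x‖ ^ 2 = 1 / 16 - ‖x‖ ^ 2 := by
    rw [h3, mul_pow, Real.sq_sqrt h1.le]
    field_simp
  refine ⟨⟨by rw [h4]; ring, ?_⟩, smul_ne_zero h2.ne' hx, h4⟩
  rw [h3, neckInv, smul_smul, mul_comm]

theorem neckRel_iff {x y : EuclideanSpace ℝ (Fin d)} (hx : x ≠ 0) (hy : y ≠ 0) :
    NeckRel x y ↔ ‖x‖ < 1 / 4 ∧ y = neckInv x :=
  ⟨fun h => ⟨h.norm_lt hy, h.eq (neckRel_neckInv hx (h.norm_lt hy)).1 hx⟩,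
    fun h => h.2 ▸ (neckRel_neckInv hx h.1).1⟩

theorem neckInv_lt {x : EuclideanSpace ℝ (Fin d)} (hx : x ≠ 0) (hx4 : ‖x‖ < 1 / 4) :
    ‖neckInv x‖ < 1 / 4 := ((neckRel_neckInv hx hx4).1.symm).norm_lt hx

theorem neckInv_neckInv {x : EuclideanSpace ℝ (Fin d)} (hx : x ≠ 0) (hx4 : ‖x‖ < 1 / 4) :
    neckInv (neckInv x) = x := by
  have h := neckRel_neckInv hx hx4
  exact ((neckRel_iff h.2.1 hx).1 h.1.symm).2.symm

theorem immersionAt_neckInv {x : EuclideanSpace ℝ (Fin d)} (hx : x ≠ 0) (hx4 : ‖x‖ < 1 / 4) :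
    ImmersionAt (neckInv (d := d)) x := by
  have hs : ∀ x : EuclideanSpace ℝ (Fin d), x ≠ 0 → ‖x‖ < 1 / 4 → ContDiffAt ℝ ∞ (neckInv (d := d)) x := by
    intro x hx hx4
    have h0 : 0 < ‖x‖ := norm_pos_iff.2 hx
    have h1 : 0 < 1 / (16 * ‖x‖ ^ 2) - 1 := by
      rw [sub_pos, lt_div_iff₀ (by positivity)]; nlinarith
    have h2 : ContDiffAt ℝ ∞ (fun x : EuclideanSpace ℝ (Fin d) => 1 / (16 * ‖x‖ ^ 2) - 1) x :=
      (contDiffAt_const.div (contDiffAt_const.mul (contDiffAt_id.norm_sq ℝ)) (by positivity)).sub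
        contDiffAt_const
    exact (h2.sqrt h1.ne').smul contDiffAt_id
  have hn := neckRel_neckInv hx hx4
  refine ImmersionAt.of_comp (hs _ hn.2.1 (neckInv_lt hx hx4)) (hs x hx hx4) ?_
  have : (fun y => neckInv (neckInv y)) =ᶠ[𝓝 x] fun y : EuclideanSpace ℝ (Fin d) => y := by
    filter_upwards [isOpen_ne.mem_nhds hx, (continuous_norm.continuousAt).eventually
      (gt_mem_nhds hx4)] with y h1 h2 using neckInv_neckInv h1 h2
  rw [this.fderiv_eq, fderiv_fun_id]
  exact fun a b h => h

/-- Two copies of `ℝᵈ` without the integer lattice. -/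
abbrev PuncturedPair (d : ℕ) : Type :=
  Bool × {v : EuclideanSpace ℝ (Fin d) // cubeRep v ≠ 0}

/-- Points of `PuncturedPair d` that are identified in the double torus: in the same copy they
differ by a lattice vector, in different copies they correspond under the inversion. -/
def GlueRel (i : Bool) (v : EuclideanSpace ℝ (Fin d)) (j : Bool) (w : EuclideanSpace ℝ (Fin d)) :
    Prop :=
  (i = j ∧ cubeRep v = cubeRep w) ∨ (i ≠ j ∧ NeckRel (cubeRep v) (cubeRep w))

/-- The equivalence relation that defines the double torus. -/
def glueSetoid (d : ℕ) : Setoid (PuncturedPair d) where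
  r x y := GlueRel x.1 x.2.1 y.1 y.2.1
  iseqv :=
    { refl := fun x => Or.inl ⟨rfl, rfl⟩
      symm := by
        rintro x y (⟨h1, h2⟩ | ⟨h1, h2⟩)
        · exact Or.inl ⟨h1.symm, h2.symm⟩
        · exact Or.inr ⟨h1.symm, h2.symm⟩
      trans := by
        rintro x y z (⟨h1, h2⟩ | ⟨h1, h2⟩) (⟨h3, h4⟩ | ⟨h3, h4⟩)
        · exact Or.inl ⟨h1.trans h3, h2.trans h4⟩
        · exact Or.inr ⟨h1 ▸ h3, h2 ▸ h4⟩
        · exact Or.inr ⟨h3 ▸ h1, h4 ▸ h2⟩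
        · refine Or.inl ⟨?_, h2.symm.eq h4 y.2.2⟩
          revert h1 h3
          cases x.1 <;> cases y.1 <;> cases z.1 <;> simp }

/-- The connected sum of two copies of `𝕋ᵈ`: two copies of the torus without a point, glued along
the punctured balls of radius `1/4` by the inversion. -/
def DoubleTorus (d : ℕ) : Type := Quotient (glueSetoid d)

instance : TopologicalSpace (DoubleTorus d) := inferInstanceAs (TopologicalSpace (Quotient _))

theorem eventually_cubeRep_ne {v : EuclideanSpace ℝ (Fin d)} (hv : cubeRep v ≠ 0) :
    ∀ᶠ w in 𝓝 v, cubeRep w ≠ 0 := by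
  have h1 := (continuous_norm_cubeRep (d := d)).continuousAt (x := v)
  filter_upwards [h1.eventually (lt_mem_nhds (norm_pos_iff.2 hv))] with w hw
  exact norm_pos_iff.1 hw

theorem isOpen_cubeRep_ne : IsOpen {v : EuclideanSpace ℝ (Fin d) | cubeRep v ≠ 0} :=
  isOpen_iff_mem_nhds.2 fun _ hv => eventually_cubeRep_ne hv

section

variable [NeZero d]

theorem cubeRep_single_ne : cubeRep (EuclideanSpace.single (0 : Fin d) (1 / 4 : ℝ)) ≠ 0 := by
  have : ‖EuclideanSpace.single (0 : Fin d) (1 / 4 : ℝ)‖ = 1 / 4 := by simp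
  rw [cubeRep_eq_self (by rw [this]; norm_num), ← norm_ne_zero_iff, this]
  norm_num

open Classical in
/-- The covering map of one of the two halves of the double torus; the value at a lattice vector
has no meaning. -/
def patch (i : Bool) (v : EuclideanSpace ℝ (Fin d)) : DoubleTorus d :=
  Quotient.mk (glueSetoid d) (i, if h : cubeRep v ≠ 0 then ⟨v, h⟩ else ⟨_, cubeRep_single_ne⟩)

theorem patch_eq_mk (i : Bool) (v : {v : EuclideanSpace ℝ (Fin d) // cubeRep v ≠ 0}) :
    patch i v.1 = Quotient.mk (glueSetoid d) (i, v) := by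
  rw [patch, dif_pos v.2]

theorem patch_eq_iff {i j : Bool} {v w : EuclideanSpace ℝ (Fin d)} (hv : cubeRep v ≠ 0)
    (hw : cubeRep w ≠ 0) : patch i v = patch j w ↔ GlueRel i v j w := by
  rw [patch_eq_mk i ⟨v, hv⟩, patch_eq_mk j ⟨w, hw⟩]
  exact Quotient.eq (r := glueSetoid d)

theorem exists_patch (p : DoubleTorus d) : ∃ i v, cubeRep v ≠ 0 ∧ patch i v = p := by
  obtain ⟨⟨i, v⟩, rfl⟩ := Quotient.exists_rep p
  exact ⟨i, v.1, v.2, patch_eq_mk i v⟩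

theorem patch_eq_patch_same {i : Bool} {v w : EuclideanSpace ℝ (Fin d)} (hv : cubeRep v ≠ 0)
    (hw : cubeRep w ≠ 0) : patch i v = patch i w ↔ cubeRep v = cubeRep w := by
  rw [patch_eq_iff hv hw]; simp [GlueRel]

theorem patch_eq_patch_not {i : Bool} {v w : EuclideanSpace ℝ (Fin d)} (hv : cubeRep v ≠ 0)
    (hw : cubeRep w ≠ 0) : patch i v = patch (!i) w ↔ NeckRel (cubeRep v) (cubeRep w) := by
  rw [patch_eq_iff hv hw]; simp [GlueRel]

/-- Two points of the covering over the same point of the double torus are related by a local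
diffeomorphism over the double torus. -/
theorem exists_transition {i j : Bool} {v w : EuclideanSpace ℝ (Fin d)} (hv : cubeRep v ≠ 0)
    (hw : cubeRep w ≠ 0) (h : patch i v = patch j w) :
    ∃ L : EuclideanSpace ℝ (Fin d) → EuclideanSpace ℝ (Fin d), ImmersionAt L v ∧ L v = w ∧
      ∀ᶠ x in 𝓝 v, cubeRep x ≠ 0 ∧ cubeRep (L x) ≠ 0 ∧ patch i x = patch j (L x) := by
  rcases (patch_eq_iff hv hw).1 h with ⟨rfl, h'⟩ | ⟨hij, h⟩
  · obtain ⟨k, rfl⟩ := cubeRep_eq_iff.1 h'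
    refine ⟨fun x => x + latticeVec k, immersionAt_add_const _ _, rfl, ?_⟩
    filter_upwards [eventually_cubeRep_ne hv] with x hx
    have hx' : cubeRep (x + latticeVec k) ≠ 0 := by rwa [cubeRep_add_latticeVec]
    exact ⟨hx, hx', (patch_eq_patch_same hx hx').2 (cubeRep_add_latticeVec x k).symm⟩
  · obtain ⟨h4, hwv⟩ := (neckRel_iff hv hw).1 h
    have hj : j = !i := by revert hij; cases i <;> cases j <;> simp
    subst hj
    have e1 : ∀ᶠ x in 𝓝 v, cubeRep x = x + (cubeRep v - v) := by
      have := (continuous_const.prodMk continuous_id).continuousAt.eventually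
        (eventually_cubeRep_add (v₀ := v) (by linarith) 0)
      filter_upwards [this] with x hx
      simpa using congrArg Prod.snd hx
    obtain ⟨k, hk⟩ : ∃ k, w - cubeRep w = latticeVec k := by
      obtain ⟨k, hk⟩ := cubeRep_eq_iff.1 (cubeRep_cubeRep w)
      exact ⟨k, by rw [sub_eq_iff_eq_add, add_comm]; exact hk⟩
    refine ⟨fun x => neckInv (x + (cubeRep v - v)) + latticeVec k, ?_, ?_, ?_⟩
    · have h1 : ImmersionAt (neckInv (d := d)) (v + (cubeRep v - v)) := by
        rw [add_sub_cancel]; exact immersionAt_neckInv hv h4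
      exact ImmersionAt.comp (g := fun y => y + latticeVec k) (immersionAt_add_const _ _)
        (ImmersionAt.comp h1 (immersionAt_add_const _ _))
    · simp only [add_sub_cancel]
      rw [← hwv, ← hk, add_sub_cancel]
    · have e2 : ∀ᶠ x in 𝓝 v, ‖cubeRep x‖ < 1 / 4 :=
        (continuous_norm_cubeRep (d := d)).continuousAt.eventually (gt_mem_nhds h4)
      filter_upwards [e1, e2, eventually_cubeRep_ne hv] with x h1 h2 h3
      rw [← h1]
      have h5 := neckRel_neckInv h3 h2
      have h6 : cubeRep (neckInv (cubeRep x) + latticeVec k) = neckInv (cubeRep x) := by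
        rw [cubeRep_add_latticeVec]
        exact cubeRep_eq_self ((neckInv_lt h3 h2).trans (by norm_num))
      refine ⟨h3, by rw [h6]; exact h5.2.1, (patch_eq_patch_not h3 (by rw [h6]; exact h5.2.1)).2 ?_⟩
      rw [h6]; exact h5.1

/-- The projection to the double torus is open, since the identifications are made by local
diffeomorphisms. -/
theorem isOpenQuotientMap_mk : IsOpenQuotientMap (Quotient.mk (glueSetoid d)) := by
  refine ⟨Quotient.mk_surjective, continuous_quotient_mk', ?_⟩
  intro U hU
  change IsOpen (Quotient.mk (glueSetoid d) ⁻¹' (Quotient.mk (glueSetoid d) '' U))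
  rw [isOpen_iff_mem_nhds]
  rintro ⟨i, v, hv⟩ ⟨⟨j, w, hw⟩, hU', he⟩
  have h1 : patch i v = patch j w := by
    rw [patch_eq_mk i ⟨v, hv⟩, patch_eq_mk j ⟨w, hw⟩]; exact he.symm
  obtain ⟨L, hL, hLv, hL2⟩ := exists_transition hv hw h1
  have h2 : {y | ∃ hy : cubeRep y ≠ 0, (j, (⟨y, hy⟩ : {v // cubeRep v ≠ 0})) ∈ U} ∈ 𝓝 w := by
    have h3 : {y : {v : EuclideanSpace ℝ (Fin d) // cubeRep v ≠ 0} | (j, y) ∈ U} ∈ 𝓝 (⟨w, hw⟩ : {v : EuclideanSpace ℝ (Fin d) // cubeRep v ≠ 0}) :=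
      (hU.preimage (Continuous.prodMk_right j)).mem_nhds hU'
    rw [nhds_subtype_eq_comap, mem_comap] at h3
    obtain ⟨t, ht, hts⟩ := h3
    filter_upwards [ht, eventually_cubeRep_ne hw] with y hy hy2
    exact ⟨hy2, hts (a := ⟨y, hy2⟩) hy⟩
  have h4 := hL.1.continuousAt.preimage_mem_nhds (hLv.symm ▸ h2)
  have h5 : ∀ᶠ x : PuncturedPair d in 𝓝 (i, ⟨v, hv⟩), x.1 = i ∧ x.2.1 ∈ L ⁻¹' {y | ∃ hy : cubeRep y ≠ 0, (j, (⟨y, hy⟩ : {v // cubeRep v ≠ 0})) ∈ U} ∧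
      patch i x.2.1 = patch j (L x.2.1) := by
    have c1 : Continuous fun x : PuncturedPair d => x.2.1 := continuous_subtype_val.comp continuous_snd
    have c2 : Continuous fun x : PuncturedPair d => x.1 := continuous_fst
    have h6 : ∀ᶠ x : PuncturedPair d in 𝓝 (i, ⟨v, hv⟩), x.1 = i :=
      c2.continuousAt.eventually ((isOpen_discrete ({i} : Set Bool)).mem_nhds (mem_singleton i))
    filter_upwards [h6, c1.continuousAt.eventually h4, c1.continuousAt.eventually hL2] with x a b c
    exact ⟨a, b, c.2.2⟩
  filter_upwards [h5]
  rintro ⟨i', x, hx⟩ ⟨rfl, ⟨hy, hyU⟩, h7⟩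
  refine ⟨_, hyU, ?_⟩
  rw [← patch_eq_mk, ← patch_eq_mk]
  exact h7.symm

theorem continuousOn_patch (i : Bool) : ContinuousOn (patch (d := d) i) {v | cubeRep v ≠ 0} := by
  rw [continuousOn_iff_continuous_domRestrict]
  have : ({v : EuclideanSpace ℝ (Fin d) | cubeRep v ≠ 0}.domRestrict (patch i)) =
      fun v : {v : EuclideanSpace ℝ (Fin d) // cubeRep v ≠ 0} => Quotient.mk (glueSetoid d) (i, v) :=
    funext fun v => patch_eq_mk i v
  rw [this]
  exact isOpenQuotientMap_mk.continuous.comp (Continuous.prodMk_right i)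

theorem isOpen_image_patch (i : Bool) {U : Set (EuclideanSpace ℝ (Fin d))} (hU : IsOpen U)
    (hU0 : U ⊆ {v | cubeRep v ≠ 0}) : IsOpen (patch i '' U) := by
  have h1 : patch i '' U = Quotient.mk (glueSetoid d) '' {x | x.1 = i ∧ x.2.1 ∈ U} := by
    ext p
    constructor
    · rintro ⟨v, hv, rfl⟩
      exact ⟨(i, ⟨v, hU0 hv⟩), ⟨rfl, hv⟩, (patch_eq_mk i ⟨v, hU0 hv⟩).symm⟩
    · rintro ⟨⟨j, v⟩, ⟨rfl, hv⟩, rfl⟩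
      exact ⟨v.1, hv, patch_eq_mk _ v⟩
  rw [h1]
  refine isOpenQuotientMap_mk.isOpenMap _ (IsOpen.inter ?_ ?_)
  · exact (isOpen_discrete {i}).preimage continuous_fst
  · exact hU.preimage (continuous_subtype_val.comp continuous_snd)

theorem injOn_patch (i : Bool) (v : EuclideanSpace ℝ (Fin d)) :
    InjOn (patch i) (Metric.ball v (1 / 4) ∩ {v | cubeRep v ≠ 0}) := by
  rintro x ⟨hx, hx0⟩ y ⟨hy, hy0⟩ h
  obtain ⟨k, rfl⟩ := cubeRep_eq_iff.1 ((patch_eq_patch_same hx0 hy0).1 h)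
  have h1 : ‖latticeVec k‖ < 1 / 2 := by
    have : latticeVec k = (x + latticeVec k - v) - (x - v) := by abel
    rw [this]
    rw [mem_ball_iff_norm] at hx hy
    exact (norm_sub_le _ _).trans_lt (by linarith)
  have h2 : cubeRep (latticeVec k) = 0 := by
    have := cubeRep_add_latticeVec (0 : EuclideanSpace ℝ (Fin d)) k
    rwa [zero_add, cubeRep_zero] at this
  rw [cubeRep_eq_self h1] at h2
  rw [h2, add_zero]

/-- The local parametrization of the double torus by a ball without lattice vectors. -/
def patchHomeo (i : Bool) (v : EuclideanSpace ℝ (Fin d)) :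
    OpenPartialHomeomorph (EuclideanSpace ℝ (Fin d)) (DoubleTorus d) :=
  OpenPartialHomeomorph.ofContinuousOpenRestrict (injOn_patch i v).toPartialEquiv
    ((continuousOn_patch i).mono inter_subset_right)
    (by
      intro U hU
      obtain ⟨t, ht, rfl⟩ := isOpen_induced_iff.1 hU
      have h1 := isOpen_image_patch i (ht.inter (Metric.isOpen_ball.inter isOpen_cubeRep_ne))
        (fun x hx => hx.2.2) (U := t ∩ (Metric.ball v (1 / 4) ∩ {v | cubeRep v ≠ 0}))
      convert h1 using 1
      ext p
      constructor
      · rintro ⟨⟨x, hx⟩, hxt, rfl⟩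
        exact ⟨x, ⟨hxt, hx⟩, rfl⟩
      · rintro ⟨x, ⟨hxt, hx⟩, rfl⟩
        exact ⟨⟨x, hx⟩, hxt, rfl⟩)
    (Metric.isOpen_ball.inter isOpen_cubeRep_ne)

theorem patchHomeo_coe (i : Bool) (v : EuclideanSpace ℝ (Fin d)) :
    ⇑(patchHomeo i v) = patch i := rfl

instance : ChartedSpace (EuclideanSpace ℝ (Fin d)) (DoubleTorus d) where
  atlas := {e | ∃ i v, cubeRep v ≠ 0 ∧ e = (patchHomeo i v).symm}
  chartAt p := (patchHomeo (exists_patch p).choose (exists_patch p).choose_spec.choose).symm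
  mem_chart_source p := by
    have h := (exists_patch p).choose_spec.choose_spec
    set i := (exists_patch p).choose
    set v := (exists_patch p).choose_spec.choose
    have h1 := (patchHomeo i v).map_source (x := v) ⟨Metric.mem_ball_self (by norm_num), h.1⟩
    rw [OpenPartialHomeomorph.symm_source]
    rwa [patchHomeo_coe, h.2] at h1
  chart_mem_atlas p := ⟨_, _, (exists_patch p).choose_spec.choose_spec.1, rfl⟩

instance : IsManifold (𝓡 d) ∞ (DoubleTorus d) := by
  refine isManifold_of_contDiffOn _ _ _ ?_
  rintro _ _ ⟨i, v, hv, rfl⟩ ⟨j, w, hw, rfl⟩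
  simp only [modelWithCornersSelf_coe, modelWithCornersSelf_coe_symm, Function.id_comp,
    Function.comp_id, preimage_id, range_id, inter_univ, OpenPartialHomeomorph.symm_symm]
  intro x hx
  have hx1 : x ∈ (patchHomeo i v).source := by
    have := hx.1; simpa using this
  have hx2 : patch i x ∈ (patchHomeo j w).target := by
    have := hx.2; simpa [patchHomeo_coe] using this
  set y := (patchHomeo j w).symm (patch i x) with hy
  have hy1 : y ∈ (patchHomeo j w).source := (patchHomeo j w).map_target hx2
  have hy2 : patch j y = patch i x := (patchHomeo j w).right_inv hx2
  obtain ⟨L, hL, hLx, hL2⟩ := exists_transition hx1.2 hy1.2 hy2.symm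
  refine (hL.1.congr_of_eventuallyEq ?_).contDiffWithinAt
  have h3 := hL.1.continuousAt.preimage_mem_nhds
    (hLx.symm ▸ (patchHomeo j w).open_source.mem_nhds hy1)
  filter_upwards [h3, hL2] with z hz hz2
  change (patchHomeo j w).symm (patch i z) = L z
  rw [hz2.2.2]
  exact (patchHomeo j w).left_inv hz

theorem isLocalDiffeomorphAt_patch (i : Bool) {v : EuclideanSpace ℝ (Fin d)} (hv : cubeRep v ≠ 0) :
    IsLocalDiffeomorphAt (𝓡 d) (𝓡 d) ∞ (patch i) v := by
  have hmem : (patchHomeo i v).symm ∈ IsManifold.maximalAtlas (𝓡 d) ∞ (DoubleTorus d) :=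
    IsManifold.subset_maximalAtlas ⟨i, v, hv, rfl⟩
  let Φ : PartialDiffeomorph (𝓡 d) (𝓡 d) (EuclideanSpace ℝ (Fin d)) (DoubleTorus d) ∞ :=
    { toPartialEquiv := (patchHomeo i v).toPartialEquiv
      open_source := (patchHomeo i v).open_source
      open_target := (patchHomeo i v).open_target
      contMDiffOn_toFun := contMDiffOn_symm_of_mem_maximalAtlas hmem
      contMDiffOn_invFun := contMDiffOn_of_mem_maximalAtlas hmem }
  exact ⟨Φ, ⟨Metric.mem_ball_self (by norm_num), hv⟩, fun x _ => rfl⟩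

end

end

section

/-! ### The double torus as a connected sum -/

variable {d : ℕ}

section LocalDiffeo

variable {E F H₁ H₂ M N : Type*} [NormedAddCommGroup E] [NormedSpace ℝ E] [NormedAddCommGroup F]
  [NormedSpace ℝ F] [TopologicalSpace H₁] [TopologicalSpace H₂] {I : ModelWithCorners ℝ E H₁}
  {J : ModelWithCorners ℝ F H₂} [TopologicalSpace M] [ChartedSpace H₁ M] [TopologicalSpace N]
  [ChartedSpace H₂ N]

theorem IsLocalDiffeomorphAt.congr_of_eventuallyEq {f g : M → N} {x : M}
    (hf : IsLocalDiffeomorphAt I J ∞ f x) (h : g =ᶠ[𝓝 x] f) : IsLocalDiffeomorphAt I J ∞ g x := by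
  obtain ⟨Φ, hx, hΦ⟩ := hf
  obtain ⟨U, hU, hUo, hxU⟩ := mem_nhds_iff.1 h
  let Ψ := Φ.toOpenPartialHomeomorph.restrOpen U hUo
  have hs : Ψ.source = Φ.source ∩ U := rfl
  let Φ' : PartialDiffeomorph I J M N ∞ :=
    { toPartialEquiv := Ψ.toPartialEquiv
      open_source := Ψ.open_source
      open_target := Ψ.open_target
      contMDiffOn_toFun := Φ.contMDiffOn_toFun.mono fun y hy => (hs ▸ hy : y ∈ Φ.source ∩ U).1
      contMDiffOn_invFun := Φ.contMDiffOn_invFun.mono fun y hy => hy.1 }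
  refine ⟨Φ', ⟨hx, hxU⟩, fun y hy => ?_⟩
  exact (hU (show y ∈ Φ.source ∩ U from hy).2).trans (hΦ (show y ∈ Φ.source ∩ U from hy).1)

end LocalDiffeo

theorem cubeRep_eq_iff_norm_sub {v w : EuclideanSpace ℝ (Fin d)} :
    cubeRep v = cubeRep w ↔ ‖cubeRep (w - v)‖ = 0 := by
  rw [norm_eq_zero, cubeRep_eq_zero_iff, cubeRep_eq_iff]
  exact exists_congr fun k => by rw [sub_eq_iff_eq_add, add_comm]

/-- The gluing relation is closed because the inversion takes points near the center to points near
the sphere of radius `1/4`. Hence the double torus is Hausdorff. -/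
theorem isClosed_glueRel : IsClosed {q : PuncturedPair d × PuncturedPair d |
    GlueRel q.1.1 q.1.2.1 q.2.1 q.2.2.1} := by
  have c1 : Continuous fun q : PuncturedPair d × PuncturedPair d => q.1.2.1 :=
    continuous_subtype_val.comp (continuous_snd.comp continuous_fst)
  have c2 : Continuous fun q : PuncturedPair d × PuncturedPair d => q.2.2.1 :=
    continuous_subtype_val.comp (continuous_snd.comp continuous_snd)
  have hA : IsClopen {q : PuncturedPair d × PuncturedPair d | q.1.1 = q.2.1} := by
    have : Continuous fun q : PuncturedPair d × PuncturedPair d => (q.1.1, q.2.1) := by fun_prop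
    exact (isClopen_discrete {b : Bool × Bool | b.1 = b.2}).preimage this
  have hB : IsClosed {q : PuncturedPair d × PuncturedPair d |
      cubeRep q.1.2.1 = cubeRep q.2.2.1} := by
    simp only [cubeRep_eq_iff_norm_sub]
    exact isClosed_eq (continuous_norm_cubeRep.comp (c2.sub c1)) continuous_const
  have hC : IsClosed {q : PuncturedPair d × PuncturedPair d |
      NeckRel (cubeRep q.1.2.1) (cubeRep q.2.2.1)} := by
    have n1 := continuous_norm_cubeRep.comp c1
    have n2 := continuous_norm_cubeRep.comp c2
    have h1 : IsClosed {q : PuncturedPair d × PuncturedPair d |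
        ‖cubeRep q.1.2.1‖ ^ 2 + ‖cubeRep q.2.2.1‖ ^ 2 = 1 / 16} :=
      isClosed_eq ((n1.pow 2).add (n2.pow 2)) continuous_const
    have hcube : ∀ v : EuclideanSpace ℝ (Fin d), ‖cubeRep v‖ < 1 / 2 →
        ContinuousAt (cubeRep (d := d)) v := by
      intro v hv
      have e1 : (fun x => cubeRep x) =ᶠ[𝓝 v] fun x => x + (cubeRep v - v) := by
        have := (continuous_const.prodMk continuous_id).continuousAt.eventually
          (eventually_cubeRep_add (v₀ := v) hv 0)
        filter_upwards [this] with x hx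
        simpa using congrArg Prod.snd hx
      exact ContinuousAt.congr (f := fun x => x + (cubeRep v - v)) (by fun_prop) e1.symm
    have h2 : ContinuousOn (fun q : PuncturedPair d × PuncturedPair d =>
        ‖cubeRep q.1.2.1‖ • cubeRep q.2.2.1 - ‖cubeRep q.2.2.1‖ • cubeRep q.1.2.1)
        {q | ‖cubeRep q.1.2.1‖ ^ 2 + ‖cubeRep q.2.2.1‖ ^ 2 = 1 / 16} := by
      intro q hq
      have hq' : ‖cubeRep q.1.2.1‖ ^ 2 + ‖cubeRep q.2.2.1‖ ^ 2 = 1 / 16 := hq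
      have l1 : ‖cubeRep q.1.2.1‖ < 1 / 2 := by nlinarith
      have l2 : ‖cubeRep q.2.2.1‖ < 1 / 2 := by nlinarith
      have k1 : ContinuousAt (fun q : PuncturedPair d × PuncturedPair d => cubeRep q.1.2.1) q :=
        ContinuousAt.comp (f := fun q : PuncturedPair d × PuncturedPair d => q.1.2.1)
          (hcube _ l1) c1.continuousAt
      have k2 : ContinuousAt (fun q : PuncturedPair d × PuncturedPair d => cubeRep q.2.2.1) q :=
        ContinuousAt.comp (f := fun q : PuncturedPair d × PuncturedPair d => q.2.2.1)
          (hcube _ l2) c2.continuousAt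
      exact ((k1.norm.smul k2).sub (k2.norm.smul k1)).continuousWithinAt
    have h3 := h2.preimage_isClosed_of_isClosed h1 (isClosed_singleton (x := 0))
    convert h3 using 1
    ext q
    simp only [NeckRel, mem_ofPred_eq, mem_inter_iff, mem_preimage, mem_singleton_iff, sub_eq_zero]
  have : {q : PuncturedPair d × PuncturedPair d | GlueRel q.1.1 q.1.2.1 q.2.1 q.2.2.1} =
      ({q | q.1.1 = q.2.1} ∩ {q | cubeRep q.1.2.1 = cubeRep q.2.2.1}) ∪
      ({q | q.1.1 = q.2.1}ᶜ ∩ {q | NeckRel (cubeRep q.1.2.1) (cubeRep q.2.2.1)}) := rfl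
  rw [this]
  exact (hA.1.inter hB).union (hA.compl.1.inter hC)

/-- The embedded disc that is removed from the torus. -/
def torusDisc (v : EuclideanSpace ℝ (Fin d)) : Torus d :=
  torusCover (OpenPartialHomeomorph.univBall (0 : EuclideanSpace ℝ (Fin d)) (1 / 4) v)

theorem univBall_lt (v : EuclideanSpace ℝ (Fin d)) :
    ‖OpenPartialHomeomorph.univBall (0 : EuclideanSpace ℝ (Fin d)) (1 / 4) v‖ < 1 / 4 := by
  have h := (OpenPartialHomeomorph.univBall (0 : EuclideanSpace ℝ (Fin d)) (1 / 4)).map_source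
    (x := v) (by simp)
  rw [OpenPartialHomeomorph.univBall_target _ (by norm_num)] at h
  simpa using h

theorem univBall_apply (v : EuclideanSpace ℝ (Fin d)) :
    OpenPartialHomeomorph.univBall (0 : EuclideanSpace ℝ (Fin d)) (1 / 4) v =
      (1 / (4 * √(1 + ‖v‖ ^ 2))) • v := by
  rw [OpenPartialHomeomorph.univBall, dif_pos (by norm_num)]
  simp [OpenPartialHomeomorph.unitBallBall, OpenPartialHomeomorph.univUnitBall, smul_smul]
  congr 1
  ring

theorem neckRel_univBall {v : EuclideanSpace ℝ (Fin d)} (hv : v ≠ 0) :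
    NeckRel (OpenPartialHomeomorph.univBall (0 : EuclideanSpace ℝ (Fin d)) (1 / 4) v)
      (OpenPartialHomeomorph.univBall (0 : EuclideanSpace ℝ (Fin d)) (1 / 4)
        ((‖v‖ ^ 2)⁻¹ • v)) := by
  have h0 : 0 < ‖v‖ := norm_pos_iff.2 hv
  rw [univBall_apply, univBall_apply]
  have h1 : ‖(‖v‖ ^ 2)⁻¹ • v‖ = ‖v‖⁻¹ := by
    rw [norm_smul, norm_inv, norm_pow, norm_norm]; field_simp
  have h2 : √(1 + ‖v‖⁻¹ ^ 2) = √(1 + ‖v‖ ^ 2) / ‖v‖ := by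
    rw [show 1 + ‖v‖⁻¹ ^ 2 = (1 + ‖v‖ ^ 2) / ‖v‖ ^ 2 by field_simp; ring,
      Real.sqrt_div (by positivity), Real.sqrt_sq h0.le]
  have h3 : 0 < √(1 + ‖v‖ ^ 2) := Real.sqrt_pos.2 (by positivity)
  have h4 : √(1 + ‖v‖ ^ 2) ^ 2 = 1 + ‖v‖ ^ 2 := Real.sq_sqrt (by positivity)
  set R := √(1 + ‖v‖ ^ 2)
  rw [h1, h2]
  constructor
  · rw [norm_smul, norm_smul, h1, Real.norm_of_nonneg (by positivity),
      Real.norm_of_nonneg (by positivity)]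
    field_simp
    rw [h4]; ring
  · rw [norm_smul, norm_smul, h1, Real.norm_of_nonneg (by positivity),
      Real.norm_of_nonneg (by positivity), smul_smul, smul_smul, smul_smul]
    congr 1
    field_simp

theorem isLocalDiffeomorph_torusDisc :
    IsLocalDiffeomorph (𝓡 d) (torusModel d) ∞ (torusDisc (d := d)) := by
  intro v
  let e := OpenPartialHomeomorph.univBall (0 : EuclideanSpace ℝ (Fin d)) (1 / 4)
  have ht : e.target = Metric.ball 0 (1 / 4) :=
    OpenPartialHomeomorph.univBall_target _ (by norm_num)
  let Φ : PartialDiffeomorph (𝓡 d) (𝓡 d) (EuclideanSpace ℝ (Fin d)) (EuclideanSpace ℝ (Fin d)) ∞ :=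
    { toPartialEquiv := e.toPartialEquiv
      open_source := e.open_source
      open_target := e.open_target
      contMDiffOn_toFun := OpenPartialHomeomorph.contDiff_univBall.contMDiff.contMDiffOn
      contMDiffOn_invFun := by
        rw [ht]
        exact OpenPartialHomeomorph.contDiffOn_univBall_symm.contMDiffOn }
  have h1 : IsLocalDiffeomorphAt (𝓡 d) (𝓡 d) ∞ e v := ⟨Φ, by simp [Φ, e], fun x _ => rfl⟩
  exact h1.comp _ _ (isLocalDiffeomorph_torusCover (e v))

theorem torusDisc_injective : Function.Injective (torusDisc (d := d)) := by
  intro v w h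
  have h1 := torusCover_eq_iff.1 h
  rw [cubeRep_eq_self ((univBall_lt v).trans (by norm_num)),
    cubeRep_eq_self ((univBall_lt w).trans (by norm_num))] at h1
  exact (OpenPartialHomeomorph.univBall (0 : EuclideanSpace ℝ (Fin d)) (1 / 4)).injOn
    (by simp) (by simp) h1

theorem torusDisc_zero : torusDisc (0 : EuclideanSpace ℝ (Fin d)) = torusCover 0 := by
  rw [torusDisc, OpenPartialHomeomorph.univBall_apply_zero]

theorem torusCover_ne_iff {v : EuclideanSpace ℝ (Fin d)} :
    torusCover v ≠ torusDisc 0 ↔ cubeRep v ≠ 0 := by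
  rw [torusDisc_zero, Ne, torusCover_eq_iff, cubeRep_zero]

section

variable [NeZero d]

instance : T2Space (DoubleTorus d) := by
  refine (t2Space_iff_of_isOpenQuotientMap (isOpenQuotientMap_mk (d := d))).2 ?_
  have : {q : PuncturedPair d × PuncturedPair d |
      Quotient.mk (glueSetoid d) q.1 = Quotient.mk (glueSetoid d) q.2} =
      {q | GlueRel q.1.1 q.1.2.1 q.2.1 q.2.2.1} := by
    ext q
    exact Quotient.eq (r := glueSetoid d)
  rw [this]
  exact isClosed_glueRel

theorem isCompact_image_patch (i : Bool) {c : ℝ} (hc : 0 < c) :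
    IsCompact (patch (d := d) i '' {v | cubeRep v = v ∧ c ≤ 16 * ‖cubeRep v‖ ^ 2}) := by
  have h1 : patch (d := d) i '' {v | cubeRep v = v ∧ c ≤ 16 * ‖cubeRep v‖ ^ 2} =
      patch i '' ({v : EuclideanSpace ℝ (Fin d) | ∀ i, v i ∈ Icc (-1 / 2 : ℝ) (1 / 2)} ∩
        {v | c ≤ 16 * ‖cubeRep v‖ ^ 2}) := by
    have hne : ∀ v : EuclideanSpace ℝ (Fin d), c ≤ 16 * ‖cubeRep v‖ ^ 2 → cubeRep v ≠ 0 := by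
      intro v hv h0
      rw [h0, norm_zero] at hv; norm_num at hv; linarith
    ext p
    constructor
    · rintro ⟨v, ⟨hv, hv2⟩, rfl⟩
      exact ⟨v, ⟨hv ▸ cubeRep_mem_cube v, hv2⟩, rfl⟩
    · rintro ⟨v, ⟨-, hv⟩, rfl⟩
      have hv' : c ≤ 16 * ‖cubeRep (cubeRep v)‖ ^ 2 := by rw [cubeRep_cubeRep]; exact hv
      exact ⟨cubeRep v, ⟨cubeRep_cubeRep v, hv'⟩,
        (patch_eq_patch_same (hne _ hv') (hne _ hv)).2 (cubeRep_cubeRep v)⟩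
  rw [h1]
  refine (isCompact_cube.inter_right ?_).image_of_continuousOn ((continuousOn_patch i).mono ?_)
  · exact isClosed_le continuous_const ((continuous_norm_cubeRep.pow 2).const_mul 16)
  · rintro v ⟨-, hv⟩ h0
    have hv' : c ≤ 16 * ‖cubeRep v‖ ^ 2 := hv
    rw [h0, norm_zero] at hv'; norm_num at hv'; linarith

theorem patch_cubeRep (i : Bool) {v : EuclideanSpace ℝ (Fin d)} (hv : cubeRep v ≠ 0) :
    patch i (cubeRep v) = patch i v :=
  (patch_eq_patch_same (by rwa [cubeRep_cubeRep]) hv).2 (cubeRep_cubeRep v)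

theorem patch_neckInv (i : Bool) {v : EuclideanSpace ℝ (Fin d)} (hv : v ≠ 0) (hv4 : ‖v‖ < 1 / 4) :
    patch i v = patch (!i) (neckInv v) := by
  have h := neckRel_neckInv hv hv4
  have h1 : cubeRep v = v := cubeRep_eq_self (by linarith)
  have h2 : cubeRep (neckInv v) = neckInv v :=
    cubeRep_eq_self (by linarith [neckInv_lt hv hv4])
  exact (patch_eq_patch_not (by rwa [h1]) (by rw [h2]; exact h.2.1)).2 (by rw [h1, h2]; exact h.1)

/-- The double torus is the union of the images of the compact parts `16 ‖v‖² ≥ 1/2` of the two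
fundamental cubes: the inversion preserves the sphere `16 ‖v‖² = 1/2`. -/
instance : CompactSpace (DoubleTorus d) := by
  refine ⟨?_⟩
  have h1 := (isCompact_image_patch (d := d) false (c := 1 / 2) (by norm_num)).union
    (isCompact_image_patch (d := d) true (c := 1 / 2) (by norm_num))
  convert h1 using 1
  refine (eq_univ_of_forall fun p => ?_).symm
  obtain ⟨i, v, hv, rfl⟩ := exists_patch p
  suffices h : ∃ j w, (cubeRep w = w ∧ 1 / 2 ≤ 16 * ‖cubeRep w‖ ^ 2) ∧ patch j w = patch i v by
    obtain ⟨j, w, hw, hj⟩ := h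
    cases j
    · exact Or.inl ⟨w, hw, hj⟩
    · exact Or.inr ⟨w, hw, hj⟩
  rcases le_or_gt (1 / 2) (16 * ‖cubeRep v‖ ^ 2) with h | h
  · exact ⟨i, cubeRep v, ⟨cubeRep_cubeRep v, by rwa [cubeRep_cubeRep]⟩, patch_cubeRep i hv⟩
  · have h4 : ‖cubeRep v‖ < 1 / 4 := by nlinarith [norm_nonneg (cubeRep v)]
    have h5 := neckRel_neckInv hv h4
    have h6 : cubeRep (neckInv (cubeRep v)) = neckInv (cubeRep v) :=
      cubeRep_eq_self (by linarith [neckInv_lt hv h4])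
    refine ⟨!i, neckInv (cubeRep v), ⟨h6, ?_⟩, ?_⟩
    · rw [h6, h5.2.2]; linarith
    · rw [← patch_neckInv i hv h4, patch_cubeRep i hv]

/-- The map of the torus to the double torus induced by `patch i`; the value at the image of the
lattice has no meaning. -/
def torusPatch (i : Bool) (p : Torus d) : DoubleTorus d :=
  patch i (surjective_torusCover p).choose

theorem torusPatch_torusCover (i : Bool) {v : EuclideanSpace ℝ (Fin d)} (hv : cubeRep v ≠ 0) :
    torusPatch i (torusCover v) = patch i v := by
  have h := torusCover_eq_iff.1 (surjective_torusCover (torusCover v)).choose_spec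
  exact (patch_eq_patch_same (by rwa [h]) hv).2 h

theorem isLocalDiffeomorphAt_torusPatch (i : Bool) {v : EuclideanSpace ℝ (Fin d)}
    (hv : cubeRep v ≠ 0) :
    IsLocalDiffeomorphAt (torusModel d) (𝓡 d) ∞ (torusPatch i) (torusCover v) := by
  have h := isLocalDiffeomorph_torusCover v
  have h1 : h.localInverse (torusCover v) = v := h.localInverse_left_inv h.localInverse_mem_target
  have h2 : IsLocalDiffeomorphAt (torusModel d) (𝓡 d) ∞
      (fun p => patch i (h.localInverse p)) (torusCover v) :=
    h.localInverse_isLocalDiffeomorphAt.comp _ _ (by rw [h1]; exact isLocalDiffeomorphAt_patch i hv)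
  refine h2.congr_of_eventuallyEq ?_
  have h3 : ContinuousAt h.localInverse (torusCover v) := h.localInverse_contMDiffAt.continuousAt
  have h4 : ∀ᶠ p in 𝓝 (torusCover v), cubeRep (h.localInverse p) ≠ 0 :=
    h3.eventually (by rw [h1]; exact eventually_cubeRep_ne hv)
  filter_upwards [h4, h.localInverse_eventuallyEq_right] with p hp hp2
  have hp3 : torusCover (h.localInverse p) = p := hp2
  conv_lhs => rw [← hp3]
  exact torusPatch_torusCover i hp

/-- In the coordinates `v ↦ v / (4 √(1 + ‖v‖²))` of the ball of radius `1/4` the inversion that glues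
the two halves is `v ↦ v / ‖v‖²`. -/
theorem isConnectedSum_doubleTorus :
    IsConnectedSum d (torusModel d) (torusModel d) (Torus d) (Torus d) (DoubleTorus d) := by
  have hinj : ∀ i, InjOn (torusPatch (d := d) i) {torusDisc 0}ᶜ := by
    intro i p hp q hq h
    obtain ⟨v, rfl⟩ := surjective_torusCover p
    obtain ⟨w, rfl⟩ := surjective_torusCover q
    have hv := torusCover_ne_iff.1 hp
    have hw := torusCover_ne_iff.1 hq
    rw [torusPatch_torusCover i hv, torusPatch_torusCover i hw, patch_eq_patch_same hv hw] at h
    exact torusCover_eq_iff.2 h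
  have hloc : ∀ i, IsLocalDiffeomorphOn (torusModel d) (𝓡 d) ∞ (torusPatch (d := d) i)
      {torusDisc 0}ᶜ := by
    rintro i ⟨p, hp⟩
    obtain ⟨v, rfl⟩ := surjective_torusCover p
    exact isLocalDiffeomorphAt_torusPatch i (torusCover_ne_iff.1 hp)
  refine ⟨torusDisc, torusDisc, torusPatch false, torusPatch true, torusDisc_injective,
    isLocalDiffeomorph_torusDisc, torusDisc_injective, isLocalDiffeomorph_torusDisc, hinj _, hloc _,
    hinj _, hloc _, ?_, ?_⟩
  · refine eq_univ_of_forall fun p => ?_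
    obtain ⟨i, v, hv, rfl⟩ := exists_patch p
    cases i
    · exact Or.inl ⟨torusCover v, torusCover_ne_iff.2 hv, torusPatch_torusCover _ hv⟩
    · exact Or.inr ⟨torusCover v, torusCover_ne_iff.2 hv, torusPatch_torusCover _ hv⟩
  · intro p hp q hq
    have hd : ∀ v : EuclideanSpace ℝ (Fin d), v ≠ 0 → ∃ x,
        OpenPartialHomeomorph.univBall (0 : EuclideanSpace ℝ (Fin d)) (1 / 4) v = x ∧ x ≠ 0 ∧
        cubeRep x = x ∧ torusDisc v = torusCover x := by
      intro v hv
      refine ⟨_, rfl, ?_, cubeRep_eq_self ((univBall_lt v).trans (by norm_num)), rfl⟩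
      rw [univBall_apply]
      have : 0 < √(1 + ‖v‖ ^ 2) := Real.sqrt_pos.2 (by positivity)
      exact smul_ne_zero (by positivity) hv
    have hinv : ∀ v : EuclideanSpace ℝ (Fin d), v ≠ 0 → (‖v‖ ^ 2)⁻¹ • v ≠ 0 := fun v hv =>
      smul_ne_zero (inv_ne_zero (pow_ne_zero 2 (norm_ne_zero_iff.2 hv))) hv
    constructor
    · intro h
      obtain ⟨v, rfl⟩ := surjective_torusCover p
      obtain ⟨w, rfl⟩ := surjective_torusCover q
      have hv := torusCover_ne_iff.1 hp
      have hw := torusCover_ne_iff.1 hq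
      rw [torusPatch_torusCover _ hv, torusPatch_torusCover _ hw] at h
      have h1 : NeckRel (cubeRep v) (cubeRep w) := (patch_eq_patch_not hv hw).1 h
      have h2 := h1.norm_lt hw
      let e := OpenPartialHomeomorph.univBall (0 : EuclideanSpace ℝ (Fin d)) (1 / 4)
      have ht : cubeRep v ∈ e.target := by
        rw [OpenPartialHomeomorph.univBall_target _ (by norm_num)]; simpa using h2
      have he : e (e.symm (cubeRep v)) = cubeRep v := e.right_inv ht
      set x := e.symm (cubeRep v)
      have hx : x ≠ 0 := by
        intro h0
        rw [h0, OpenPartialHomeomorph.univBall_apply_zero] at he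
        exact hv he.symm
      have h3 := neckRel_univBall hx
      refine ⟨x, hx, ?_, ?_⟩
      · refine torusCover_eq_iff.2 ?_
        rw [show OpenPartialHomeomorph.univBall (0 : EuclideanSpace ℝ (Fin d)) (1 / 4) x = cubeRep v
          from he, cubeRep_cubeRep]
      · rw [show OpenPartialHomeomorph.univBall (0 : EuclideanSpace ℝ (Fin d)) (1 / 4) x = cubeRep v
          from he] at h3
        have h4 := h1.eq h3 hv
        refine torusCover_eq_iff.2 ?_
        rw [← h4, cubeRep_cubeRep]
    · rintro ⟨v, hv, rfl, rfl⟩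
      obtain ⟨x, hx, hx0, hxc, hxt⟩ := hd v hv
      obtain ⟨y, hy, hy0, hyc, hyt⟩ := hd _ (hinv v hv)
      rw [hxt, hyt, torusPatch_torusCover _ (by rwa [hxc]), torusPatch_torusCover _ (by rwa [hyc])]
      refine (patch_eq_patch_not (i := false) (by rwa [hxc]) (by rwa [hyc])).2 ?_
      rw [hxc, hyc, ← hx, ← hy]
      exact neckRel_univBall hv

end

end

/-! ### The handles -/

section ModelForm

variable {d : ℕ}

theorem modelForm_eq (v w : LocalModel d) : modelForm v w = (v.1 * w.2.1 - v.2.1 * w.1) +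
    (inner ℝ v.2.2.1 w.2.2.2 - inner ℝ v.2.2.2 w.2.2.1) := by
  simp only [modelForm, PiLp.inner_apply, Finset.sum_sub_distrib]
  simp [mul_comm]

theorem modelForm_zero_left (w : LocalModel d) : modelForm 0 w = 0 := by
  simp [modelForm]

theorem eq_zero_of_modelForm {v : LocalModel d} (h : ∀ w, modelForm v w = 0) : v = 0 := by
  have h1 := h (-v.2.1, v.1, -v.2.2.2, v.2.2.1)
  rw [modelForm_eq] at h1
  simp only [inner_neg_right, real_inner_self_eq_norm_sq] at h1
  have h2 : v.1 = 0 := pow_eq_zero_iff two_ne_zero |>.1 (le_antisymm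
    (by nlinarith [sq_nonneg ‖v.2.2.1‖, sq_nonneg ‖v.2.2.2‖, sq_nonneg v.2.1]) (sq_nonneg _))
  have h3 : v.2.1 = 0 := pow_eq_zero_iff two_ne_zero |>.1 (le_antisymm
    (by nlinarith [sq_nonneg ‖v.2.2.1‖, sq_nonneg ‖v.2.2.2‖]) (sq_nonneg _))
  rw [h2, h3] at h1
  have h4 : ‖v.2.2.1‖ = 0 := pow_eq_zero_iff two_ne_zero |>.1 (le_antisymm
    (by nlinarith [sq_nonneg ‖v.2.2.2‖]) (sq_nonneg _))
  have h5 : ‖v.2.2.2‖ = 0 := pow_eq_zero_iff two_ne_zero |>.1 (le_antisymm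
    (by nlinarith [sq_nonneg ‖v.2.2.1‖]) (sq_nonneg _))
  rw [norm_eq_zero] at h4 h5
  exact Prod.ext h2 (Prod.ext h3 (Prod.ext h4 h5))

theorem isOpen_modelBox (m : ℕ) (ε : ℝ) : IsOpen (modelBox m ε) := by
  have h : modelBox m ε = {p | |p.2.1| < ε} ∩ ((⋂ i, {p | |p.2.2.1 i| < ε}) ∩
      ⋂ i, {p | |p.2.2.2 i| < ε}) := by
    ext p; simp [modelBox]
  rw [h]
  refine IsOpen.inter (isOpen_lt (by fun_prop) continuous_const) (IsOpen.inter ?_ ?_) <;>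
  exact isOpen_iInter_of_finite fun i => isOpen_lt (by fun_prop) continuous_const

/-- The map `(s, x) ↦ (s, 0, f(‖x‖²) x, g(‖x‖²) x)` is a Lagrangian immersion into the local model. -/
theorem isotropicImmersionAt_radialPair {f g : ℝ → ℝ} {s : ℝ} {x : EuclideanSpace ℝ (Fin d)}
    {f' g' : ℝ} (hf : ContDiffAt ℝ ∞ f (‖x‖ ^ 2)) (hg : ContDiffAt ℝ ∞ g (‖x‖ ^ 2))
    (hf' : HasDerivAt f f' (‖x‖ ^ 2)) (hg' : HasDerivAt g g' (‖x‖ ^ 2))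
    (h1 : f (‖x‖ ^ 2) + 2 * ‖x‖ ^ 2 * f' ≠ 0 ∨ g (‖x‖ ^ 2) + 2 * ‖x‖ ^ 2 * g' ≠ 0)
    (h0 : f (‖x‖ ^ 2) ≠ 0 ∨ g (‖x‖ ^ 2) ≠ 0) :
    IsotropicImmersionAt (modelForm (m := d)) (fun w : ℝ × EuclideanSpace ℝ (Fin d) =>
      ((w.1, 0, f (‖w.2‖ ^ 2) • w.2, g (‖w.2‖ ^ 2) • w.2) : LocalModel d)) (s, x) := by
  have key : ∀ {f : ℝ → ℝ} {f' : ℝ}, ContDiffAt ℝ ∞ f (‖x‖ ^ 2) → HasDerivAt f f' (‖x‖ ^ 2) →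
      ContDiffAt ℝ ∞ (fun w : ℝ × EuclideanSpace ℝ (Fin d) => f (‖w.2‖ ^ 2) • w.2) (s, x) ∧
      ∃ L : ℝ × EuclideanSpace ℝ (Fin d) →L[ℝ] EuclideanSpace ℝ (Fin d),
        HasFDerivAt (fun w : ℝ × EuclideanSpace ℝ (Fin d) => f (‖w.2‖ ^ 2) • w.2) L (s, x) ∧
        ∀ q, L q = f (‖x‖ ^ 2) • q.2 + (2 * f' * inner ℝ x q.2) • x := by
    intro f f' hf hf'
    constructor
    · have : ContDiff ℝ ∞ fun w : ℝ × EuclideanSpace ℝ (Fin d) => ‖w.2‖ ^ 2 :=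
        contDiff_snd.norm_sq ℝ
      exact (ContDiffAt.comp (s, x) (f := fun w : ℝ × EuclideanSpace ℝ (Fin d) => ‖w.2‖ ^ 2) hf
        this.contDiffAt).smul contDiffAt_snd
    · have h1 := HasDerivAt.comp_hasFDerivAt (f := fun w : ℝ × EuclideanSpace ℝ (Fin d) => ‖w.2‖ ^ 2)
        (s, x) hf' (hasFDerivAt_norm_sq_snd (s, x))
      refine ⟨_, h1.smul (hasFDerivAt_snd (𝕜 := ℝ) (p := (s, x))), fun q => ?_⟩
      simp
      congr 1
      ring
  obtain ⟨cf, Lf, hLf, hLf'⟩ := key hf hf'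
  obtain ⟨cg, Lg, hLg, hLg'⟩ := key hg hg'
  have hD : HasFDerivAt (fun w : ℝ × EuclideanSpace ℝ (Fin d) =>
      ((w.1, 0, f (‖w.2‖ ^ 2) • w.2, g (‖w.2‖ ^ 2) • w.2) : LocalModel d))
      ((ContinuousLinearMap.fst ℝ ℝ _).prod ((0 : _ →L[ℝ] ℝ).prod (Lf.prod Lg))) (s, x) :=
    hasFDerivAt_fst.prodMk ((hasFDerivAt_const (0 : ℝ) _).prodMk (hLf.prodMk hLg))
  refine ⟨immersionAt_of_hasFDerivAt
    (contDiffAt_fst.prodMk (contDiffAt_const.prodMk (cf.prodMk cg))) hD fun q hq => ?_,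
    fun p q => ?_⟩
  · have e1 : q.1 = 0 := by simpa using congrArg Prod.fst hq
    have e2 : Lf q = 0 := by simpa using congrArg (fun z : LocalModel d => z.2.2.1) hq
    have e3 : Lg q = 0 := by simpa using congrArg (fun z : LocalModel d => z.2.2.2) hq
    rw [hLf'] at e2
    rw [hLg'] at e3
    have e4 : (f (‖x‖ ^ 2) + 2 * ‖x‖ ^ 2 * f') * inner ℝ x q.2 = 0 := by
      have := congrArg (inner ℝ x) e2
      rw [inner_add_right, inner_smul_right, inner_smul_right, real_inner_self_eq_norm_sq,
        inner_zero_right] at this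
      linarith
    have e5 : (g (‖x‖ ^ 2) + 2 * ‖x‖ ^ 2 * g') * inner ℝ x q.2 = 0 := by
      have := congrArg (inner ℝ x) e3
      rw [inner_add_right, inner_smul_right, inner_smul_right, real_inner_self_eq_norm_sq,
        inner_zero_right] at this
      linarith
    have e6 : inner ℝ x q.2 = 0 := by
      rcases h1 with h | h
      · exact (mul_eq_zero.1 e4).resolve_left h
      · exact (mul_eq_zero.1 e5).resolve_left h
    rw [e6, mul_zero, zero_smul, add_zero] at e2 e3
    have e7 : q.2 = 0 := by
      rcases h0 with h | h
      · exact (smul_eq_zero.1 e2).resolve_left h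
      · exact (smul_eq_zero.1 e3).resolve_left h
    exact Prod.ext e1 e7
  · rw [hD.fderiv, modelForm_eq]
    simp only [ContinuousLinearMap.prod_apply, ContinuousLinearMap.coe_fst', zero_apply, hLf', hLg',
      inner_add_left, inner_add_right, inner_smul_left, inner_smul_right, real_inner_self_eq_norm_sq]
    simp only [real_inner_comm x]
    simp
    ring

end ModelForm

namespace SmoothingData

variable {V : Type*} [NormedAddCommGroup V] [NormedSpace ℝ V] {d : ℕ}
  {Ω : V → V → ℝ} {L₀ L₁ Δ : Set V} (D : SmoothingData d Ω L₀ L₁ Δ)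

theorem contDiffAt_chart {p : LocalModel d} (hp : p ∈ modelBox d D.ε) :
    ContDiffAt ℝ ∞ D.chart p :=
  D.chart_smooth.contDiffAt ((isOpen_modelBox d D.ε).mem_nhds hp)

theorem immersionAt_chart {p : LocalModel d} (hp : p ∈ modelBox d D.ε) :
    ImmersionAt D.chart p := by
  refine ⟨D.contDiffAt_chart hp, (injective_iff_map_eq_zero _).2 fun v hv => ?_⟩
  refine eq_zero_of_modelForm fun w => ?_
  rw [← D.chart_symplectic p hp, hv, ← map_zero (fderiv ℝ D.chart p), D.chart_symplectic p hp,
    modelForm_zero_left]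

theorem isotropicImmersionAt_chart_comp {X : Type*} [NormedAddCommGroup X] [NormedSpace ℝ X]
    {l : X → LocalModel d} {w : X} (hp : l w ∈ modelBox d D.ε)
    (hl : IsotropicImmersionAt modelForm l w) :
    IsotropicImmersionAt Ω (fun x => D.chart (l x)) w := by
  refine ⟨(D.immersionAt_chart hp).comp hl.1, fun a b => ?_⟩
  have h : fderiv ℝ (fun x => D.chart (l x)) w = (fderiv ℝ D.chart (l w)).comp (fderiv ℝ l w) :=
    fderiv_fun_comp w ((D.contDiffAt_chart hp).differentiableAt (by simp)) hl.1.differentiableAt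
  rw [h]
  exact (D.chart_symplectic _ hp _ _).trans (hl.2 a b)

theorem ε_pos : 0 < D.ε := D.r_pos.trans D.r_lt

theorem mem_modelBox {s : ℝ} {x y : EuclideanSpace ℝ (Fin d)} (hx : ‖x‖ < D.ε) (hy : ‖y‖ < D.ε) :
    ((s, 0, x, y) : LocalModel d) ∈ modelBox d D.ε :=
  ⟨by simpa using D.ε_pos, fun i => (EuclideanSpace.abs_apply_le_norm x i).trans_lt hx,
    fun i => (EuclideanSpace.abs_apply_le_norm y i).trans_lt hy⟩

theorem chart_eq {s s' : ℝ} {x y x' y' : EuclideanSpace ℝ (Fin d)} (hx : ‖x‖ < D.ε) (hy : ‖y‖ < D.ε)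
    (hx' : ‖x'‖ < D.ε) (hy' : ‖y'‖ < D.ε) :
    D.chart (s, 0, x, y) = D.chart (s', 0, x', y') ↔ (∃ k : ℤ, s' = s + k) ∧ x = x' ∧ y = y' := by
  rw [D.chart_eq_iff _ (D.mem_modelBox hx hy) _ (D.mem_modelBox hx' hy')]
  simp only [Prod.mk.injEq, true_and]
  exact and_comm

/-- The orientation of the handle coordinate as seen from the left (`false`) or right (`true`) end. -/
def endSign (i : Bool) : ℝ := cond i 1 (-1)

/-- The sign with which the left or right end of the handle enters the corresponding torus. -/
def legSign (i : Bool) : ℝ := cond i D.sign 1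

/-- The left or right Lagrangian in the local model. -/
def leg (i : Bool) (p : ℝ × EuclideanSpace ℝ (Fin d)) : V :=
  D.chart (cond i (p.1, 0, 0, p.2) (p.1, 0, p.2, 0))

theorem leg_false (p : ℝ × EuclideanSpace ℝ (Fin d)) : D.leg false p = D.chart (p.1, 0, p.2, 0) := rfl

theorem leg_true (p : ℝ × EuclideanSpace ℝ (Fin d)) : D.leg true p = D.chart (p.1, 0, 0, p.2) := rfl

/-- The point of the handle in direction `n` and at height `u` above the middle, as seen from the
left or right end. -/
def handlePt (i : Bool) (s u : ℝ) (n : EuclideanSpace ℝ (Fin d)) : V :=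
  D.chart (s, 0, D.a (endSign i * u) • n, (D.sign * D.b (endSign i * u)) • n)

theorem sign_abs : |D.sign| = 1 := by
  rcases D.sign_eq with h | h <;> simp [h]

theorem legSign_sq (i : Bool) : D.legSign i * D.legSign i = 1 := by
  cases i
  · simp [legSign]
  · rcases D.sign_eq with h | h <;> simp [legSign, h]

theorem abs_legSign (i : Bool) : |D.legSign i| = 1 := by
  cases i
  · simp [legSign]
  · exact D.sign_abs

theorem handlePt_not (i : Bool) (s u : ℝ) (n : EuclideanSpace ℝ (Fin d)) :
    D.handlePt (!i) s u n = D.handlePt i s (-u) n := by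
  cases i <;> simp [handlePt, endSign]

/-- Beyond height `r` the handle follows the Lagrangian. -/
theorem handlePt_of_ge (i : Bool) {s u : ℝ} (hu : D.r ≤ u) (n : EuclideanSpace ℝ (Fin d)) :
    D.handlePt i s u n = D.leg i (s, u • D.legSign i • n) := by
  cases i
  · have := D.incoming (-u) (by linarith)
    simp [handlePt, endSign, leg, legSign, this]
  · have := D.outgoing u hu
    simp [handlePt, endSign, leg, legSign, this, mul_comm, smul_smul]

theorem norm_ab_lt {u : ℝ} (hu : |u| < D.ε) {n : EuclideanSpace ℝ (Fin d)} (hn : ‖n‖ = 1) :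
    ‖D.a u • n‖ < D.ε ∧ ‖(D.sign * D.b u) • n‖ < D.ε := by
  have h : D.a u < D.ε ∧ D.b u < D.ε := by
    rcases le_or_gt (|u|) D.r with h | h
    · exact ⟨(D.bounded u h).1.trans_lt D.r_lt, (D.bounded u h).2.trans_lt D.r_lt⟩
    · rcases lt_abs.1 h with h1 | h1
      · rw [(D.outgoing u h1.le).1, (D.outgoing u h1.le).2]
        exact ⟨D.ε_pos, (le_abs_self u).trans_lt hu⟩
      · rw [(D.incoming u (by linarith)).1, (D.incoming u (by linarith)).2]
        exact ⟨(neg_le_abs u).trans_lt hu, D.ε_pos⟩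
  rw [norm_smul, norm_smul, hn, norm_mul, Real.norm_eq_abs D.sign, D.sign_abs, mul_one, mul_one,
    one_mul, Real.norm_of_nonneg (D.a_nonneg u), Real.norm_of_nonneg (D.b_nonneg u)]
  exact h

theorem handlePt_eq_iff {i : Bool} {s s' u u' : ℝ} {n n' : EuclideanSpace ℝ (Fin d)}
    (hu : |u| < D.ε) (hu' : |u'| < D.ε) (hn : ‖n‖ = 1) (hn' : ‖n'‖ = 1) :
    D.handlePt i s u n = D.handlePt i s' u' n' ↔ (∃ k : ℤ, s' = s + k) ∧ u = u' ∧ n = n' := by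
  have he : |endSign i| = 1 := by cases i <;> simp [endSign]
  have h1 := D.norm_ab_lt (u := endSign i * u) (by rwa [abs_mul, he, one_mul]) hn
  have h2 := D.norm_ab_lt (u := endSign i * u') (by rwa [abs_mul, he, one_mul]) hn'
  rw [handlePt, handlePt, D.chart_eq h1.1 h1.2 h2.1 h2.2]
  refine and_congr_right fun _ => ⟨?_, by rintro ⟨rfl, rfl⟩; exact ⟨rfl, rfl⟩⟩
  rintro ⟨e1, e2⟩
  have e3 := congrArg norm e1
  have e4 := congrArg norm e2
  rw [norm_smul, norm_smul, hn, hn', mul_one, mul_one, Real.norm_of_nonneg (D.a_nonneg _),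
    Real.norm_of_nonneg (D.a_nonneg _)] at e3
  rw [norm_smul, norm_smul, hn, hn', mul_one, mul_one, norm_mul, norm_mul, Real.norm_eq_abs D.sign,
    D.sign_abs, one_mul, one_mul, Real.norm_of_nonneg (D.b_nonneg _),
    Real.norm_of_nonneg (D.b_nonneg _)] at e4
  have e5 := D.embedded (Prod.ext e3 e4 : (D.a (endSign i * u), D.b (endSign i * u)) =
    (D.a (endSign i * u'), D.b (endSign i * u')))
  have he0 : endSign i ≠ 0 := by rw [← abs_ne_zero, he]; exact one_ne_zero
  refine ⟨mul_left_cancel₀ he0 e5, ?_⟩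
  rw [← e5] at e1 e2
  rcases D.ne_origin (endSign i * u) with h | h
  · exact smul_right_injective _ h e1
  · refine smul_right_injective _ (mul_ne_zero ?_ h) e2
    rw [← abs_ne_zero, D.sign_abs]; exact one_ne_zero

/-- The handle is a Lagrangian immersion, in coordinates in which the direction is a prescribed
family of linear maps. -/
theorem isotropicImmersionAt_handlePt (i : Bool)
    {B : ℝ → EuclideanSpace ℝ (Fin d) →L[ℝ] EuclideanSpace ℝ (Fin d)} (hB : ContDiff ℝ ∞ B)
    (hBi : ∀ s v, B s v = 0 → v = 0) {s : ℝ} {v : EuclideanSpace ℝ (Fin d)} (hv : v ≠ 0)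
    (hu : |4 * D.r * (16 * ‖v‖ ^ 2 - 1 / 2)| < D.ε) :
    IsotropicImmersionAt Ω (fun w : ℝ × EuclideanSpace ℝ (Fin d) =>
      D.handlePt i w.1 (4 * D.r * (16 * ‖w.2‖ ^ 2 - 1 / 2)) (‖B w.1 w.2‖⁻¹ • B w.1 w.2)) (s, v) := by
  have hr := D.r_pos
  -- the polar coordinates `x = ‖v‖² n`
  let l : ℝ × EuclideanSpace ℝ (Fin d) → ℝ × EuclideanSpace ℝ (Fin d) := fun w =>
    (w.1, (‖w.2‖ ^ 2 / ‖B w.1 w.2‖) • B w.1 w.2)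
  have hv0 : 0 < ‖v‖ := norm_pos_iff.2 hv
  have hl : ImmersionAt l (s, v) :=
    immersionAt_polar (M := fun q : ℝ × ℝ => B q.1) (φ := fun x => x) (c := 1)
      (hB.comp contDiff_fst) contDiff_id hv (fun q u h => hBi _ _ h) (by positivity) one_pos
      (hasDerivAt_id _)
  have hBn : ∀ w : ℝ × EuclideanSpace ℝ (Fin d), w.2 ≠ 0 → 0 < ‖B w.1 w.2‖ := fun w hw =>
    norm_pos_iff.2 fun h => hw (hBi _ _ h)
  have hln : ∀ w : ℝ × EuclideanSpace ℝ (Fin d), w.2 ≠ 0 → ‖(l w).2‖ = ‖w.2‖ ^ 2 ∧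
      ‖B w.1 w.2‖⁻¹ • B w.1 w.2 = (√(‖(l w).2‖ ^ 2))⁻¹ • (l w).2 := by
    intro w hw
    have h0 := hBn w hw
    have h1 : 0 < ‖w.2‖ := norm_pos_iff.2 hw
    have h2 : ‖(l w).2‖ = ‖w.2‖ ^ 2 := by
      simp only [l]
      rw [norm_smul, Real.norm_of_nonneg (by positivity)]
      field_simp
    refine ⟨h2, ?_⟩
    rw [h2, Real.sqrt_sq (by positivity)]
    simp only [l, smul_smul]
    congr 1
    field_simp
  let ht : ℝ → ℝ := fun ρ => endSign i * (4 * D.r * (16 * √ρ - 1 / 2))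
  let f : ℝ → ℝ := fun ρ => D.a (ht ρ) * (√ρ)⁻¹
  let g : ℝ → ℝ := fun ρ => D.sign * D.b (ht ρ) * (√ρ)⁻¹
  set x := (l (s, v)).2 with hx
  have hxn : ‖x‖ = ‖v‖ ^ 2 := (hln (s, v) hv).1
  have hρ : 0 < ‖x‖ ^ 2 := by rw [hxn]; positivity
  have hsq : √(‖x‖ ^ 2) = ‖x‖ := Real.sqrt_sq (norm_nonneg _)
  have hx0 : 0 < ‖x‖ := by rw [hxn]; positivity
  have hsqc : ContDiffAt ℝ ∞ (fun ρ : ℝ => √ρ) (‖x‖ ^ 2) := Real.contDiffAt_sqrt hρ.ne'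
  have hsqd : HasDerivAt (fun ρ : ℝ => √ρ) (1 / (2 * ‖x‖)) (‖x‖ ^ 2) := by
    have := Real.hasDerivAt_sqrt hρ.ne'
    rwa [hsq] at this
  have hsqi : HasDerivAt (fun ρ : ℝ => (√ρ)⁻¹) (-(1 / (2 * ‖x‖)) / ‖x‖ ^ 2) (‖x‖ ^ 2) := by
    have := hsqd.inv (by rw [hsq]; exact hx0.ne')
    rwa [hsq] at this
  have htc : ContDiffAt ℝ ∞ ht (‖x‖ ^ 2) :=
    contDiffAt_const.mul (contDiffAt_const.mul ((contDiffAt_const.mul hsqc).sub contDiffAt_const))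
  have htd : HasDerivAt ht (endSign i * (4 * D.r * (16 * (1 / (2 * ‖x‖))))) (‖x‖ ^ 2) :=
    (((hsqd.const_mul 16).sub_const _).const_mul _).const_mul _
  have hac : ContDiffAt ℝ ∞ (fun ρ => D.a (ht ρ)) (‖x‖ ^ 2) := D.a_smooth.contDiffAt.comp _ htc
  have hbc : ContDiffAt ℝ ∞ (fun ρ => D.b (ht ρ)) (‖x‖ ^ 2) := D.b_smooth.contDiffAt.comp _ htc
  set u := ht (‖x‖ ^ 2) with hudef
  have had := HasDerivAt.comp (‖x‖ ^ 2) (h₂ := D.a)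
    ((D.a_smooth.differentiable (by simp) u).hasDerivAt) htd
  have hbd := HasDerivAt.comp (‖x‖ ^ 2) (h₂ := D.b)
    ((D.b_smooth.differentiable (by simp) u).hasDerivAt) htd
  have hsqic : ContDiffAt ℝ ∞ (fun ρ : ℝ => (√ρ)⁻¹) (‖x‖ ^ 2) :=
    hsqc.inv (by rw [hsq]; exact hx0.ne')
  have hfd := had.mul hsqi
  have hgd := (hbd.const_mul D.sign).mul hsqi
  have hs0 : D.sign ≠ 0 := by rw [← abs_ne_zero, D.sign_abs]; exact one_ne_zero
  have he0 : endSign i ≠ 0 := by cases i <;> simp [endSign]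
  have hiso := isotropicImmersionAt_radialPair (f := f) (g := g) (s := s) (x := x)
    (hac.mul hsqic) ((contDiffAt_const.mul hbc).mul hsqic) hfd hgd (by
      simp only [f, g, Function.comp, ← hudef, hsq]
      have e : ∀ y y' : ℝ, y * ‖x‖⁻¹ + 2 * ‖x‖ ^ 2 * (y' * (endSign i *
          (4 * D.r * (16 * (1 / (2 * ‖x‖))))) * ‖x‖⁻¹ + y * (-(1 / (2 * ‖x‖)) / ‖x‖ ^ 2)) =
          y' * (endSign i * (64 * D.r)) := by
        intro y y'
        field_simp
        ring
      have e' : ∀ y y' : ℝ, D.sign * y * ‖x‖⁻¹ + 2 * ‖x‖ ^ 2 * (D.sign * (y' * (endSign i *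
          (4 * D.r * (16 * (1 / (2 * ‖x‖)))))) * ‖x‖⁻¹ +
          D.sign * y * (-(1 / (2 * ‖x‖)) / ‖x‖ ^ 2)) =
          D.sign * (y' * (endSign i * (64 * D.r))) := by
        intro y y'
        field_simp
        ring
      rw [e, e']
      rcases D.regular u with h | h
      · left; positivity
      · right; positivity)
    (by
      simp only [f, g, ← hudef, hsq]
      rcases D.ne_origin u with h | h
      · left; positivity
      · right; positivity)
  have hpt : ∀ w : ℝ × EuclideanSpace ℝ (Fin d), w.2 ≠ 0 →
      (((w.1, 0, D.a (endSign i * (4 * D.r * (16 * ‖w.2‖ ^ 2 - 1 / 2))) • ‖B w.1 w.2‖⁻¹ • B w.1 w.2,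
      (D.sign * D.b (endSign i * (4 * D.r * (16 * ‖w.2‖ ^ 2 - 1 / 2)))) • ‖B w.1 w.2‖⁻¹ • B w.1 w.2)) :
        LocalModel d) = ((l w).1, 0, f (‖(l w).2‖ ^ 2) • (l w).2, g (‖(l w).2‖ ^ 2) • (l w).2) := by
    intro w hw
    obtain ⟨k1, k2⟩ := hln w hw
    have k3 : √(‖(l w).2‖ ^ 2) = ‖w.2‖ ^ 2 := by rw [Real.sqrt_sq (norm_nonneg _), k1]
    rw [k2]
    simp only [f, g, ht, k3, smul_smul]
    rfl
  have hbox : ((((l (s, v)).1, 0, f (‖(l (s, v)).2‖ ^ 2) • (l (s, v)).2,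
      g (‖(l (s, v)).2‖ ^ 2) • (l (s, v)).2)) : LocalModel d) ∈ modelBox d D.ε := by
    rw [← hpt (s, v) hv]
    have hn1 : ‖‖B s v‖⁻¹ • B s v‖ = 1 := by
      rw [norm_smul, norm_inv, norm_norm, inv_mul_cancel₀ (hBn (s, v) hv).ne']
    have he : |endSign i| = 1 := by cases i <;> simp [endSign]
    have h2 := D.norm_ab_lt (u := endSign i * (4 * D.r * (16 * ‖v‖ ^ 2 - 1 / 2)))
      (by rwa [abs_mul, he, one_mul]) hn1
    exact D.mem_modelBox h2.1 h2.2
  have hfin := D.isotropicImmersionAt_chart_comp (l := fun w => (((l w).1, 0,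
    f (‖(l w).2‖ ^ 2) • (l w).2, g (‖(l w).2‖ ^ 2) • (l w).2) : LocalModel d)) (w := (s, v)) hbox
    (IsotropicImmersionAt.comp (g := fun q : ℝ × EuclideanSpace ℝ (Fin d) => ((q.1, 0,
      f (‖q.2‖ ^ 2) • q.2, g (‖q.2‖ ^ 2) • q.2) : LocalModel d)) (l := l) (w := (s, v)) hiso hl)
  refine hfin.congr ?_
  have : ∀ᶠ w : ℝ × EuclideanSpace ℝ (Fin d) in 𝓝 (s, v), w.2 ≠ 0 :=
    continuous_snd.continuousAt.eventually_ne hv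
  filter_upwards [this] with w hw
  rw [handlePt, hpt w hw]

end SmoothingData

section

/-! ### Gluing the handle to the two punctured tori -/

section LocalCoordinates

variable {E H N V X : Type*} [NormedAddCommGroup E] [NormedSpace ℝ E] [TopologicalSpace H]
  {I : ModelWithCorners ℝ E H} [TopologicalSpace N] [ChartedSpace H N] [NormedAddCommGroup V]
  [NormedSpace ℝ V] [NormedAddCommGroup X] [NormedSpace ℝ X]

/-- A map that is an isotropic immersion in local coordinates is one. -/
theorem isotropic_of_local {Ω : V → V → ℝ} {f : N → V} {σ : N → X} {g : X → V} {p : N}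
    (hf : f =ᶠ[𝓝 p] fun q => g (σ q)) (hσ : ContMDiffAt I 𝓘(ℝ, X) ∞ σ p)
    (hσi : Function.Injective (mfderiv I 𝓘(ℝ, X) σ p)) (hg : IsotropicImmersionAt Ω g (σ p)) :
    ContMDiffAt I 𝓘(ℝ, V) ∞ f p ∧ Function.Injective (mfderiv I 𝓘(ℝ, V) f p) ∧
      ∀ v w : TangentSpace I p,
        Ω (mfderiv I 𝓘(ℝ, V) f p v) (mfderiv I 𝓘(ℝ, V) f p w) = 0 := by
  have h1 : ContMDiffAt I 𝓘(ℝ, V) ∞ (g ∘ σ) p := hg.1.1.contMDiffAt.comp p hσ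
  have h2 : mfderiv I 𝓘(ℝ, V) f p = (fderiv ℝ g (σ p)).comp (mfderiv I 𝓘(ℝ, X) σ p) := by
    have e : f =ᶠ[𝓝 p] g ∘ σ := hf
    rw [e.mfderiv_eq, mfderiv_comp p (hg.1.1.contMDiffAt.mdifferentiableAt (by simp))
      (hσ.mdifferentiableAt (by simp)), mfderiv_eq_fderiv]
    rfl
  refine ⟨h1.congr_of_eventuallyEq hf, ?_, fun v w => ?_⟩
  · rw [h2]
    exact Function.Injective.comp (g := fderiv ℝ g (σ p)) hg.1.2 hσi
  · rw [h2]
    exact hg.2 _ _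

end LocalCoordinates

variable {V : Type*} [NormedAddCommGroup V] [NormedSpace ℝ V] {d : ℕ}
  {Ω : V → V → ℝ} {L₀ L₁ Δ : Set V}

namespace SmoothingData

variable (D : SmoothingData d Ω L₀ L₁ Δ)

/-- The left or right Lagrangian. -/
def side (_ : SmoothingData d Ω L₀ L₁ Δ) (i : Bool) : Set V := cond i L₁ L₀

/-- The tube that is removed from the left or right Lagrangian. -/
def tube (i : Bool) : Set V := cond i D.rightTube D.leftTube

theorem mem_tube {i : Bool} {z : V} : z ∈ D.tube i ↔ ∃ p, ‖p.2‖ < D.r ∧ D.leg i p = z := by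
  cases i
  · exact ⟨fun ⟨s, x, hx, hz⟩ => ⟨(s, x), hx, hz.symm⟩, fun ⟨p, hp, hz⟩ => ⟨p.1, p.2, hp, hz.symm⟩⟩
  · exact ⟨fun ⟨s, x, hx, hz⟩ => ⟨(s, x), hx, hz.symm⟩, fun ⟨p, hp, hz⟩ => ⟨p.1, p.2, hp, hz.symm⟩⟩

theorem leg_eq {i : Bool} {p p' : ℝ × EuclideanSpace ℝ (Fin d)} (hp : ‖p.2‖ < D.ε)
    (hp' : ‖p'.2‖ < D.ε) : D.leg i p = D.leg i p' ↔ (∃ k : ℤ, p'.1 = p.1 + k) ∧ p.2 = p'.2 := by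
  have h0 : ‖(0 : EuclideanSpace ℝ (Fin d))‖ < D.ε := by simpa using D.ε_pos
  cases i
  · rw [leg_false, leg_false, D.chart_eq hp h0 hp' h0]; simp
  · rw [leg_true, leg_true, D.chart_eq h0 hp h0 hp']; simp

theorem leg_mem_side {i : Bool} {p : ℝ × EuclideanSpace ℝ (Fin d)} (hp : ‖p.2‖ < D.ε) :
    D.leg i p ∈ D.side i := by
  have h0 : ‖(0 : EuclideanSpace ℝ (Fin d))‖ < D.ε := by simpa using D.ε_pos
  cases i
  · exact (D.chart_mem_left _ (D.mem_modelBox hp h0)).2 ⟨rfl, rfl⟩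
  · exact (D.chart_mem_right _ (D.mem_modelBox h0 hp)).2 ⟨rfl, rfl⟩

end SmoothingData

/-- Parametrizations `Q` of the two tori without closed tubes, each by the complement of a ball, that
continue the handle: near the ball both are given, up to the radial factor, by the same linear
maps `B`. The ball is `16 ‖v‖² ≤ 3/4`, and the handle occupies the shell `1/4 < 16 ‖v‖² < 3/4`, which
the inversion preserves. -/
structure FittedPair (D : SmoothingData d Ω L₀ L₁ Δ) where
  B : ℝ → EuclideanSpace ℝ (Fin d) →L[ℝ] EuclideanSpace ℝ (Fin d)
  Q : Bool → ℝ × EuclideanSpace ℝ (Fin d) → V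
  η : ℝ
  B_smooth : ContDiff ℝ ∞ B
  B_per : ∀ s, B (s + 1) = B s
  B_inj : ∀ s v, B s v = 0 → v = 0
  η_pos : 0 < η
  η_le : η ≤ 1 / 16
  η_lt : D.r + 4 * D.r * η < D.ε
  Q_iso : ∀ i s v, 3 / 4 < 16 * ‖cubeRep v‖ ^ 2 → IsotropicImmersionAt Ω (Q i) (s, v)
  Q_eq : ∀ i s v, 3 / 4 < 16 * ‖v‖ ^ 2 → 16 * ‖v‖ ^ 2 < 3 / 4 + η → Q i (s, v) =
    D.leg i (s, (4 * D.r * (16 * ‖v‖ ^ 2 - 1 / 2) / ‖B s v‖) • D.legSign i • B s v)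
  Q_inj : ∀ i (w w' : ℝ × EuclideanSpace ℝ (Fin d)), 3 / 4 < 16 * ‖cubeRep w.2‖ ^ 2 →
    3 / 4 < 16 * ‖cubeRep w'.2‖ ^ 2 → (Q i w = Q i w' ↔
      (∃ k : ℤ, w'.1 = w.1 + k) ∧ cubeRep w.2 = cubeRep w'.2)
  Q_image : ∀ i, Q i '' {w | 3 / 4 < 16 * ‖cubeRep w.2‖ ^ 2} =
    D.side i \ D.leg i '' {p | ‖p.2‖ ≤ D.r}

namespace FittedPair

variable {D : SmoothingData d Ω L₀ L₁ Δ} (S : FittedPair D)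

/-- The height on the handle: it is `r` for `16 ‖v‖² = 3/4`, and the inversion changes its sign. -/
def ht (_ : FittedPair D) (v : EuclideanSpace ℝ (Fin d)) : ℝ := 4 * D.r * (16 * ‖v‖ ^ 2 - 1 / 2)

/-- The direction on the handle. -/
def dir (s : ℝ) (v : EuclideanSpace ℝ (Fin d)) : EuclideanSpace ℝ (Fin d) :=
  ‖S.B s v‖⁻¹ • S.B s v

/-- The handle. -/
def hd (i : Bool) (w : ℝ × EuclideanSpace ℝ (Fin d)) : V :=
  D.handlePt i w.1 (S.ht w.2) (S.dir w.1 w.2)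

theorem B_norm_pos {s : ℝ} {v : EuclideanSpace ℝ (Fin d)} (hv : v ≠ 0) : 0 < ‖S.B s v‖ :=
  norm_pos_iff.2 fun h => hv (S.B_inj s v h)

theorem B_add_int (s : ℝ) (k : ℤ) : S.B (s + k) = S.B s := by
  have : Function.Periodic S.B 1 := S.B_per
  have := this.int_mul k s
  rwa [mul_one] at this

theorem norm_dir {s : ℝ} {v : EuclideanSpace ℝ (Fin d)} (hv : v ≠ 0) : ‖S.dir s v‖ = 1 := by
  rw [dir, norm_smul, norm_inv, norm_norm, inv_mul_cancel₀ (S.B_norm_pos hv).ne']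

theorem dir_smul {s t : ℝ} {v : EuclideanSpace ℝ (Fin d)} (ht : 0 < t) :
    S.dir s (t • v) = S.dir s v := by
  rw [dir, dir, map_smul, norm_smul, Real.norm_of_nonneg ht.le, smul_smul, mul_inv, mul_comm t⁻¹,
    mul_assoc, inv_mul_cancel₀ ht.ne', mul_one]

theorem eq_of_dir_eq {s s' : ℝ} {v v' : EuclideanSpace ℝ (Fin d)} (hs : ∃ k : ℤ, s' = s + k)
    (hv : v ≠ 0) (hv' : v' ≠ 0) (hn : ‖v‖ = ‖v'‖) (h : S.dir s v = S.dir s' v') : v = v' := by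
  obtain ⟨k, rfl⟩ := hs
  have h1 := S.B_norm_pos (s := s) hv
  have h2 := S.B_norm_pos (s := s) hv'
  rw [dir, dir, S.B_add_int, ← map_smul, ← map_smul, ← sub_eq_zero, ← map_sub] at h
  have h3 := sub_eq_zero.1 (S.B_inj s _ h)
  have h4 := congrArg norm h3
  rw [norm_smul, norm_smul, hn, norm_inv, norm_inv, norm_norm, norm_norm] at h4
  have h5 := mul_right_cancel₀ (norm_ne_zero_iff.2 hv') h4
  rw [h5] at h3
  exact smul_right_injective _ (inv_ne_zero h2.ne') h3

theorem exists_dir_eq (s : ℝ) {ρ : ℝ} (hρ : 0 < ρ) {ξ : EuclideanSpace ℝ (Fin d)} (hξ : ‖ξ‖ = 1) :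
    ∃ v, ‖v‖ = ρ ∧ S.dir s v = ξ := by
  have hs : Function.Surjective (S.B s : _ →ₗ[ℝ] EuclideanSpace ℝ (Fin d)) :=
    LinearMap.injective_iff_surjective.1 ((injective_iff_map_eq_zero _).2 (S.B_inj s))
  obtain ⟨u, hu⟩ := hs ξ
  have hu' : S.B s u = ξ := hu
  have hu0 : u ≠ 0 := by rintro rfl; rw [map_zero] at hu'; rw [← hu'] at hξ; simp at hξ
  have hn : 0 < ‖u‖ := norm_pos_iff.2 hu0
  refine ⟨(ρ / ‖u‖) • u, ?_, ?_⟩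
  · rw [norm_smul, Real.norm_of_nonneg (by positivity)]; field_simp
  · rw [S.dir_smul (by positivity), dir, hu', hξ, inv_one, one_smul]

theorem abs_ht_lt {v : EuclideanSpace ℝ (Fin d)} (h1 : 1 / 4 ≤ 16 * ‖v‖ ^ 2)
    (h2 : 16 * ‖v‖ ^ 2 < 3 / 4 + S.η) : |S.ht v| < D.ε := by
  have hr := D.r_pos
  have := S.η_pos
  have := S.η_lt
  have h3 := D.r_lt
  rw [ht, abs_lt]
  constructor <;> nlinarith

theorem norm_eq_of_ht_eq {v v' : EuclideanSpace ℝ (Fin d)} (h : S.ht v = S.ht v') : ‖v‖ = ‖v'‖ := by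
  have hr := D.r_pos
  have h1 := mul_left_cancel₀ (by positivity) h
  have : ‖v‖ ^ 2 = ‖v'‖ ^ 2 := by linarith
  exact (sq_eq_sq₀ (norm_nonneg _) (norm_nonneg _)).1 this

theorem ne_zero_of_lt {c : ℝ} {v : EuclideanSpace ℝ (Fin d)} (hc : 0 ≤ c) (h : c < 16 * ‖v‖ ^ 2) :
    v ≠ 0 := by
  rintro rfl
  rw [norm_zero] at h; norm_num at h; linarith

theorem Q_eq_hd {i : Bool} {s : ℝ} {v : EuclideanSpace ℝ (Fin d)} (h1 : 3 / 4 < 16 * ‖v‖ ^ 2)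
    (h2 : 16 * ‖v‖ ^ 2 < 3 / 4 + S.η) : S.Q i (s, v) = S.hd i (s, v) := by
  have hr := D.r_pos
  rw [S.Q_eq i s v h1 h2, hd, D.handlePt_of_ge i (show D.r ≤ S.ht v by rw [ht]; nlinarith)]
  simp only [dir, ht, smul_smul]
  congr 3
  ring

/-- The inversion exchanges the ends of the handle: it preserves directions and changes the sign of
the height. -/
theorem hd_neckInv {i : Bool} {s : ℝ} {v : EuclideanSpace ℝ (Fin d)} (hv : v ≠ 0)
    (hv4 : ‖v‖ < 1 / 4) : S.hd (!i) (s, neckInv v) = S.hd i (s, v) := by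
  have h := neckRel_neckInv hv hv4
  have h0 : 0 < ‖v‖ := norm_pos_iff.2 hv
  have h1 : S.dir s (neckInv v) = S.dir s v := by
    refine S.dir_smul (Real.sqrt_pos.2 ?_)
    rw [sub_pos, lt_div_iff₀ (by positivity)]; nlinarith
  have h2 : S.ht (neckInv v) = -S.ht v := by
    rw [ht, ht, h.2.2]; ring
  rw [hd, hd, D.handlePt_not]
  simp only [h1, h2, neg_neg]

open Classical in
/-- The immersion on one half of the double torus, up to and including the handle. -/
def half (i : Bool) (w : ℝ × EuclideanSpace ℝ (Fin d)) : V :=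
  if 3 / 4 < 16 * ‖cubeRep w.2‖ ^ 2 then S.Q i w else S.hd i (w.1, cubeRep w.2)

open Classical in
/-- The immersion in the coordinates of one half of the double torus. -/
def loc (i : Bool) (w : ℝ × EuclideanSpace ℝ (Fin d)) : V :=
  if 1 / 4 ≤ 16 * ‖cubeRep w.2‖ ^ 2 then S.half i w else S.half (!i) (w.1, neckInv (cubeRep w.2))

theorem half_of_lt {i : Bool} {w : ℝ × EuclideanSpace ℝ (Fin d)} (h : 3 / 4 < 16 * ‖cubeRep w.2‖ ^ 2) :
    S.half i w = S.Q i w := if_pos h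

theorem half_of_le {i : Bool} {w : ℝ × EuclideanSpace ℝ (Fin d)} (h : 16 * ‖cubeRep w.2‖ ^ 2 ≤ 3 / 4) :
    S.half i w = S.hd i (w.1, cubeRep w.2) := if_neg (not_lt.2 h)

theorem half_of_zone {i : Bool} {w : ℝ × EuclideanSpace ℝ (Fin d)}
    (h : 16 * ‖cubeRep w.2‖ ^ 2 < 3 / 4 + S.η) : S.half i w = S.hd i (w.1, cubeRep w.2) := by
  rcases lt_or_ge (3 / 4) (16 * ‖cubeRep w.2‖ ^ 2) with h1 | h1
  · rw [S.half_of_lt h1, ← S.Q_eq_hd h1 h]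
    exact (S.Q_inj i _ _ h1 (by simpa only [cubeRep_cubeRep] using h1)).2
      ⟨⟨0, by simp⟩, (cubeRep_cubeRep _).symm⟩
  · exact S.half_of_le h1

theorem half_eq {i : Bool} {w w' : ℝ × EuclideanSpace ℝ (Fin d)} (hs : ∃ k : ℤ, w'.1 = w.1 + k)
    (h : cubeRep w.2 = cubeRep w'.2) (h4 : 1 / 4 ≤ 16 * ‖cubeRep w.2‖ ^ 2) :
    S.half i w = S.half i w' := by
  rcases lt_or_ge (3 / 4) (16 * ‖cubeRep w.2‖ ^ 2) with h1 | h1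
  · rw [S.half_of_lt h1, S.half_of_lt (h ▸ h1)]
    exact (S.Q_inj i _ _ h1 (h ▸ h1)).2 ⟨hs, h⟩
  · have h0 : cubeRep w.2 ≠ 0 := ne_zero_of_lt (c := 1 / 8) (by norm_num) (by linarith)
    have h2 := S.abs_ht_lt h4 (by linarith [S.η_pos])
    rw [S.half_of_le h1, S.half_of_le (h ▸ h1), ← h]
    refine (D.handlePt_eq_iff h2 h2 (S.norm_dir h0) (S.norm_dir h0)).2 ⟨hs, rfl, ?_⟩
    obtain ⟨k, hk⟩ := hs
    simp only [hk, dir, S.B_add_int]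

theorem half_neckInv {i : Bool} {s : ℝ} {v : EuclideanSpace ℝ (Fin d)} (hv : cubeRep v = v)
    (h1 : 1 / 4 ≤ 16 * ‖v‖ ^ 2) (h2 : 16 * ‖v‖ ^ 2 ≤ 3 / 4) :
    S.half (!i) (s, neckInv v) = S.half i (s, v) := by
  have h0 : v ≠ 0 := ne_zero_of_lt (c := 1 / 8) (by norm_num) (by linarith)
  have h4 : ‖v‖ < 1 / 4 := by nlinarith [norm_nonneg v]
  have h5 := neckRel_neckInv h0 h4
  have h6 : cubeRep (neckInv v) = neckInv v := cubeRep_eq_self (by linarith [neckInv_lt h0 h4])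
  rw [S.half_of_le (w := (s, v)) (by rwa [hv]), S.half_of_le (w := (s, neckInv v))
    (by simp only [h6, h5.2.2]; linarith)]
  simp only [h6, hv]
  exact S.hd_neckInv h0 h4

theorem loc_of_le {i : Bool} {w : ℝ × EuclideanSpace ℝ (Fin d)} (h : 1 / 4 ≤ 16 * ‖cubeRep w.2‖ ^ 2) :
    S.loc i w = S.half i w := if_pos h

theorem loc_of_lt {i : Bool} {w : ℝ × EuclideanSpace ℝ (Fin d)} (h : 16 * ‖cubeRep w.2‖ ^ 2 < 1 / 4) :
    S.loc i w = S.half (!i) (w.1, neckInv (cubeRep w.2)) := if_neg (not_le.2 h)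

theorem loc_neckInv {i : Bool} {s : ℝ} {v : EuclideanSpace ℝ (Fin d)} (h0 : v ≠ 0)
    (h4 : ‖v‖ < 1 / 4) : S.loc (!i) (s, neckInv v) = S.loc i (s, v) := by
  have hv : cubeRep v = v := cubeRep_eq_self (by linarith)
  have h5 := neckRel_neckInv h0 h4
  have h6 : cubeRep (neckInv v) = neckInv v := cubeRep_eq_self (by linarith [neckInv_lt h0 h4])
  have h7 : 16 * ‖cubeRep (neckInv v)‖ ^ 2 = 1 - 16 * ‖v‖ ^ 2 := by rw [h6, h5.2.2]; ring
  rcases lt_or_ge (16 * ‖v‖ ^ 2) (1 / 4) with h | h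
  · rw [S.loc_of_lt (w := (s, v)) (by rwa [hv]), S.loc_of_le (w := (s, neckInv v))
      (by simp only [h7]; linarith), hv]
  · rw [S.loc_of_le (w := (s, v)) (by rwa [hv])]
    rcases lt_or_ge (3 / 4) (16 * ‖v‖ ^ 2) with h' | h'
    · rw [S.loc_of_lt (w := (s, neckInv v)) (by simp only [h7]; linarith)]
      simp only [h6, neckInv_neckInv h0 h4, Bool.not_not]
    · rw [S.loc_of_le (w := (s, neckInv v)) (by simp only [h7]; linarith), S.half_neckInv hv h h']

theorem loc_eq {i : Bool} {w w' : ℝ × EuclideanSpace ℝ (Fin d)} (hs : ∃ k : ℤ, w'.1 = w.1 + k)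
    (h : cubeRep w.2 = cubeRep w'.2) (h0 : cubeRep w.2 ≠ 0) : S.loc i w = S.loc i w' := by
  rcases lt_or_ge (16 * ‖cubeRep w.2‖ ^ 2) (1 / 4) with h1 | h1
  · have h4 : ‖cubeRep w.2‖ < 1 / 4 := by nlinarith [norm_nonneg (cubeRep w.2)]
    have h5 := neckRel_neckInv h0 h4
    have h6 : cubeRep (neckInv (cubeRep w.2)) = neckInv (cubeRep w.2) :=
      cubeRep_eq_self (by linarith [neckInv_lt h0 h4])
    rw [S.loc_of_lt h1, S.loc_of_lt (h ▸ h1), ← h]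
    exact S.half_eq hs rfl (by simp only [h6, h5.2.2]; linarith)
  · rw [S.loc_of_le h1, S.loc_of_le (h ▸ h1)]
    exact S.half_eq hs h h1

theorem loc_compat [NeZero d] {i j : Bool} {w w' : ℝ × EuclideanSpace ℝ (Fin d)}
    (hs : ∃ k : ℤ, w'.1 = w.1 + k) (h0 : cubeRep w.2 ≠ 0) (h0' : cubeRep w'.2 ≠ 0)
    (h : patch i w.2 = patch j w'.2) : S.loc i w = S.loc j w' := by
  rcases (patch_eq_iff h0 h0').1 h with ⟨rfl, h1⟩ | ⟨hij, h1⟩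
  · exact S.loc_eq hs h1 h0
  · have hj : j = !i := by revert hij; cases i <;> cases j <;> simp
    subst hj
    obtain ⟨h2, h3⟩ := (neckRel_iff h0 h0').1 h1
    have e1 : S.loc i w = S.loc i (w'.1, cubeRep w.2) := S.loc_eq hs (cubeRep_cubeRep _).symm h0
    have e2 : S.loc (!i) w' = S.loc (!i) (w'.1, cubeRep w'.2) :=
      S.loc_eq ⟨0, by simp⟩ (cubeRep_cubeRep _).symm h0'
    rw [e1, e2, h3, S.loc_neckInv h0 h2]

theorem loc_iso (i : Bool) {s : ℝ} {v : EuclideanSpace ℝ (Fin d)} (h0 : cubeRep v ≠ 0) :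
    IsotropicImmersionAt Ω (S.loc i) (s, v) := by
  have main : ∀ (i : Bool) {s : ℝ} {v : EuclideanSpace ℝ (Fin d)}, 1 / 4 < 16 * ‖cubeRep v‖ ^ 2 →
      IsotropicImmersionAt Ω (S.loc i) (s, v) := by
    intro i s v h
    rcases lt_or_ge (16 * ‖cubeRep v‖ ^ 2) (3 / 4 + S.η) with h1 | h1
    · have hη := S.η_le
      obtain ⟨l, hl, hlv, hle⟩ := TorusTube.exists_translate (v := v)
        (by nlinarith [norm_nonneg (cubeRep v)]) s
      have h2 : IsotropicImmersionAt Ω (S.hd i) (l (s, v)) := by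
        rw [hlv]
        exact D.isotropicImmersionAt_handlePt i S.B_smooth S.B_inj
          (ne_zero_of_lt (by norm_num) h) (S.abs_ht_lt h.le h1)
      refine (h2.comp hl).congr ?_
      filter_upwards [hle, TorusTube.eventually_lt_sq_norm_cubeRep (s := s) h,
        TorusTube.eventually_sq_norm_cubeRep_lt (s := s) h1] with w hw a b
      rw [S.loc_of_le a.le, S.half_of_zone b, hw]
    · have h2 : 3 / 4 < 16 * ‖cubeRep v‖ ^ 2 := by linarith [S.η_pos]
      refine (S.Q_iso i s v h2).congr ?_
      filter_upwards [TorusTube.eventually_lt_sq_norm_cubeRep (s := s) h2] with w hw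
      rw [S.loc_of_le (by linarith), S.half_of_lt hw]
  rcases lt_or_ge (1 / 4) (16 * ‖cubeRep v‖ ^ 2) with h | h
  · exact main i h
  · have h4 : ‖cubeRep v‖ < 1 / 4 := by nlinarith [norm_nonneg (cubeRep v)]
    have h5 := neckRel_neckInv h0 h4
    have h6 : cubeRep (neckInv (cubeRep v)) = neckInv (cubeRep v) :=
      cubeRep_eq_self (by linarith [neckInv_lt h0 h4])
    obtain ⟨l, hl, hlv, hle⟩ := TorusTube.exists_translate (v := v) (by linarith) s
    have i1 : ImmersionAt (fun w : ℝ × EuclideanSpace ℝ (Fin d) => (w.1, neckInv w.2))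
        (l (s, v)) := by
      rw [hlv]
      obtain ⟨k1, k2⟩ := immersionAt_neckInv h0 h4
      have k3 := (k1.differentiableAt (by simp)).hasFDerivAt
      refine immersionAt_of_hasFDerivAt (contDiffAt_fst.prodMk (ContDiffAt.comp (s, cubeRep v)
        (f := fun w : ℝ × EuclideanSpace ℝ (Fin d) => w.2) k1 contDiffAt_snd))
        (hasFDerivAt_fst.prodMk (HasFDerivAt.comp (s, cubeRep v)
          (f := fun w : ℝ × EuclideanSpace ℝ (Fin d) => w.2) k3 hasFDerivAt_snd)) fun q hq => ?_
      have e1 : q.1 = 0 := by simpa using congrArg Prod.fst hq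
      have e2 : fderiv ℝ neckInv (cubeRep v) q.2 = 0 := by simpa using congrArg Prod.snd hq
      exact Prod.ext e1 ((injective_iff_map_eq_zero _).1 k2 _ e2)
    have i2 : IsotropicImmersionAt Ω (S.loc (!i)) ((l (s, v)).1, neckInv (l (s, v)).2) := by
      rw [hlv]
      exact main (!i) (by rw [h6, h5.2.2]; linarith)
    refine (IsotropicImmersionAt.comp (l := fun x => ((l x).1, neckInv (l x).2)) i2
      (ImmersionAt.comp i1 hl)).congr ?_
    have e1 : ∀ᶠ w : ℝ × EuclideanSpace ℝ (Fin d) in 𝓝 (s, v), ‖cubeRep w.2‖ < 1 / 4 :=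
      eventually_norm_cubeRep_lt h4 s
    have e2 : ∀ᶠ w : ℝ × EuclideanSpace ℝ (Fin d) in 𝓝 (s, v), cubeRep w.2 ≠ 0 :=
      continuous_snd.continuousAt.eventually (eventually_cubeRep_ne h0)
    filter_upwards [hle, e1, e2] with w a b c
    rw [a, S.loc_neckInv c b]
    exact S.loc_eq ⟨0, by simp⟩ (cubeRep_cubeRep _).symm c

variable [NeZero d]

/-- The smoothing as a map of `S¹` times the double torus. -/
def glued (x : Circle × DoubleTorus d) : V :=
  S.loc (exists_patch x.2).choose
    ((surjective_circleCover x.1).choose, (exists_patch x.2).choose_spec.choose)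

theorem glued_apply (i : Bool) (s : ℝ) {v : EuclideanSpace ℝ (Fin d)} (hv : cubeRep v ≠ 0) :
    S.glued (circleCover s, patch i v) = S.loc i (s, v) := by
  have h1 := (surjective_circleCover (circleCover s)).choose_spec
  have h2 := (exists_patch (patch i v)).choose_spec.choose_spec
  exact S.loc_compat (w := (_, _)) (w' := (s, v)) (circleCover_eq_iff.1 h1) h2.1 hv h2.2

theorem glued_isLagrangian (hdim : 2 * (1 + d) = Module.finrank ℝ V) :
    IsLagrangianImmersion ((𝓡 1).prod (𝓡 d)) Ω S.glued := by
  have key : ∀ x : Circle × DoubleTorus d,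
      ContMDiffAt ((𝓡 1).prod (𝓡 d)) 𝓘(ℝ, V) ∞ S.glued x ∧
      Function.Injective (mfderiv ((𝓡 1).prod (𝓡 d)) 𝓘(ℝ, V) S.glued x) ∧
      ∀ v w : TangentSpace ((𝓡 1).prod (𝓡 d)) x,
        Ω (mfderiv ((𝓡 1).prod (𝓡 d)) 𝓘(ℝ, V) S.glued x v)
          (mfderiv ((𝓡 1).prod (𝓡 d)) 𝓘(ℝ, V) S.glued x w) = 0 := by
    rintro ⟨z, p⟩
    obtain ⟨s, rfl⟩ := surjective_circleCover z
    obtain ⟨i, v, hv, rfl⟩ := exists_patch p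
    have l1 := isLocalDiffeomorph_circleCover s
    have l2 := isLocalDiffeomorphAt_patch i hv
    have a1 : l1.localInverse (circleCover s) = s := l1.localInverse_left_inv l1.localInverse_mem_target
    have a2 : l2.localInverse (patch i v) = v := l2.localInverse_left_inv l2.localInverse_mem_target
    let σ : Circle × DoubleTorus d → ℝ × EuclideanSpace ℝ (Fin d) := fun x =>
      (l1.localInverse x.1, l2.localInverse x.2)
    have hσx : σ (circleCover s, patch i v) = (s, v) := Prod.ext a1 a2
    have c1 : ContMDiffAt ((𝓡 1).prod (𝓡 d)) 𝓘(ℝ, ℝ) ∞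
        (fun x : Circle × DoubleTorus d => l1.localInverse x.1) (circleCover s, patch i v) :=
      ContMDiffAt.comp (g := l1.localInverse) (f := fun x : Circle × DoubleTorus d => x.1)
        (circleCover s, patch i v) l1.localInverse_contMDiffAt contMDiffAt_fst
    have c2 : ContMDiffAt ((𝓡 1).prod (𝓡 d)) (𝓡 d) ∞
        (fun x : Circle × DoubleTorus d => l2.localInverse x.2) (circleCover s, patch i v) :=
      ContMDiffAt.comp (g := l2.localInverse) (f := fun x : Circle × DoubleTorus d => x.2)
        (circleCover s, patch i v) l2.localInverse_contMDiffAt contMDiffAt_snd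
    have hσ : ContMDiffAt ((𝓡 1).prod (𝓡 d)) 𝓘(ℝ, ℝ × EuclideanSpace ℝ (Fin d)) ∞ σ
        (circleCover s, patch i v) := c1.prodMk_space c2
    have ev2 : ∀ᶠ x : Circle × DoubleTorus d in 𝓝 (circleCover s, patch i v),
        patch i (l2.localInverse x.2) = x.2 :=
      (continuous_snd.tendsto (circleCover s, patch i v)).eventually
        (p := fun y => patch i (l2.localInverse y) = y) l2.localInverse_eventuallyEq_right
    have ev1 : ∀ᶠ x : Circle × DoubleTorus d in 𝓝 (circleCover s, patch i v),
        circleCover (l1.localInverse x.1) = x.1 :=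
      (continuous_fst.tendsto (circleCover s, patch i v)).eventually
        (p := fun y => circleCover (l1.localInverse y) = y) l1.localInverse_eventuallyEq_right
    refine isotropic_of_local (g := S.loc i) (σ := σ) ?_ hσ ?_ (by rw [hσx]; exact S.loc_iso i hv)
    · have ev3 : ∀ᶠ x : Circle × DoubleTorus d in 𝓝 (circleCover s, patch i v),
          cubeRep (l2.localInverse x.2) ≠ 0 := by
        have h3 := c2.continuousAt
        rw [ContinuousAt] at h3
        simp only [a2] at h3
        exact h3.eventually (p := fun y => cubeRep y ≠ 0) (eventually_cubeRep_ne hv)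
      filter_upwards [ev1, ev2, ev3] with x b1 b2 b3
      have := S.glued_apply i (l1.localInverse x.1) b3
      rw [b1, b2] at this
      exact this
    · let π : ℝ × EuclideanSpace ℝ (Fin d) → Circle × DoubleTorus d := fun w =>
        (circleCover w.1, patch i w.2)
      have hπ : ContMDiffAt 𝓘(ℝ, ℝ × EuclideanSpace ℝ (Fin d)) ((𝓡 1).prod (𝓡 d)) ∞ π
          (σ (circleCover s, patch i v)) := by
        rw [hσx]
        have p1 : ContMDiffAt 𝓘(ℝ, ℝ × EuclideanSpace ℝ (Fin d)) (𝓡 1) ∞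
            (fun w : ℝ × EuclideanSpace ℝ (Fin d) => circleCover w.1) (s, v) :=
          ContMDiffAt.comp (g := circleCover) (f := fun w : ℝ × EuclideanSpace ℝ (Fin d) => w.1)
            (s, v) l1.contMDiffAt contDiff_fst.contMDiff.contMDiffAt
        have p2 : ContMDiffAt 𝓘(ℝ, ℝ × EuclideanSpace ℝ (Fin d)) (𝓡 d) ∞
            (fun w : ℝ × EuclideanSpace ℝ (Fin d) => patch i w.2) (s, v) :=
          ContMDiffAt.comp (g := patch i) (f := fun w : ℝ × EuclideanSpace ℝ (Fin d) => w.2)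
            (s, v) l2.contMDiffAt contDiff_snd.contMDiff.contMDiffAt
        exact p1.prodMk p2
      have hid : π ∘ σ =ᶠ[𝓝 (circleCover s, patch i v)] id := by
        filter_upwards [ev1, ev2] with x b1 b2 using Prod.ext b1 b2
      have hcomp := mfderiv_comp (circleCover s, patch i v) (hπ.mdifferentiableAt (by simp))
        (hσ.mdifferentiableAt (by simp))
      rw [hid.mfderiv_eq, mfderiv_id] at hcomp
      intro a b hab
      have := congrArg (mfderiv 𝓘(ℝ, ℝ × EuclideanSpace ℝ (Fin d)) ((𝓡 1).prod (𝓡 d)) π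
        (σ (circleCover s, patch i v))) hab
      have ha := DFunLike.congr_fun hcomp a
      have hb := DFunLike.congr_fun hcomp b
      exact ha.trans (this.trans hb.symm)
  refine ⟨fun x => (key x).1, ?_, fun x => (key x).2.1, fun x => (key x).2.2⟩
  rw [← hdim]
  simp

end FittedPair

end

/-! ### The pieces of a smoothing -/

namespace FittedPair

variable {V : Type*} [NormedAddCommGroup V] [NormedSpace ℝ V] {d : ℕ}
  {Ω : V → V → ℝ} {L₀ L₁ Δ : Set V} {D : SmoothingData d Ω L₀ L₁ Δ} (S : FittedPair D)

theorem half_of_eq {i : Bool} {s : ℝ} {v : EuclideanSpace ℝ (Fin d)} (hv : cubeRep v = v)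
    (h : 16 * ‖v‖ ^ 2 = 3 / 4) : S.half i (s, v) = D.leg i (s, D.r • D.legSign i • S.dir s v) := by
  have h1 : S.ht v = D.r := by rw [ht, h]; ring
  rw [S.half_of_le (w := (s, v)) (by rw [hv, h]), hv, hd, h1, D.handlePt_of_ge i le_rfl]

theorem norm_leg_dir {i : Bool} {s : ℝ} {v : EuclideanSpace ℝ (Fin d)} (hv : v ≠ 0) :
    ‖D.r • D.legSign i • S.dir s v‖ = D.r := by
  rw [norm_smul, norm_smul, S.norm_dir hv, Real.norm_eq_abs, Real.norm_eq_abs, D.abs_legSign,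
    abs_of_pos D.r_pos, mul_one, mul_one]

variable [NeZero d]

/-- The part of `S¹` times the double torus that goes to the left or right punctured torus. -/
def outer (_ : FittedPair D) (i : Bool) : Set (Circle × DoubleTorus d) :=
  univ ×ˢ (patch i '' {v | cubeRep v = v ∧ 3 / 4 ≤ 16 * ‖cubeRep v‖ ^ 2})

theorem isClosed_outer (i : Bool) : IsClosed (S.outer i) :=
  isClosed_univ.prod (isCompact_image_patch i (by norm_num)).isClosed

theorem mem_outer {i : Bool} {x : Circle × DoubleTorus d} : x ∈ S.outer i ↔
    ∃ s v, cubeRep v = v ∧ 3 / 4 ≤ 16 * ‖v‖ ^ 2 ∧ (circleCover s, patch i v) = x := by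
  constructor
  · rintro ⟨-, v, ⟨h1, h2⟩, h3⟩
    obtain ⟨s, hs⟩ := surjective_circleCover x.1
    exact ⟨s, v, h1, by rwa [h1] at h2, Prod.ext hs h3⟩
  · rintro ⟨s, v, h1, h2, rfl⟩
    exact ⟨mem_univ _, v, ⟨h1, by rwa [h1]⟩, rfl⟩

theorem not_mem_outer {i : Bool} {s : ℝ} {v : EuclideanSpace ℝ (Fin d)} (hv : cubeRep v = v)
    (h1 : 1 / 4 < 16 * ‖v‖ ^ 2) (h2 : 16 * ‖v‖ ^ 2 < 3 / 4) (j : Bool) :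
    (circleCover s, patch i v) ∉ S.outer j := by
  intro h
  obtain ⟨t, w, hw, h3, h4⟩ := S.mem_outer.1 h
  have hv0 : cubeRep v ≠ 0 := by rw [hv]; exact ne_zero_of_lt (c := 1 / 4) (by norm_num) h1
  have hw0 : cubeRep w ≠ 0 := by
    rw [hw]; exact ne_zero_of_lt (c := 1 / 4) (by norm_num) (by linarith)
  have h5 : patch j w = patch i v := congrArg Prod.snd h4
  rcases (patch_eq_iff hw0 hv0).1 h5 with ⟨-, h6⟩ | ⟨-, h6⟩
  · rw [hw, hv] at h6; rw [h6] at h3; linarith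
  · rw [hw, hv] at h6; have := h6.1; linarith

theorem disjoint_outer : Disjoint (S.outer false) (S.outer true) := by
  rw [Set.disjoint_left]
  intro x h h'
  obtain ⟨s, v, hv, h1, rfl⟩ := S.mem_outer.1 h
  obtain ⟨t, w, hw, h3, h4⟩ := S.mem_outer.1 h'
  have hv0 : cubeRep v ≠ 0 := by
    rw [hv]; exact ne_zero_of_lt (c := 1 / 4) (by norm_num) (by linarith)
  have hw0 : cubeRep w ≠ 0 := by
    rw [hw]; exact ne_zero_of_lt (c := 1 / 4) (by norm_num) (by linarith)
  have h5 : patch true w = patch false v := congrArg Prod.snd h4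
  rcases (patch_eq_iff hw0 hv0).1 h5 with ⟨h6, -⟩ | ⟨-, h6⟩
  · cases h6
  · rw [hw, hv] at h6; have := h6.1; linarith

theorem glued_outer {i : Bool} {s : ℝ} {v : EuclideanSpace ℝ (Fin d)} (hv : cubeRep v = v)
    (h : 1 / 4 < 16 * ‖v‖ ^ 2) : S.glued (circleCover s, patch i v) = S.half i (s, v) := by
  rw [S.glued_apply i s (by rw [hv]; exact ne_zero_of_lt (c := 1 / 4) (by norm_num) h),
    S.loc_of_le (by simp only [hv]; exact h.le)]

theorem bijOn_outer (i : Bool) : BijOn S.glued (S.outer i) (D.side i \ D.tube i) := by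
  have hr := D.r_pos
  have hrε := D.r_lt
  -- the boundary sphere goes to the boundary of the tube, everything else to the outside of it
  have hlt : ∀ {s : ℝ} {v}, cubeRep v = v → 3 / 4 < 16 * ‖v‖ ^ 2 →
      S.half i (s, v) ∈ D.side i \ D.leg i '' {p | ‖p.2‖ ≤ D.r} := by
    intro s v hv h
    rw [S.half_of_lt (w := (s, v)) (by rwa [hv]), ← S.Q_image i]
    exact ⟨(s, v), by rwa [mem_ofPred_eq, hv], rfl⟩
  have hne : ∀ {v : EuclideanSpace ℝ (Fin d)}, 3 / 4 ≤ 16 * ‖v‖ ^ 2 → v ≠ 0 :=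
    fun h => ne_zero_of_lt (c := 1 / 4) (by norm_num) (by linarith)
  have heq : ∀ {s : ℝ} {v}, cubeRep v = v → 3 / 4 = 16 * ‖v‖ ^ 2 →
      S.half i (s, v) ∈ D.leg i '' {p | ‖p.2‖ ≤ D.r} := by
    intro s v hv h
    rw [S.half_of_eq hv h.symm]
    refine ⟨(s, D.r • D.legSign i • S.dir s v), ?_, rfl⟩
    rw [mem_ofPred_eq]
    exact (S.norm_leg_dir (hne h.le)).le
  refine ⟨?_, ?_, ?_⟩
  · intro x hx
    obtain ⟨s, v, hv, h1, rfl⟩ := S.mem_outer.1 hx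
    rw [S.glued_outer hv (by linarith)]
    rcases h1.lt_or_eq with h | h
    · refine ⟨(hlt hv h).1, fun ht => (hlt (s := s) hv h).2 ?_⟩
      obtain ⟨p, hp, hp'⟩ := D.mem_tube.1 ht
      exact ⟨p, hp.le, hp'⟩
    · rw [S.half_of_eq hv h.symm]
      have h2 := S.norm_leg_dir (i := i) (s := s) (hne h.le)
      refine ⟨D.leg_mem_side (by simpa only [h2] using hrε), fun ht => ?_⟩
      obtain ⟨p, hp, hp'⟩ := D.mem_tube.1 ht
      have h3 := ((D.leg_eq (hp.trans hrε) (by simpa only [h2] using hrε)).1 hp').2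
      rw [h3] at hp
      simp only [h2, lt_irrefl] at hp
  · intro x hx y hy hxy
    obtain ⟨s, v, hv, h1, rfl⟩ := S.mem_outer.1 hx
    obtain ⟨t, w, hw, h2, rfl⟩ := S.mem_outer.1 hy
    rw [S.glued_outer hv (by linarith), S.glued_outer hw (by linarith)] at hxy
    suffices h : (∃ k : ℤ, t = s + k) ∧ v = w by
      rw [h.2, circleCover_eq_iff.2 h.1]
    rcases h1.lt_or_eq with h1 | h1 <;> rcases h2.lt_or_eq with h2 | h2
    · rw [S.half_of_lt (w := (s, v)) (by rwa [hv]), S.half_of_lt (w := (t, w)) (by rwa [hw])] at hxy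
      have := (S.Q_inj i _ _ (by rwa [hv]) (by rwa [hw])).1 hxy
      rwa [hv, hw] at this
    · exact absurd (show S.half i (s, v) ∈ _ by rw [hxy]; exact heq hw h2) (hlt hv h1).2
    · exact absurd (show S.half i (t, w) ∈ _ by rw [← hxy]; exact heq hv h1) (hlt hw h2).2
    · have hv0 := hne h1.le
      have hw0 := hne h2.le
      rw [S.half_of_le (w := (s, v)) (by rw [hv, h1]), S.half_of_le (w := (t, w)) (by rw [hw, h2])]
        at hxy
      simp only [hv, hw, hd] at hxy
      have h3 := S.η_pos
      obtain ⟨h4, h5, h6⟩ := (D.handlePt_eq_iff (S.abs_ht_lt (by linarith) (by linarith))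
        (S.abs_ht_lt (by linarith) (by linarith)) (S.norm_dir hv0) (S.norm_dir hw0)).1 hxy
      exact ⟨h4, S.eq_of_dir_eq h4 hv0 hw0 (S.norm_eq_of_ht_eq h5) h6⟩
  · rintro z ⟨hz, hzt⟩
    by_cases h : z ∈ D.leg i '' {p | ‖p.2‖ ≤ D.r}
    · obtain ⟨p, hp, rfl⟩ := h
      have hp' : ‖p.2‖ = D.r := le_antisymm hp
        (not_lt.1 fun h => hzt (D.mem_tube.2 ⟨p, h, rfl⟩))
      have h0 : (0 : ℝ) < √(3 / 64) := Real.sqrt_pos.2 (by norm_num)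
      have hn : ‖D.legSign i • D.r⁻¹ • p.2‖ = 1 := by
        rw [norm_smul, norm_smul, hp', Real.norm_eq_abs, D.abs_legSign, one_mul,
          Real.norm_of_nonneg (by positivity), inv_mul_cancel₀ hr.ne']
      obtain ⟨v, h1, h2⟩ := S.exists_dir_eq p.1 h0 hn
      have h3 : 16 * ‖v‖ ^ 2 = 3 / 4 := by rw [h1, Real.sq_sqrt (by norm_num)]; norm_num
      have hv : cubeRep v = v := cubeRep_eq_self (by nlinarith [norm_nonneg v])
      refine ⟨(circleCover p.1, patch i v), S.mem_outer.2 ⟨p.1, v, hv, h3.ge, rfl⟩, ?_⟩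
      rw [S.glued_outer hv (by linarith), S.half_of_eq hv h3, h2, smul_smul (D.legSign i),
        D.legSign_sq, one_smul, smul_inv_smul₀ hr.ne']
    · have h1 : z ∈ S.Q i '' {w | 3 / 4 < 16 * ‖cubeRep w.2‖ ^ 2} := by
        rw [S.Q_image i]; exact ⟨hz, h⟩
      obtain ⟨⟨s, v⟩, hv, rfl⟩ := h1
      rw [mem_ofPred_eq] at hv
      simp only at hv
      have hc : cubeRep (cubeRep v) = cubeRep v := cubeRep_cubeRep v
      have hv' : 3 / 4 < 16 * ‖cubeRep (cubeRep v)‖ ^ 2 := by rwa [hc]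
      refine ⟨(circleCover s, patch i (cubeRep v)), S.mem_outer.2 ⟨s, cubeRep v, hc, hv.le, rfl⟩, ?_⟩
      rw [S.glued_outer hc (by linarith), S.half_of_lt (w := (s, cubeRep v)) hv']
      exact (S.Q_inj i (s, cubeRep v) (s, v) hv' hv).2 ⟨⟨0, by simp⟩, hc⟩

theorem exists_of_not_mem_outer {x : Circle × DoubleTorus d}
    (hx : x ∉ S.outer false ∪ S.outer true) : ∃ s v, cubeRep v = v ∧ 1 / 4 < 16 * ‖v‖ ^ 2 ∧
      16 * ‖v‖ ^ 2 < 3 / 4 ∧ (circleCover s, patch false v) = x := by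
  obtain ⟨s, hs⟩ := surjective_circleCover x.1
  have hx' : ∀ j, x ∉ S.outer j := fun j h => hx (by cases j; exacts [Or.inl h, Or.inr h])
  -- a point of the neck region can be represented in either patch
  have key : ∀ {j : Bool} {v : EuclideanSpace ℝ (Fin d)}, cubeRep v = v → v ≠ 0 →
      patch j v = x.2 → 16 * ‖v‖ ^ 2 < 3 / 4 ∧ cubeRep (neckInv v) = neckInv v ∧
        16 * ‖neckInv v‖ ^ 2 = 1 - 16 * ‖v‖ ^ 2 ∧ neckInv v ≠ 0 ∧
        patch (!j) (neckInv v) = x.2 := by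
    intro j v hv h0 h1
    have h2 : 16 * ‖v‖ ^ 2 < 3 / 4 := by
      by_contra h
      exact hx' j (S.mem_outer.2 ⟨s, v, hv, not_lt.1 h, Prod.ext hs h1⟩)
    have h4 : ‖v‖ < 1 / 4 := by nlinarith [norm_nonneg v]
    have h5 := neckRel_neckInv h0 h4
    refine ⟨h2, cubeRep_eq_self (by linarith [neckInv_lt h0 h4]), by rw [h5.2.2]; ring, h5.2.1, ?_⟩
    rw [← h1, patch_neckInv j h0 h4]
  have main : ∀ {j : Bool} {v : EuclideanSpace ℝ (Fin d)}, cubeRep v = v → v ≠ 0 →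
      patch j v = x.2 → 1 / 4 < 16 * ‖v‖ ^ 2 ∧ 16 * ‖v‖ ^ 2 < 3 / 4 := by
    intro j v hv h0 h1
    obtain ⟨h2, h3, h4, h5, h6⟩ := key hv h0 h1
    have := (key h3 h5 h6).1
    exact ⟨by linarith, h2⟩
  obtain ⟨i, v, hv0, hv⟩ := exists_patch x.2
  rw [← patch_cubeRep i hv0] at hv
  have hc := cubeRep_cubeRep v
  cases i
  · obtain ⟨h1, h2⟩ := main hc hv0 hv
    exact ⟨s, _, hc, h1, h2, Prod.ext hs hv⟩
  · obtain ⟨-, h3, -, h5, h6⟩ := key hc hv0 hv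
    obtain ⟨h1, h2⟩ := main h3 h5 h6
    exact ⟨s, _, h3, h1, h2, Prod.ext hs h6⟩

theorem bijOn_handle : BijOn S.glued (S.outer false ∪ S.outer true)ᶜ D.handle := by
  have hr := D.r_pos
  have hrε := D.r_lt
  have hη := S.η_pos
  have hval : ∀ {s : ℝ} {v}, cubeRep v = v → 1 / 4 < 16 * ‖v‖ ^ 2 → 16 * ‖v‖ ^ 2 < 3 / 4 →
      S.glued (circleCover s, patch false v) = S.hd false (s, v) := by
    intro s v hv h1 h2
    rw [S.glued_outer hv h1, S.half_of_le (by simp only [hv]; exact h2.le), hv]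
  have hne : ∀ {v : EuclideanSpace ℝ (Fin d)}, 1 / 4 < 16 * ‖v‖ ^ 2 → v ≠ 0 :=
    fun h => ne_zero_of_lt (c := 1 / 4) (by norm_num) h
  refine ⟨?_, ?_, ?_⟩
  · intro x hx
    obtain ⟨s, v, hv, h1, h2, rfl⟩ := S.exists_of_not_mem_outer hx
    rw [hval hv h1 h2]
    refine ⟨s, SmoothingData.endSign false * S.ht v, S.dir s v, ?_, S.norm_dir (hne h1), rfl⟩
    rw [ht, abs_lt]
    simp only [SmoothingData.endSign, cond_false]
    constructor <;> nlinarith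
  · intro x hx y hy hxy
    obtain ⟨s, v, hv, h1, h2, rfl⟩ := S.exists_of_not_mem_outer hx
    obtain ⟨t, w, hw, h3, h4, rfl⟩ := S.exists_of_not_mem_outer hy
    rw [hval hv h1 h2, hval hw h3 h4] at hxy
    obtain ⟨e1, e2, e3⟩ := (D.handlePt_eq_iff (S.abs_ht_lt h1.le (by linarith))
      (S.abs_ht_lt h3.le (by linarith)) (S.norm_dir (hne h1)) (S.norm_dir (hne h3))).1 hxy
    rw [S.eq_of_dir_eq e1 (hne h1) (hne h3) (S.norm_eq_of_ht_eq e2) e3, circleCover_eq_iff.2 e1]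
  · rintro z ⟨s, u, ξ, hu, hξ, rfl⟩
    rw [abs_lt] at hu
    -- the radius at which the handle has height `-u`
    have h0 : 1 / 4 < 1 / 2 - u / (4 * D.r) ∧ 1 / 2 - u / (4 * D.r) < 3 / 4 := by
      constructor
      · have : u / (4 * D.r) < 1 / 4 := by rw [div_lt_iff₀ (by positivity)]; linarith
        linarith
      · have : -(1 / 4) < u / (4 * D.r) := by rw [lt_div_iff₀ (by positivity)]; linarith
        linarith
    have hρ : 0 < (1 / 2 - u / (4 * D.r)) / 16 := by linarith
    obtain ⟨v, h1, h2⟩ := S.exists_dir_eq s (Real.sqrt_pos.2 hρ) hξ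
    have h3 : 16 * ‖v‖ ^ 2 = 1 / 2 - u / (4 * D.r) := by rw [h1, Real.sq_sqrt hρ.le]; ring
    have hv : cubeRep v = v := cubeRep_eq_self (by nlinarith [norm_nonneg v])
    refine ⟨(circleCover s, patch false v), ?_, ?_⟩
    · rintro (h | h)
      · exact S.not_mem_outer hv (by linarith) (by linarith) _ h
      · exact S.not_mem_outer hv (by linarith) (by linarith) _ h
    · rw [hval hv (by linarith) (by linarith), hd, SmoothingData.handlePt, h2]
      have : SmoothingData.endSign false * S.ht v = u := by
        rw [ht, h3]; simp only [SmoothingData.endSign, cond_false]; field_simp; ring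
      simp only [this]

theorem glued_isRealizedBy : D.IsRealizedBy S.glued :=
  ⟨S.outer false, S.outer true, S.isClosed_outer _, S.isClosed_outer _, S.disjoint_outer,
    S.bijOn_outer false, S.bijOn_outer true, S.bijOn_handle⟩

end FittedPair

/-! ### Paths of invertible linear maps -/

section Paths

variable {d : ℕ}

/-- Every invertible real matrix is joined to a diagonal matrix of signs by a smooth path of
invertible matrices. -/
theorem exists_matrix_path (B : Matrix (Fin d) (Fin d) ℝ) (hB : B.det ≠ 0) :
    ∃ (e : Fin d → ℝ) (γ : ℝ → Matrix (Fin d) (Fin d) ℝ), (∀ i, e i = 1 ∨ e i = -1) ∧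
      (∀ i j, ContDiff ℝ ∞ fun t => γ t i j) ∧ (∀ t, (γ t).det ≠ 0) ∧
      γ 0 = Matrix.diagonal e ∧ γ 1 = B := by
  refine Matrix.diagonal_transvection_induction_of_det_ne_zero (fun B => ∃ (e : Fin d → ℝ)
    (γ : ℝ → Matrix (Fin d) (Fin d) ℝ), (∀ i, e i = 1 ∨ e i = -1) ∧
      (∀ i j, ContDiff ℝ ∞ fun t => γ t i j) ∧ (∀ t, (γ t).det ≠ 0) ∧
      γ 0 = Matrix.diagonal e ∧ γ 1 = B) B hB ?_ ?_ ?_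
  · intro D hD
    rw [Matrix.det_diagonal, Finset.prod_ne_zero_iff] at hD
    have hD' : ∀ i, D i ≠ 0 := fun i => hD i (Finset.mem_univ i)
    have hs : ∀ i, SignType.sign (D i) * |D i| = D i := fun i => sign_mul_abs (D i)
    have hs0 : ∀ i, ((SignType.sign (D i) : SignType) : ℝ) ≠ 0 := by
      intro i h; have := hs i; rw [h, zero_mul] at this; exact hD' i this.symm
    refine ⟨fun i => SignType.sign (D i), fun t => Matrix.diagonal fun i =>
      SignType.sign (D i) * Real.exp (t * Real.log |D i|), fun i => ?_, fun i j => ?_, fun t => ?_,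
      ?_, ?_⟩
    · rcases lt_or_gt_of_ne (hD' i) with h | h
      · right; simp [sign_neg h]
      · left; simp [sign_pos h]
    · by_cases h : i = j
      · subst h
        simp only [Matrix.diagonal_apply_eq]
        exact contDiff_const.mul (Real.contDiff_exp.comp (contDiff_id.mul contDiff_const))
      · simp only [Matrix.diagonal_apply_ne _ h]
        exact contDiff_const
    · rw [Matrix.det_diagonal, Finset.prod_ne_zero_iff]
      exact fun i _ => mul_ne_zero (hs0 i) (Real.exp_pos _).ne'
    · simp
    · refine congrArg Matrix.diagonal (funext fun i => ?_)
      rw [one_mul, Real.exp_log (abs_pos.2 (hD' i)), hs]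
  · intro t
    refine ⟨fun _ => 1, fun τ => Matrix.transvection t.i t.j (τ * t.c), fun i => Or.inl rfl,
      fun i j => ?_, fun τ => ?_, by simp [Matrix.transvection_zero], by
        simp [Matrix.TransvectionStruct.toMatrix]⟩
    · simp only [Matrix.transvection, Matrix.add_apply, Matrix.single_apply]
      refine contDiff_const.add ?_
      split_ifs
      · exact contDiff_id.mul contDiff_const
      · exact contDiff_const
    · rw [Matrix.det_transvection_of_ne _ _ t.hij]; exact one_ne_zero
  · rintro A B - - ⟨e, γ, h1, h2, h3, h4, h5⟩ ⟨e', γ', h1', h2', h3', h4', h5'⟩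
    refine ⟨fun i => e i * e' i, fun t => γ t * γ' t, fun i => ?_, fun i j => ?_, fun t => ?_, ?_,
      by simp only [h5, h5']⟩
    · rcases h1 i with h | h <;> rcases h1' i with h' | h' <;> simp [h, h']
    · simp only [Matrix.mul_apply]
      exact ContDiff.sum fun k _ => (h2 i k).mul (h2' k j)
    · rw [Matrix.det_mul]; exact mul_ne_zero (h3 t) (h3' t)
    · simp only [h4, h4', Matrix.diagonal_mul_diagonal]

/-- The coordinatewise multiplication by `e`. -/
def diagMap (e : Fin d → ℝ) : EuclideanSpace ℝ (Fin d) →L[ℝ] EuclideanSpace ℝ (Fin d) :=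
  Matrix.toEuclideanCLM (𝕜 := ℝ) (Matrix.diagonal e)

@[simp] theorem diagMap_apply (e : Fin d → ℝ) (v : EuclideanSpace ℝ (Fin d)) (i : Fin d) :
    diagMap e v i = e i * v i := by
  simp [diagMap, Matrix.ofLp_toEuclideanCLM, Matrix.mulVec_diagonal]

theorem diagMap_diagMap {e : Fin d → ℝ} (he : ∀ i, e i = 1 ∨ e i = -1)
    (v : EuclideanSpace ℝ (Fin d)) : diagMap e (diagMap e v) = v := by
  ext i
  rw [diagMap_apply, diagMap_apply, ← mul_assoc]
  rcases he i with h | h <;> simp [h]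

/-- Coordinatewise changes of sign preserve the integer lattice. -/
theorem cubeRep_diagMap_eq_iff {e : Fin d → ℝ} (he : ∀ i, e i = 1 ∨ e i = -1)
    {v w : EuclideanSpace ℝ (Fin d)} :
    cubeRep (diagMap e v) = cubeRep (diagMap e w) ↔ cubeRep v = cubeRep w := by
  have h : ∀ {v w : EuclideanSpace ℝ (Fin d)}, cubeRep v = cubeRep w →
      cubeRep (diagMap e v) = cubeRep (diagMap e w) := by
    intro v w h
    obtain ⟨k, rfl⟩ := cubeRep_eq_iff.1 h
    refine cubeRep_eq_iff.2 ⟨fun i => SignType.sign (e i) * k i, ?_⟩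
    ext i
    rcases he i with h | h <;> simp [h]
  refine ⟨fun h' => ?_, h⟩
  have := h h'
  rwa [diagMap_diagMap he, diagMap_diagMap he] at this

/-- Every invertible linear map is joined to coordinatewise changes of sign by a smooth path of
invertible linear maps. -/
theorem exists_linearMap_path (B : EuclideanSpace ℝ (Fin d) →L[ℝ] EuclideanSpace ℝ (Fin d))
    (hB : ∀ v, B v = 0 → v = 0) :
    ∃ (e : Fin d → ℝ) (γ : ℝ → EuclideanSpace ℝ (Fin d) →L[ℝ] EuclideanSpace ℝ (Fin d)),
      (∀ i, e i = 1 ∨ e i = -1) ∧ ContDiff ℝ ∞ γ ∧ (∀ t v, γ t v = 0 → v = 0) ∧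
      γ 0 = diagMap e ∧ γ 1 = B := by
  let M := (Matrix.toEuclideanCLM (n := Fin d) (𝕜 := ℝ)).symm B
  have hM : Matrix.toEuclideanCLM (𝕜 := ℝ) M = B := StarAlgEquiv.apply_symm_apply _ _
  have hinj : ∀ N : Matrix (Fin d) (Fin d) ℝ, N.det ≠ 0 →
      ∀ v, Matrix.toEuclideanCLM (𝕜 := ℝ) N v = 0 → v = 0 := by
    intro N hN v hv
    have h1 : N.mulVec v.ofLp = 0 := by
      rw [← Matrix.ofLp_toEuclideanCLM, hv]; rfl
    have := Matrix.eq_zero_of_mulVec_eq_zero hN h1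
    ext i; exact congrFun this i
  have hdet : M.det ≠ 0 := by
    intro h
    obtain ⟨v, hv, hv0⟩ := Matrix.exists_mulVec_eq_zero_iff.2 h
    refine hv ?_
    have h1 : B (WithLp.toLp 2 v) = 0 := by
      rw [← hM]
      ext i
      rw [Matrix.ofLp_toEuclideanCLM]
      exact congrFun hv0 i
    have := hB _ h1
    funext i
    simpa using congrArg (fun x : EuclideanSpace ℝ (Fin d) => x i) this
  obtain ⟨e, γ, h1, h2, h3, h4, h5⟩ := exists_matrix_path M hdet
  refine ⟨e, fun t => Matrix.toEuclideanCLM (𝕜 := ℝ) (γ t), h1, ?_, fun t => hinj _ (h3 t),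
    by simp only [h4]; rfl, by simp only [h5, hM]⟩
  rw [contDiff_clm_apply_iff]
  intro v
  rw [contDiff_euclidean]
  intro i
  simp only [Matrix.ofLp_toEuclideanCLM, Matrix.mulVec, dotProduct]
  exact ContDiff.sum fun j _ => (h2 i j).mul contDiff_const

end Paths

/-! ### Torus parametrizations near the loop -/

namespace SmoothingData

variable {V : Type*} [NormedAddCommGroup V] [NormedSpace ℝ V] {d : ℕ}
  {Ω : V → V → ℝ} {L₀ L₁ Δ : Set V} (D : SmoothingData d Ω L₀ L₁ Δ)

/-- The inclusion of the left or right Lagrangian in the local model. -/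
def incl (d : ℕ) (i : Bool) : ℝ × EuclideanSpace ℝ (Fin d) →L[ℝ] LocalModel d :=
  cond i
    ((ContinuousLinearMap.fst ℝ _ _).prod ((0 : _ →L[ℝ] ℝ).prod
      ((0 : _ →L[ℝ] EuclideanSpace ℝ (Fin d)).prod (ContinuousLinearMap.snd ℝ _ _))))
    ((ContinuousLinearMap.fst ℝ _ _).prod ((0 : _ →L[ℝ] ℝ).prod
      ((ContinuousLinearMap.snd ℝ _ _).prod (0 : _ →L[ℝ] EuclideanSpace ℝ (Fin d)))))

/-- The projection of the local model to its left or right Lagrangian. -/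
def proj (d : ℕ) (i : Bool) : LocalModel d →L[ℝ] ℝ × EuclideanSpace ℝ (Fin d) :=
  (ContinuousLinearMap.fst ℝ _ _).prod ((cond i (ContinuousLinearMap.snd ℝ _ _)
    (ContinuousLinearMap.fst ℝ _ _)).comp ((ContinuousLinearMap.snd ℝ _ _).comp
      (ContinuousLinearMap.snd ℝ _ _)))

theorem leg_apply (i : Bool) (p : ℝ × EuclideanSpace ℝ (Fin d)) :
    D.leg i p = D.chart (incl d i p) := by cases i <;> rfl

theorem proj_incl (i : Bool) (p : ℝ × EuclideanSpace ℝ (Fin d)) : proj d i (incl d i p) = p := by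
  cases i <;> rfl

theorem incl_mem (i : Bool) {p : ℝ × EuclideanSpace ℝ (Fin d)} (hp : ‖p.2‖ < D.ε) :
    incl d i p ∈ modelBox d D.ε := by
  have h0 : ‖(0 : EuclideanSpace ℝ (Fin d))‖ < D.ε := by simpa using D.ε_pos
  cases i
  · exact D.mem_modelBox hp h0
  · exact D.mem_modelBox h0 hp

theorem incl_proj {i : Bool} {q : LocalModel d} (hq : q ∈ modelBox d D.ε)
    (h : D.chart q ∈ D.side i) : incl d i (proj d i q) = q := by
  cases i
  · obtain ⟨h1, h2⟩ := (D.chart_mem_left q hq).1 h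
    exact Prod.ext rfl (Prod.ext h1.symm (Prod.ext rfl h2.symm))
  · obtain ⟨h1, h2⟩ := (D.chart_mem_right q hq).1 h
    exact Prod.ext rfl (Prod.ext h1.symm (Prod.ext h2.symm rfl))

theorem modelForm_incl (i : Bool) (p q : ℝ × EuclideanSpace ℝ (Fin d)) :
    modelForm (incl d i p) (incl d i q) = 0 := by
  cases i <;> simp [modelForm, incl]

theorem isotropicImmersionAt_leg (i : Bool) {p : ℝ × EuclideanSpace ℝ (Fin d)}
    (hp : ‖p.2‖ < D.ε) : IsotropicImmersionAt Ω (D.leg i) p := by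
  have h : IsotropicImmersionAt modelForm (incl d i) p := by
    refine ⟨⟨(incl d i).contDiff.contDiffAt, ?_⟩, fun a b => ?_⟩
    · rw [(incl d i).fderiv]
      exact fun a b hab => by rw [← proj_incl i a, hab, proj_incl]
    · rw [(incl d i).fderiv]; exact modelForm_incl i a b
  exact (D.isotropicImmersionAt_chart_comp (D.incl_mem i hp) h).congr
    (Eventually.of_forall (D.leg_apply i))

variable [FiniteDimensional ℝ V]

theorem finrank_localModel : Module.finrank ℝ (LocalModel d) = 2 * (1 + d) := by
  simp [LocalModel]; ring

/-- The chart is locally invertible. -/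
theorem exists_chart_inverse (hdim : 2 * (1 + d) = Module.finrank ℝ V) {p : LocalModel d}
    (hp : p ∈ modelBox d D.ε) : ∃ l : V → LocalModel d, ContDiffAt ℝ ∞ l (D.chart p) ∧
      l (D.chart p) = p ∧ ∀ᶠ y in 𝓝 (D.chart p), l y ∈ modelBox d D.ε ∧ D.chart (l y) = y := by
  obtain ⟨l, h1, h2, h3, -⟩ := (D.immersionAt_chart hp).exists_localInverse
    (finrank_localModel.trans hdim)
  refine ⟨l, h1, h2, ?_⟩
  have h4 : ∀ᶠ y in 𝓝 (D.chart p), l y ∈ modelBox d D.ε :=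
    h1.continuousAt.eventually ((isOpen_modelBox d D.ε).mem_nhds (by rwa [h2]))
  exact h4.and h3

/-- A parametrization of the left or right torus that restricts to the core of the chart is a
`TorusTube` together with the chart. -/
theorem exists_torusTube (hdim : 2 * (1 + d) = Module.finrank ℝ V) (i : Bool)
    {C : ℝ × EuclideanSpace ℝ (Fin d) → V} (C_iso : ∀ w, IsotropicImmersionAt Ω C w)
    (C_eq : ∀ w w', C w = C w' ↔ (∃ k : ℤ, w'.1 = w.1 + k) ∧ cubeRep w.2 = cubeRep w'.2)
    (C_range : range C = D.side i) (C_zero : ∀ s, C (s, 0) = D.chart (s, 0, 0, 0)) :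
    ∃ S : TorusTube d Ω, S.C = C ∧ S.T = D.leg i ∧ S.ε = D.ε := by
  classical
  have hε := D.ε_pos
  have hz : ∀ {s : ℝ} {z : LocalModel d}, ‖z‖ < D.ε →
      ((s, 0, 0, 0) : LocalModel d) + z ∈ modelBox d D.ε := by
    intro s z hz
    obtain ⟨z1, z2, z3, z4⟩ := z
    simp only [Prod.norm_mk, max_lt_iff] at hz
    refine ⟨by simpa using hz.2.1, fun i => ?_, fun i => ?_⟩
    · simpa using (EuclideanSpace.abs_apply_le_norm z3 i).trans_lt hz.2.2.1
    · simpa using (EuclideanSpace.abs_apply_le_norm z4 i).trans_lt hz.2.2.2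
  have C_per : ∀ s v, C (s + 1, v) = C (s, v) := fun s v =>
    ((C_eq (s, v) (s + 1, v)).2 ⟨⟨1, by simp⟩, rfl⟩).symm
  have chart_per : ∀ {s : ℝ} {z : LocalModel d}, ‖z‖ < D.ε →
      D.chart (((s + 1, 0, 0, 0) : LocalModel d) + z) =
        D.chart (((s, 0, 0, 0) : LocalModel d) + z) := by
    intro s z h
    refine ((D.chart_eq_iff _ (hz h) _ (hz h)).2 ⟨by simp, 1, ?_⟩).symm
    simp; ring
  let H : (ℝ × EuclideanSpace ℝ (Fin d)) × LocalModel d → V := fun q =>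
    if ‖q.2‖ < D.ε then D.chart (((q.1.1, 0, 0, 0) : LocalModel d) + q.2) - C q.1 else 0
  have hH : ∀ s v z, ‖z‖ < D.ε → H ((s, v), z) =
      D.chart (((s, 0, 0, 0) : LocalModel d) + z) - C (s, v) := fun s v z h => if_pos h
  have hHev : ∀ s v z, ‖z‖ < D.ε → H =ᶠ[𝓝 ((s, v), z)] fun q =>
      D.chart (((q.1.1, 0, 0, 0) : LocalModel d) + q.2) - C q.1 := by
    intro s v z h
    have h1 : ∀ᶠ q : (ℝ × EuclideanSpace ℝ (Fin d)) × LocalModel d in 𝓝 ((s, v), z),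
        ‖q.2‖ < D.ε := (isOpen_lt (continuous_norm.comp continuous_snd)
          continuous_const).mem_nhds (by simpa using h)
    filter_upwards [h1] with q hq
    exact if_pos hq
  have hdC : ∀ s v z, ‖z‖ < D.ε → ContDiffAt ℝ ∞
      (fun q : (ℝ × EuclideanSpace ℝ (Fin d)) × LocalModel d =>
        D.chart (((q.1.1, 0, 0, 0) : LocalModel d) + q.2)) ((s, v), z) := fun s v z h =>
    ContDiffAt.comp ((s, v), z) (g := D.chart)
      (f := fun q : (ℝ × EuclideanSpace ℝ (Fin d)) × LocalModel d =>
        ((q.1.1, 0, 0, 0) : LocalModel d) + q.2) (D.contDiffAt_chart (hz h)) (by fun_prop)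
  have hdK : ∀ s v z, ContDiffAt ℝ ∞
      (fun q : (ℝ × EuclideanSpace ℝ (Fin d)) × LocalModel d => C q.1) ((s, v), z) := fun s v z =>
    ContDiffAt.comp ((s, v), z) (g := C)
      (f := fun q : (ℝ × EuclideanSpace ℝ (Fin d)) × LocalModel d => q.1) (C_iso _).1.1 contDiffAt_fst
  have h00 : ‖(0 : LocalModel d)‖ < D.ε := by simpa using hε
  obtain ⟨δ, hδ, -, -, φ, h1, h2, -⟩ := exists_periodic_implicit (H := H) hε
    (fun s v z _ h => ((hdC s v z h).sub (hdK s v z)).congr_of_eventuallyEq (hHev s v z h))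
    (fun s => by rw [hH s 0 0 h00, C_zero, add_zero, sub_self])
    (fun s => by
      have hd : ∀ z, fderiv ℝ H ((s, 0), 0) ((0, 0), z) =
          fderiv ℝ D.chart ((s, 0, 0, 0) : LocalModel d) z := by
        intro z
        have e0 : ((s, 0, 0, 0) : LocalModel d) ∈ modelBox d D.ε := by
          simpa using hz (s := s) h00
        have e1 : HasFDerivAt D.chart (fderiv ℝ D.chart ((s, 0, 0, 0) : LocalModel d))
            ((s, 0, 0, 0) : LocalModel d) :=
          ((D.contDiffAt_chart e0).differentiableAt (by simp)).hasFDerivAt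
        have e2 : fderiv ℝ H ((s, 0), 0) ((0, 0), z) = fderiv ℝ (fun z => H ((s, 0), z)) 0 z := by
          have d1 : DifferentiableAt ℝ H ((s, 0), 0) :=
            (((hdC s 0 0 h00).sub (hdK s 0 0)).congr_of_eventuallyEq
              (hHev s 0 0 h00)).differentiableAt (by simp)
          have d2 : HasFDerivAt (fun z : LocalModel d => (((s, (0 : EuclideanSpace ℝ (Fin d))), z)))
              (ContinuousLinearMap.inr ℝ (ℝ × EuclideanSpace ℝ (Fin d)) (LocalModel d)) 0 :=
            hasFDerivAt_prodMk_right _ _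
          have d3 := (HasFDerivAt.comp (0 : LocalModel d) d1.hasFDerivAt d2).fderiv
          exact (DFunLike.congr_fun d3 z).symm
        have e3 : (fun z => H ((s, 0), z)) =ᶠ[𝓝 0] fun z =>
            D.chart (((s, 0, 0, 0) : LocalModel d) + z) - C (s, 0) := by
          filter_upwards [(isOpen_lt continuous_norm continuous_const).mem_nhds h00] with z hz
          exact hH s 0 z hz
        rw [e2, e3.fderiv_eq, fderiv_sub_const, fderiv_comp_add_left, add_zero]
      simp only [hd]
      have e0 : ((s, 0, 0, 0) : LocalModel d) ∈ modelBox d D.ε := by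
        simpa using hz (s := s) h00
      have e1 := (D.immersionAt_chart e0).2
      exact ⟨e1, (LinearMap.injective_iff_surjective_of_finrank_eq_finrank
        (f := (fderiv ℝ D.chart ((s, 0, 0, 0) : LocalModel d) : LocalModel d →ₗ[ℝ] V))
        (finrank_localModel.trans hdim)).1 e1⟩)
    (fun s v z => by
      by_cases h : ‖z‖ < D.ε
      · rw [hH _ _ _ h, hH _ _ _ h, chart_per h, C_per]
      · exact (if_neg h).trans (if_neg h).symm)
  have hφ : ∀ s v, ‖v‖ < δ → ‖φ (s, v)‖ < D.ε ∧
      D.chart (((s, 0, 0, 0) : LocalModel d) + φ (s, v)) = C (s, v) := by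
    intro s v hv
    obtain ⟨-, e1, e2, -⟩ := h1 s v hv
    rw [hH s v _ e1, sub_eq_zero] at e2
    exact ⟨e1, e2⟩
  have hCs : ∀ w, C w ∈ D.side i := fun w => C_range ▸ mem_range_self w
  have hf : ∀ s v, ‖v‖ < δ →
      incl d i (proj d i (((s, 0, 0, 0) : LocalModel d) + φ (s, v))) =
        ((s, 0, 0, 0) : LocalModel d) + φ (s, v) := fun s v hv =>
    D.incl_proj (hz (hφ s v hv).1) (by rw [(hφ s v hv).2]; exact hCs _)
  refine ⟨{ C := C, T := D.leg i,
            f := fun w => proj d i (((w.1, 0, 0, 0) : LocalModel d) + φ w),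
            ε := D.ε, ρ := δ, ρ_pos := hδ, C_iso := C_iso,
            T_iso := fun p hp => D.isotropicImmersionAt_leg i hp, C_eq := C_eq,
            T_eq := fun p p' hp hp' => D.leg_eq hp hp'
            T_mem := fun p hp => C_range ▸ D.leg_mem_side hp
            lift := fun w p hp h => ?_
            f_smooth := fun s v hv => ?_
            f_zero := fun s => ?_
            f_per := fun s v hv => ?_
            f_lift := fun s v hv => ⟨?_, ?_⟩ }, rfl, rfl, rfl⟩
  · rw [D.leg_apply] at h
    obtain ⟨l, e1, e2, e3⟩ := D.exists_chart_inverse hdim (D.incl_mem i hp)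
    rw [← h] at e1 e2 e3
    refine ⟨fun w' => proj d i (l (C w')), ?_, by simp only [e2, proj_incl], ?_⟩
    · exact (proj d i).contDiff.contDiffAt.comp w (e1.comp w (C_iso w).1.1)
    · filter_upwards [(C_iso w).1.1.continuousAt.eventually e3] with w' hw'
      rw [D.leg_apply, D.incl_proj hw'.1 (by rw [hw'.2]; exact hCs _), hw'.2]
  · refine (proj d i).contDiff.contDiffAt.comp (s, v) (ContDiffAt.add ?_ (h1 s v hv).1)
    fun_prop
  · rw [h2, add_zero]; cases i <;> rfl
  · rw [(h1 s v hv).2.2.2]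
    have : ((s + 1, 0, 0, 0) : LocalModel d) + φ (s, v) =
        (((s, 0, 0, 0) : LocalModel d) + φ (s, v)) + ((1, 0, 0, 0) : LocalModel d) := by
      simp only [Prod.ext_iff, Prod.fst_add, Prod.snd_add]
      refine ⟨by ring, by ring, by simp, by simp⟩
    rw [this, map_add]
    congr 1
    cases i <;> rfl
  · have e1 := (hφ s v hv).1
    have e2 : ‖(φ (s, v)).2.2.1‖ < D.ε ∧ ‖(φ (s, v)).2.2.2‖ < D.ε := by
      simp only [Prod.norm_def, max_lt_iff] at e1
      exact e1.2.2
    cases i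
    · simpa [proj] using e2.1
    · simpa [proj] using e2.2
  · rw [D.leg_apply, hf s v hv, (hφ s v hv).2]

end SmoothingData

/-! ### Fitting the two tori to the handle -/

namespace SmoothingData

variable {V : Type*} [NormedAddCommGroup V] [NormedSpace ℝ V] {d : ℕ}
  {Ω : V → V → ℝ} {L₀ L₁ Δ : Set V} (D : SmoothingData d Ω L₀ L₁ Δ)

theorem modelForm_incl_incl (p q : ℝ × EuclideanSpace ℝ (Fin d)) :
    modelForm (incl d false p) (incl d true q) = inner ℝ p.2 q.2 := by
  rw [modelForm_eq]
  simp [incl]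

theorem fderiv_C {i : Bool} {S : TorusTube d Ω} (hT : S.T = D.leg i) (s : ℝ)
    (q : ℝ × EuclideanSpace ℝ (Fin d)) : fderiv ℝ S.C (s, 0) q =
      fderiv ℝ D.chart (incl d i (s, 0)) (incl d i (fderiv ℝ S.f (s, 0) q)) := by
  have h0 : ‖(0 : EuclideanSpace ℝ (Fin d))‖ < D.ε := by simpa using D.ε_pos
  have h1 : S.C =ᶠ[𝓝 (s, 0)] fun w => D.chart (incl d i (S.f w)) := by
    have : ∀ᶠ w : ℝ × EuclideanSpace ℝ (Fin d) in 𝓝 (s, 0), ‖w.2‖ < S.ρ :=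
      (isOpen_lt (continuous_norm.comp continuous_snd) continuous_const).mem_nhds
        (by simpa using S.ρ_pos)
    filter_upwards [this] with w hw
    have := (S.f_lift w.1 w.2 hw).2
    rw [hT, D.leg_apply] at this
    exact this
  have h2 : HasFDerivAt D.chart (fderiv ℝ D.chart (incl d i (s, 0))) (incl d i (S.f (s, 0))) := by
    rw [S.f_zero]
    have hm : incl d i (s, 0) ∈ modelBox d D.ε := D.incl_mem i (p := (s, 0)) h0
    generalize incl d i (s, 0) = z at hm
    exact ((D.contDiffAt_chart hm).differentiableAt (by simp)).hasFDerivAt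
  have h3 : HasFDerivAt (fun w => incl d i (S.f w)) ((incl d i).comp (fderiv ℝ S.f (s, 0))) (s, 0) :=
    HasFDerivAt.comp (s, 0) (f := S.f) (g := fun p => incl d i p)
      ((incl d i).hasFDerivAt (x := S.f (s, 0))) (S.hasFDerivAt_f s)
  have h4 : HasFDerivAt (fun w => D.chart (incl d i (S.f w)))
      ((fderiv ℝ D.chart (incl d i (s, 0))).comp ((incl d i).comp (fderiv ℝ S.f (s, 0)))) (s, 0) :=
    HasFDerivAt.comp (s, 0) (f := fun w => incl d i (S.f w)) h2 h3
  rw [h1.fderiv_eq, h4.fderiv]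
  rfl

/-- The transverse linear parts of the two tori are dual to each other for the symplectic form. -/
theorem inner_A {S₀ S₁ : TorusTube d Ω} (h₀ : S₀.T = D.leg false) (h₁ : S₁.T = D.leg true)
    (s : ℝ) (v w : EuclideanSpace ℝ (Fin d)) :
    Ω (fderiv ℝ S₀.C (s, 0) (0, v)) (fderiv ℝ S₁.C (s, 0) (0, w)) =
      inner ℝ (S₀.A s v) (S₁.A s w) := by
  have h0 : ‖(0 : EuclideanSpace ℝ (Fin d))‖ < D.ε := by simpa using D.ε_pos
  rw [D.fderiv_C h₀, D.fderiv_C h₁,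
    show incl d true (s, 0) = incl d false (s, 0) from rfl,
    D.chart_symplectic _ (D.incl_mem false (p := (s, 0)) h0), modelForm_incl_incl]
  rfl

variable [FiniteDimensional ℝ V]

/-- Two periodic parametrizations of the tori that agree with the core of the chart, and whose
transverse derivatives along the core are paired by a fixed bilinear form up to a positive factor,
can be fitted to the handle. -/
theorem exists_fittedPair (hdim : 2 * (1 + d) = Module.finrank ℝ V)
    {C : Bool → ℝ × EuclideanSpace ℝ (Fin d) → V}
    (C_iso : ∀ i w, IsotropicImmersionAt Ω (C i) w)
    (C_eq : ∀ i w w', C i w = C i w' ↔ (∃ k : ℤ, w'.1 = w.1 + k) ∧ cubeRep w.2 = cubeRep w'.2)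
    (C_range : ∀ i, range (C i) = D.side i) (C_zero : ∀ i s, C i (s, 0) = D.chart (s, 0, 0, 0))
    {ρ : ℝ → ℝ} (hρ : ∀ s, 0 < ρ s)
    {B : EuclideanSpace ℝ (Fin d) →L[ℝ] EuclideanSpace ℝ (Fin d)}
    (hB : ∀ s v w, Ω (fderiv ℝ (C false) (s, 0) (0, v)) (fderiv ℝ (C true) (s, 0) (0, w)) =
      ρ s * inner ℝ v (B w)) : Nonempty (FittedPair D) := by
  obtain ⟨S₀, hC₀, hT₀, hε₀⟩ := D.exists_torusTube hdim false (C_iso _) (C_eq _) (C_range _) (C_zero _)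
  have hA₀s : ∀ s, Function.Surjective (S₀.A s) := fun s =>
    (LinearMap.injective_iff_surjective (f := (S₀.A s : _ →ₗ[ℝ] EuclideanSpace ℝ (Fin d)))).1
      ((injective_iff_map_eq_zero _).2 (S₀.A_injective s))
  have hBi : ∀ w, B w = 0 → w = 0 := by
    intro w hw
    obtain ⟨S₁, hC₁, hT₁, hε₁⟩ :=
      D.exists_torusTube hdim true (C_iso _) (C_eq _) (C_range _) (C_zero _)
    refine S₁.A_injective 0 w ?_
    obtain ⟨v, hv⟩ := hA₀s 0 (S₁.A 0 w)
    have h := D.inner_A hT₀ hT₁ 0 v w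
    rw [hC₀, hC₁, hB, hw, inner_zero_right, mul_zero, hv] at h
    exact inner_self_eq_zero.1 h.symm
  obtain ⟨e, γ, he, hγ, hγi, hγ0, hγ1⟩ := exists_linearMap_path B hBi
  -- the signs are absorbed by an automorphism of the lattice
  let e' : Fin d → ℝ := fun i => D.sign * e i
  have he' : ∀ i, e' i = 1 ∨ e' i = -1 := by
    intro i
    rcases D.sign_eq with h | h <;> rcases he i with h' | h' <;> simp [e', h, h']
  let J := diagMap e'
  have hJJ : ∀ v, J (J v) = v := diagMap_diagMap he'
  have hJi : ∀ v, J v = 0 → v = 0 := fun v hv => by rw [← hJJ v, hv, map_zero]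
  let JJ : ℝ × EuclideanSpace ℝ (Fin d) →L[ℝ] ℝ × EuclideanSpace ℝ (Fin d) :=
    (ContinuousLinearMap.fst ℝ _ _).prod (J.comp (ContinuousLinearMap.snd ℝ _ _))
  have hJd : ∀ w, HasFDerivAt (fun w => JJ w) JJ w := fun w => JJ.hasFDerivAt
  obtain ⟨S₁, hC₁, hT₁, hε₁⟩ := D.exists_torusTube hdim true (C := fun w => C true (JJ w))
    (fun w => (C_iso true (JJ w)).comp (immersionAt_of_hasFDerivAt JJ.contDiff.contDiffAt (hJd w)
      fun v hv => Prod.ext (show v.1 = 0 from congrArg Prod.fst hv)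
        (hJi _ (show J v.2 = 0 from congrArg Prod.snd hv))))
    (fun w w' => (C_eq true _ _).trans (and_congr_right fun _ => cubeRep_diagMap_eq_iff he'))
    (by
      rw [← C_range true]
      refine Subset.antisymm ?_ ?_
      · rintro _ ⟨w, rfl⟩; exact ⟨_, rfl⟩
      · rintro _ ⟨w, rfl⟩
        exact ⟨JJ w, congrArg (C true) (Prod.ext rfl (hJJ _))⟩)
    (fun s => by
      rw [show JJ (s, 0) = (s, 0) from Prod.ext rfl (map_zero J), C_zero])
  have hpair : ∀ s v w, inner ℝ (S₀.A s v) (S₁.A s w) = ρ s * inner ℝ v (B (J w)) := by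
    intro s v w
    rw [← D.inner_A hT₀ hT₁, hC₀, hC₁, ← hB]
    congr 1
    have h1 : HasFDerivAt (C true) (fderiv ℝ (C true) (s, 0)) (JJ (s, 0)) := by
      rw [show JJ (s, 0) = (s, 0) from Prod.ext rfl (map_zero J)]
      exact (C_iso true _).1.differentiableAt.hasFDerivAt
    have h2 := (HasFDerivAt.comp (s, (0 : EuclideanSpace ℝ (Fin d))) h1 (hJd _)).fderiv
    exact DFunLike.congr_fun h2 (0, w)
  let BJ := (LinearEquiv.ofInjectiveEndo ((B.comp J : _ →L[ℝ] EuclideanSpace ℝ (Fin d)) :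
    EuclideanSpace ℝ (Fin d) →ₗ[ℝ] EuclideanSpace ℝ (Fin d))
      ((injective_iff_map_eq_zero _).2 fun v hv => hJi v (hBi _ hv))).toContinuousLinearEquiv
  have hBJ : ∀ w, BJ w = B (J w) := fun w => rfl
  let G : EuclideanSpace ℝ (Fin d) →L[ℝ] EuclideanSpace ℝ (Fin d) := BJ.symm
  have hG1 : ∀ w, B (J (G w)) = w := fun w => BJ.apply_symm_apply w
  have hG2 : ∀ w, G (B (J w)) = w := fun w => BJ.symm_apply_apply w
  let χ : ℝ → ℝ := Real.smoothTransition
  -- `A₀` and `A₁ ∘ (B ∘ J)⁻¹` have positive pairing, so the segment between them is invertible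
  let M : ℝ × ℝ → EuclideanSpace ℝ (Fin d) →L[ℝ] EuclideanSpace ℝ (Fin d) := fun q =>
    ((1 - χ q.2) • S₀.A q.1 + χ q.2 • (S₁.A q.1).comp G).comp ((γ q.2).comp J)
  have hχ : ContDiff ℝ ∞ fun q : ℝ × ℝ => χ q.2 := Real.smoothTransition.contDiff.comp contDiff_snd
  have hM : ContDiff ℝ ∞ M := by
    refine ContDiff.clm_comp (ContDiff.add ?_ ?_) ((hγ.comp contDiff_snd).clm_comp contDiff_const)
    · exact (contDiff_const.sub hχ).smul (S₀.contDiff_A.comp contDiff_fst)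
    · exact hχ.smul ((S₁.contDiff_A.comp contDiff_fst).clm_comp contDiff_const)
  have hMi : ∀ q u, M q u = 0 → u = 0 := by
    intro q u hu
    refine hJi u (hγi q.2 _ ?_)
    have hu' : (1 - χ q.2) • S₀.A q.1 (γ q.2 (J u)) + χ q.2 • S₁.A q.1 (G (γ q.2 (J u))) = 0 := hu
    generalize γ q.2 (J u) = x at hu'
    by_contra hx
    have h1 := congrArg (fun y => inner ℝ (S₀.A q.1 x) y) hu'
    simp only [inner_add_right, inner_smul_right, hpair, hG1, inner_zero_right,
      real_inner_self_eq_norm_sq] at h1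
    have h2 : 0 < ‖S₀.A q.1 x‖ := norm_pos_iff.2 fun h => hx (S₀.A_injective _ _ h)
    have h3 : 0 < ρ q.1 * ‖x‖ ^ 2 := mul_pos (hρ _) (pow_pos (norm_pos_iff.2 hx) 2)
    have h4 : 0 ≤ χ q.2 := Real.smoothTransition.nonneg _
    have h5 : χ q.2 ≤ 1 := Real.smoothTransition.le_one _
    rcases h4.eq_or_lt with h | h
    · rw [← h] at h1; nlinarith [pow_pos h2 2]
    · have := mul_pos h h3
      have := mul_nonneg (sub_nonneg.2 h5) (pow_pos h2 2).le
      linarith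
  have hM0 : ∀ s v, M (s, 0) v = D.sign • S₀.A s v := by
    intro s v
    have h1 : γ 0 (J v) = D.sign • v := by
      rw [hγ0]
      ext i
      simp only [J, e', diagMap_apply, PiLp.smul_apply, smul_eq_mul]
      rcases he i with h | h <;> simp [h]
    have h2 : M (s, 0) v = (1 - χ 0) • S₀.A s (γ 0 (J v)) + χ 0 • S₁.A s (G (γ 0 (J v))) := rfl
    rw [h2, h1, show χ 0 = 0 from Real.smoothTransition.zero]
    simp
  have hM1 : ∀ s, M (s, 1) = S₁.A s := by
    intro s
    ext1 v
    have h2 : M (s, 1) v = (1 - χ 1) • S₀.A s (γ 1 (J v)) + χ 1 • S₁.A s (G (γ 1 (J v))) := rfl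
    rw [h2, hγ1, hG2, show χ 1 = 1 from Real.smoothTransition.one]
    simp
  have hr := D.r_pos
  obtain ⟨Q₀, η₀, a1, a2, a3, a4, a5, a6, a7⟩ := S₀.exists_param hr (hε₀ ▸ D.r_lt)
    (M := fun q => S₀.A q.1) (S₀.contDiff_A.comp contDiff_fst) (fun q => S₀.A_injective q.1)
    (fun s _ => S₀.A_periodic s) (fun _ => rfl)
  obtain ⟨Q₁, η₁, b1, b2, b3, b4, b5, b6, b7⟩ := S₁.exists_param hr (hε₁ ▸ D.r_lt) hM hMi
    (fun s τ => by simp only [M, S₀.A_periodic s, S₁.A_periodic s]) hM1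
  have hr1 : range S₁.C = D.side true := by
    rw [hC₁, ← C_range true]
    refine Subset.antisymm ?_ ?_
    · rintro _ ⟨w, rfl⟩; exact ⟨_, rfl⟩
    · rintro _ ⟨w, rfl⟩
      exact ⟨JJ w, congrArg (C true) (Prod.ext rfl (hJJ _))⟩
  refine ⟨{ B := S₀.A, Q := fun i => cond i Q₁ Q₀, η := min η₀ η₁, B_smooth := S₀.contDiff_A,
            B_per := S₀.A_periodic, B_inj := S₀.A_injective, η_pos := lt_min a1 b1,
            η_le := (min_le_left _ _).trans a2, η_lt := ?_, Q_iso := ?_, Q_eq := ?_, Q_inj := ?_,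
            Q_image := ?_ }⟩
  · rw [hε₀] at a3
    have := min_le_left η₀ η₁
    nlinarith
  · rintro (_ | _)
    exacts [a4, b4]
  · rintro (_ | _) s v h1 h2
    · refine (a5 s v h1 (h2.trans_le (by gcongr; exact min_le_left _ _))).trans ?_
      rw [hT₀, show D.legSign false = 1 from rfl, one_smul]
    · refine (b5 s v h1 (h2.trans_le (by gcongr; exact min_le_right _ _))).trans ?_
      rw [hT₁, hM0, show D.legSign true = D.sign from rfl, norm_smul, Real.norm_eq_abs, D.sign_abs,
        one_mul]
  · rintro (_ | _)
    exacts [a6, b6]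
  · rintro (_ | _)
    · rw [hC₀, hT₀, C_range] at a7; exact a7
    · rw [hr1, hT₁] at b7; exact b7

end SmoothingData

/-! ### Products of curves and the evaluation map -/

section Tori

variable {n d : ℕ}

/-- The linear map that `evalChange` is. -/
def evalChangeLin (α β : Fin n → ℂ) : (Fin n → ℂ) →ₗ[ℂ] (Fin n → ℂ) :=
  LinearMap.pi fun k => (Polynomial.leval (β k)).comp (Lagrange.interpolate Finset.univ α)

/-- `evalChange` as a continuous real linear map. -/
def evalChangeCLM (α β : Fin n → ℂ) : (Fin n → ℂ) →L[ℝ] (Fin n → ℂ) :=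
  (LinearMap.toContinuousLinearMap (evalChangeLin α β)).restrictScalars ℝ

@[simp] theorem evalChangeCLM_apply (α β : Fin n → ℂ) (z : Fin n → ℂ) :
    evalChangeCLM α β z = evalChange α β z := rfl

theorem evalChange_smul (α β : Fin n → ℂ) (a : ℂ) (z : Fin n → ℂ) :
    evalChange α β (a • z) = a • evalChange α β z := (evalChangeLin α β).map_smul a z

theorem evalChange_const [NeZero n] {α : Fin n → ℂ} (hα : Function.Injective α) (β : Fin n → ℂ)
    (a : ℂ) : evalChange α β (fun _ => a) = fun _ => a := by
  have := evalChange_eval α β hα (Polynomial.C a)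
    (lt_of_le_of_lt Polynomial.degree_C_le (by exact_mod_cast Nat.pos_of_ne_zero (NeZero.ne n)))
  simpa using this

theorem diagonalForm_smul (μ : Fin n → ℝ) (a : ℂ) (v w : Fin n → ℂ) :
    diagonalForm μ (a • v) (a • w) = ‖a‖ ^ 2 * diagonalForm μ v w := by
  rw [diagonalForm, diagonalForm, Finset.mul_sum]
  refine Finset.sum_congr rfl fun k _ => ?_
  rw [← Complex.normSq_eq_norm_sq, Complex.normSq_apply]
  simp only [Pi.smul_apply, smul_eq_mul, Complex.mul_re, Complex.mul_im]
  ring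

theorem eq_zero_of_diagonalForm {μ : Fin n → ℝ} (hμ : ∀ k, 0 < μ k) {v : Fin n → ℂ}
    (h : ∀ w, diagonalForm μ v w = 0) : v = 0 := by
  have h1 := h (Complex.I • v)
  simp only [diagonalForm, Pi.smul_apply, smul_eq_mul, Complex.mul_re, Complex.mul_im,
    Complex.I_re, Complex.I_im, zero_mul, one_mul, zero_sub, zero_add] at h1
  have h2 := (Finset.sum_eq_zero_iff_of_nonneg (fun k _ => mul_nonneg (hμ k).le
    (by nlinarith [mul_self_nonneg (v k).re, mul_self_nonneg (v k).im]))).1 h1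
  funext k
  have h3 := (mul_eq_zero.1 (h2 k (Finset.mem_univ k))).resolve_left (hμ k).ne'
  refine Complex.ext ?_ ?_
  · show (v k).re = 0; nlinarith [mul_self_nonneg (v k).re, mul_self_nonneg (v k).im]
  · show (v k).im = 0; nlinarith [mul_self_nonneg (v k).re, mul_self_nonneg (v k).im]

theorem IsAdaptedForm.injective {α β : Fin n → ℂ} {μ : Fin n → ℝ} (h : IsAdaptedForm α β μ) :
    Function.Injective (evalChangeCLM α β) := by
  obtain ⟨-, ν, hν, hF⟩ := h
  refine (injective_iff_map_eq_zero _).2 fun v hv => eq_zero_of_diagonalForm hν fun w => ?_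
  rw [← hF, ← evalChangeCLM_apply, hv]
  simp [diagonalForm]

/-- The linear map `(s, v) ↦ (s, s + v₁, …, s + v_d)`. -/
def spread (d : ℕ) : ℝ × EuclideanSpace ℝ (Fin d) →L[ℝ] (Fin (d + 1) → ℝ) :=
  ContinuousLinearMap.pi (Fin.cons (ContinuousLinearMap.fst ℝ _ _) fun i =>
    ContinuousLinearMap.fst ℝ _ _ + (EuclideanSpace.proj i).comp (ContinuousLinearMap.snd ℝ _ _))

@[simp] theorem spread_zero (w : ℝ × EuclideanSpace ℝ (Fin d)) : spread d w 0 = w.1 := by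
  simp [spread]

@[simp] theorem spread_succ (w : ℝ × EuclideanSpace ℝ (Fin d)) (i : Fin d) :
    spread d w i.succ = w.1 + w.2 i := by
  simp [spread]

theorem spread_core (s : ℝ) : spread d (s, 0) = fun _ => s := by
  funext k
  refine Fin.cases ?_ (fun i => ?_) k <;> simp

theorem spread_injective : Function.Injective (spread d) := by
  refine (injective_iff_map_eq_zero _).2 fun w hw => ?_
  have h0 : w.1 = 0 := by rw [← spread_zero w, hw]; rfl
  refine Prod.ext h0 ?_
  ext i
  have h1 := congrFun hw i.succ
  rw [spread_succ, h0, zero_add] at h1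
  exact h1

/-- The torus `γⁿ`, parametrized by `(s, v) ↦ (c(s), c(s + v₁), …, c(s + v_d))`. -/
def torusParam (d : ℕ) (c : ℝ → ℂ) (w : ℝ × EuclideanSpace ℝ (Fin d)) : Fin (d + 1) → ℂ :=
  fun k => c (spread d w k)

theorem torusParam_core (c : ℝ → ℂ) (s : ℝ) : torusParam d c (s, 0) = fun _ => c s := by
  funext k
  rw [torusParam, spread_core]

theorem hasFDerivAt_torusParam {c : ℝ → ℂ} (hc : ContDiff ℝ ∞ c)
    (w : ℝ × EuclideanSpace ℝ (Fin d)) : HasFDerivAt (torusParam d c)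
      (ContinuousLinearMap.pi fun k => (ContinuousLinearMap.smulRight
        ((ContinuousLinearMap.proj k).comp (spread d)) (deriv c (spread d w k)))) w := by
  refine hasFDerivAt_pi.2 fun k => ?_
  have h1 : HasDerivAt c (deriv c (spread d w k)) (spread d w k) :=
    (hc.differentiable (by simp) _).hasDerivAt
  have h2 : HasFDerivAt (fun w => spread d w k) ((ContinuousLinearMap.proj k).comp (spread d)) w :=
    ((ContinuousLinearMap.proj (R := ℝ) k).comp (spread d)).hasFDerivAt
  have h3 := HasFDerivAt.comp w (g := c) (f := fun w => spread d w k) h1.hasFDerivAt h2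
  refine h3.congr_fderiv ?_
  ext q <;> simp

theorem fderiv_torusParam {c : ℝ → ℂ} (hc : ContDiff ℝ ∞ c) (w q : ℝ × EuclideanSpace ℝ (Fin d)) :
    fderiv ℝ (torusParam d c) w q = fun k => (spread d q k : ℂ) * deriv c (spread d w k) := by
  rw [(hasFDerivAt_torusParam hc w).fderiv]
  funext k
  simp

/-- A product of curves is isotropic for every diagonal form. -/
theorem isotropicImmersionAt_torusParam {c : ℝ → ℂ} (hc : ContDiff ℝ ∞ c)
    (hc' : ∀ s, deriv c s ≠ 0) (μ : Fin (d + 1) → ℝ) (w : ℝ × EuclideanSpace ℝ (Fin d)) :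
    IsotropicImmersionAt (diagonalForm μ) (torusParam d c) w := by
  have h1 : ContDiff ℝ ∞ (torusParam d c) := contDiff_pi.2 fun k =>
    hc.comp (((ContinuousLinearMap.proj (R := ℝ) k).comp (spread d)).contDiff)
  refine ⟨⟨h1.contDiffAt, (injective_iff_map_eq_zero _).2 fun q hq => ?_⟩, fun a b => ?_⟩
  · rw [fderiv_torusParam hc] at hq
    refine spread_injective ?_
    rw [map_zero]
    funext k
    have := congrFun hq k
    exact_mod_cast (mul_eq_zero.1 this).resolve_right (hc' _)
  · simp only [fderiv_torusParam hc, diagonalForm]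
    refine Finset.sum_eq_zero fun k _ => ?_
    simp only [Complex.mul_re, Complex.mul_im, Complex.ofReal_re, Complex.ofReal_im]
    ring

theorem torusParam_eq_iff {c : ℝ → ℂ} (hc : ∀ s s', c s = c s' ↔ ∃ k : ℤ, s' = s + k)
    (w w' : ℝ × EuclideanSpace ℝ (Fin d)) : torusParam d c w = torusParam d c w' ↔
      (∃ k : ℤ, w'.1 = w.1 + k) ∧ cubeRep w.2 = cubeRep w'.2 := by
  constructor
  · intro h
    have h1 : ∀ k, ∃ m : ℤ, spread d w' k = spread d w k + m := fun k => (hc _ _).1 (congrFun h k)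
    choose m hm using h1
    have h0 := hm 0
    rw [spread_zero, spread_zero] at h0
    refine ⟨⟨_, h0⟩, cubeRep_eq_iff.2 ⟨fun i => m i.succ - m 0, ?_⟩⟩
    ext i
    have h2 := hm i.succ
    rw [spread_succ, spread_succ] at h2
    simp only [PiLp.add_apply, latticeVec_apply, Int.cast_sub]
    linarith
  · rintro ⟨⟨k, hk⟩, h⟩
    obtain ⟨m, hm⟩ := cubeRep_eq_iff.1 h
    funext j
    refine (hc _ _).2 ?_
    refine Fin.cases ⟨k, by simpa using hk⟩ (fun i => ⟨k + m i, ?_⟩) j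
    rw [spread_succ, spread_succ, hk, hm]
    simp only [PiLp.add_apply, latticeVec_apply, Int.cast_add]
    ring

theorem range_torusParam {c : ℝ → ℂ} {Γ : Set ℂ} (hc : range c = Γ) :
    range (torusParam d c) = curveTorus (d + 1) Γ := by
  refine Subset.antisymm ?_ fun z hz => ?_
  · rintro _ ⟨w, rfl⟩ k
    exact hc ▸ mem_range_self _
  · have h : ∀ k, ∃ t, c t = z k := fun k => by
      have := hz k
      rwa [← hc] at this
    choose t ht using h
    refine ⟨(t 0, WithLp.toLp 2 fun i => t i.succ - t 0), funext fun k => ?_⟩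
    rw [← ht k, torusParam]
    refine congrArg c ?_
    refine Fin.cases ?_ (fun i => ?_) k <;> simp

/-- The points of a cyclically ordered family are distinct. -/
theorem CyclicallyOrdered.injective {α β : Fin n → ℂ} (h : CyclicallyOrdered α β) :
    Function.Injective α ∧ ∀ k l, α k ≠ β l := by
  obtain ⟨θ, φ, h1, h2, h3, h4⟩ := h
  have hπ := Real.pi_pos
  have key : ∀ x y : ℝ, Complex.exp (x * Complex.I) = Complex.exp (y * Complex.I) →
      |x - y| < 2 * Real.pi → x = y := by
    intro x y hxy hlt
    obtain ⟨m, hm⟩ := Complex.exp_eq_exp_iff_exists_int.1 hxy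
    have h5 : x = y + m * (2 * Real.pi) := by
      have := congrArg Complex.im hm
      simpa using this
    rw [h5, add_sub_cancel_left, abs_mul, abs_of_pos (by positivity : 0 < 2 * Real.pi)] at hlt
    have h6 : |(m : ℝ)| < 1 := by
      by_contra h; rw [not_lt] at h; nlinarith
    have h7 : m = 0 := by
      rw [← Int.abs_lt_one_iff]; exact_mod_cast h6
    rw [h5, h7]; simp
  have key' : ∀ x y : ℝ, Complex.exp (-(x * Complex.I)) = Complex.exp (-(y * Complex.I)) →
      |x - y| < 2 * Real.pi → x = y := by
    intro x y hxy hlt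
    refine key x y ?_ hlt
    rw [Complex.exp_neg, Complex.exp_neg] at hxy
    exact inv_injective hxy
  have hθ : ∀ k l, k < l → 0 < θ l - θ k ∧ θ l - θ k < 2 * Real.pi := fun k l hkl =>
    ⟨by linarith [h1 k, h2 k l hkl], by linarith [h1 l, h3 l k]⟩
  have hθ' : ∀ k l, |θ k - θ l| < 2 * Real.pi := by
    intro k l
    rcases lt_trichotomy k l with h | h | h
    · rw [abs_lt]; constructor <;> linarith [hθ k l h]
    · rw [h]; simp [hπ]
    · rw [abs_lt]; constructor <;> linarith [hθ l k h]
  have hθi : ∀ k l, θ k = θ l → k = l := by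
    intro k l hkl
    rcases lt_trichotomy k l with h | h | h
    · linarith [hθ k l h]
    · exact h
    · linarith [hθ l k h]
  have hφ : ∀ k l, |θ k - φ l| < 2 * Real.pi ∧ θ k ≠ φ l := by
    intro k l
    rcases le_or_gt k l with h | h
    · have : θ k ≤ θ l := h.eq_or_lt.elim (fun h => by rw [h]) fun h => by linarith [hθ k l h]
      refine ⟨?_, by linarith [h1 l] |> ne_of_lt⟩
      rw [abs_lt]; constructor <;> linarith [h1 l, h3 l k]
    · refine ⟨?_, (h2 l k h).ne'⟩
      rw [abs_lt]; constructor <;> linarith [h2 l k h, h1 k, h3 k l, h1 l]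
  rcases h4 with h4 | h4
  · refine ⟨fun k l hkl => ?_, fun k l hkl => ?_⟩
    · rw [(h4 k).1, (h4 l).1] at hkl
      exact hθi k l (key _ _ hkl (hθ' k l))
    · rw [(h4 k).1, (h4 l).2] at hkl
      exact (hφ k l).2 (key _ _ hkl (hφ k l).1)
  · refine ⟨fun k l hkl => ?_, fun k l hkl => ?_⟩
    · rw [(h4 k).1, (h4 l).1] at hkl
      exact hθi k l (key' _ _ hkl (hθ' k l))
    · rw [(h4 k).1, (h4 l).2] at hkl
      exact (hφ k l).2 (key' _ _ hkl (hφ k l).1)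

end Tori

/-! ### The realization of a smoothing -/

section Realization

variable {d : ℕ} {α β : Fin (d + 1) → ℂ} {Γ : Set ℂ} {μ : Fin (d + 1) → ℝ}

theorem finrank_complex_pi : 2 * (1 + d) = Module.finrank ℝ (Fin (d + 1) → ℂ) := by
  rw [Module.finrank_pi_fintype]
  simp [Complex.finrank_real_complex]; ring

/-- The core of a smoothing along the diagonal loop parametrizes the curve. -/
theorem exists_core (D : SmoothingData d (diagonalForm μ) (curveTorus (d + 1) Γ)
      (evalChange α β '' curveTorus (d + 1) Γ) (diagonalLoop (d + 1) Γ)) :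
    ∃ c : ℝ → ℂ, ContDiff ℝ ∞ c ∧ (∀ s, deriv c s ≠ 0) ∧
      (∀ s s', c s = c s' ↔ ∃ k : ℤ, s' = s + k) ∧ range c = Γ ∧
      ∀ s, D.chart (s, 0, 0, 0) = fun _ => c s := by
  have h0 : ‖(0 : EuclideanSpace ℝ (Fin d))‖ < D.ε := by simpa using D.ε_pos
  have hbox : ∀ s : ℝ, ((s, 0, 0, 0) : LocalModel d) ∈ modelBox d D.ε := fun s =>
    D.mem_modelBox h0 h0
  let c : ℝ → ℂ := fun s => D.chart (s, 0, 0, 0) 0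
  have hdiag : ∀ s, ∃ a ∈ Γ, (fun _ => a) = D.chart (s, 0, 0, 0) := by
    intro s
    exact D.chart_core.subset (mem_range_self (f := fun s : ℝ => D.chart (s, 0, 0, 0)) s)
  have hc : ∀ s, D.chart (s, 0, 0, 0) = fun _ => c s := by
    intro s
    obtain ⟨a, -, ha⟩ := hdiag s
    have h1 : c s = a := (congrFun ha 0).symm
    rw [h1, ha]
  have hline : ∀ s : ℝ, HasFDerivAt (fun s : ℝ => ((s, 0, 0, 0) : LocalModel d))
      (ContinuousLinearMap.inl ℝ ℝ _) s := fun s =>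
    (ContinuousLinearMap.inl ℝ ℝ (ℝ × EuclideanSpace ℝ (Fin d) × EuclideanSpace ℝ (Fin d))).hasFDerivAt
  have hcore : ∀ s, ImmersionAt (fun s : ℝ => D.chart (s, 0, 0, 0)) s := fun s =>
    (D.immersionAt_chart (hbox s)).comp (l := fun s : ℝ => ((s, 0, 0, 0) : LocalModel d))
      (immersionAt_of_hasFDerivAt (by fun_prop) (hline s) fun v hv => congrArg Prod.fst hv)
  have hcs : ContDiff ℝ ∞ c := contDiff_iff_contDiffAt.2 fun s =>
    contDiffAt_pi.1 (hcore s).1 0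
  refine ⟨c, hcs, fun s hs => ?_, fun s s' => ?_, ?_, hc⟩
  · have h1 : HasFDerivAt (fun s : ℝ => D.chart (s, 0, 0, 0)) (fderiv ℝ (fun s : ℝ =>
        D.chart (s, 0, 0, 0)) s) s := (hcore s).differentiableAt.hasFDerivAt
    have h2 : HasFDerivAt (fun s : ℝ => D.chart (s, 0, 0, 0)) (0 : ℝ →L[ℝ] Fin (d + 1) → ℂ) s := by
      have h3 : HasDerivAt c 0 s := hs ▸ (hcs.differentiable (by simp) s).hasDerivAt
      have h4 : HasDerivAt (fun s (_ : Fin (d + 1)) => c s) (fun _ => 0) s :=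
        hasDerivAt_pi.2 fun _ => h3
      have h5 := h4.hasFDerivAt
      simp only [hc]
      refine h5.congr_fderiv ?_
      ext; simp
    have h3 := (hcore s).2
    rw [h2.fderiv] at h3
    exact one_ne_zero (h3 (show (0 : ℝ →L[ℝ] Fin (d + 1) → ℂ) 1 =
      (0 : ℝ →L[ℝ] Fin (d + 1) → ℂ) 0 from rfl))
  · rw [← (D.chart_eq (s := s) (s' := s') h0 h0 h0 h0).trans (and_iff_left ⟨rfl, rfl⟩), hc, hc]
    exact ⟨fun h => by rw [h], fun h => congrFun h 0⟩
  · refine Subset.antisymm ?_ fun a ha => ?_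
    · rintro _ ⟨s, rfl⟩
      obtain ⟨a, ha, h⟩ := hdiag s
      rw [hc] at h
      rwa [← congrFun h 0]
    · have h : (fun _ => a) ∈ diagonalLoop (d + 1) Γ := ⟨a, ha, rfl⟩
      obtain ⟨s, hs⟩ := D.chart_core.symm.subset h
      exact ⟨s, congrFun hs 0⟩

/-- Every smoothing of `γⁿ ∪ F(γⁿ)` along the diagonal loop is a Lagrangian immersion of `S¹` times
the double torus. -/
theorem exists_realization [NeZero d] (hα : Function.Injective α) (hμ : IsAdaptedForm α β μ)
    (D : SmoothingData d (diagonalForm μ) (curveTorus (d + 1) Γ)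
      (evalChange α β '' curveTorus (d + 1) Γ) (diagonalLoop (d + 1) Γ)) :
    ∃ ι : Circle × DoubleTorus d → (Fin (d + 1) → ℂ),
      IsLagrangianImmersion ((𝓡 1).prod (𝓡 d)) (diagonalForm μ) ι ∧ D.IsRealizedBy ι := by
  obtain ⟨c, hc, hc', hci, hcr, hcore⟩ := exists_core D
  have hF := hμ.injective
  obtain ⟨ν, -, hν⟩ := hμ.2
  let C : Bool → ℝ × EuclideanSpace ℝ (Fin d) → (Fin (d + 1) → ℂ) := fun i w =>
    cond i (evalChangeCLM α β (torusParam d c w)) (torusParam d c w)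
  have h1 : ∀ w, HasFDerivAt (fun w => evalChangeCLM α β (torusParam d c w))
      ((evalChangeCLM α β).comp (fderiv ℝ (torusParam d c) w)) w := fun w =>
    HasFDerivAt.comp w (g := fun z => evalChangeCLM α β z) (f := torusParam d c)
      (evalChangeCLM α β).hasFDerivAt
      (isotropicImmersionAt_torusParam hc hc' μ w).1.differentiableAt.hasFDerivAt
  -- the transverse derivatives along the core are real multiples of `c'`
  let B : EuclideanSpace ℝ (Fin d) →L[ℝ] EuclideanSpace ℝ (Fin d) :=
    LinearMap.toContinuousLinearMap
      { toFun := fun w => WithLp.toLp 2 fun i =>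
          μ i.succ * (evalChangeCLM α β (fun k => (spread d (0, w) k : ℂ)) i.succ).im
        map_add' := fun v w => by
          have : (fun k => (spread d (0, v + w) k : ℂ)) =
              (fun k => (spread d (0, v) k : ℂ)) + fun k => (spread d (0, w) k : ℂ) := by
            funext k
            rw [show ((0 : ℝ), v + w) = (0, v) + (0, w) by simp, map_add]
            simp
          ext i
          simp only [this, map_add, Pi.add_apply, Complex.add_im, PiLp.add_apply]
          ring
        map_smul' := fun a w => by
          have : (fun k => (spread d (0, a • w) k : ℂ)) = a • fun k => (spread d (0, w) k : ℂ) := by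
            funext k
            rw [show ((0 : ℝ), a • w) = a • (0, w) by simp, map_smul]
            simp
          ext i
          simp only [this, map_smul, Pi.smul_apply, Complex.smul_im, PiLp.smul_apply, smul_eq_mul,
            RingHom.id_apply]
          ring }
  have hB : ∀ w i, B w i =
      μ i.succ * (evalChangeCLM α β (fun k => (spread d (0, w) k : ℂ)) i.succ).im := fun _ _ => rfl
  have hd : ∀ s (v : EuclideanSpace ℝ (Fin d)), fderiv ℝ (torusParam d c) (s, 0) (0, v) =
      deriv c s • fun k => (spread d (0, v) k : ℂ) := by
    intro s v
    rw [fderiv_torusParam hc, spread_core]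
    funext k
    simp [mul_comm]
  have S : Nonempty (FittedPair D) := by
    refine D.exists_fittedPair finrank_complex_pi (C := C) (B := B)
      (ρ := fun s => ‖deriv c s‖ ^ 2) (fun i w => ?_) (fun i w w' => ?_) (fun i => ?_) (fun i s => ?_)
      (fun s => pow_pos (norm_pos_iff.2 (hc' s)) 2) (fun s v w => ?_)
    · cases i
      · exact isotropicImmersionAt_torusParam hc hc' μ w
      · have h2 := isotropicImmersionAt_torusParam hc hc' ν w
        refine ⟨⟨(evalChangeCLM α β).contDiff.contDiffAt.comp w h2.1.1, ?_⟩, fun a b => ?_⟩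
        · rw [show fderiv ℝ (C true) w = _ from (h1 w).fderiv]
          exact hF.comp h2.1.2
        · rw [show fderiv ℝ (C true) w = _ from (h1 w).fderiv]
          exact (hν _ _).trans (h2.2 a b)
    · cases i
      · exact torusParam_eq_iff hci w w'
      · exact hF.eq_iff.trans (torusParam_eq_iff hci w w')
    · cases i
      · exact range_torusParam hcr
      · have : C true = (fun z => evalChange α β z) ∘ torusParam d c := rfl
        rw [this, range_comp, range_torusParam hcr]
        rfl
    · rw [hcore]
      cases i
      · exact torusParam_core c s
      · have : C true (s, 0) = evalChange α β (torusParam d c (s, 0)) := rfl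
        rw [this, torusParam_core, evalChange_const hα]
    · have e1 : fderiv ℝ (C true) (s, 0) (0, w) =
          deriv c s • evalChange α β (fun k => (spread d (0, w) k : ℂ)) := by
        have : fderiv ℝ (C true) (s, 0) = _ := (h1 (s, 0)).fderiv
        rw [this]
        refine Eq.trans ?_ (evalChange_smul _ _ _ _)
        rw [← hd]; rfl
      have e2 : fderiv ℝ (C false) (s, 0) (0, v) = deriv c s • fun k => (spread d (0, v) k : ℂ) :=
        hd s v
      rw [e1, e2, diagonalForm_smul]
      congr 1
      rw [diagonalForm, Fin.sum_univ_succ, PiLp.inner_apply]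
      simp only [spread_zero, spread_succ, hB, evalChangeCLM_apply, zero_add, Complex.ofReal_zero,
        Complex.zero_re, Complex.zero_im, zero_mul, sub_zero, mul_zero, Complex.ofReal_re,
        Complex.ofReal_im]
      refine Finset.sum_congr rfl fun i _ => ?_
      simp only [RCLike.inner_apply, conj_trivial]
      ring
  obtain ⟨S⟩ := S
  exact ⟨S.glued, S.glued_isLagrangian finrank_complex_pi, S.glued_isRealizedBy⟩

end Realization

/-! ### Adapted forms -/

section Adapted

variable {n : ℕ} {α β : Fin n → ℂ}

/-- If `Q = ∏ (z - βₖ)` and `P = ∏ (z - αₖ)`, then `P / Q = 1 + ∑ cₖ / (z - βₖ)`, and this vanishes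
at the points `αᵢ`. -/
theorem sum_nodalWeight_div (hβ : Function.Injective β) (hαβ : ∀ k l, α k ≠ β l) (i : Fin n) :
    ∑ k, Lagrange.nodalWeight Finset.univ β k * (∏ j, (β k - α j)) * (β k - α i)⁻¹ = 1 := by
  have hdeg : (Lagrange.nodal Finset.univ α - Lagrange.nodal Finset.univ β).degree < n := by
    have h1 : (Lagrange.nodal Finset.univ α).degree = n := by simp [Lagrange.degree_nodal]
    have h2 : (Lagrange.nodal Finset.univ β).degree = n := by simp [Lagrange.degree_nodal]
    rcases Nat.eq_zero_or_pos n with rfl | hn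
    · exact i.elim0
    · rw [← h1]
      refine Polynomial.degree_sub_lt_left (h1.trans h2.symm) ?_ ?_
      · exact Lagrange.nodal_ne_zero
      · rw [Lagrange.nodal_monic.leadingCoeff, Lagrange.nodal_monic.leadingCoeff]
  have h1 := Lagrange.eq_interpolate (s := Finset.univ) (v := β)
    (f := Lagrange.nodal Finset.univ α - Lagrange.nodal Finset.univ β) hβ.injOn (by simpa using hdeg)
  have h2 := congrArg (Polynomial.eval (α i)) h1
  rw [Lagrange.eval_interpolate_not_at_node _ fun k _ => hαβ i k, Polynomial.eval_sub,
    Lagrange.eval_nodal_at_node (Finset.mem_univ i)] at h2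
  have h3 : Polynomial.eval (α i) (Lagrange.nodal Finset.univ β) ≠ 0 := by
    rw [Lagrange.eval_nodal, Finset.prod_ne_zero_iff]
    exact fun k _ => sub_ne_zero.2 (hαβ i k)
  have h4 : ∑ k, Lagrange.nodalWeight Finset.univ β k * (α i - β k)⁻¹ * Polynomial.eval (β k)
      (Lagrange.nodal Finset.univ α - Lagrange.nodal Finset.univ β) = -1 := by
    refine mul_left_cancel₀ h3 ?_
    rw [← h2]; ring
  rw [← neg_inj, ← h4, ← Finset.sum_neg_distrib]
  refine Finset.sum_congr rfl fun k _ => ?_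
  rw [Polynomial.eval_sub, Lagrange.eval_nodal_at_node (Finset.mem_univ k), sub_zero,
    Lagrange.eval_nodal, ← neg_sub (β k) (α i), inv_neg]
  ring

/-- For alternating points on the circle the residues of `P / (z Q)` at the points `βₖ` are, up to a
common factor, positive. -/
theorem CyclicallyOrdered.exists_weights (h : CyclicallyOrdered α β) :
    (∀ k, ‖α k‖ = 1) ∧ (∀ k, ‖β k‖ = 1) ∧ ∃ (z : ℂ) (R : Fin n → ℝ), z ≠ 0 ∧ (∀ k, 0 < R k) ∧
      ∀ k, (∏ j, (β k - α j)) = z * β k * R k * ∏ j ∈ Finset.univ.erase k, (β k - β j) := by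
  obtain ⟨θ, φ, h1, h2, h3, h4⟩ := h
  obtain ⟨σ, hσ, h5⟩ : ∃ σ : ℝ, σ * σ = 1 ∧ ∀ k, α k = Complex.exp ((σ * θ k : ℝ) * Complex.I) ∧
      β k = Complex.exp ((σ * φ k : ℝ) * Complex.I) := by
    rcases h4 with h4 | h4
    · exact ⟨1, by norm_num, fun k => by simpa using h4 k⟩
    · exact ⟨-1, by norm_num, fun k => by simpa using h4 k⟩
  have hσ0 : σ ≠ 0 := by rintro rfl; norm_num at hσ
  refine ⟨fun k => by rw [(h5 k).1, Complex.norm_exp_ofReal_mul_I],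
    fun k => by rw [(h5 k).2, Complex.norm_exp_ofReal_mul_I], ?_⟩
  let g : ℝ → ℂ := fun x => Complex.exp ((σ * x / 2 : ℝ) * Complex.I)
  have hg0 : ∀ x, g x ≠ 0 := fun x => Complex.exp_ne_zero _
  have hgg : ∀ x, g x * g x = Complex.exp ((σ * x : ℝ) * Complex.I) := fun x => by
    rw [← Complex.exp_add]; congr 1; push_cast; ring
  -- the chord between two points of the circle in terms of the sine of half the angle
  have chord : ∀ x y : ℝ, g x * g x - g y * g y =
      2 * Complex.I * σ * Real.sin ((x - y) / 2) * g x * g y := by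
    intro x y
    have e1 : g x * g x - g y * g y = (g x / g y - g y / g x) * (g x * g y) := by
      field_simp [hg0 x, hg0 y]
    have e2 : g x / g y = Complex.exp ((σ * ((x - y) / 2) : ℝ) * Complex.I) := by
      rw [← Complex.exp_sub]; congr 1; push_cast; ring
    have e3 : g y / g x = Complex.exp (-((σ * ((x - y) / 2) : ℝ) * Complex.I)) := by
      rw [← Complex.exp_sub]; congr 1; push_cast; ring
    have e4 : (Real.sin (σ * ((x - y) / 2)) : ℝ) = σ * Real.sin ((x - y) / 2) := by
      rcases mul_self_eq_one_iff.1 hσ with h | h <;> simp [h]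
    have e5 : Complex.exp ((σ * ((x - y) / 2) : ℝ) * Complex.I) -
        Complex.exp (-((σ * ((x - y) / 2) : ℝ) * Complex.I)) =
        2 * Complex.I * (Real.sin (σ * ((x - y) / 2)) : ℝ) := by
      rw [Complex.ofReal_sin, Complex.sin]
      ring_nf
      simp only [Complex.I_sq]
      ring
    rw [e1, e2, e3, e5, e4]
    push_cast; ring
  have hα : ∀ k, α k = g (θ k) * g (θ k) := fun k => by rw [hgg, (h5 k).1]
  have hβ : ∀ k, β k = g (φ k) * g (φ k) := fun k => by rw [hgg, (h5 k).2]
  let R : Fin n → ℝ := fun k => (∏ j, Real.sin ((φ k - θ j) / 2)) /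
    ∏ j ∈ Finset.univ.erase k, Real.sin ((φ k - φ j) / 2)
  have hpos : ∀ x, 0 < x → x < 2 * Real.pi → 0 < Real.sin (x / 2) := fun x hx hx' =>
    Real.sin_pos_of_pos_of_lt_pi (by linarith) (by linarith)
  have hφφ : ∀ k l, k < l → 0 < Real.sin ((φ l - φ k) / 2) := fun k l hkl =>
    hpos _ (by linarith [h2 k l hkl, h1 l]) (by linarith [h3 l k, h1 k])
  have hs0 : ∀ k, ∀ j ∈ Finset.univ.erase k, Real.sin ((φ k - φ j) / 2) ≠ 0 := by
    intro k j hj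
    rcases lt_or_gt_of_ne (Finset.ne_of_mem_erase hj) with h | h
    · exact (hφφ j k h).ne'
    · have := hφφ k j h
      rw [← neg_sub (φ k), neg_div, Real.sin_neg] at this
      linarith
  refine ⟨2 * Complex.I * σ * (∏ j, g (θ j)) / ∏ j, g (φ j), R, ?_, fun k => ?_, fun k => ?_⟩
  · refine div_ne_zero (mul_ne_zero (mul_ne_zero (mul_ne_zero two_ne_zero Complex.I_ne_zero)
      (Complex.ofReal_ne_zero.2 hσ0)) ?_) ?_ <;>
    exact Finset.prod_ne_zero_iff.2 fun j _ => hg0 _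
  · have e : R k = Real.sin ((φ k - θ k) / 2) * ∏ j ∈ Finset.univ.erase k,
        (Real.sin ((φ k - θ j) / 2) / Real.sin ((φ k - φ j) / 2)) := by
      rw [Finset.prod_div_distrib, ← mul_div_assoc,
        Finset.mul_prod_erase _ (fun j => Real.sin ((φ k - θ j) / 2)) (Finset.mem_univ k)]
    rw [e]
    refine mul_pos (hpos _ (by linarith [h1 k]) (by linarith [h3 k k])) (Finset.prod_pos fun j hj => ?_)
    rcases lt_or_gt_of_ne (Finset.ne_of_mem_erase hj) with h | h
    · exact div_pos (hpos _ (by linarith [h2 j k h, h1 k, h1 j]) (by linarith [h3 k j])) (hφφ j k h)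
    · rw [← neg_sub (θ j), ← neg_sub (φ j), neg_div, neg_div, Real.sin_neg, Real.sin_neg, neg_div_neg_eq]
      exact div_pos (hpos _ (by linarith [h2 k j h]) (by linarith [h3 j k, h1 j, h1 k])) (hφφ k j h)
  · have e1 : ∏ j, (β k - α j) = (2 * Complex.I * σ) ^ n * (∏ j, (Real.sin ((φ k - θ j) / 2) : ℂ)) *
        g (φ k) ^ n * ∏ j, g (θ j) := by
      simp only [hα, hβ, chord, Finset.prod_mul_distrib, Finset.prod_const, Finset.card_univ,
        Fintype.card_fin]
      ring
    have e2 : g (φ k) * ∏ j ∈ Finset.univ.erase k, (β k - β j) = (2 * Complex.I * σ) ^ (n - 1) *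
        (∏ j ∈ Finset.univ.erase k, (Real.sin ((φ k - φ j) / 2) : ℂ)) *
        g (φ k) ^ (n - 1) * ∏ j, g (φ j) := by
      simp only [hβ, chord, Finset.prod_mul_distrib, Finset.prod_const, Finset.card_univ,
        Fintype.card_fin, Finset.card_erase_of_mem (Finset.mem_univ k)]
      rw [← Finset.mul_prod_erase _ (fun j => g (φ j)) (Finset.mem_univ k)]
      ring
    have e3 : (∏ j ∈ Finset.univ.erase k, (Real.sin ((φ k - φ j) / 2) : ℂ)) ≠ 0 :=
      Finset.prod_ne_zero_iff.2 fun j hj => Complex.ofReal_ne_zero.2 (hs0 k j hj)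
    have e4 : (∏ j, g (φ j)) ≠ 0 := Finset.prod_ne_zero_iff.2 fun j _ => hg0 _
    have e5 : (R k : ℂ) * (∏ j ∈ Finset.univ.erase k, (Real.sin ((φ k - φ j) / 2) : ℂ)) =
        ∏ j, (Real.sin ((φ k - θ j) / 2) : ℂ) := by
      simp only [R, Complex.ofReal_div, Complex.ofReal_prod]
      exact div_mul_cancel₀ _ e3
    have hn : ∀ x : ℂ, x ^ n = x ^ (n - 1) * x := fun x => by
      rw [← pow_succ, Nat.sub_add_cancel k.pos]
    have e6 : 2 * Complex.I * σ * (∏ j, g (θ j)) / (∏ j, g (φ j)) * β k * R k *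
        ∏ j ∈ Finset.univ.erase k, (β k - β j) = 2 * Complex.I * σ * (∏ j, g (θ j)) / (∏ j, g (φ j)) *
          g (φ k) * R k * (g (φ k) * ∏ j ∈ Finset.univ.erase k, (β k - β j)) := by
      have : β k = g (φ k) * g (φ k) := hβ k
      rw [show ∀ a b c e : ℂ, a * b * c * e = b * (a * c * e) by intros; ring, this]; ring
    rw [e6, e2, e1, ← e5]
    rw [hn, hn]
    field_simp

theorem CyclicallyOrdered.injective_right (h : CyclicallyOrdered α β) : Function.Injective β := by
  obtain ⟨-, -, z, R, -, -, hprod⟩ := h.exists_weights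
  intro k l hkl
  by_contra hne
  have h1 := hprod k
  have h2 : ∏ j ∈ Finset.univ.erase k, (β k - β j) = 0 :=
    Finset.prod_eq_zero (Finset.mem_erase.2 ⟨Ne.symm hne, Finset.mem_univ l⟩) (sub_eq_zero.2 hkl)
  rw [h2, mul_zero] at h1
  obtain ⟨j, -, hj⟩ := Finset.prod_eq_zero_iff.1 h1
  exact h.injective.2 j k (sub_eq_zero.1 hj).symm

/-- There is a positive diagonal form with positive diagonal pull-back: the coefficients are chosen so
that the columns of the matrix of `F` become orthogonal. -/
theorem exists_isAdaptedForm [NeZero n] (h : CyclicallyOrdered α β) :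
    ∃ μ : Fin n → ℝ, IsAdaptedForm α β μ := by
  obtain ⟨hα, hαβ⟩ := h.injective
  obtain ⟨hα1, hβ1, z, R, hz, hR, hprod⟩ := h.exists_weights
  have hβ := h.injective_right
  have hα0 : ∀ k, α k ≠ 0 := fun k hk => by have := hα1 k; rw [hk] at this; simp at this
  have hβ0 : ∀ k, β k ≠ 0 := fun k hk => by have := hβ1 k; rw [hk] at this; simp at this
  have hsub : ∀ k i, β k - α i ≠ 0 := fun k i => sub_ne_zero.2 (hαβ i k).symm
  have hsum : ∀ i, ∑ k, R k * β k * (β k - α i)⁻¹ = z⁻¹ := by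
    intro i
    rw [← mul_right_inj' hz, mul_inv_cancel₀ hz, ← sum_nodalWeight_div hβ hαβ i, Finset.mul_sum]
    refine Finset.sum_congr rfl fun k _ => ?_
    have h1 : ∏ j ∈ Finset.univ.erase k, (β k - β j) ≠ 0 := Finset.prod_ne_zero_iff.2 fun j hj =>
      sub_ne_zero.2 fun h => Finset.ne_of_mem_erase hj (hβ h).symm
    rw [hprod k, Lagrange.nodalWeight, Finset.prod_inv_distrib]
    field_simp
  let P : Fin n → ℂ := fun k => ∏ j, (β k - α j)
  have hP : ∀ k, P k ≠ 0 := fun k => Finset.prod_ne_zero_iff.2 fun j _ => hsub k j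
  let a : Fin n → ℂ := Lagrange.nodalWeight Finset.univ α
  have ha : ∀ i, a i ≠ 0 := fun i => Lagrange.nodalWeight_ne_zero hα.injOn (Finset.mem_univ i)
  let L : Fin n → Fin n → ℂ := fun k i => P k * (a i * (β k - α i)⁻¹)
  have hF : ∀ v k, evalChange α β v k = ∑ i, L k i * v i := by
    intro v k
    rw [evalChange, Lagrange.eval_interpolate_not_at_node _ fun i _ => (hαβ i k).symm,
      Lagrange.eval_nodal, Finset.mul_sum]
    exact Finset.sum_congr rfl fun i _ => by simp only [L, P, a]; ring
  let μ : Fin n → ℝ := fun k => R k / ‖P k‖ ^ 2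
  have hμ : ∀ k, 0 < μ k := fun k => div_pos (hR k) (pow_pos (norm_pos_iff.2 (hP k)) 2)
  let ν : Fin n → ℝ := fun i => ∑ k, μ k * ‖L k i‖ ^ 2
  -- by partial fractions a product of two columns is a multiple of a difference of values of `hsum`
  have horth : ∀ i j, i ≠ j → ∑ k, (μ k : ℂ) * (starRingEnd ℂ (L k i) * L k j) = 0 := by
    intro i j hij
    have hij' : α i - α j ≠ 0 := sub_ne_zero.2 fun h => hij (hα h)
    have h1 : ∀ k, (μ k : ℂ) * (starRingEnd ℂ (L k i) * L k j) =
        (-(starRingEnd ℂ (a i) * a j * α i) * (α i - α j)⁻¹) *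
          (R k * β k * (β k - α i)⁻¹ - R k * β k * (β k - α j)⁻¹) := by
      intro k
      have e1 : starRingEnd ℂ (β k - α i) = -(β k - α i) * (α i)⁻¹ * (β k)⁻¹ := by
        have c1 : starRingEnd ℂ (β k) = (β k)⁻¹ := by
          rw [Complex.inv_def, Complex.normSq_eq_norm_sq, hβ1]; simp
        have c2 : starRingEnd ℂ (α i) = (α i)⁻¹ := by
          rw [Complex.inv_def, Complex.normSq_eq_norm_sq, hα1]; simp
        rw [map_sub, c1, c2]
        field_simp [hα0 i, hβ0 k]
        ring
      have e2 : (μ k : ℂ) * (starRingEnd ℂ (P k) * P k) = R k := by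
        rw [← Complex.normSq_eq_conj_mul_self, Complex.normSq_eq_norm_sq]
        simp only [μ]
        rw [← Complex.ofReal_mul, div_mul_cancel₀ _ (pow_pos (norm_pos_iff.2 (hP k)) 2).ne']
      have e3 : (β k - α i)⁻¹ - (β k - α j)⁻¹ =
          (α i - α j) * ((β k - α i)⁻¹ * (β k - α j)⁻¹) := by
        field_simp [hsub k i, hsub k j]; ring
      have e4 : (μ k : ℂ) * (starRingEnd ℂ (L k i) * L k j) =
          (μ k * (starRingEnd ℂ (P k) * P k)) * (starRingEnd ℂ (a i) * a j *
            ((starRingEnd ℂ (β k - α i))⁻¹ * (β k - α j)⁻¹)) := by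
        simp only [L, map_mul, map_inv₀]; ring
      rw [e4, e2, e1, ← mul_sub, e3]
      have := hα0 i
      have := hβ0 k
      have := hsub k i
      have := hsub k j
      field_simp
    simp only [h1]
    rw [← Finset.mul_sum, Finset.sum_sub_distrib, hsum, hsum, sub_self, mul_zero]
  have hform : ∀ (κ : Fin n → ℝ) (v w : Fin n → ℂ),
      diagonalForm κ v w = (∑ k, (κ k : ℂ) * (starRingEnd ℂ (v k) * w k)).im := by
    intro κ v w
    rw [Complex.im_sum, diagonalForm]
    refine Finset.sum_congr rfl fun k _ => ?_
    rw [Complex.im_ofReal_mul, Complex.mul_im, Complex.conj_re, Complex.conj_im]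
    ring
  refine ⟨μ, hμ, ν, fun i => Finset.sum_pos (fun k _ => mul_pos (hμ k) (pow_pos (norm_pos_iff.2
    (mul_ne_zero (hP k) (mul_ne_zero (ha i) (inv_ne_zero (hsub k i))))) 2)) Finset.univ_nonempty,
    fun v w => ?_⟩
  rw [hform, hform]
  congr 1
  have h1 : ∀ k, (μ k : ℂ) * (starRingEnd ℂ (evalChange α β v k) * evalChange α β w k) =
      ∑ i, ∑ j, starRingEnd ℂ (v i) * w j * (μ k * (starRingEnd ℂ (L k i) * L k j)) := by
    intro k
    rw [hF, hF, map_sum, Finset.sum_mul_sum, Finset.mul_sum]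
    refine Finset.sum_congr rfl fun i _ => ?_
    rw [Finset.mul_sum]
    refine Finset.sum_congr rfl fun j _ => ?_
    rw [map_mul]; ring
  simp only [h1]
  rw [Finset.sum_comm]
  refine Finset.sum_congr rfl fun i _ => ?_
  rw [Finset.sum_comm]
  simp only [← Finset.mul_sum]
  rw [Finset.sum_eq_single i]
  · have h2 : ∑ k, (μ k : ℂ) * (starRingEnd ℂ (L k i) * L k i) = ν i := by
      simp only [ν, Complex.ofReal_sum]
      refine Finset.sum_congr rfl fun k _ => ?_
      rw [← Complex.normSq_eq_conj_mul_self, Complex.normSq_eq_norm_sq, ← Complex.ofReal_mul]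
    rw [h2]; ring
  · intro j _ hj
    rw [horth i j hj.symm, mul_zero]
  · intro h; exact absurd (Finset.mem_univ i) h

end Adapted

/-! ### Real vectors with real image -/

section RealVectors

variable {d : ℕ} {α β : Fin (d + 1) → ℂ}

/-- A polynomial of degree `≤ d` that is real at `2d + 2` points of the unit circle is constant:
there `zᵈ p(z)` agrees with `zᵈ` times the conjugate polynomial at `1/z`, and both are polynomials of
degree `≤ 2d`. -/
theorem eq_C_of_real_on_circle {ι : Type*} [Fintype ι] (hι : 2 * d < Fintype.card ι) {x : ι → ℂ}
    (hx : Function.Injective x) (hx1 : ∀ i, ‖x i‖ = 1) {p : Polynomial ℂ} (hp : p.natDegree ≤ d)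
    (hr : ∀ i, starRingEnd ℂ (p.eval (x i)) = p.eval (x i)) : p = Polynomial.C (p.coeff 0) := by
  let q : Polynomial ℂ := p.map (starRingEnd ℂ)
  have hq : q.natDegree ≤ d := Polynomial.natDegree_map_le.trans hp
  have hqr : (q.reflect d).natDegree ≤ d :=
    Polynomial.natDegree_reflect_le.trans (max_le le_rfl hq)
  have h0 : Polynomial.X ^ d * p - q.reflect d = 0 := by
    refine Polynomial.eq_zero_of_natDegree_lt_card_of_eval_eq_zero _ hx (fun i => ?_)
      (lt_of_le_of_lt ?_ hι)
    · have hx0 : x i ≠ 0 := fun h => by have := hx1 i; rw [h] at this; simp at this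
      let _ : Invertible (x i) := invertibleOfNonzero hx0
      have h1 := Polynomial.eval₂_reflect_mul_pow (RingHom.id ℂ) (x i) d (q.reflect d) hqr
      have h2 : (q.reflect d).reflect d = q := Polynomial.reflect_reflect
      have h3 : (x i)⁻¹ = starRingEnd ℂ (x i) := by
        rw [Complex.inv_def, Complex.normSq_eq_norm_sq, hx1]; simp
      have h4 : q.eval (starRingEnd ℂ (x i)) = p.eval (x i) := by
        rw [← hr i, Polynomial.eval_map, Polynomial.eval₂_hom]
      rw [h2, invOf_eq_inv, h3] at h1
      simp only [Polynomial.eval₂_id] at h1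
      rw [Polynomial.eval_sub, Polynomial.eval_mul, Polynomial.eval_pow, Polynomial.eval_X, ← h1, h4]
      ring
    · refine (Polynomial.natDegree_sub_le _ _).trans (max_le ?_ (by omega))
      refine Polynomial.natDegree_mul_le.trans ?_
      rw [Polynomial.natDegree_X_pow]; omega
  ext j
  rcases Nat.eq_zero_or_pos j with rfl | hj
  · simp
  · have h1 := congrArg (fun f => f.coeff (j + d)) h0
    simp only [Polynomial.coeff_sub, Polynomial.coeff_X_pow_mul, Polynomial.coeff_zero,
      Polynomial.coeff_eq_zero_of_natDegree_lt (lt_of_le_of_lt hqr (by omega : d < j + d)),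
      sub_zero] at h1
    rw [h1, Polynomial.coeff_C_of_ne_zero hj.ne']

/-- The real vectors with real image under `evalChange` are the constant ones. -/
theorem exists_eq_const_of_real (h : CyclicallyOrdered α β) {τ : Fin (d + 1) → ℝ}
    (hτ : ∀ k, (evalChange α β (fun j => (τ j : ℂ)) k).im = 0) :
    ∃ a : ℝ, (∀ k, τ k = a) ∧ ∀ k, evalChange α β (fun j => (τ j : ℂ)) k = a := by
  obtain ⟨hα, hαβ⟩ := h.injective
  obtain ⟨hα1, hβ1, -⟩ := h.exists_weights
  let p := Lagrange.interpolate Finset.univ α fun j => (τ j : ℂ)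
  have hpα : ∀ k, p.eval (α k) = τ k := fun k =>
    Lagrange.eval_interpolate_at_node _ hα.injOn (Finset.mem_univ k)
  have hp : p.natDegree ≤ d := by
    have := Lagrange.degree_interpolate_lt (s := Finset.univ) (v := α) (fun j => (τ j : ℂ)) hα.injOn
    rw [Finset.card_univ, Fintype.card_fin] at this
    exact Polynomial.natDegree_le_of_degree_le (Order.le_of_lt_succ (by exact_mod_cast this))
  have hc := eq_C_of_real_on_circle (d := d) (ι := Fin (d + 1) ⊕ Fin (d + 1)) (by simp; omega)
    (x := Sum.elim α β) (hα.sumElim h.injective_right hαβ) (by rintro (k | k); exacts [hα1 k, hβ1 k])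
    hp (by
      rintro (k | k)
      · rw [Sum.elim_inl, hpα, Complex.conj_ofReal]
      · rw [Complex.conj_eq_iff_im]; exact hτ k)
  have h0 : ∀ k, (τ k : ℂ) = p.coeff 0 := fun k => by rw [← hpα, hc]; simp
  have h1 : ∀ k, τ k = τ 0 := fun k => by exact_mod_cast (h0 k).trans (h0 0).symm
  refine ⟨τ 0, h1, fun k => ?_⟩
  have h2 : evalChange α β (fun j => (τ j : ℂ)) k = p.eval (β k) := rfl
  rw [h2, hc, Polynomial.eval_C, h0]

end RealVectors

/-! ### Area-preserving collars of curves -/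

section Collar

/-- The square of the speed of `c`. -/
def speedSq (c : ℝ → ℂ) (q : ℝ) : ℝ := Complex.normSq (deriv c q)

/-- The rate at which the normal field `i c'` changes the area. -/
def bend (c : ℝ → ℂ) (q : ℝ) : ℝ := (starRingEnd ℂ (deriv (deriv c) q) * deriv c q).im

/-- The solution `h` of `|c'|² h + bend h² / 2 = p`. -/
def height (c : ℝ → ℂ) (z : ℝ × ℝ) : ℝ :=
  2 * z.2 / (speedSq c z.1 + √(speedSq c z.1 ^ 2 + 2 * bend c z.1 * z.2))

/-- The collar `(q, p) ↦ c(q) + i c'(q) h(q, p)` of the curve `c`; the height is chosen so that the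
collar preserves area. -/
def collar (c : ℝ → ℂ) (z : ℝ × ℝ) : ℂ := c z.1 + height c z • (Complex.I * deriv c z.1)

/-- A domain on which the collar is an area-preserving immersion. -/
def collarDomain (c : ℝ → ℂ) : Set (ℝ × ℝ) :=
  {z | 0 < speedSq c z.1 ^ 2 + 2 * bend c z.1 * z.2}

variable {c : ℝ → ℂ}

theorem contDiff_deriv_of_infty {f : ℝ → ℂ} (hf : ContDiff ℝ ∞ f) : ContDiff ℝ ∞ (deriv f) :=
  (contDiff_infty_iff_deriv.1 hf).2

theorem contDiff_speedSq (hc : ContDiff ℝ ∞ c) : ContDiff ℝ ∞ (speedSq c) := by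
  have h := contDiff_deriv_of_infty hc
  have h1 : ContDiff ℝ ∞ fun q => (deriv c q).re := Complex.reCLM.contDiff.comp h
  have h2 : ContDiff ℝ ∞ fun q => (deriv c q).im := Complex.imCLM.contDiff.comp h
  have h3 : speedSq c = fun q => (deriv c q).re * (deriv c q).re + (deriv c q).im * (deriv c q).im :=
    funext fun q => Complex.normSq_apply _
  rw [h3]
  exact (h1.mul h1).add (h2.mul h2)

theorem contDiff_bend (hc : ContDiff ℝ ∞ c) : ContDiff ℝ ∞ (bend c) := by
  have h := contDiff_deriv_of_infty hc
  have h' := contDiff_deriv_of_infty h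
  exact Complex.imCLM.contDiff.comp ((Complex.conjCLE.contDiff.comp h').mul h)

theorem speedSq_pos (hc' : ∀ s, deriv c s ≠ 0) (q : ℝ) : 0 < speedSq c q :=
  Complex.normSq_pos.2 (hc' q)

theorem isOpen_collarDomain (hc : ContDiff ℝ ∞ c) : IsOpen (collarDomain c) := by
  have h1 := (contDiff_speedSq hc).continuous
  have h2 := (contDiff_bend hc).continuous
  exact isOpen_lt continuous_const (by fun_prop)

theorem core_mem_collarDomain (hc' : ∀ s, deriv c s ≠ 0) (q : ℝ) : (q, 0) ∈ collarDomain c := by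
  have := speedSq_pos hc' q
  simp only [collarDomain, mem_ofPred_eq, mul_zero, add_zero]
  positivity

theorem height_zero (q : ℝ) : height c (q, 0) = 0 := by simp [height]

theorem collar_zero (q : ℝ) : collar c (q, 0) = c q := by simp [collar, height_zero]

theorem contDiffAt_height (hc : ContDiff ℝ ∞ c) (hc' : ∀ s, deriv c s ≠ 0) {z : ℝ × ℝ}
    (hz : z ∈ collarDomain c) : ContDiffAt ℝ ∞ (height c) z := by
  have h1 : ContDiffAt ℝ ∞ (fun z : ℝ × ℝ => speedSq c z.1) z :=
    ((contDiff_speedSq hc).comp contDiff_fst).contDiffAt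
  have h2 : ContDiffAt ℝ ∞ (fun z : ℝ × ℝ => bend c z.1) z :=
    ((contDiff_bend hc).comp contDiff_fst).contDiffAt
  refine (contDiffAt_const.mul contDiffAt_snd).div (h1.add (ContDiffAt.sqrt ((h1.pow 2).add
    ((contDiffAt_const.mul h2).mul contDiffAt_snd)) (ne_of_gt hz))) ?_
  exact (add_pos_of_pos_of_nonneg (speedSq_pos hc' _) (Real.sqrt_nonneg _)).ne'

theorem height_identity (hc' : ∀ s, deriv c s ≠ 0) {z : ℝ × ℝ} (hz : z ∈ collarDomain c) :
    speedSq c z.1 * height c z + bend c z.1 * height c z ^ 2 / 2 = z.2 := by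
  have h1 := Real.sq_sqrt (le_of_lt hz)
  have h2 := speedSq_pos hc' z.1
  have h3 : 0 < speedSq c z.1 + √(speedSq c z.1 ^ 2 + 2 * bend c z.1 * z.2) :=
    add_pos_of_pos_of_nonneg h2 (Real.sqrt_nonneg _)
  simp only [height]
  generalize √(speedSq c z.1 ^ 2 + 2 * bend c z.1 * z.2) = R at h1 h3
  field_simp
  linear_combination -z.2 * h1

/-- The defining property of the height, obtained by differentiating `height_identity`. -/
theorem fderiv_height_snd (hc : ContDiff ℝ ∞ c) (hc' : ∀ s, deriv c s ≠ 0) {z : ℝ × ℝ}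
    (hz : z ∈ collarDomain c) :
    (speedSq c z.1 + bend c z.1 * height c z) * fderiv ℝ (height c) z (0, 1) = 1 := by
  have h1 : HasFDerivAt (height c) (fderiv ℝ (height c) z) (z.1, z.2) :=
    ((contDiffAt_height hc hc' hz).differentiableAt (by simp)).hasFDerivAt
  have h2 : HasDerivAt (fun p : ℝ => (z.1, p)) (0, 1) z.2 :=
    (hasDerivAt_const _ _).prodMk (hasDerivAt_id _)
  have h3 : HasDerivAt (fun p : ℝ => height c (z.1, p)) (fderiv ℝ (height c) z (0, 1)) z.2 :=
    h1.comp_hasDerivAt z.2 h2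
  have h4 := (h3.const_mul (speedSq c z.1)).add (((h3.pow 2).const_mul (bend c z.1)).div_const 2)
  have h5 : ∀ᶠ p : ℝ in 𝓝 z.2, speedSq c z.1 * height c (z.1, p) +
      bend c z.1 * height c (z.1, p) ^ 2 / 2 = p := by
    have h6 : ∀ᶠ p : ℝ in 𝓝 z.2, (z.1, p) ∈ collarDomain c :=
      (Continuous.tendsto (by fun_prop : Continuous fun p : ℝ => (z.1, p)) z.2).eventually
        ((isOpen_collarDomain hc).mem_nhds hz)
    filter_upwards [h6] with p hp using height_identity hc' hp
  have h6 := (h4.congr_of_eventuallyEq (h5.mono fun p hp => hp.symm)).unique (hasDerivAt_id z.2)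
  simp only [Prod.mk.eta] at h6
  refine Eq.trans ?_ h6
  push_cast; ring

theorem hasFDerivAt_collar (hc : ContDiff ℝ ∞ c) (hc' : ∀ s, deriv c s ≠ 0) {z : ℝ × ℝ}
    (hz : z ∈ collarDomain c) : ContDiffAt ℝ ∞ (collar c) z ∧ ∀ a, fderiv ℝ (collar c) z a =
      a.1 • deriv c z.1 + (height c z • (Complex.I * (a.1 • deriv (deriv c) z.1)) +
        fderiv ℝ (height c) z a • (Complex.I * deriv c z.1)) := by
  have hd := contDiff_deriv_of_infty hc
  have hh := contDiffAt_height hc hc' hz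
  have k1 : ContDiffAt ℝ ∞ (fun z : ℝ × ℝ => c z.1) z := (hc.comp contDiff_fst).contDiffAt
  have k2 : ContDiffAt ℝ ∞ (fun z : ℝ × ℝ => Complex.I * deriv c z.1) z :=
    contDiffAt_const.mul (hd.comp contDiff_fst).contDiffAt
  refine ⟨k1.add (hh.smul k2), fun a => ?_⟩
  have h1 : HasFDerivAt (fun z : ℝ × ℝ => c z.1)
      ((ContinuousLinearMap.fst ℝ ℝ ℝ).smulRight (deriv c z.1)) z := by
    have := HasFDerivAt.comp z (g := c) (f := fun z : ℝ × ℝ => z.1)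
      (hc.differentiable (by simp) z.1).hasDerivAt.hasFDerivAt hasFDerivAt_fst
    refine this.congr_fderiv ?_
    ext <;> simp
  have h2 : HasFDerivAt (fun z : ℝ × ℝ => Complex.I * deriv c z.1)
      ((ContinuousLinearMap.fst ℝ ℝ ℝ).smulRight (Complex.I * deriv (deriv c) z.1)) z := by
    have := HasFDerivAt.comp z (g := fun q => Complex.I * deriv c q) (f := fun z : ℝ × ℝ => z.1)
      ((hd.differentiable (by simp) z.1).hasDerivAt.const_mul Complex.I).hasFDerivAt hasFDerivAt_fst
    refine this.congr_fderiv ?_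
    ext <;> simp
  have h3 := h1.add ((hh.differentiableAt (by simp)).hasFDerivAt.smul h2)
  have h4 : fderiv ℝ (collar c) z = _ := h3.fderiv
  rw [h4]
  simp [mul_left_comm]

/-- The collar preserves area. -/
theorem collar_area (hc : ContDiff ℝ ∞ c) (hc' : ∀ s, deriv c s ≠ 0) {z : ℝ × ℝ}
    (hz : z ∈ collarDomain c) (a b : ℝ × ℝ) :
    (fderiv ℝ (collar c) z a).re * (fderiv ℝ (collar c) z b).im -
      (fderiv ℝ (collar c) z a).im * (fderiv ℝ (collar c) z b).re = a.1 * b.2 - a.2 * b.1 := by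
  have h1 := fderiv_height_snd hc hc' hz
  have h2 : ∀ a : ℝ × ℝ, fderiv ℝ (height c) z a =
      a.1 * fderiv ℝ (height c) z (1, 0) + a.2 * fderiv ℝ (height c) z (0, 1) := by
    intro a
    rw [← smul_eq_mul, ← smul_eq_mul, ← map_smul, ← map_smul, ← map_add]
    simp
  rw [(hasFDerivAt_collar hc hc' hz).2, (hasFDerivAt_collar hc hc' hz).2, h2 a, h2 b]
  simp only [speedSq, bend, Complex.normSq_apply, Complex.mul_im, Complex.conj_re,
    Complex.conj_im] at h1
  simp only [Complex.add_re, Complex.add_im, Complex.real_smul, Complex.mul_re, Complex.mul_im,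
    Complex.I_re, Complex.I_im, Complex.ofReal_re, Complex.ofReal_im]
  linear_combination (a.1 * b.2 - a.2 * b.1) * h1

theorem fderiv_collar_zero (hc : ContDiff ℝ ∞ c) (hc' : ∀ s, deriv c s ≠ 0) (q : ℝ) (a : ℝ × ℝ) :
    fderiv ℝ (collar c) (q, 0) a = deriv c q * (a.1 + (a.2 / speedSq c q : ℝ) * Complex.I) := by
  have hz := core_mem_collarDomain hc' q
  have h1 : fderiv ℝ (height c) (q, 0) (0, 1) = 1 / speedSq c q := by
    have := fderiv_height_snd hc hc' hz
    rw [height_zero, mul_zero, add_zero] at this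
    rw [eq_div_iff (speedSq_pos hc' q).ne', mul_comm]; exact this
  have h2 : fderiv ℝ (height c) (q, 0) (1, 0) = 0 := by
    have e1 : HasFDerivAt (height c) (fderiv ℝ (height c) (q, 0)) (q, 0) :=
      ((contDiffAt_height hc hc' hz).differentiableAt (by simp)).hasFDerivAt
    have e2 : HasDerivAt (fun p : ℝ => (p, (0 : ℝ))) (1, 0) q :=
      (hasDerivAt_id _).prodMk (hasDerivAt_const _ _)
    have e3 : HasDerivAt (fun p : ℝ => height c (p, 0)) (fderiv ℝ (height c) (q, 0) (1, 0)) q :=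
      HasFDerivAt.comp_hasDerivAt (f := fun p : ℝ => (p, (0 : ℝ))) q e1 e2
    simp only [height_zero] at e3
    exact e3.unique (hasDerivAt_const q 0)
  have h3 : fderiv ℝ (height c) (q, 0) a = a.2 / speedSq c q := by
    have : a = a.1 • (1, 0) + a.2 • (0, 1) := by simp
    conv_lhs => rw [this]
    rw [map_add, map_smul, map_smul, h1, h2]
    simp [div_eq_mul_inv]
  rw [(hasFDerivAt_collar hc hc' hz).2, h3, height_zero]
  simp only [Complex.real_smul, zero_smul, zero_add]
  push_cast; ring

end Collar

section TorusCollar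

variable {d : ℕ} {c : ℝ → ℂ} {μ : Fin (d + 1) → ℝ}

/-- The position and momentum in the `k`-th plane as functions on the local model: the positions are
`s, s + x₁, …, s + x_d`, and the momenta are dual to them. -/
def planeCoord (μ : Fin (d + 1) → ℝ) : Fin (d + 1) → LocalModel d →L[ℝ] ℝ × ℝ :=
  let S : LocalModel d →L[ℝ] ℝ := ContinuousLinearMap.fst ℝ _ _
  let T : LocalModel d →L[ℝ] ℝ := (ContinuousLinearMap.fst ℝ _ _).comp (ContinuousLinearMap.snd ℝ _ _)
  let X : Fin d → LocalModel d →L[ℝ] ℝ := fun i => (EuclideanSpace.proj i).comp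
    ((ContinuousLinearMap.fst ℝ _ _).comp ((ContinuousLinearMap.snd ℝ _ _).comp
      (ContinuousLinearMap.snd ℝ _ _)))
  let Y : Fin d → LocalModel d →L[ℝ] ℝ := fun i => (EuclideanSpace.proj i).comp
    ((ContinuousLinearMap.snd ℝ _ _).comp ((ContinuousLinearMap.snd ℝ _ _).comp
      (ContinuousLinearMap.snd ℝ _ _)))
  Fin.cons (S.prod ((μ 0)⁻¹ • (T - ∑ i, Y i))) fun i => (S + X i).prod ((μ i.succ)⁻¹ • Y i)

theorem planeCoord_zero (p : LocalModel d) :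
    planeCoord μ 0 p = (p.1, (μ 0)⁻¹ * (p.2.1 - ∑ i, p.2.2.2 i)) := by
  simp [planeCoord]

theorem planeCoord_succ (p : LocalModel d) (i : Fin d) :
    planeCoord μ i.succ p = (p.1 + p.2.2.1 i, (μ i.succ)⁻¹ * p.2.2.2 i) := by
  simp [planeCoord]

/-- The symplectic neighbourhood of `γⁿ` near the diagonal that is made of the collars. -/
def torusCollar (c : ℝ → ℂ) (μ : Fin (d + 1) → ℝ) (p : LocalModel d) : Fin (d + 1) → ℂ :=
  fun k => collar c (planeCoord μ k p)

/-- The points of the local model whose positions and momenta lie in the domain of the collar. -/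
def torusCollarDomain (c : ℝ → ℂ) (μ : Fin (d + 1) → ℝ) : Set (LocalModel d) :=
  {p | ∀ k, planeCoord μ k p ∈ collarDomain c}

theorem isOpen_torusCollarDomain (hc : ContDiff ℝ ∞ c) : IsOpen (torusCollarDomain c μ) := by
  have : torusCollarDomain c μ = ⋂ k, planeCoord μ k ⁻¹' collarDomain c := by
    ext p; simp [torusCollarDomain]
  rw [this]
  exact isOpen_iInter_of_finite fun k => (isOpen_collarDomain hc).preimage (planeCoord μ k).continuous

theorem planeCoord_left (s : ℝ) (x : EuclideanSpace ℝ (Fin d)) (k : Fin (d + 1)) :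
    planeCoord μ k (s, 0, x, 0) = (spread d (s, x) k, 0) := by
  refine Fin.cases ?_ (fun i => ?_) k
  · rw [planeCoord_zero]; simp
  · rw [planeCoord_succ]; simp

theorem core_mem_torusCollarDomain (hc' : ∀ s, deriv c s ≠ 0) (s : ℝ) :
    (s, 0, 0, 0) ∈ torusCollarDomain c μ := fun k => by
  rw [planeCoord_left]; exact core_mem_collarDomain hc' _

theorem torusCollar_left (s : ℝ) (x : EuclideanSpace ℝ (Fin d)) :
    torusCollar c μ (s, 0, x, 0) = torusParam d c (s, x) := by
  funext k
  rw [torusCollar, planeCoord_left, collar_zero, torusParam]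

theorem hasFDerivAt_torusCollar (hc : ContDiff ℝ ∞ c) (hc' : ∀ s, deriv c s ≠ 0) {p : LocalModel d}
    (hp : p ∈ torusCollarDomain c μ) : ContDiffAt ℝ ∞ (torusCollar c μ) p ∧
      ∀ v k, fderiv ℝ (torusCollar c μ) p v k =
        fderiv ℝ (collar c) (planeCoord μ k p) (planeCoord μ k v) := by
  refine ⟨contDiffAt_pi.2 fun k => (hasFDerivAt_collar hc hc' (hp k)).1.comp p
    (planeCoord μ k).contDiff.contDiffAt, fun v k => ?_⟩
  have h1 : HasFDerivAt (torusCollar c μ) (ContinuousLinearMap.pi fun k =>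
      (fderiv ℝ (collar c) (planeCoord μ k p)).comp (planeCoord μ k)) p := by
    refine hasFDerivAt_pi.2 fun k => HasFDerivAt.comp p (g := collar c)
      (f := fun p => planeCoord μ k p) ?_ (planeCoord μ k).hasFDerivAt
    exact ((hasFDerivAt_collar hc hc' (hp k)).1.differentiableAt (by simp)).hasFDerivAt
  rw [h1.fderiv]
  rfl

/-- The collar of `γⁿ` is symplectic. -/
theorem torusCollar_symplectic (hc : ContDiff ℝ ∞ c) (hc' : ∀ s, deriv c s ≠ 0) (hμ : ∀ k, 0 < μ k)
    {p : LocalModel d} (hp : p ∈ torusCollarDomain c μ) (v w : LocalModel d) :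
    diagonalForm μ (fderiv ℝ (torusCollar c μ) p v) (fderiv ℝ (torusCollar c μ) p w) =
      modelForm v w := by
  simp only [diagonalForm, (hasFDerivAt_torusCollar hc hc' hp).2, collar_area hc hc' (hp _)]
  rw [Fin.sum_univ_succ, modelForm]
  simp only [planeCoord_zero, planeCoord_succ]
  have h0 := (hμ 0).ne'
  have h1 : ∀ i : Fin d, μ i.succ * ((v.1 + v.2.2.1 i) * ((μ i.succ)⁻¹ * w.2.2.2 i) -
      (μ i.succ)⁻¹ * v.2.2.2 i * (w.1 + w.2.2.1 i)) = (v.2.2.1 i * w.2.2.2 i - v.2.2.2 i * w.2.2.1 i) +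
        (v.1 * w.2.2.2 i - w.1 * v.2.2.2 i) := by
    intro i
    have := (hμ i.succ).ne'
    field_simp; ring
  simp only [h1]
  rw [Finset.sum_add_distrib, Finset.sum_sub_distrib (f := fun i => v.1 * w.2.2.2 i),
    ← Finset.mul_sum, ← Finset.mul_sum]
  field_simp; ring

end TorusCollar

/-! ### Smoothing data from a germ of a chart along the loop -/

section Profile

/-- A positive smooth function that equals `|u|` for `|u| ≥ r` and lies between `|u|` and `r`
otherwise. -/
theorem exists_smooth_abs {r : ℝ} (hr : 0 < r) : ∃ e : ℝ → ℝ, ContDiff ℝ ∞ e ∧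
    (∀ u, r ≤ |u| → e u = |u|) ∧ (∀ u, |u| ≤ r → e u ≤ r) ∧ (∀ u, |u| ≤ e u) ∧ ∀ u, 0 < e u := by
  let χ : ℝ → ℝ := fun u => Real.smoothTransition ((u ^ 2 - r ^ 2 / 4) / (r ^ 2 / 4))
  have hr2 : 0 < r ^ 2 / 4 := by positivity
  have hχ : ContDiff ℝ ∞ χ := Real.smoothTransition.contDiff.comp (by fun_prop)
  have h0 : ∀ u, 0 ≤ χ u := fun u => Real.smoothTransition.nonneg _
  have h1 : ∀ u, χ u ≤ 1 := fun u => Real.smoothTransition.le_one _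
  have hχ0 : ∀ u, |u| ≤ r / 2 → χ u = 0 := fun u hu => Real.smoothTransition.zero_of_nonpos
    (div_nonpos_of_nonpos_of_nonneg (by nlinarith [sq_abs u, abs_nonneg u]) hr2.le)
  have hχ1 : ∀ u, r ≤ |u| → χ u = 1 := fun u hu => Real.smoothTransition.one_of_one_le (by
    rw [le_div_iff₀ hr2]; nlinarith [sq_abs u, abs_nonneg u])
  refine ⟨fun u => (1 - χ u) * r + χ u * |u|, ?_, fun u hu => ?_, fun u hu => ?_, fun u => ?_,
    fun u => ?_⟩
  · refine ((contDiff_const.sub hχ).mul contDiff_const).add (contDiff_iff_contDiffAt.2 fun u => ?_)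
    by_cases hu : u = 0
    · have : (fun u => χ u * |u|) =ᶠ[𝓝 u] fun _ => 0 := by
        have h2 : ∀ᶠ v : ℝ in 𝓝 u, |v| < r / 2 := continuous_abs.continuousAt.eventually_lt
          continuousAt_const (by rw [hu, abs_zero]; linarith)
        filter_upwards [h2] with v hv
        rw [hχ0 v hv.le, zero_mul]
      exact contDiffAt_const.congr_of_eventuallyEq this
    · exact hχ.contDiffAt.mul (contDiffAt_abs hu)
  · simp only [hχ1 u hu]; ring
  · nlinarith [h0 u]
  · rcases le_or_gt r |u| with hu | hu
    · simp only [hχ1 u hu]; linarith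
    · nlinarith [h1 u]
  · rcases le_or_gt |u| (r / 2) with hu | hu
    · simp only [hχ0 u hu]; linarith
    · rcases (h0 u).eq_or_lt with h | h
      · simp only [← h]; linarith
      · nlinarith [mul_nonneg (sub_nonneg.2 (h1 u)) hr.le]

end Profile

section UniformInjective

theorem add_int_of_add_one {V Z : Type*} [SeminormedAddCommGroup Z] {Ψ : ℝ × Z → V} {δ : ℝ}
    (hper : ∀ s z, ‖z‖ < δ → Ψ (s + 1, z) = Ψ (s, z)) {z : Z} (hz : ‖z‖ < δ) (s : ℝ) (k : ℤ) :
    Ψ (s + k, z) = Ψ (s, z) := by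
  have h : Function.Periodic (fun s => Ψ (s, z)) 1 := fun s => hper s z hz
  have := h.int_mul k s
  rwa [mul_one] at this

variable {V Z : Type*} [NormedAddCommGroup V] [NormedSpace ℝ V] [NormedAddCommGroup Z]
  [NormedSpace ℝ Z] [FiniteDimensional ℝ Z]

/-- A periodic map that is an immersion along a circle, and injective on the circle, is injective on
a tube around it. -/
theorem exists_injective_tube {Ψ : ℝ × Z → V} {δ : ℝ} (hδ : 0 < δ)
    (himm : ∀ s, ImmersionAt Ψ (s, 0)) (hper : ∀ s z, ‖z‖ < δ → Ψ (s + 1, z) = Ψ (s, z))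
    (hcore : ∀ s s', Ψ (s, 0) = Ψ (s', 0) → ∃ k : ℤ, s' = s + k) :
    ∃ δ' > 0, δ' ≤ δ ∧ ∀ s s' z z', ‖z‖ < δ' → ‖z'‖ < δ' → Ψ (s, z) = Ψ (s', z') →
      z = z' ∧ ∃ k : ℤ, s' = s + k := by
  have h := (isCompact_Icc (a := (0 : ℝ)) (b := 1)).prod (isCompact_Icc (a := (0 : ℝ)) (b := 1))
    |>.eventually_forall_of_forall_eventually (x₀ := (0 : Z × Z)) (P := fun z s =>
      Ψ (s.1, z.1) = Ψ (s.2, z.2) → z.1 = z.2 ∧ ∃ k : ℤ, s.2 = s.1 + k) (fun s _ => by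
    obtain ⟨s, s'⟩ := s
    have t1 : Tendsto (fun q : (Z × Z) × (ℝ × ℝ) => (q.2.1, q.1.1)) (𝓝 (0, (s, s'))) (𝓝 (s, 0)) :=
      Continuous.tendsto' (by fun_prop) _ _ rfl
    have t2 : Tendsto (fun q : (Z × Z) × (ℝ × ℝ) => (q.2.2, q.1.2)) (𝓝 (0, (s, s')))
        (𝓝 (s', 0)) := Continuous.tendsto' (by fun_prop) _ _ rfl
    by_cases hs : Ψ (s, 0) = Ψ (s', 0)
    · obtain ⟨k, rfl⟩ := hcore _ _ hs
      obtain ⟨U, hU, hUi⟩ := (himm s).eventually_injective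
      have t3 : Tendsto (fun q : (Z × Z) × (ℝ × ℝ) => (q.2.2 - k, q.1.2)) (𝓝 (0, (s, s + k)))
        (𝓝 (s, 0)) := Continuous.tendsto' (by fun_prop) _ _ (by simp)
      have t4 : ∀ᶠ q : (Z × Z) × (ℝ × ℝ) in 𝓝 (0, (s, s + k)), ‖q.1.2‖ < δ :=
        (isOpen_lt (by fun_prop) continuous_const).mem_nhds (by simpa using hδ)
      filter_upwards [t1.eventually hU, t3.eventually hU, t4] with q h1 h2 h3 he
      have h4 := add_int_of_add_one hper h3 (q.2.2 - k) k
      rw [sub_add_cancel] at h4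
      have h5 := hUi h1 h2 (he.trans h4)
      exact ⟨congrArg Prod.snd h5, k, by linarith [congrArg Prod.fst h5]⟩
    · have := (((himm s).1.continuousAt.tendsto.comp t1).prodMk_nhds
        ((himm s').1.continuousAt.tendsto.comp t2)).eventually
        ((isOpen_ne_fun continuous_fst continuous_snd).mem_nhds hs)
      filter_upwards [this] with q hq he using absurd he hq)
  obtain ⟨δ', hδ', H⟩ := Metric.eventually_nhds_iff.1 h
  refine ⟨min δ' δ, lt_min hδ' hδ, min_le_right _ _, fun s s' z z' hz hz' he => ?_⟩
  have hf : ∀ s z, ‖z‖ < δ → Ψ (Int.fract s, z) = Ψ (s, z) := fun s z hz => by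
    have := add_int_of_add_one hper hz (Int.fract s) ⌊s⌋
    rw [Int.fract_add_floor] at this
    exact this.symm
  have hm : ∀ s : ℝ, Int.fract s ∈ Icc (0 : ℝ) 1 := fun s =>
    ⟨Int.fract_nonneg s, (Int.fract_lt_one s).le⟩
  obtain ⟨h1, k, h2⟩ := H (y := (z, z')) (by
    simpa [Prod.norm_def] using ⟨hz.trans_le (min_le_left _ _), hz'.trans_le (min_le_left _ _)⟩)
    (Int.fract s, Int.fract s') ⟨hm s, hm s'⟩ (by
      rw [hf s z (hz.trans_le (min_le_right _ _)), hf s' z' (hz'.trans_le (min_le_right _ _)), he])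
  refine ⟨h1, ⌊s'⌋ - ⌊s⌋ + k, ?_⟩
  have e1 := Int.fract_add_floor s
  have e2 := Int.fract_add_floor s'
  push_cast
  simp only at h2
  linarith

end UniformInjective

section ExistsData

variable {V : Type*} [NormedAddCommGroup V] [NormedSpace ℝ V] {d : ℕ}
  {Ω : V → V → ℝ} {L₀ L₁ Δ : Set V}

theorem norm_lt_of_mem_modelBox {δ : ℝ} (hδ : 0 < δ) {p : LocalModel d}
    (hp : p ∈ modelBox d (δ / (d + 1))) : ‖p.2‖ < δ := by
  have hd : (0 : ℝ) < d + 1 := by positivity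
  have hε : 0 < δ / (d + 1) := by positivity
  have hle : δ / (d + 1) * (d + 1) = δ := div_mul_cancel₀ _ hd.ne'
  have key : ∀ x : EuclideanSpace ℝ (Fin d), (∀ i, |x i| < δ / (d + 1)) → ‖x‖ < δ := by
    intro x hx
    refine lt_of_pow_lt_pow_left₀ 2 hδ.le ?_
    rw [EuclideanSpace.norm_sq_eq]
    calc ∑ i, ‖x i‖ ^ 2 ≤ ∑ _i : Fin d, (δ / (d + 1)) ^ 2 := Finset.sum_le_sum fun i _ =>
          pow_le_pow_left₀ (norm_nonneg _) (by rw [Real.norm_eq_abs]; exact (hx i).le) 2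
      _ = d * (δ / (d + 1)) ^ 2 := by simp
      _ < δ ^ 2 := by
          rw [← hle, mul_div_assoc, div_self hd.ne', mul_one, mul_pow, mul_comm]
          refine mul_lt_mul_of_pos_left ?_ (by positivity)
          nlinarith
  obtain ⟨h1, h2, h3⟩ := hp
  rw [Prod.norm_def, Prod.norm_def, max_lt_iff, max_lt_iff]
  refine ⟨?_, key _ h2, key _ h3⟩
  rw [Real.norm_eq_abs]
  refine h1.trans_le (div_le_self hδ.le ?_)
  linarith [(Nat.cast_nonneg d : (0 : ℝ) ≤ d)]

theorem immersionAt_of_symplectic {Ψ : LocalModel d → V} {p : LocalModel d}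
    (hsm : ContDiffAt ℝ ∞ Ψ p)
    (hsy : ∀ v w, Ω (fderiv ℝ Ψ p v) (fderiv ℝ Ψ p w) = modelForm v w) : ImmersionAt Ψ p := by
  refine ⟨hsm, (injective_iff_map_eq_zero _).2 fun v hv => eq_zero_of_modelForm fun w => ?_⟩
  rw [← hsy, hv, ← map_zero (fderiv ℝ Ψ p), hsy, modelForm_zero_left]

/-- A periodic symplectic germ of a chart along a clean loop of intersection gives smoothing data of
either sign in any neighbourhood of the loop. -/
theorem exists_smoothingData {Ψ : LocalModel d → V} {δ : ℝ} (hδ : 0 < δ)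
    (hsm : ∀ s z, ‖z‖ < δ → ContDiffAt ℝ ∞ Ψ (s, z))
    (hsy : ∀ s z, ‖z‖ < δ → ∀ v w, Ω (fderiv ℝ Ψ (s, z) v) (fderiv ℝ Ψ (s, z) w) = modelForm v w)
    (hper : ∀ s z, ‖z‖ < δ → Ψ (s + 1, z) = Ψ (s, z))
    (hcore : ∀ s s', Ψ (s, 0) = Ψ (s', 0) → ∃ k : ℤ, s' = s + k)
    (h₀ : ∀ s x, ‖x‖ < δ → Ψ (s, 0, x, 0) ∈ L₀) (h₁ : ∀ s y, ‖y‖ < δ → Ψ (s, 0, 0, y) ∈ L₁)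
    (h₀' : ∀ s, ∀ᶠ p : LocalModel d in 𝓝 (s, 0), Ψ p ∈ L₀ → p.2.1 = 0 ∧ p.2.2.2 = 0)
    (h₁' : ∀ s, ∀ᶠ p : LocalModel d in 𝓝 (s, 0), Ψ p ∈ L₁ → p.2.1 = 0 ∧ p.2.2.1 = 0)
    (hΔ : range (fun s : ℝ => Ψ (s, 0)) = Δ) {U : Set V} (hU : IsOpen U) (hΔU : Δ ⊆ U) {σ : ℝ}
    (hσ : σ = 1 ∨ σ = -1) : ∃ D : SmoothingData d Ω L₀ L₁ Δ, D.sign = σ ∧ D.nbhd ⊆ U := by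
  have h00 : ‖(0 : ℝ × EuclideanSpace ℝ (Fin d) × EuclideanSpace ℝ (Fin d))‖ < δ := by simpa using hδ
  have himm : ∀ s, ImmersionAt Ψ (s, 0) := fun s =>
    immersionAt_of_symplectic (hsm s 0 h00) (hsy s 0 h00)
  obtain ⟨δ₁, hδ₁, hδ₁δ, hinj⟩ := exists_injective_tube hδ himm hper hcore
  obtain ⟨δ₂, hδ₂, H⟩ := exists_uniform_ball_of_periodic
    (p := fun s (z : ℝ × EuclideanSpace ℝ (Fin d) × EuclideanSpace ℝ (Fin d)) => ‖z‖ < δ ∧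
      Ψ (s, z) ∈ U ∧ (Ψ (s, z) ∈ L₀ → z.1 = 0 ∧ z.2.2 = 0) ∧ (Ψ (s, z) ∈ L₁ → z.1 = 0 ∧ z.2.1 = 0))
    (fun s z => and_congr_right fun hz => by rw [hper s z hz]) (fun s => by
      have e1 : ∀ᶠ q : ℝ × ℝ × EuclideanSpace ℝ (Fin d) × EuclideanSpace ℝ (Fin d) in 𝓝 (s, 0),
          ‖q.2‖ < δ := (isOpen_lt (continuous_norm.comp continuous_snd)
            continuous_const).mem_nhds (by simpa using hδ)
      have e2 : ∀ᶠ q in 𝓝 (s, 0), Ψ q ∈ U := (hsm s 0 h00).continuousAt.eventually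
        (hU.mem_nhds (hΔU (hΔ ▸ mem_range_self (f := fun s : ℝ => Ψ (s, 0)) s)))
      filter_upwards [e1, e2, h₀' s, h₁' s] with q a1 a2 a3 a4 using ⟨a1, a2, a3, a4⟩)
  let δ₃ := min δ₁ δ₂
  have hδ₃ : 0 < δ₃ := lt_min hδ₁ hδ₂
  have hε : 0 < δ₃ / (d + 1) := by positivity
  have hb : ∀ p ∈ modelBox d (δ₃ / (d + 1)), ‖p.2‖ < δ ∧ ‖p.2‖ < δ₁ ∧ ‖p.2‖ < δ₂ := fun p hp => by
    have := norm_lt_of_mem_modelBox hδ₃ hp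
    have h1 := this.trans_le (min_le_left _ _)
    exact ⟨h1.trans_le hδ₁δ, h1, this.trans_le (min_le_right _ _)⟩
  have hr : 0 < δ₃ / (d + 1) / 2 := by positivity
  obtain ⟨e, he1, he2, he3, he4, he5⟩ := exists_smooth_abs hr
  have hed : ∀ u, HasDerivAt e (deriv e u) u := fun u => (he1.differentiable (by simp) u).hasDerivAt
  have hda : ∀ u, HasDerivAt (fun u => (e u - u) / 2) ((deriv e u - 1) / 2) u := fun u =>
    ((hed u).sub (hasDerivAt_id u)).div_const 2
  have hdb : ∀ u, HasDerivAt (fun u => (e u + u) / 2) ((deriv e u + 1) / 2) u := fun u =>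
    ((hed u).add (hasDerivAt_id u)).div_const 2
  -- the curve `u ↦ ((e(u) - u) / 2, (e(u) + u) / 2)` rounds off the corner of the two half-axes
  refine ⟨{ ε := δ₃ / (d + 1), chart := Ψ, chart_smooth := fun p hp =>
              (hsm p.1 p.2 (hb p hp).1).contDiffWithinAt
            chart_eq_iff := fun p hp q hq => ⟨fun h => ?_, ?_⟩
            chart_symplectic := fun p hp => hsy p.1 p.2 (hb p hp).1
            chart_mem_left := fun p hp => ⟨(H p.1 p.2 (hb p hp).2.2).2.2.1, ?_⟩
            chart_mem_right := fun p hp => ⟨(H p.1 p.2 (hb p hp).2.2).2.2.2, ?_⟩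
            chart_core := hΔ
            r := δ₃ / (d + 1) / 2, r_pos := hr, r_lt := half_lt_self hε
            a := fun u => (e u - u) / 2, b := fun u => (e u + u) / 2
            a_smooth := (he1.sub contDiff_id).div_const 2
            b_smooth := (he1.add contDiff_id).div_const 2
            regular := fun u => ?_, embedded := fun u u' h => ?_
            a_nonneg := fun u => ?_, b_nonneg := fun u => ?_, ne_origin := fun u => ?_
            incoming := fun u hu => ?_, outgoing := fun u hu => ?_, bounded := fun u hu => ?_
            sign := σ, sign_eq := hσ }, rfl, ?_⟩
  · exact hinj p.1 q.1 p.2 q.2 (hb p hp).2.1 (hb q hq).2.1 h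
  · rintro ⟨h1, k, h2⟩
    have := add_int_of_add_one hper (hb p hp).1 p.1 k
    rw [← h2, h1] at this
    have e1 : p = (p.1, q.2) := Prod.ext rfl h1
    rw [e1]
    exact this.symm
  · rintro ⟨h1, h2⟩
    have h3 : p = (p.1, 0, p.2.2.1, 0) := Prod.ext rfl (Prod.ext h1 (Prod.ext rfl h2))
    rw [h3]
    exact h₀ _ _ (lt_of_le_of_lt ((norm_fst_le p.2.2).trans (norm_snd_le p.2)) (hb p hp).1)
  · rintro ⟨h1, h2⟩
    have h3 : p = (p.1, 0, 0, p.2.2.2) := Prod.ext rfl (Prod.ext h1 (Prod.ext h2 rfl))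
    rw [h3]
    exact h₁ _ _ (lt_of_le_of_lt ((norm_snd_le p.2.2).trans (norm_snd_le p.2)) (hb p hp).1)
  · rw [(hda u).deriv, (hdb u).deriv]
    by_contra! h
    linarith [h.1, h.2]
  · have h1 := congrArg Prod.fst h
    have h2 := congrArg Prod.snd h
    simp only at h1 h2
    linarith
  · linarith [he4 u, le_abs_self u]
  · linarith [he4 u, neg_abs_le u]
  · by_contra! h
    linarith [h.1, h.2, he5 u]
  · have h1 : |u| = -u := abs_of_nonpos (by linarith)
    simp only [he2 u (by rw [h1]; linarith), h1]
    constructor <;> ring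
  · have h1 : |u| = u := abs_of_nonneg (by linarith)
    simp only [he2 u (by rw [h1]; linarith), h1]
    constructor <;> ring
  · have h1 := he3 u hu
    have h2 := abs_le.1 hu
    constructor <;> linarith [h2.1, h2.2]
  · rintro _ ⟨p, hp, rfl⟩
    exact (H p.1 p.2 (hb p hp).2.2).2.1

end ExistsData

/-! ### The symplectic neighbourhood of the diagonal loop -/

section Lifting

/-- A point of a closed curve close to `c s₀` has a parameter close to `s₀`. -/
theorem eventually_exists_parameter {V : Type*} [TopologicalSpace V] [T2Space V] {c : ℝ → V}
    (hc : Continuous c) (hci : ∀ s s', c s = c s' ↔ ∃ k : ℤ, s' = s + k) (s₀ : ℝ) {δ : ℝ}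
    (hδ : 0 < δ) : ∀ᶠ a in 𝓝 (c s₀), a ∈ range c → ∃ t, |t - s₀| < δ ∧ c t = a := by
  have hK : IsCompact {t | |t - s₀| ≤ 1 / 2 ∧ δ ≤ |t - s₀|} := by
    have h1 : IsClosed {t | |t - s₀| ≤ 1 / 2} := isClosed_le (by fun_prop) (by fun_prop)
    have h2 : IsClosed {t | δ ≤ |t - s₀|} := isClosed_le (by fun_prop) (by fun_prop)
    refine (isCompact_Icc (a := s₀ - 1 / 2) (b := s₀ + 1 / 2)).of_isClosed_subset (h1.inter h2)
      fun t ht => ?_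
    have := abs_le.1 ht.1
    exact ⟨by linarith [this.1], by linarith [this.2]⟩
  have hn : c s₀ ∉ c '' {t | |t - s₀| ≤ 1 / 2 ∧ δ ≤ |t - s₀|} := by
    rintro ⟨t, ⟨h1, h2⟩, h3⟩
    obtain ⟨k, rfl⟩ := (hci _ _).1 h3.symm
    rw [add_sub_cancel_left] at h1 h2
    have h4 : |k| < 1 := by
      have : |(k : ℝ)| < 1 := by linarith
      exact_mod_cast this
    rw [Int.abs_lt_one_iff.1 h4, Int.cast_zero, abs_zero] at h2
    linarith
  filter_upwards [(hK.image hc).isClosed.isOpen_compl.mem_nhds hn] with a ha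
  rintro ⟨t, rfl⟩
  have h1 : c (t - round (t - s₀)) = c t := (hci _ _).2 ⟨round (t - s₀), by ring⟩
  refine ⟨t - round (t - s₀), ?_, h1⟩
  by_contra! h
  refine ha ⟨_, ⟨?_, h⟩, h1⟩
  have := abs_sub_round (t - s₀)
  rwa [show t - (round (t - s₀) : ℝ) - s₀ = t - s₀ - round (t - s₀) by ring]

/-- A point of `γⁿ` close to the diagonal has parameters close to each other. -/
theorem eventually_exists_torusParam {d : ℕ} {c : ℝ → ℂ} (hc : Continuous c)
    (hci : ∀ s s', c s = c s' ↔ ∃ k : ℤ, s' = s + k) (s₀ : ℝ)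
    {P : ℝ × EuclideanSpace ℝ (Fin d) → Prop} (hP : ∀ᶠ w in 𝓝 (s₀, 0), P w) :
    ∀ᶠ z in 𝓝 (fun _ => c s₀), z ∈ curveTorus (d + 1) (range c) →
      ∃ w, P w ∧ torusParam d c w = z := by
  have h1 : ∀ᶠ t : Fin (d + 1) → ℝ in 𝓝 fun _ => s₀,
      P (t 0, WithLp.toLp 2 fun i : Fin d => t i.succ - t 0) := by
    refine Tendsto.eventually (Continuous.tendsto' ?_ _ _ ?_) hP
    · exact (continuous_apply 0).prodMk ((PiLp.continuous_toLp 2 _).comp (by fun_prop))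
    · simp only [sub_self]; rfl
  obtain ⟨δ, hδ, H⟩ := Metric.eventually_nhds_iff.1 h1
  have h2 : ∀ᶠ z : Fin (d + 1) → ℂ in 𝓝 (fun _ => c s₀), ∀ k, z k ∈ range c →
      ∃ t, |t - s₀| < δ ∧ c t = z k := eventually_all.2 fun k =>
    ((continuous_apply k).tendsto (fun _ => c s₀)).eventually (eventually_exists_parameter hc hci s₀ hδ)
  filter_upwards [h2] with z hz hzc
  choose t ht htz using fun k => hz k (hzc k)
  refine ⟨_, H (y := t) ((dist_pi_lt_iff hδ).2 fun k => ht k), funext fun k => ?_⟩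
  rw [← htz k, torusParam]
  congr 1
  refine Fin.cases ?_ (fun i => ?_) k <;> simp

end Lifting

section Existence

variable {d : ℕ} {α β : Fin (d + 1) → ℂ} {c : ℝ → ℂ} {μ ν : Fin (d + 1) → ℝ}

theorem speedSq_bend_add_one (hper : Function.Periodic c 1) (q : ℝ) :
    deriv c (q + 1) = deriv c q ∧ speedSq c (q + 1) = speedSq c q ∧ bend c (q + 1) = bend c q := by
  have h1 : ∀ (f : ℝ → ℂ), Function.Periodic f 1 → Function.Periodic (deriv f) 1 := fun f hf q => by
    rw [← deriv_comp_add_const, show (fun x => f (x + 1)) = f from funext hf]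
  have h2 := h1 c hper q
  have h3 := h1 _ (h1 c hper) q
  exact ⟨h2, by rw [speedSq, speedSq, h2], by rw [bend, bend, h2, h3]⟩

theorem planeCoord_add_one (k : Fin (d + 1)) (p : LocalModel d) :
    planeCoord μ k (p.1 + 1, p.2) = ((planeCoord μ k p).1 + 1, (planeCoord μ k p).2) := by
  refine Fin.cases ?_ (fun i => ?_) k
  · simp only [planeCoord_zero]
  · simp only [planeCoord_succ, add_right_comm]

theorem mem_torusCollarDomain_add_one (hper : Function.Periodic c 1) (p : LocalModel d) :
    (p.1 + 1, p.2) ∈ torusCollarDomain c μ ↔ p ∈ torusCollarDomain c μ :=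
  forall_congr' fun k => by
    obtain ⟨-, h1, h2⟩ := speedSq_bend_add_one hper (planeCoord μ k p).1
    simp only [planeCoord_add_one, collarDomain, mem_ofPred_eq, h1, h2]

theorem torusCollar_add_one (hper : Function.Periodic c 1) (p : LocalModel d) :
    torusCollar c μ (p.1 + 1, p.2) = torusCollar c μ p := by
  funext k
  obtain ⟨h0, h1, h2⟩ := speedSq_bend_add_one hper (planeCoord μ k p).1
  simp only [torusCollar, planeCoord_add_one, collar, height, h0, h1, h2, hper (planeCoord μ k p).1]

theorem torusParam_add_one (hper : Function.Periodic c 1) (w : ℝ × EuclideanSpace ℝ (Fin d)) :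
    torusParam d c (w.1 + 1, w.2) = torusParam d c w := by
  rw [← torusCollar_left (μ := 0), ← torusCollar_left (μ := 0)]
  exact torusCollar_add_one hper (w.1, 0, w.2, 0)

/-- The derivative along the diagonal of the equation that describes `F(γⁿ)` in the collar of `γⁿ` as
a graph over the momenta is injective: in suitable coordinates `F` has no fixed real vectors besides
the diagonal ones. -/
theorem eq_zero_of_transversality (h : CyclicallyOrdered α β) (hμ : ∀ k, 0 < μ k)
    (hν : ∀ v w, diagonalForm μ (evalChange α β v) (evalChange α β w) = diagonalForm ν v w)
    {ρ f : ℝ} (hρ : 0 < ρ) {w : ℝ × EuclideanSpace ℝ (Fin d)} {g : EuclideanSpace ℝ (Fin d)}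
    (h0 : evalChange α β (fun j => (spread d w j : ℂ)) 0 = ((μ 0)⁻¹ * f / ρ : ℝ) * Complex.I)
    (h1 : ∀ i : Fin d, evalChange α β (fun j => (spread d w j : ℂ)) i.succ = (g i : ℂ)) :
    w = 0 ∧ f = 0 ∧ g = 0 := by
  have e1 : f = 0 := by
    have := hν (fun _ => 1) (fun j => (spread d w j : ℂ))
    rw [evalChange_const h.injective.1, diagonalForm, Fin.sum_univ_succ, h0] at this
    simp only [h1] at this
    simp [diagonalForm, (hμ 0).ne', hρ.ne'] at this
    exact this
  obtain ⟨a, ha, hb⟩ := exists_eq_const_of_real h (τ := fun j => spread d w j) fun k => by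
    refine Fin.cases ?_ (fun i => ?_) k
    · rw [h0, e1]; simp
    · rw [h1]; simp
  have e2 : a = 0 := by
    have := (hb 0).symm.trans h0
    rw [e1] at this
    simpa using this
  refine ⟨spread_injective ?_, e1, ?_⟩
  · rw [map_zero]; funext k; rw [ha k, e2]; rfl
  · ext i
    have := (h1 i).symm.trans (hb _)
    rw [e2] at this
    simpa using this

/-- Near the diagonal loop, `F(γⁿ)` is the graph, in the collar of `γⁿ`, of a map from the momenta
`y` and the parameter `s` of the loop to the other two coordinates. -/
theorem exists_graph (h : CyclicallyOrdered α β) (hc : ContDiff ℝ ∞ c) (hper : Function.Periodic c 1)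
    (hc' : ∀ s, deriv c s ≠ 0) (hμ : ∀ k, 0 < μ k)
    (hν : ∀ v w, diagonalForm μ (evalChange α β v) (evalChange α β w) = diagonalForm ν v w)
    {δ₀ : ℝ} (hδ₀ : 0 < δ₀) (hdom : ∀ p : LocalModel d, ‖p.2‖ < δ₀ → p ∈ torusCollarDomain c μ) :
    ∃ δ > 0, ∃ δ₁ > 0, ∃ φ : ℝ × EuclideanSpace ℝ (Fin d) →
        (ℝ × EuclideanSpace ℝ (Fin d)) × ℝ × EuclideanSpace ℝ (Fin d),
      (∀ s y, ‖y‖ < δ → ContDiffAt ℝ ∞ φ (s, y) ∧ ‖φ (s, y)‖ < δ₀ ∧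
        torusCollar c μ (s, (φ (s, y)).2.1, (φ (s, y)).2.2, y) =
          evalChange α β (torusParam d c ((s, 0) + (φ (s, y)).1)) ∧ φ (s + 1, y) = φ (s, y)) ∧
      (∀ s, φ (s, 0) = 0) ∧
      ∀ s y z, ‖y‖ < δ → ‖z‖ < δ₁ → torusCollar c μ (s, z.2.1, z.2.2, y) =
          evalChange α β (torusParam d c ((s, 0) + z.1)) → z = φ (s, y) := by
  let E := EuclideanSpace ℝ (Fin d)
  let Z := (ℝ × E) × ℝ × E
  let H : (ℝ × E) × Z → (Fin (d + 1) → ℂ) := fun q =>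
    torusCollar c μ (q.1.1, q.2.2.1, q.2.2.2, q.1.2) -
      evalChangeCLM α β (torusParam d c ((q.1.1, 0) + q.2.1))
  have hT : ContDiff ℝ ∞ (torusParam d c) := contDiff_iff_contDiffAt.2 fun w =>
    (isotropicImmersionAt_torusParam hc hc' μ w).1.1
  have hmem : ∀ (s : ℝ) (y : E) (z : Z), ‖y‖ < δ₀ → ‖z‖ < δ₀ →
      ((s, z.2.1, z.2.2, y) : LocalModel d) ∈ torusCollarDomain c μ := fun s y z hy hz => by
    have h1 := (norm_snd_le z).trans_lt hz
    refine hdom _ (max_lt ((norm_fst_le z.2).trans_lt h1) (max_lt ((norm_snd_le z.2).trans_lt h1) hy))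
  have hH : ∀ (s : ℝ) (y : E) (z : Z), ‖y‖ < δ₀ → ‖z‖ < δ₀ → ContDiffAt ℝ ∞ H ((s, y), z) := by
    intro s y z hy hz
    have e1 : ContDiffAt ℝ ∞ (fun q : (ℝ × E) × (ℝ × E) × ℝ × E =>
        torusCollar c μ (q.1.1, q.2.2.1, q.2.2.2, q.1.2)) ((s, y), z) :=
      ContDiffAt.comp (g := torusCollar c μ) (f := fun q : (ℝ × E) × (ℝ × E) × ℝ × E =>
        ((q.1.1, q.2.2.1, q.2.2.2, q.1.2) : LocalModel d)) ((s, y), z)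
        (hasFDerivAt_torusCollar hc hc' (hmem s y z hy hz)).1
        (ContDiff.contDiffAt (by fun_prop))
    exact e1.sub ((evalChangeCLM α β).contDiff.comp (hT.comp
      (by fun_prop : ContDiff ℝ ∞ fun q : (ℝ × E) × (ℝ × E) × ℝ × E => (q.1.1, (0 : E)) + q.2.1))).contDiffAt
  have q1 : ∀ s, H ((s, 0), 0) = 0 := fun s => by
    change torusCollar c μ (s, 0, 0, 0) - evalChangeCLM α β (torusParam d c ((s, 0) + 0)) = 0
    rw [add_zero, torusCollar_left, torusParam_core, evalChangeCLM_apply,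
      evalChange_const h.injective.1, sub_self]
  have q2 : ∀ s, Function.Bijective fun z : Z => fderiv ℝ H ((s, 0), 0) ((0, 0), z) := fun s => by
    have hm := core_mem_torusCollarDomain (d := d) (μ := μ) hc' s
    have d1 : HasFDerivAt (fun q : (ℝ × E) × (ℝ × E) × ℝ × E => torusCollar c μ (q.1.1, q.2.2.1, q.2.2.2, q.1.2))
        _ ((s, 0), 0) := HasFDerivAt.comp (g := torusCollar c μ) (f := fun q : (ℝ × E) × (ℝ × E) × ℝ × E =>
          ((q.1.1, q.2.2.1, q.2.2.2, q.1.2) : LocalModel d)) ((s, 0), 0)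
      (((hasFDerivAt_torusCollar hc hc' hm).1.differentiableAt (by simp)).hasFDerivAt)
      ((hasFDerivAt_fst.fst).prodMk ((hasFDerivAt_snd.snd.fst).prodMk
        ((hasFDerivAt_snd.snd.snd).prodMk hasFDerivAt_fst.snd)))
    have d2 : HasFDerivAt (fun q : (ℝ × E) × (ℝ × E) × ℝ × E => torusParam d c ((q.1.1, 0) + q.2.1))
        _ ((s, 0), 0) := HasFDerivAt.comp (g := torusParam d c) (f := fun q : (ℝ × E) × (ℝ × E) × ℝ × E =>
          (q.1.1, (0 : E)) + q.2.1) ((s, 0), 0)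
      ((hT.differentiable (by simp) _).hasFDerivAt)
      (((hasFDerivAt_fst.fst).prodMk (hasFDerivAt_const (0 : E) _)).add hasFDerivAt_snd.fst)
    have d3 := (d1.sub (HasFDerivAt.comp (g := evalChangeCLM α β) _
      (evalChangeCLM α β).hasFDerivAt d2)).fderiv
    have hval : ∀ (z : Z) (k : Fin (d + 1)), fderiv ℝ H ((s, 0), 0) ((0, 0), z) k =
        deriv c s * (((planeCoord μ k (0, z.2.1, z.2.2, 0)).1 +
          ((planeCoord μ k (0, z.2.1, z.2.2, 0)).2 / speedSq c s : ℝ) * Complex.I) -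
          evalChange α β (fun j => (spread d z.1 j : ℂ)) k) := by
      intro z k
      have e1 : fderiv ℝ (torusParam d c) (s, 0) z.1 =
          deriv c s • fun j => (spread d z.1 j : ℂ) := by
        rw [fderiv_torusParam hc, spread_core]
        funext j
        simp [mul_comm]
      have e2 : planeCoord μ k ((s, 0, 0, 0) : LocalModel d) = (s, 0) := by
        rw [planeCoord_left, spread_core]
      have e3 : fderiv ℝ H ((s, 0), 0) ((0, 0), z) =
          fderiv ℝ (torusCollar c μ) (s, 0, 0, 0) (0, z.2.1, z.2.2, 0) -
            evalChangeCLM α β (fderiv ℝ (torusParam d c) (s, 0) z.1) := by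
        rw [show fderiv ℝ H ((s, 0), 0) = _ from d3]
        simp
        rw [← evalChangeCLM_apply, show (((0, 0) : ℝ × E)) = 0 from rfl, map_zero, map_zero]
      rw [e3, e1, Pi.sub_apply, (hasFDerivAt_torusCollar hc hc' hm).2, e2, fderiv_collar_zero hc hc',
        evalChangeCLM_apply, evalChange_smul, Pi.smul_apply, smul_eq_mul, ← mul_sub]
    have hinj : Function.Injective ((fderiv ℝ H ((s, 0), 0)).comp
        (ContinuousLinearMap.inr ℝ (ℝ × E) Z) : Z →ₗ[ℝ] Fin (d + 1) → ℂ) := by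
      refine (injective_iff_map_eq_zero _).2 fun z hz => ?_
      have hz' : fderiv ℝ H ((s, 0), 0) ((0, 0), z) = 0 := hz
      have hk : ∀ k, evalChange α β (fun j => (spread d z.1 j : ℂ)) k =
          (planeCoord μ k (0, z.2.1, z.2.2, 0)).1 +
          ((planeCoord μ k (0, z.2.1, z.2.2, 0)).2 / speedSq c s : ℝ) * Complex.I := fun k => by
        have := hval z k
        rw [hz', Pi.zero_apply, eq_comm, mul_eq_zero, or_iff_right (hc' s), sub_eq_zero] at this
        exact this.symm
      obtain ⟨a1, a2, a3⟩ := eq_zero_of_transversality h hμ hν (speedSq_pos hc' s) (f := z.2.1)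
        (g := z.2.2) (w := z.1) (by rw [hk, planeCoord_zero]; simp)
        fun i => by rw [hk, planeCoord_succ]; simp
      exact Prod.ext a1 (Prod.ext a2 a3)
    have hfin : Module.finrank ℝ Z = Module.finrank ℝ (Fin (d + 1) → ℂ) := by
      rw [← finrank_complex_pi]
      simp [Z, E]
      ring
    exact ⟨hinj, (LinearMap.injective_iff_surjective_of_finrank_eq_finrank hfin).1 hinj⟩
  have q3 : ∀ s y z, H ((s + 1, y), z) = H ((s, y), z) := fun s y z => by
    change torusCollar c μ (s + 1, z.2.1, z.2.2, y) -
      evalChangeCLM α β (torusParam d c ((s + 1, 0) + z.1)) = torusCollar c μ (s, z.2.1, z.2.2, y) -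
      evalChangeCLM α β (torusParam d c ((s, 0) + z.1))
    rw [← torusCollar_add_one hper (s, z.2.1, z.2.2, y), ← torusParam_add_one hper ((s, 0) + z.1)]
    congr 4
    simp only [Prod.fst_add, Prod.snd_add, zero_add]
    refine Prod.ext ?_ ?_
    · simp only [Prod.fst_add]; ring
    · simp
  obtain ⟨δ, hδ, δ₁, hδ₁, φ, h1, h2, h3⟩ := exists_periodic_implicit hδ₀ hH q1 q2 q3
  refine ⟨δ, hδ, δ₁, hδ₁, φ, fun s y hy => ?_, h2, fun s y z hy hz he =>
    h3 s y z hy hz (sub_eq_zero.2 he)⟩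
  obtain ⟨k1, k2, k3, k4⟩ := h1 s y hy
  exact ⟨k1, k2, sub_eq_zero.1 k3, k4⟩

end Existence

section Existence

variable {d : ℕ} {α β : Fin (d + 1) → ℂ}

theorem modelForm_shear (v w : LocalModel d) (f f' : ℝ) (g g' : EuclideanSpace ℝ (Fin d)) :
    modelForm (m := d) (v.1, v.2.1 + f, v.2.2.1 + g, v.2.2.2) (w.1, w.2.1 + f', w.2.2.1 + g', w.2.2.2) =
      modelForm v w + modelForm (m := d) (v.1, f, g, v.2.2.2) (w.1, f', g', w.2.2.2) := by
  simp only [modelForm_eq, inner_add_left, inner_add_right]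
  ring

/-- Lagrangian smoothings exist, for either sign and in any neighbourhood of the diagonal loop. The
chart is the collar of `γⁿ` composed with the shear that takes `{t = 0, x = 0}` to the graph that is
`F(γⁿ)`; the shear is symplectic because the graph is Lagrangian. -/
theorem exists_smoothing (h : CyclicallyOrdered α β) {Γ : Set ℂ} (hΓ : IsSmoothJordanCurve Γ)
    {μ : Fin (d + 1) → ℝ} (hμ : IsAdaptedForm α β μ) {U : Set (Fin (d + 1) → ℂ)} (hU : IsOpen U)
    (hΔU : diagonalLoop (d + 1) Γ ⊆ U) {σ : ℝ} (hσ : σ = 1 ∨ σ = -1) :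
    ∃ D : SmoothingData d (diagonalForm μ) (curveTorus (d + 1) Γ)
      (evalChange α β '' curveTorus (d + 1) Γ) (diagonalLoop (d + 1) Γ),
      D.sign = σ ∧ D.nbhd ⊆ U := by
  obtain ⟨c, hc, hper, hc', hinj, rfl⟩ := hΓ
  have hFi := hμ.injective
  obtain ⟨hμ, ν, hν0, hν⟩ := hμ
  let E := EuclideanSpace ℝ (Fin d)
  have hci : ∀ s s', c s = c s' ↔ ∃ k : ℤ, s' = s + k := by
    have hf : ∀ s, c (Int.fract s) = c s := fun s => by
      have := hper.sub_int_mul_eq (x := s) ⌊s⌋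
      rwa [mul_one] at this
    refine fun s s' => ⟨fun he => ⟨⌊s'⌋ - ⌊s⌋, ?_⟩, ?_⟩
    · have h1 := hinj ⟨Int.fract_nonneg s, Int.fract_lt_one s⟩
        ⟨Int.fract_nonneg s', Int.fract_lt_one s'⟩ (by rw [hf, hf, he])
      have h2 := Int.fract_add_floor s
      have h3 := Int.fract_add_floor s'
      push_cast
      linarith
    · rintro ⟨k, rfl⟩
      have := hper.int_mul k s
      rw [mul_one] at this
      exact this.symm
  obtain ⟨δ₀, hδ₀, hdom⟩ := exists_uniform_ball_of_periodic
    (p := fun s (z : ℝ × E × E) => (s, z) ∈ torusCollarDomain c μ)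
    (fun s z => mem_torusCollarDomain_add_one hper (s, z))
    (fun s => (isOpen_torusCollarDomain hc).mem_nhds (core_mem_torusCollarDomain hc' s))
  obtain ⟨δ₁, hδ₁, δ₂, hδ₂, φ, hφ, hφ0, hφu⟩ := exists_graph h hc hper hc' hμ hν hδ₀
    fun p hp => hdom p.1 p.2 hp
  let sh : LocalModel d → LocalModel d := fun p =>
    (p.1, p.2.1 + (φ (p.1, p.2.2.2)).2.1, p.2.2.1 + (φ (p.1, p.2.2.2)).2.2, p.2.2.2)
  let Ψ : LocalModel d → (Fin (d + 1) → ℂ) := fun p => torusCollar c μ (sh p)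
  have hy : ∀ z : ℝ × E × E, ‖z.2.2‖ ≤ ‖z‖ := fun z => (norm_snd_le z.2).trans (norm_snd_le z)
  have hsh : ∀ p : LocalModel d, ‖p.2.2.2‖ < δ₁ → ContDiffAt ℝ ∞ sh p := fun p hp => by
    have h1 : ContDiffAt ℝ ∞ (fun p : LocalModel d => φ (p.1, p.2.2.2)) p :=
      ContDiffAt.comp (f := fun p : LocalModel d => (p.1, p.2.2.2)) p (hφ p.1 p.2.2.2 hp).1
        (ContDiff.contDiffAt (by fun_prop))
    exact contDiffAt_fst.prodMk ((contDiffAt_snd.fst.add h1.snd.fst).prodMk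
      ((contDiffAt_snd.snd.fst.add h1.snd.snd).prodMk contDiffAt_snd.snd.snd))
  have hsh0 : ∀ s x, sh (s, 0, x, 0) = (s, 0, x, 0) := fun s x => by
    simp only [sh, hφ0, Prod.snd_zero, Prod.fst_zero, add_zero]
  have hsh1 : ∀ s z, ‖z‖ < δ₁ → sh (s + 1, z) = ((sh (s, z)).1 + 1, (sh (s, z)).2) := fun s z hz => by
    simp only [sh, (hφ s z.2.2 ((hy z).trans_lt hz)).2.2.2]
  obtain ⟨δ₃, hδ₃, hball⟩ := exists_uniform_ball_of_periodic
    (p := fun s (z : ℝ × E × E) => ‖z‖ < min δ₁ δ₀ ∧ ‖(sh (s, z)).2‖ < δ₀)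
    (fun s z => and_congr_right fun hz => by rw [hsh1 s z (hz.trans_le (min_le_left _ _))])
    (fun s => by
      have h1 : ContinuousAt (fun q : LocalModel d => ‖(sh q).2‖) (s, 0) :=
        ((hsh (s, 0) (by simpa using hδ₁)).continuousAt.snd).norm
      have h2 : ‖(sh (s, 0)).2‖ < δ₀ := by
        rw [show sh (s, 0) = (s, 0, 0, 0) from hsh0 s 0]; simpa using hδ₀
      have h3 : ∀ᶠ q : LocalModel d in 𝓝 (s, 0), ‖q.2‖ < min δ₁ δ₀ :=
        (isOpen_lt (by fun_prop) continuous_const).mem_nhds (by simp [hδ₁, hδ₀])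
      filter_upwards [h3, h1.eventually_lt continuousAt_const h2] with q a b using ⟨a, b⟩)
  have hb : ∀ s z, ‖z‖ < δ₃ → ‖z.2.2‖ < δ₁ ∧ ‖z.2.2‖ < δ₀ ∧ sh (s, z) ∈ torusCollarDomain c μ :=
    fun s z hz => by
      have := lt_min_iff.1 (hball s z hz).1
      exact ⟨(hy z).trans_lt this.1, (hy z).trans_lt this.2, hdom _ _ (hball s z hz).2⟩
  have hsm : ∀ s z, ‖z‖ < δ₃ → ContDiffAt ℝ ∞ Ψ (s, z) := fun s z hz =>
    (hasFDerivAt_torusCollar hc hc' (hb s z hz).2.2).1.comp (s, z) (hsh _ (hb s z hz).1)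
  -- The graph of `φ` is Lagrangian because it parametrizes a piece of `F(γⁿ)`.
  have hgraph : ∀ s y, ‖y‖ < δ₁ → ‖y‖ < δ₀ → ∀ v w : ℝ × E,
      modelForm (m := d) (v.1, (fderiv ℝ φ (s, y) v).2.1, (fderiv ℝ φ (s, y) v).2.2, v.2)
        (w.1, (fderiv ℝ φ (s, y) w).2.1, (fderiv ℝ φ (s, y) w).2.2, w.2) = 0 := by
    intro s y hy₁ hy₀ v w
    obtain ⟨k1, k2, -, -⟩ := hφ s y hy₁
    have hφd : HasFDerivAt φ (fderiv ℝ φ (s, y)) (s, y) :=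
      (k1.differentiableAt (by simp)).hasFDerivAt
    have hm : ((s, (φ (s, y)).2.1, (φ (s, y)).2.2, y) : LocalModel d) ∈ torusCollarDomain c μ := by
      have h1 := (norm_snd_le (φ (s, y))).trans_lt k2
      exact hdom _ _ (max_lt ((norm_fst_le (φ (s, y)).2).trans_lt h1)
        (max_lt ((norm_snd_le (φ (s, y)).2).trans_lt h1) hy₀))
    have d1 : HasFDerivAt (fun q : ℝ × E => torusCollar c μ (q.1, (φ q).2.1, (φ q).2.2, q.2))
        _ (s, y) := HasFDerivAt.comp (g := torusCollar c μ)
      (f := fun q : ℝ × E => ((q.1, (φ q).2.1, (φ q).2.2, q.2) : LocalModel d)) (s, y)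
      ((hasFDerivAt_torusCollar hc hc' hm).1.differentiableAt (by simp)).hasFDerivAt
      (hasFDerivAt_fst.prodMk (hφd.snd.fst.prodMk (hφd.snd.snd.prodMk hasFDerivAt_snd)))
    have hT := isotropicImmersionAt_torusParam (d := d) hc hc' ν ((s, 0) + (φ (s, y)).1)
    have d2 : HasFDerivAt (fun q : ℝ × E => torusParam d c ((q.1, 0) + (φ q).1)) _ (s, y) :=
      HasFDerivAt.comp (g := torusParam d c) (f := fun q : ℝ × E => (q.1, (0 : E)) + (φ q).1) (s, y)
        hT.1.differentiableAt.hasFDerivAt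
        ((hasFDerivAt_fst.prodMk (hasFDerivAt_const (0 : E) _)).add hφd.fst)
    have d3 := HasFDerivAt.comp (g := evalChangeCLM α β) _ (evalChangeCLM α β).hasFDerivAt d2
    have he : (fun q : ℝ × E => torusCollar c μ (q.1, (φ q).2.1, (φ q).2.2, q.2)) =ᶠ[𝓝 (s, y)]
        evalChangeCLM α β ∘ fun q : ℝ × E => torusParam d c ((q.1, 0) + (φ q).1) := by
      have h1 : ∀ᶠ q : ℝ × E in 𝓝 (s, y), ‖q.2‖ < δ₁ :=
        (isOpen_lt (by fun_prop) continuous_const).mem_nhds hy₁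
      filter_upwards [h1] with q hq using (hφ q.1 q.2 hq).2.2.1
    have h4 := (d3.congr_of_eventuallyEq he).unique d1
    rw [← torusCollar_symplectic hc hc' hμ hm]
    have h5 := DFunLike.congr_fun h4 v
    have h6 := DFunLike.congr_fun h4 w
    refine (congrArg₂ (diagonalForm μ) h5.symm h6.symm).trans ((hν _ _).trans (hT.2 _ _))
  have hsy : ∀ s z, ‖z‖ < δ₃ → ∀ v w,
      diagonalForm μ (fderiv ℝ Ψ (s, z) v) (fderiv ℝ Ψ (s, z) w) = modelForm v w := by
    intro s z hz v w
    obtain ⟨b1, b2, b3⟩ := hb s z hz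
    have hφd : HasFDerivAt φ (fderiv ℝ φ (s, z.2.2)) (s, z.2.2) :=
      ((hφ s z.2.2 b1).1.differentiableAt (by simp)).hasFDerivAt
    have d0 : HasFDerivAt (fun p : LocalModel d => φ (p.1, p.2.2.2)) _ (s, z) :=
      HasFDerivAt.comp (g := φ) (f := fun p : LocalModel d => (p.1, p.2.2.2)) (s, z) hφd
        (hasFDerivAt_fst.prodMk hasFDerivAt_snd.snd.snd)
    have d1 : HasFDerivAt Ψ _ (s, z) := HasFDerivAt.comp (g := torusCollar c μ) (f := sh) (s, z)
      ((hasFDerivAt_torusCollar hc hc' b3).1.differentiableAt (by simp)).hasFDerivAt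
      (hasFDerivAt_fst.prodMk ((hasFDerivAt_snd.fst.add d0.snd.fst).prodMk
        ((hasFDerivAt_snd.snd.fst.add d0.snd.snd).prodMk hasFDerivAt_snd.snd.snd)))
    rw [d1.fderiv]
    refine (torusCollar_symplectic hc hc' hμ b3 _ _).trans
      ((modelForm_shear v w _ _ _ _).trans ?_)
    rw [add_eq_left]
    exact hgraph s z.2.2 b1 b2 (v.1, v.2.2.2) (w.1, w.2.2.2)
  have hΨ0 : ∀ s, Ψ (s, 0) = fun _ => c s := fun s => by
    change torusCollar c μ (sh (s, 0, 0, 0)) = _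
    rw [hsh0, torusCollar_left, torusParam_core]
  refine exists_smoothingData hδ₃ hsm hsy (fun s z hz => ?_) (fun s s' he => ?_) (fun s x hx => ?_)
    (fun s y hy => ?_) (fun s => ?_) (fun s => ?_) ?_ hU hΔU hσ
  · simp only [Ψ]
    rw [hsh1 s z ((hball s z hz).1.trans_le (min_le_left _ _)), torusCollar_add_one hper]
  · rw [hΨ0, hΨ0] at he
    exact (hci _ _).1 (congrFun he 0)
  · rw [← range_torusParam rfl]
    refine ⟨(s, x), ?_⟩
    simp only [Ψ]
    rw [hsh0, torusCollar_left]
  · have hy' : ‖((0, 0, y) : ℝ × E × E)‖ < δ₃ := by simpa [Prod.norm_def] using hy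
    have h1 := (hφ s y (hb s _ hy').1).2.2.1
    refine ⟨_, ?_, h1.symm.trans ?_⟩
    · rw [← range_torusParam rfl]; exact mem_range_self _
    · simp only [Ψ, sh, zero_add]
  · have h00 : ‖(0 : ℝ × E × E)‖ < δ₃ := by simpa using hδ₃
    obtain ⟨N, hN, hNi⟩ := (immersionAt_of_symplectic (hsm s 0 h00) (hsy s 0 h00)).eventually_injective
    have h1 : ∀ᶠ w : ℝ × E in 𝓝 (s, 0), ((w.1, 0, w.2, 0) : LocalModel d) ∈ N :=
      (Continuous.tendsto' (by fun_prop) _ _ rfl :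
        Tendsto (fun w : ℝ × E => ((w.1, 0, w.2, 0) : LocalModel d)) _ (𝓝 (s, 0))).eventually hN
    have h2 := (hΨ0 s ▸ (hsm s 0 h00).continuousAt.tendsto).eventually
      (eventually_exists_torusParam hc.continuous hci s h1)
    filter_upwards [h2, hN] with p hp hpN hpL
    obtain ⟨w, hw, hwp⟩ := hp hpL
    have h3 : Ψ p = Ψ (w.1, 0, w.2, 0) := by
      rw [← hwp, ← torusCollar_left (μ := μ)]
      simp only [Ψ]
      rw [hsh0]
    rw [hNi hpN hw h3]
    exact ⟨rfl, rfl⟩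
  · have h00 : ‖(0 : ℝ × E × E)‖ < δ₃ := by simpa using hδ₃
    have hemb := LinearMap.isClosedEmbedding_of_injective
      (f := (evalChangeCLM α β : (Fin (d + 1) → ℂ) →ₗ[ℝ] Fin (d + 1) → ℂ)) (LinearMap.ker_eq_bot.2 hFi)
    have h1 : ∀ᶠ w : ℝ × E in 𝓝 (s, 0), ‖w - (s, 0)‖ < δ₂ / 2 :=
      (isOpen_lt (by fun_prop) continuous_const).mem_nhds (by simpa using hδ₂)
    have h2 := eventually_exists_torusParam hc.continuous hci s h1
    rw [hemb.isInducing.nhds_eq_comap, eventually_comap] at h2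
    have h3 : (evalChangeCLM α β : (Fin (d + 1) → ℂ) →ₗ[ℝ] Fin (d + 1) → ℂ) (fun _ => c s) =
      Ψ (s, 0) := (evalChange_const h.injective.1 β _).trans (hΨ0 s).symm
    rw [h3] at h2
    have h4 : ∀ᶠ p : LocalModel d in 𝓝 (s, 0), ‖p - (s, 0)‖ < min (δ₂ / 2) δ₁ :=
      (isOpen_lt (by fun_prop) continuous_const).mem_nhds (by simp [hδ₁, hδ₂])
    have h5 : ∀ᶠ p : LocalModel d in 𝓝 (s, 0), ‖(sh p).2‖ < δ₂ :=
      ((hsh (s, 0) (hb s 0 h00).1).continuousAt.snd.norm).eventually_lt continuousAt_const (by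
        rw [show sh (s, 0) = (s, 0, 0, 0) from hsh0 s 0]; simpa using hδ₂)
    filter_upwards [(hsm s 0 h00).continuousAt.tendsto.eventually h2, h4, h5] with p hp hp4 hp5
    rintro ⟨z, hz, hzp⟩
    obtain ⟨w, hw, rfl⟩ := hp z hzp hz
    obtain ⟨a1, a2⟩ := lt_min_iff.1 hp4
    have hy₁ : ‖p.2.2.2‖ < δ₁ := by
      refine (hy p.2).trans_lt (lt_of_le_of_lt ?_ a2)
      exact (congrArg norm (sub_zero p.2)).symm.trans_le (norm_snd_le (p - (s, 0)))
    have hx : ‖p.1 - s‖ < δ₂ / 2 := (norm_fst_le (p - (s, 0))).trans_lt a1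
    have hw' : ‖w - (p.1, 0)‖ < δ₂ := by
      have e1 : w - (p.1, 0) = (w - (s, 0)) - (p.1 - s, 0) := by
        rw [show ((p.1 - s, 0) : ℝ × E) = (p.1, 0) - (s, 0) from Prod.ext rfl (sub_zero 0).symm]
        abel
      have e2 : ‖((p.1 - s, 0) : ℝ × E)‖ = ‖p.1 - s‖ :=
        (congrArg (max ‖p.1 - s‖) norm_zero).trans (max_eq_left (norm_nonneg _))
      rw [e1]
      linarith [norm_sub_le (w - (s, 0)) ((p.1 - s, 0) : ℝ × E)]
    have h6 := hφu p.1 p.2.2.2 (w - (p.1, 0), (sh p).2.1, (sh p).2.2.1) hy₁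
      (max_lt hw' (max_lt ((norm_fst_le (sh p).2).trans_lt hp5)
        (((norm_fst_le _).trans (norm_snd_le (sh p).2)).trans_lt hp5)))
      (by rw [add_sub_cancel]; exact hzp.symm)
    have h7 := congrArg Prod.snd h6
    exact ⟨add_eq_right.1 (congrArg Prod.fst h7), add_eq_right.1 (congrArg Prod.snd h7)⟩
  · rw [show (fun s : ℝ => Ψ (s, 0)) = (fun (a : ℂ) (_ : Fin (d + 1)) => a) ∘ c from
      funext fun s => hΨ0 s, range_comp]
    rfl

end Existence

end

theorem mainTheorem5 (d : ℕ) (hd : 1 ≤ d) :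
    ∃ (P : Type) (_ : TopologicalSpace P) (_ : ChartedSpace (EuclideanSpace ℝ (Fin d)) P),
      IsManifold (𝓡 d) ∞ P ∧ T2Space P ∧ CompactSpace P ∧
      IsConnectedSum d (torusModel d) (torusModel d) (Torus d) (Torus d) P ∧
      ∀ (α β : Fin (d + 1) → ℂ), CyclicallyOrdered α β →
      ∀ Γ : Set ℂ, IsSmoothJordanCurve Γ →
        (∃ μ : Fin (d + 1) → ℝ, IsAdaptedForm α β μ) ∧
        ∀ μ : Fin (d + 1) → ℝ, IsAdaptedForm α β μ →
          (∀ U : Set (Fin (d + 1) → ℂ), IsOpen U → diagonalLoop (d + 1) Γ ⊆ U →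
            ∀ σ : ℝ, σ = 1 ∨ σ = -1 →
            ∃ D : SmoothingData d (diagonalForm μ) (curveTorus (d + 1) Γ)
                (evalChange α β '' curveTorus (d + 1) Γ) (diagonalLoop (d + 1) Γ),
              D.sign = σ ∧ D.nbhd ⊆ U) ∧
          ∀ D : SmoothingData d (diagonalForm μ) (curveTorus (d + 1) Γ)
              (evalChange α β '' curveTorus (d + 1) Γ) (diagonalLoop (d + 1) Γ),
            ∃ ι : Circle × P → (Fin (d + 1) → ℂ),
              IsLagrangianImmersion ((𝓡 1).prod (𝓡 d)) (diagonalForm μ) ι ∧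
              D.IsRealizedBy ι := by
  have : NeZero d := ⟨by omega⟩
  exact ⟨DoubleTorus d, inferInstance, inferInstance, inferInstance, inferInstance, inferInstance,
    isConnectedSum_doubleTorus, fun α β h Γ hΓ => ⟨exists_isAdaptedForm h, fun μ hμ =>
      ⟨fun U hU hΔU σ hσ => exists_smoothing h hΓ hμ hU hΔU hσ,
        fun D => exists_realization h.injective.1 hμ D⟩⟩⟩
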